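/- Let $\alpha,\beta,\gamma\in\mathbb{R}$ with $\alpha,\gamma\neq 0$, let $\mathbb{T}=\mathbb{R}/2\pi\mathbb{Z}$, and consider the periodic Kawahara equation $$\partial_t u+\alpha\,\partial_x^5u+\beta\,\partial_x^3u+\gamma\,\partial_x(u^2)=0,\qquad u(0,\cdot)=u_0,$$ for real- or complex-valued $u$ with mean zero in $x$. Put $\langle x\rangle=(1+x^2)^{1/2}$, $p(k)=-\alpha k^5+\beta k^3$, $\widehat{U(t)\varphi}(k)=e^{ip(k)t}\widehat\varphi(k)$, let $\dot H^s(\mathbb{T})$ be the space of mean-zero periodic distributions with $\|\varphi\|_{\dot H^s}=\|\langle k\rangle^s\widehat\varphi(k)\|_{\ell^2_k}<\infty$, and let $B_r(\dot H^s)$ be its closed ball of radius $r$ about $0$. All frequencies $k$ run over $\mathbb{Z}\setminus\{0\}$. For a function $u$ on $\mathbb{R}\times\mathbb{T}$ with space-time Fourier transform $\widehat u(\tau,k)$, and $D\subset\mathbb{R}\times(\mathbb{Z}\setminus\{0\})$, let $P_D$ be the Fourier projection onto $D$ and $$\|u\|_{X^{\sigma,b}}=\|\langle k\rangle^\sigma\langle\tau-p(k)\rangle^b\,\widehat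 u\|_{\ell^2_kL^2_\tau},\qquad \|u\|_{Y^s}=\|\langle k\rangle^s\,\widehat u\|_{\ell^2_kL^1_\tau}.$$ For $-3/2\le s\le-1$ let $$\|u\|_{Z^s}=\|P_{D_1}u\|_{X^{s,3/4}}+\|P_{D_2}u\|_{X^{-3s-1,\,s+1}}+\|P_{D_3}u\|_{X^{-s/2-1,\,s/2+1}}+\|u\|_{Y^s},$$ where $D_1=\{|\tau-p(k)|\le|k|^4/10,\ |k|\ge1\}$, $D_2=\{|k|^4/10\le|\tau-p(k)|\le|k|^5/10,\ |k|\ge1\}$ and $D_3=\{|\tau-p(k)|\ge|k|^5/10\ \text{or}\ |k|\le1\}$. For $s>-1$ let $Z^s$ denote instead the space with norm $\|u\|_{X^{s,1/2}}+\|u\|_{Y^s}$. Let $Z^s([0,T])$ be the space of restrictions to $[0,T]$, with norm the infimum of $\|v\|_{Z^s}$ over all extensions $v$. **Theorem.** Let $s\ge-3/2$. There is a constant $c>0$, depending only on $\alpha,\beta,\gamma,s$, such that for every $r>1$ the following holds with $T=c\,r^{-5/2}$. 1. For every $u_0\in B_r(\dot H^s)$ there is a unique $u\in Z^s([0,T])$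 which satisfies $$u(t)=U(t)u_0-\gamma\int_0^tU(t-t')\,\partial_x\big(u(t')^2\big)\,dt',\qquad 0\le t\le T.$$ Moreover $u\in C([0,T];\dot H^s(\mathbb{T}))$, and $u$ is real-valued if $u_0$ is. 2. The map $B_r(\dot H^s)\ni u_0\mapsto u\in Z^s([0,T])$ is locally Lipschitz continuous. Here the Fourier coefficients of the integral are understood as the absolutely convergent sums, over all pairs of frequencies $k_1+k_2=k$, of the time integrals $\int_0^t e^{ip(k)(t-t')}\,ik\,\widehat u(t',k_1)\,\widehat u(t',k_2)\,dt'$ (times the normalizing constant of the Fourier transform). -/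

import Mathlib

open MeasureTheory Set Filter Topology
open scoped ENNReal NNReal ComplexConjugate

noncomputable section

namespace Kawahara

/-- The bracket `⟨x⟩ = (1 + |x|²)^{1/2}`. -/
def bracket (x : ℝ) : ℝ := Real.sqrt (1 + x ^ 2)

/-- The dispersion relation of `∂ₜu + α ∂ₓ⁵u + β ∂ₓ³u = 0`: a Fourier mode `e^{ikx}` evolves by the
factor `e^{i p(k) t}`. For `α = -1` this is `p(k) = k⁵ + β k³`. -/
def disp (α β : ℝ) (k : ℤ) : ℝ := -α * (k : ℝ) ^ 5 + β * (k : ℝ) ^ 3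

/-! ### Mean-zero Sobolev spaces on the torus `ℝ / 2πℤ`

A periodic distribution is identified with the sequence of its Fourier coefficients
`a k = (2π)^{-1/2} ∫₀^{2π} e^{-ikx} u(x) dx`; it has mean zero if and only if `a 0 = 0`. -/

/-- The norm `‖⟨k⟩^s a‖_{ℓ²}`, with values in `[0, ∞]`. -/
def hsNorm (s : ℝ) (a : ℤ → ℂ) : ℝ≥0∞ :=
  (∑' k : ℤ, (ENNReal.ofReal (bracket k ^ s) * ‖a k‖ₑ) ^ 2) ^ (1 / 2 : ℝ)

/-- The closed ball of radius `r` about the origin of the mean-zero space `Ḣ^s(𝕋)`. -/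
def hsBall (s r : ℝ) : Set (ℤ → ℂ) :=
  {a | a 0 = 0 ∧ hsNorm s a ≤ ENNReal.ofReal r}

/-! ### Bourgain spaces

A space-time distribution `u` on `ℝ × 𝕋` is given through its space-time Fourier transform
`f k τ`, where `k` is the frequency in space and `τ` the frequency in time. -/

/-- The norm of `P_D u` in `X^{σ,b}`: `‖⟨k⟩^σ ⟨τ - p(k)⟩^b f‖_{ℓ²_k L²_τ}`, restricted to `D`. -/
def xNorm (p : ℤ → ℝ) (σ b : ℝ) (D : Set (ℝ × ℤ)) (f : ℤ → ℝ → ℂ) : ℝ≥0∞ :=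
  (∑' k : ℤ, ∫⁻ τ in {τ : ℝ | (τ, k) ∈ D},
    (ENNReal.ofReal (bracket k ^ σ * bracket (τ - p k) ^ b) * ‖f k τ‖ₑ) ^ 2) ^ (1 / 2 : ℝ)

/-- The norm of `Y^s`: `‖⟨k⟩^s f‖_{ℓ²_k L¹_τ}`. -/
def yNorm (s : ℝ) (f : ℤ → ℝ → ℂ) : ℝ≥0∞ :=
  (∑' k : ℤ, (ENNReal.ofReal (bracket k ^ s) * ∫⁻ τ : ℝ, ‖f k τ‖ₑ) ^ 2) ^ (1 / 2 : ℝ)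

/-- The region of small modulation. -/
def D₁ (p : ℤ → ℝ) : Set (ℝ × ℤ) :=
  {z | |z.1 - p z.2| ≤ |(z.2 : ℝ)| ^ 4 / 10 ∧ 1 ≤ |(z.2 : ℝ)|}

/-- The region of intermediate modulation. -/
def D₂ (p : ℤ → ℝ) : Set (ℝ × ℤ) :=
  {z | |(z.2 : ℝ)| ^ 4 / 10 ≤ |z.1 - p z.2| ∧ |z.1 - p z.2| ≤ |(z.2 : ℝ)| ^ 5 / 10 ∧
    1 ≤ |(z.2 : ℝ)|}

/-- The region of large modulation or low frequency. -/
def D₃ (p : ℤ → ℝ) : Set (ℝ × ℤ) :=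
  {z | |(z.2 : ℝ)| ^ 5 / 10 ≤ |z.1 - p z.2| ∨ |(z.2 : ℝ)| ≤ 1}

/-- The norm of the modified Bourgain space `Z^s`, used for `-3/2 ≤ s ≤ -1`. -/
def zNorm (p : ℤ → ℝ) (s : ℝ) (f : ℤ → ℝ → ℂ) : ℝ≥0∞ :=
  xNorm p s (3 / 4) (D₁ p) f + xNorm p (-3 * s - 1) (s + 1) (D₂ p) f +
    xNorm p (-s / 2 - 1) (s / 2 + 1) (D₃ p) f + yNorm s f

/-- The norm of `W^s = X^{s,1/2} ∩ Y^s`, used for `s > -1`. -/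
def wNorm (p : ℤ → ℝ) (s : ℝ) (f : ℤ → ℝ → ℂ) : ℝ≥0∞ :=
  xNorm p s (1 / 2) univ f + yNorm s f

/-- The norm of the solution space: `Z^s` for `s ≤ -1` and `W^s` for `s > -1`. -/
def solNorm (p : ℤ → ℝ) (s : ℝ) (f : ℤ → ℝ → ℂ) : ℝ≥0∞ :=
  if s ≤ -1 then zNorm p s f else wNorm p s f

/-- `f` is the space-time Fourier transform of a mean-zero extension to `ℝ × 𝕋` of the function
`u` on `[0,T] × 𝕋`. Here `u t k` is the `k`-th Fourier coefficient of `u(t)`. If `f` has finite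
`Y^s` norm, then every `f k` is integrable and the inverse Fourier transform in time is the
integral below. -/
def IsExtension (T : ℝ) (u : ℝ → ℤ → ℂ) (f : ℤ → ℝ → ℂ) : Prop :=
  (∀ k, AEStronglyMeasurable (f k) volume) ∧ f 0 = 0 ∧
    ∀ t ∈ Icc 0 T, ∀ k, u t k =
      ((Real.sqrt (2 * Real.pi))⁻¹ : ℝ) *
        ∫ τ : ℝ, Complex.exp (Complex.I * (t : ℂ) * (τ : ℂ)) * f k τ

/-- The norm of the solution space restricted to `[0,T]`: the infimum of the norms of all
extensions. It is `∞` if there is no extension of finite norm. -/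
def restrNorm (p : ℤ → ℝ) (s T : ℝ) (u : ℝ → ℤ → ℂ) : ℝ≥0∞ :=
  ⨅ (f : ℤ → ℝ → ℂ) (_ : IsExtension T u f), solNorm p s f

/-! ### The integral equation -/

/-- The contribution of the pair of frequencies `(k₁, k - k₁)` to the `k`-th Fourier coefficient of
`∫₀ᵗ U(t-t') (u(t')²) dt'`. The factor `(2π)^{-1/2}` comes from the normalization of the Fourier
coefficients. -/
def interaction (p : ℤ → ℝ) (u : ℝ → ℤ → ℂ) (t : ℝ) (k k₁ : ℤ) : ℂ :=
  ((Real.sqrt (2 * Real.pi))⁻¹ : ℝ) *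
    ∫ t' in (0 : ℝ)..t, Complex.exp (Complex.I * (p k : ℂ) * ((t - t' : ℝ) : ℂ)) *
      (u t' k₁ * u t' (k - k₁))

/-- The Duhamel formula `u(t) = U(t) u₀ - γ ∫₀ᵗ U(t-t') ∂ₓ(u(t')²) dt'` on `[0,T]`, for the
Fourier coefficients of mean-zero functions. As `u(t)²` need not have a meaning at a fixed time
when `u(t)` is only a distribution, the time integral of each interaction of two frequencies is
taken before the (absolutely convergent) sum over all interactions. -/
def Duhamel (p : ℤ → ℝ) (γ T : ℝ) (u₀ : ℤ → ℂ) (u : ℝ → ℤ → ℂ) : Prop :=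
  ∀ t ∈ Icc 0 T, u t 0 = 0 ∧ ∀ k : ℤ, k ≠ 0 → ∃ S : ℂ,
    HasSum (interaction p u t k) S ∧
      u t k = Complex.exp (Complex.I * (p k : ℂ) * (t : ℂ)) * u₀ k
        - (γ : ℂ) * (Complex.I * (k : ℂ)) * S

/-- `u` belongs to the solution space on `[0,T]` and solves the Duhamel formula there. -/
def IsSolution (α β γ s T : ℝ) (u₀ : ℤ → ℂ) (u : ℝ → ℤ → ℂ) : Prop :=
  restrNorm (disp α β) s T u < ∞ ∧ Duhamel (disp α β) γ T u₀ u

/-- `u ∈ C([0,T]; Ḣ^s(𝕋))`. -/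
def IsContinuousInHs (s T : ℝ) (u : ℝ → ℤ → ℂ) : Prop :=
  ∀ t ∈ Icc 0 T, (u t 0 = 0 ∧ hsNorm s (u t) < ∞) ∧
    Tendsto (fun t' => hsNorm s (u t' - u t)) (𝓝[Icc 0 T] t) (𝓝 0)

/-- The sequence `a` of Fourier coefficients belongs to a real-valued function or distribution. -/
def IsRealValued (a : ℤ → ℂ) : Prop := ∀ k, a (-k) = conj (a k)

end Kawahara

end

/-! The solution is constructed by a contraction argument on [0, λ⁻⁵], where λ is a large multiple
of r^{1/2}. Instead of rescaling the torus, u is replaced by its profile (`prof`): the linear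
evolution is undone and the time interval is stretched to [0,1]. Frequencies then enter as k/λ,
modulations as (τ - p(k))/λ⁵, and β as β/λ². The Duhamel formula becomes a = u₀ + B(a,a), where B
(`duhamelOp`) integrates products of modes against e^{-itΦ}, with Φ the resonance function, and
carries a coefficient of size λ⁻⁴|k/λ|.

The core is a bilinear estimate with a gain of one power of the output modulation, in which squared
norms lose only a factor λ (`exists_bilinearBound`). By `resonance_eq`, Φ has the size |ξξ₁ξ₂| times
the square of the largest frequency, so at least one of the three modulations is that large. In
logarithmic variables the weight of Z^s is a continuous, piecewise linear function, and the
multiplier estimate becomes a finite case distinction between linear inequalities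
(`multiplier_highLow`, `multiplier_highHigh`). Several of them are sharp at s = -3/2. Each case ends
in one of two ways. Either Young's inequality applies, with a coefficient of one frequency whose
squares sum to O(λ) over the lattice (`exists_tsum_lowCoeff_le`). Or the weights cancel up to powers
of the modulations, and Cauchy-Schwarz with one frequency fixed leaves a sum of ⟨a ± Φ⟩^{-1/2} over
the other frequencies. That sum is O(λ) too, because for a fixed frequency Φ is a polynomial of
degree four which separates lattice points (`resonance_separated`, `exists_tsum_resonance_le`). The
gain in modulation comes from the time integration (`exists_duhamelKernel`).

Consequently B has norm O(λ⁻⁴ λ^{1/2}) = O(λ^{-7/2}) (`exists_opBound`), while data of size r have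
norm O(λ^{3/2} r). The Picard iteration converges as soon as λ² ≥ K r, and T = λ⁻⁵ is then of order
r^{-5/2}. For s > -1 the iteration runs in Z^{-1} with an additional factor ⟨k⟩^{s+1} in the
weights, which embeds into W^s.

Uniqueness concerns arbitrary solutions, without smallness, and is proved at the lowest regularity s
= -3/2. On an interval of length (λμ)⁻⁵ the norm at the finer scale grows by at most μ^{5/2}
(`exists_profNorm_prof_le`), whereas B has norm O((λμ)^{-7/2}). The product is O(1/μ), so for large
μ two solutions agree on one short interval after the other. A solution in W^s, s > -1, is at first
only known to lie in X^{-1,1/2} ∩ Y^{-1}; since B maps this space into Z^{-3/2}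
(`exists_bilinearBound_half`), the equation itself places it there. The Lipschitz bound and the
reality of solutions follow from the contraction estimate, applied to the small solutions that were
constructed. -/

noncomputable section

namespace Kawahara

section

/-! ### Logarithmic weights -/

/-- The logarithm of the weight of `Z^s`, as a function of `j = log ⟨k⟩` and `a = log ⟨τ - p k⟩`. -/
def logWeight (s j a : ℝ) : ℝ :=
  if a ≤ 4 * j then s * j + 3 / 4 * a
  else if a ≤ 5 * j then (-3 * s - 1) * j + (s + 1) * a
  else (-s / 2 - 1) * j + (s / 2 + 1) * a

section LogWeight

variable {s j a K : ℝ}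

/-- The quarter is the slope s/2 + 1 of the last piece at the endpoint s = -3/2. It is the gain in
modulation over the L¹ weight that is available in every region. -/
lemma logWeight_ge (hs : -(3 / 2) ≤ s) (hs' : s ≤ -1) (hj : 0 ≤ j) (ha : 0 ≤ a) :
    s * j + a / 4 ≤ logWeight s j a := by
  have h1 : 0 ≤ s + 3 / 2 := by linarith
  have h2 : 0 ≤ -1 - s := by linarith
  unfold logWeight
  split_ifs with h h'
  · linarith
  · nlinarith [mul_nonneg h2 hj, mul_nonneg h1 hj, mul_nonneg h1 (sub_nonneg.2 h'),
      mul_nonneg h2 (sub_nonneg.2 h'), mul_nonneg h1 (sub_nonneg.2 (not_le.1 h).le),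
      mul_nonneg h2 (sub_nonneg.2 (not_le.1 h).le)]
  · nlinarith [mul_nonneg h2 hj, mul_nonneg h1 hj, mul_nonneg h1 (sub_nonneg.2 (not_le.1 h').le),
      mul_nonneg h2 (sub_nonneg.2 (not_le.1 h').le)]

/-- The counterpart for the output, which carries one inverse power of the modulation. The first
piece is the worst: it uses up 3/4 of that power. -/
lemma logWeight_sub_le (hs : -(3 / 2) ≤ s) (hs' : s ≤ -1) (hj : 0 ≤ j) :
    logWeight s j a - a ≤ s * j - a / 4 := by
  have h1 : 0 ≤ s + 3 / 2 := by linarith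
  have h2 : 0 ≤ -1 - s := by linarith
  unfold logWeight
  split_ifs with h h'
  · linarith
  · nlinarith [mul_nonneg h2 hj, mul_nonneg h1 hj, mul_nonneg h1 (sub_nonneg.2 (not_le.1 h).le),
      mul_nonneg h2 (sub_nonneg.2 (not_le.1 h).le)]
  · nlinarith [mul_nonneg h2 hj, mul_nonneg h1 hj, mul_nonneg h1 (sub_nonneg.2 (not_le.1 h').le),
      mul_nonneg h2 (sub_nonneg.2 (not_le.1 h').le)]

lemma logWeight_ge_of_le (hs : -(3 / 2) ≤ s) (hs' : s ≤ -1) (hj : 0 ≤ j) (hK : 0 ≤ K)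
    (h : a ≤ 4 * j + K) : s * j + 3 / 4 * a - 2 * K ≤ logWeight s j a := by
  have h1 : 0 ≤ s + 3 / 2 := by linarith
  have h2 : 0 ≤ -1 - s := by linarith
  have h3 := sub_nonneg.2 h
  unfold logWeight
  split_ifs with h4 h5
  · linarith
  · nlinarith [mul_nonneg h1 hK, mul_nonneg h2 hK, mul_nonneg h1 h3, mul_nonneg h2 h3,
      mul_nonneg h1 (sub_nonneg.2 (not_le.1 h4).le), mul_nonneg h2 (sub_nonneg.2 (not_le.1 h4).le)]
  · nlinarith [mul_nonneg h1 hK, mul_nonneg h2 hK, mul_nonneg h1 h3, mul_nonneg h2 h3,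
      mul_nonneg h1 (sub_nonneg.2 (not_le.1 h5).le), mul_nonneg h2 (sub_nonneg.2 (not_le.1 h5).le),
      mul_nonneg h1 hj, mul_nonneg h2 hj]

/-- Beyond a = 4j the weight does not increase up to the second corner a = 5j and increases
afterwards, so its minimum there is the corner value (2s + 4)j. -/
lemma logWeight_ge_of_ge (hs : -(3 / 2) ≤ s) (hs' : s ≤ -1) (hj : 0 ≤ j) (hK : 0 ≤ K)
    (h : 4 * j - K ≤ a) : (2 * s + 4) * j - K ≤ logWeight s j a := by
  have h1 : 0 ≤ s + 3 / 2 := by linarith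
  have h2 : 0 ≤ -1 - s := by linarith
  unfold logWeight
  split_ifs with h4 h5
  · nlinarith [mul_nonneg h2 hj]
  · nlinarith [mul_nonneg h2 (sub_nonneg.2 h5)]
  · nlinarith [mul_nonneg h1 (sub_nonneg.2 (not_le.1 h5).le)]

lemma logWeight_sub_le_of_ge (hs : -(3 / 2) ≤ s) (hs' : s ≤ -1) (hj : 0 ≤ j) (hK : 0 ≤ K)
    (h : 5 * j - K ≤ a) : logWeight s j a - a ≤ (-s / 2 - 1) * j + s / 2 * a + 3 * K := by
  have h1 : 0 ≤ s + 3 / 2 := by linarith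
  have h2 : 0 ≤ -1 - s := by linarith
  unfold logWeight
  split_ifs with h4 h5
  · nlinarith [mul_nonneg h2 hj, mul_nonneg h1 hj, mul_nonneg h1 (sub_nonneg.2 h4),
      mul_nonneg h2 (sub_nonneg.2 h4), mul_nonneg h1 hK, mul_nonneg h2 hK,
      mul_nonneg h1 (sub_nonneg.2 h), mul_nonneg h2 (sub_nonneg.2 h)]
  · nlinarith [mul_nonneg h1 (sub_nonneg.2 h5), mul_nonneg h2 (sub_nonneg.2 h5),
      mul_nonneg h1 hK, mul_nonneg h2 hK, mul_nonneg h1 (sub_nonneg.2 h),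
      mul_nonneg h2 (sub_nonneg.2 h)]
  · nlinarith

/-- Output bound in the regime of a high-low interaction. -/
lemma logWeight_output_le {m : ℝ} (hs : -(3 / 2) ≤ s) (hs' : s ≤ -1) (hj : 0 ≤ j) (hK : 0 ≤ K)
    (hm : 0 ≤ m) (hmj : m ≤ j + K) (h : 4 * j + m - K ≤ a) :
    j + logWeight s j a - a ≤ s * j + s * m + 10 * K := by
  have h1 : 0 ≤ s + 3 / 2 := by linarith
  have h2 : 0 ≤ -1 - s := by linarith
  unfold logWeight
  split_ifs with h4 h5
  · nlinarith [mul_nonneg h2 hm, mul_nonneg h1 hm, mul_nonneg h1 hK, mul_nonneg h2 hK]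
  · nlinarith [mul_nonneg h1 (sub_nonneg.2 h), mul_nonneg h2 (sub_nonneg.2 h),
      mul_nonneg h1 hK, mul_nonneg h2 hK]
  · nlinarith [mul_nonneg h1 (sub_nonneg.2 (not_le.1 h5).le),
      mul_nonneg h2 (sub_nonneg.2 (not_le.1 h5).le), mul_nonneg h1 hK, mul_nonneg h2 hK,
      mul_nonneg h1 (sub_nonneg.2 hmj), mul_nonneg h2 (sub_nonneg.2 hmj)]

/-- A modulation of exactly the size 4j + m of the resonance, with 0 ≤ m ≤ j, lies in the middle
piece, whose value there is (s + 3)j + (s + 1)m. -/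
lemma logWeight_ge_of_near {m : ℝ} (hs : -(3 / 2) ≤ s) (hs' : s ≤ -1) (hj : 0 ≤ j) (hK : 0 ≤ K)
    (hm : 0 ≤ m) (hmj : m ≤ j + K) (h : 4 * j + m - K ≤ a) (h' : a ≤ 4 * j + m + K) :
    (s + 3) * j + (s + 1) * m - 10 * K ≤ logWeight s j a := by
  have h1 : 0 ≤ s + 3 / 2 := by linarith
  have h2 : 0 ≤ -1 - s := by linarith
  unfold logWeight
  split_ifs with h4 h5
  · nlinarith [mul_nonneg h2 hm, mul_nonneg h1 hm, mul_nonneg h1 hK, mul_nonneg h2 hK]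
  · nlinarith [mul_nonneg h1 (sub_nonneg.2 h), mul_nonneg h2 (sub_nonneg.2 h),
      mul_nonneg h1 (sub_nonneg.2 h'), mul_nonneg h2 (sub_nonneg.2 h'),
      mul_nonneg h1 hK, mul_nonneg h2 hK]
  · nlinarith [mul_nonneg h1 (sub_nonneg.2 (not_le.1 h5).le),
      mul_nonneg h2 (sub_nonneg.2 (not_le.1 h5).le), mul_nonneg h1 hK, mul_nonneg h2 hK,
      mul_nonneg h1 (sub_nonneg.2 hmj), mul_nonneg h2 (sub_nonneg.2 hmj),
      mul_nonneg h1 (sub_nonneg.2 h), mul_nonneg h2 (sub_nonneg.2 h),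
      mul_nonneg h1 (sub_nonneg.2 h'), mul_nonneg h2 (sub_nonneg.2 h')]

/-- The three linear pieces agree at the corners a = 4j and a = 5j, so the weight is continuous, and
its slopes 3/4, s + 1 and s/2 + 1 are at most 3/4 in absolute value. -/
lemma logWeight_lipschitz {b : ℝ} (hs : -(3 / 2) ≤ s) (hs' : s ≤ -1) (hj : 0 ≤ j) :
    logWeight s j a ≤ logWeight s j b + 3 / 4 * |a - b| := by
  have h1 : 0 ≤ s + 3 / 2 := by linarith
  have h2 : 0 ≤ -1 - s := by linarith
  have e1 := le_abs_self (a - b)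
  have e2 := neg_abs_le (a - b)
  have e3 : ∀ {p q : ℝ}, ¬ p ≤ q → 0 ≤ p - q := fun h => by linarith [not_le.1 h]
  have e4 : ∀ {p q : ℝ}, p ≤ q → 0 ≤ q - p := fun h => by linarith
  unfold logWeight
  split_ifs with h4 h5 h6 h7 h8 h9 h10 h11
  · linarith
  · nlinarith [mul_nonneg h1 (e4 h4), mul_nonneg h1 (e3 h5), mul_nonneg h2 (e3 h5)]
  · nlinarith [mul_nonneg h1 hj, mul_nonneg h2 hj, mul_nonneg h1 (e3 h6), mul_nonneg h2 (e3 h6)]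
  · nlinarith [mul_nonneg h1 (e3 h4), mul_nonneg h2 (e3 h4)]
  · rcases le_total a b with h | h
    · nlinarith [mul_nonneg h1 (e4 h), mul_nonneg h2 (e4 h)]
    · nlinarith [mul_nonneg h1 (e4 h), mul_nonneg h2 (e4 h)]
  · nlinarith [mul_nonneg h1 (e4 h7), mul_nonneg h2 (e4 h7), mul_nonneg h1 (e3 h9),
      mul_nonneg h2 (e3 h9)]
  · nlinarith [mul_nonneg h1 hj, mul_nonneg h2 hj, mul_nonneg h1 (e3 h7), mul_nonneg h2 (e3 h7)]
  · nlinarith [mul_nonneg h1 (e3 h7), mul_nonneg h2 (e3 h7), mul_nonneg h1 (e4 h11),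
      mul_nonneg h2 (e4 h11)]
  · rcases le_total a b with h | h
    · nlinarith [mul_nonneg h1 (e4 h), mul_nonneg h2 (e4 h)]
    · nlinarith [mul_nonneg h1 (e4 h), mul_nonneg h2 (e4 h)]

end LogWeight

end

/-! ### Case analysis for the multipliers, in logarithmic variables -/

section

/-- The logarithm of the coefficient `min (m^{-1/4}) (m^{-5/8})` in terms of `log m`. -/
def logCoeff (m : ℝ) : ℝ := min (-m / 4) (-(5 / 8) * m)

lemma logCoeff_of_nonneg {m : ℝ} (hm : 0 ≤ m) : logCoeff m = -(5 / 8) * m :=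
  min_eq_right (by linarith)

lemma logCoeff_of_nonpos {m : ℝ} (hm : m ≤ 0) : logCoeff m = -m / 4 :=
  min_eq_left (by linarith)

section Multiplier

variable {s x j j₁ j₂ m f a a₁ a₂ K : ℝ}

/-- The alternatives for the logarithm of the multiplier `A`, with logarithmic weights `W₁, W₂`
in `L²` and `y₁, y₂` in `L¹` for the two inputs. The first three are estimated with the triangle
inequality, the others with the Cauchy-Schwarz inequality. -/
def MultiplierAlt (C κ A a a₁ a₂ W₁ W₂ y₁ y₂ : ℝ) (p q₁ q₂ : Prop) : Prop :=
  A ≤ C + κ + W₁ + y₂ ∨ A ≤ C + κ + y₁ + W₂ ∨ A ≤ C + κ - 5 / 8 * a + W₁ + W₂ ∨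
  (p ∧ A ≤ C + W₁ + W₂ - 3 / 4 * a₁ - 3 / 4 * a₂) ∨
  (q₁ ∧ A ≤ C + W₁ + W₂ - a / 4 - 3 / 4 * a₂) ∨
  (q₂ ∧ A ≤ C + W₁ + W₂ - a / 4 - 3 / 4 * a₁)

/-- The second input is the lowest frequency, with m = log|ξ₂| of either sign, and f is the
logarithm of the resonance, about m + 4j. The cases depend on which modulation dominates and on
whether the inputs exceed their own thresholds 4j₁, 4j₂. An input below its threshold has weight s
jᵢ + (3/4)aᵢ, which pays for Cauchy-Schwarz; an input above it has a weight large enough for the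
triangle inequality. -/
lemma multiplier_highLow (hs : -(3 / 2) ≤ s) (hs' : s ≤ -1) (hK : 0 ≤ K) (hj : 0 ≤ j)
    (hj₁ : 0 ≤ j₁) (h₁ : j₁ ≤ j + K) (h₁' : j ≤ j₁ + K) (hx : x ≤ j) (hj₂ : j₂ = max m 0)
    (hm : m ≤ j + K) (hf : m + 4 * j - K ≤ f)
    (ha : 0 ≤ a) (ha₁ : 0 ≤ a₁) (ha₂ : 0 ≤ a₂) (hmax : f ≤ a + K ∨ f ≤ a₁ + K ∨ f ≤ a₂ + K) :
    MultiplierAlt (100 * K) (logCoeff m) (x + logWeight s j a - a) a a₁ a₂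
      (logWeight s j₁ a₁) (logWeight s j₂ a₂) (s * j₁) (s * j₂) (0 ≤ m) (0 ≤ m) (0 ≤ m) := by
  have k1 : 0 ≤ s + 3 / 2 := by linarith
  have k2 : 0 ≤ -1 - s := by linarith
  have sK : s * K ≤ -K := by nlinarith
  have sK' : -(3 / 2 * K) ≤ s * K := by nlinarith
  have sj : s * j₁ ≤ s * j + 3 / 2 * K := by nlinarith
  have sj' : s * j ≤ s * j₁ + 3 / 2 * K := by nlinarith
  have u1 := logWeight_ge hs hs' hj₁ ha₁
  have u := logWeight_sub_le (a := a) hs hs' hj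
  unfold MultiplierAlt
  -- For m < 0 a quarter of the resonance is worth j + m/4; the missing -m/4 is exactly the
  -- logarithm of the coefficient.
  rcases lt_or_ge m 0 with hm0 | hm0
  · have e2 : j₂ = 0 := by rw [hj₂]; exact max_eq_right hm0.le
    subst e2
    have u2 := logWeight_ge hs hs' le_rfl ha₂
    rw [logCoeff_of_nonpos hm0.le]
    by_cases c2 : f ≤ a₂ + K
    · right; left; linarith
    · left
      rcases hmax with h | h | h
      · linarith
      · linarith
      · exact absurd h c2
  · have e2 : j₂ = m := by rw [hj₂]; exact max_eq_left hm0
    clear hj₂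
    subst e2
    rw [logCoeff_of_nonneg hm0]
    have n1 := mul_nonneg k1 hj
    have n2 := mul_nonneg k2 hj
    have n3 := mul_nonneg k1 hm0
    have n4 := mul_nonneg k2 hm0
    have n5 := mul_nonneg k1 (sub_nonneg.2 hm)
    have n6 := mul_nonneg k2 (sub_nonneg.2 hm)
    have G1 : 4 * j₁ ≤ a₁ → (2 * s + 4) * j₁ ≤ logWeight s j₁ a₁ := fun h => by
      have := logWeight_ge_of_ge (K := 0) hs hs' hj₁ le_rfl (by linarith : 4 * j₁ - 0 ≤ a₁)
      linarith
    have G2 : 4 * j₂ ≤ a₂ → (2 * s + 4) * j₂ ≤ logWeight s j₂ a₂ := fun h => by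
      have := logWeight_ge_of_ge (K := 0) hs hs' hm0 le_rfl (by linarith : 4 * j₂ - 0 ≤ a₂)
      linarith
    have H1 : a₁ ≤ 4 * j₁ → s * j₁ + 3 / 4 * a₁ ≤ logWeight s j₁ a₁ := fun h => by
      have := logWeight_ge_of_le (K := 0) hs hs' hj₁ le_rfl (by linarith : a₁ ≤ 4 * j₁ + 0)
      linarith
    have H2 : a₂ ≤ 4 * j₂ → s * j₂ + 3 / 4 * a₂ ≤ logWeight s j₂ a₂ := fun h => by
      have := logWeight_ge_of_le (K := 0) hs hs' hm0 le_rfl (by linarith : a₂ ≤ 4 * j₂ + 0)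
      linarith
    -- If the output modulation dominates, the multiplier is at most s j + s m, which is the product
    -- of the two L¹ weights.
    by_cases co : j₂ + 4 * j - 2 * K ≤ a
    · have v := logWeight_output_le (K := 2 * K) hs hs' hj (by linarith) hm0 (by linarith)
        (by linarith : 4 * j + j₂ - 2 * K ≤ a)
      rcases le_or_gt a₂ (4 * j₂) with c2 | c2
      · rcases le_or_gt a₁ (4 * j₁) with c1 | c1
        · have := H1 c1
          have := H2 c2
          right; right; right; left
          exact ⟨hm0, by linarith⟩
        · have := G1 c1.le
          left
          linarith
      · have := G2 c2.le
        right; left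
        linarith
    · have hin : a ≤ j₂ + 4 * j - 2 * K := (not_le.1 co).le
      -- The high input is now the resonant one. Up to multiples of K there remains 0 ≤ (s + 3)j + s
      -- m if a₂ is below its threshold, and (3/8)a ≤ (s + 3)j + (2s + 27/8)m if it is above. Both
      -- are sharp at s = -3/2, and the second one fixes the exponent 5/8.
      by_cases c : j₂ + 4 * j - 2 * K ≤ a₁
      · have w1 := logWeight_ge_of_ge (K := 6 * K) hs hs' hj₁ (by linarith)
          (by linarith : 4 * j₁ - 6 * K ≤ a₁)
        rcases le_or_gt a₂ (4 * j₂) with c2 | c2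
        · have := H2 c2
          right; right; right; right; left
          exact ⟨hm0, by linarith⟩
        · have := G2 c2.le
          right; right; left
          linarith
      · have c' : j₂ + 4 * j - 2 * K ≤ a₂ := by
          rcases hmax with h | h | h
          · linarith
          · linarith
          · linarith
        -- In the last piece the terms in m cancel at a₂ = m + 4j and leave (2s + 4)j. If instead a₂
        -- ≤ 5m, then m itself is comparable with j.
        have w2 : (2 * s + 4) * j - 20 * K ≤ logWeight s j₂ a₂ := by
          rcases le_or_gt a₂ (5 * j₂) with d | d
          · have t := logWeight_ge_of_ge (K := 6 * K) hs hs' hm0 (by linarith)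
              (by linarith : 4 * j₂ - 6 * K ≤ a₂)
            nlinarith
          · unfold logWeight
            rw [if_neg (by linarith), if_neg (by linarith)]
            nlinarith [mul_nonneg (by linarith : (0 : ℝ) ≤ s / 2 + 1) (sub_nonneg.2 c')]
        rcases le_or_gt a₁ (4 * j₁) with c1 | c1
        · have := H1 c1
          right; right; right; right; right
          exact ⟨hm0, by linarith⟩
        · have := G1 c1.le
          right; right; left
          linarith

/-- Now the output is the lowest frequency, x = log|ξ|, and j₁ ≈ j₂. Upper bounds for the
modulations are needed as well: a dominating input modulation either has the size of the resonance,
where the middle piece gives a precise weight, or is balanced by the other input modulation, so that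
both weights are large. -/
lemma multiplier_highHigh (hs : -(3 / 2) ≤ s) (hs' : s ≤ -1) (hK : 1 ≤ K)
    (hj₁ : 0 ≤ j₁) (hj₂ : 0 ≤ j₂) (h₁ : j₁ ≤ j₂ + K) (h₁' : j₂ ≤ j₁ + K) (hj : j = max x 0)
    (hx : x ≤ j₂ + K) (hf : x + 4 * j₂ - K ≤ f) (hf' : f ≤ x + 4 * j₂ + K)
    (ha : 0 ≤ a) (ha₁ : 0 ≤ a₁) (ha₂ : 0 ≤ a₂) (hmax : f ≤ a + K ∨ f ≤ a₁ + K ∨ f ≤ a₂ + K)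
    (hmax₁ : a₁ ≤ a + K ∨ a₁ ≤ f + K ∨ a₁ ≤ a₂ + K)
    (hmax₂ : a₂ ≤ a + K ∨ a₂ ≤ f + K ∨ a₂ ≤ a₁ + K) :
    MultiplierAlt (200 * K) (logCoeff x) (x + logWeight s j a - a) a a₁ a₂
      (logWeight s j₁ a₁) (logWeight s j₂ a₂) (s * j₁) (s * j₂) (0 ≤ x) (0 ≤ x) (0 ≤ x) := by
  have k1 : 0 ≤ s + 3 / 2 := by linarith
  have k2 : 0 ≤ -1 - s := by linarith
  have sK : s * K ≤ -K := by nlinarith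
  have sK' : -(3 / 2 * K) ≤ s * K := by nlinarith
  have sj : s * j₁ ≤ s * j₂ + 3 / 2 * K := by nlinarith
  have sj' : s * j₂ ≤ s * j₁ + 3 / 2 * K := by nlinarith
  have u1 := logWeight_ge hs hs' hj₁ ha₁
  have u2 := logWeight_ge hs hs' hj₂ ha₂
  have n1 := mul_nonneg k1 hj₂
  have n2 := mul_nonneg k2 hj₂
  have G1 : 4 * j₂ - 20 * K ≤ a₁ → (2 * s + 4) * j₂ - 30 * K ≤ logWeight s j₁ a₁ := fun h => by
    have := logWeight_ge_of_ge (K := 24 * K) hs hs' hj₁ (by linarith)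
      (by linarith : 4 * j₁ - 24 * K ≤ a₁)
    nlinarith [mul_nonneg (by linarith : (0 : ℝ) ≤ 2 * s + 4) (sub_nonneg.2 h₁')]
  have G2 : 4 * j₂ - 20 * K ≤ a₂ → (2 * s + 4) * j₂ - 30 * K ≤ logWeight s j₂ a₂ := fun h => by
    have := logWeight_ge_of_ge (K := 20 * K) hs hs' hj₂ (by linarith)
      (by linarith : 4 * j₂ - 20 * K ≤ a₂)
    linarith
  unfold MultiplierAlt
  rcases lt_or_ge x 0 with hx0 | hx0
  · have e : j = 0 := by rw [hj]; exact max_eq_right hx0.le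
    subst e
    -- For j = 0 both corners sit at a = 0, so that only the last piece is left.
    have u : logWeight s 0 a = (s / 2 + 1) * a := by
      unfold logWeight
      split_ifs with h h'
      · have : a = 0 := by linarith
        subst this; ring
      · exact absurd (by linarith) h
      · ring
    have ux : x + logWeight s 0 a - a ≤ x - a / 4 := by rw [u]; nlinarith
    rw [logCoeff_of_nonpos hx0.le]
    by_cases co : x + 4 * j₂ - 2 * K ≤ a
    · left
      rw [u]
      nlinarith
    · have hin : a ≤ x + 4 * j₂ - 2 * K := (not_le.1 co).le
      by_cases c : x + 4 * j₂ - 2 * K ≤ a₁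
      -- Since x < 0, the resonance does not exceed 4j₂ + K. A modulation a₁ above 4j₁ + 10K can
      -- therefore be balanced by a₂ only.
      · rcases le_or_gt a₁ (4 * j₁ + 10 * K) with d | d
        · have := logWeight_ge_of_le hs hs' hj₁ (by linarith) d
          left
          linarith
        · have h2 : a₁ ≤ a₂ + K := by
            rcases hmax₁ with h | h | h <;> linarith
          have := G1 (by linarith)
          have := G2 (by linarith)
          right; right; left
          linarith
      · have c' : x + 4 * j₂ - 2 * K ≤ a₂ := by
          rcases hmax with h | h | h <;> linarith
        rcases le_or_gt a₂ (4 * j₂ + 10 * K) with d | d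
        · have := logWeight_ge_of_le hs hs' hj₂ (by linarith) d
          right; left
          linarith
        · have h2 : a₂ ≤ a₁ + K := by
            rcases hmax₂ with h | h | h <;> linarith
          have := G1 (by linarith)
          have := G2 (by linarith)
          right; right; left
          linarith
  · have e : j = x := by rw [hj]; exact max_eq_left hx0
    clear hj
    subst e
    have u := logWeight_sub_le (a := a) hs hs' hx0
    rw [logCoeff_of_nonneg hx0]
    have n3 := mul_nonneg k1 hx0
    have n4 := mul_nonneg k2 hx0
    have n5 := mul_nonneg k1 (sub_nonneg.2 hx)
    have n6 := mul_nonneg k2 (sub_nonneg.2 hx)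
    have H1 : a₁ ≤ 4 * j₁ → s * j₁ + 3 / 4 * a₁ ≤ logWeight s j₁ a₁ := fun h => by
      have := logWeight_ge_of_le (K := 0) hs hs' hj₁ le_rfl (by linarith : a₁ ≤ 4 * j₁ + 0)
      linarith
    have H2 : a₂ ≤ 4 * j₂ → s * j₂ + 3 / 4 * a₂ ≤ logWeight s j₂ a₂ := fun h => by
      have := logWeight_ge_of_le (K := 0) hs hs' hj₂ le_rfl (by linarith : a₂ ≤ 4 * j₂ + 0)
      linarith
    -- Such an output modulation lies beyond the second corner 5j, up to a multiple of K. There the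
    -- terms in j cancel, and 2s j₂ remains, the product of the L¹ weights of the inputs.
    by_cases co : j + 4 * j₂ - 2 * K ≤ a
    · have v := logWeight_sub_le_of_ge (K := 7 * K) hs hs' hx0 (by linarith)
        (by linarith : 5 * j - 7 * K ≤ a)
      have v' : j + logWeight s j a - a ≤ 2 * (s * j₂) + 25 * K := by nlinarith
      rcases le_or_gt a₂ (4 * j₂) with c2 | c2
      · rcases le_or_gt a₁ (4 * j₁) with c1 | c1
        · have := H1 c1
          have := H2 c2
          right; right; right; left
          exact ⟨hx0, by linarith⟩
        · have := G1 (by linarith)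
          left
          linarith
      · have := G2 (by linarith)
        right; left
        linarith
    · have hin : a ≤ j + 4 * j₂ - 2 * K := (not_le.1 co).le
      -- With a₂ clearly below its threshold, a₁ must have the size of the resonance. After
      -- `logWeight_ge_of_near` there remains 0 ≤ (2s + 3)j₂, which is again sharp at s = -3/2.
      rcases le_or_gt a₂ (4 * j₂ - 20 * K) with c2 | c2
      · have d1 : f ≤ a₁ + K := by rcases hmax with h | h | h <;> linarith
        have d2 : a₁ ≤ f + K := by rcases hmax₁ with h | h | h <;> linarith
        have w1 := logWeight_ge_of_near (K := 6 * K) (m := j) hs hs' hj₁ (by linarith) hx0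
          (by linarith) (by linarith) (by linarith : a₁ ≤ 4 * j₁ + j + 6 * K)
        have := H2 (by linarith)
        right; right; right; right; left
        exact ⟨hx0, by linarith⟩
      · rcases le_or_gt a₁ (4 * j₂ - 20 * K) with c1 | c1
        · have d1 : f ≤ a₂ + K := by rcases hmax with h | h | h <;> linarith
          have d2 : a₂ ≤ f + K := by rcases hmax₂ with h | h | h <;> linarith
          have w2 := logWeight_ge_of_near (K := 6 * K) (m := j) hs hs' hj₂ (by linarith) hx0
            (by linarith) (by linarith) (by linarith : a₂ ≤ 4 * j₂ + j + 6 * K)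
          have := H1 (by linarith)
          right; right; right; right; right
          exact ⟨hx0, by linarith⟩
        · have := G1 c1.le
          have := G2 c2.le
          right; right; left
          linarith

/-- The alternatives for the logarithm of the multiplier `A` in the estimate in `L¹`. -/
def MultiplierAltL1 (C κ A a W₁ W₂ y₁ y₂ : ℝ) : Prop :=
  A ≤ C + κ + y₁ + y₂ ∨ A ≤ C + κ - 5 / 8 * a + W₁ + y₂ ∨ A ≤ C + κ - 5 / 8 * a + y₁ + W₂ ∨
  A ≤ C + κ - 5 / 4 * a + W₁ + W₂

/-- For a ≥ 4j the factor x - a ≤ -3j pays for the low L¹ weight and the coefficient at once.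
Smaller a are not needed: there the L¹ weight is ⟨σ⟩^{-3/4} times the L² weight, and the L² estimate
takes over. -/
lemma multiplierL1_highLow {W₁ W₂ : ℝ} (hs : -(3 / 2) ≤ s) (hs' : s ≤ -1) (hK : 0 ≤ K)
    (hj : 0 ≤ j) (h₁ : j₁ ≤ j + K) (hx : x ≤ j) (hj₂ : j₂ = max m 0)
    (hm : m ≤ j + K) (ha : 4 * j ≤ a) :
    MultiplierAltL1 (100 * K) (logCoeff m) (x + s * j - a) a W₁ W₂ (s * j₁) (s * j₂) := by
  have k1 : 0 ≤ s + 3 / 2 := by linarith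
  have k2 : 0 ≤ -1 - s := by linarith
  have sj' : s * j ≤ s * j₁ + 3 / 2 * K := by nlinarith
  left
  rcases lt_or_ge m 0 with hm0 | hm0
  · rw [logCoeff_of_nonpos hm0.le, hj₂, max_eq_right hm0.le]
    linarith
  · rw [logCoeff_of_nonneg hm0, hj₂, max_eq_left hm0]
    nlinarith

/-- All alternatives are of triangle inequality type: every input that is measured in L² comes with
a factor ⟨σ⟩^{-5/8}, and no resonances have to be counted. -/
lemma multiplierL1_highHigh (hs : -(3 / 2) ≤ s) (hs' : s ≤ -1) (hK : 1 ≤ K)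
    (hj₁ : 0 ≤ j₁) (hj₂ : 0 ≤ j₂) (h₁ : j₁ ≤ j₂ + K) (h₁' : j₂ ≤ j₁ + K) (hj : j = max x 0)
    (hx : x ≤ j₂ + K) (hf : x + 4 * j₂ - K ≤ f) (hf' : f ≤ x + 4 * j₂ + K)
    (ha : 0 ≤ a) (hmax : f ≤ a + K ∨ f ≤ a₁ + K ∨ f ≤ a₂ + K)
    (hmax₁ : a₁ ≤ a + K ∨ a₁ ≤ f + K ∨ a₁ ≤ a₂ + K)
    (hmax₂ : a₂ ≤ a + K ∨ a₂ ≤ f + K ∨ a₂ ≤ a₁ + K) (haj : 4 * j ≤ a) :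
    MultiplierAltL1 (200 * K) (logCoeff x) (x + s * j - a) a
      (logWeight s j₁ a₁) (logWeight s j₂ a₂) (s * j₁) (s * j₂) := by
  have k1 : 0 ≤ s + 3 / 2 := by linarith
  have k2 : 0 ≤ -1 - s := by linarith
  have sK : s * K ≤ -K := by nlinarith
  have sK' : -(3 / 2 * K) ≤ s * K := by nlinarith
  have sj : s * j₁ ≤ s * j₂ + 3 / 2 * K := by nlinarith
  have sj' : s * j₂ ≤ s * j₁ + 3 / 2 * K := by nlinarith
  have n1 := mul_nonneg k1 hj₂
  have n2 := mul_nonneg k2 hj₂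
  have G1 : 4 * j₂ - 20 * K ≤ a₁ → (2 * s + 4) * j₂ - 30 * K ≤ logWeight s j₁ a₁ := fun h => by
    have := logWeight_ge_of_ge (K := 24 * K) hs hs' hj₁ (by linarith)
      (by linarith : 4 * j₁ - 24 * K ≤ a₁)
    nlinarith [mul_nonneg (by linarith : (0 : ℝ) ≤ 2 * s + 4) (sub_nonneg.2 h₁')]
  have G2 : 4 * j₂ - 20 * K ≤ a₂ → (2 * s + 4) * j₂ - 30 * K ≤ logWeight s j₂ a₂ := fun h => by
    have := logWeight_ge_of_ge (K := 20 * K) hs hs' hj₂ (by linarith)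
      (by linarith : 4 * j₂ - 20 * K ≤ a₂)
    linarith
  unfold MultiplierAltL1
  rcases lt_or_ge x 0 with hx0 | hx0
  · have e : j = 0 := by rw [hj]; exact max_eq_right hx0.le
    subst e
    rw [logCoeff_of_nonpos hx0.le]
    by_cases co : x + 4 * j₂ - 2 * K ≤ a
    · left
      nlinarith
    · have hin : a ≤ x + 4 * j₂ - 2 * K := (not_le.1 co).le
      by_cases c : x + 4 * j₂ - 2 * K ≤ a₁
      · rcases le_or_gt a₁ (4 * j₁ + 10 * K) with d | d
        · have := logWeight_ge_of_le hs hs' hj₁ (by linarith) d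
          right; left
          linarith
        · have h2 : a₁ ≤ a₂ + K := by
            rcases hmax₁ with h | h | h <;> linarith
          have := G1 (by linarith)
          have := G2 (by linarith)
          right; right; right
          linarith
      · have c' : x + 4 * j₂ - 2 * K ≤ a₂ := by
          rcases hmax with h | h | h <;> linarith
        rcases le_or_gt a₂ (4 * j₂ + 10 * K) with d | d
        · have := logWeight_ge_of_le hs hs' hj₂ (by linarith) d
          right; right; left
          linarith
        · have h2 : a₂ ≤ a₁ + K := by
            rcases hmax₂ with h | h | h <;> linarith
          have := G1 (by linarith)
          have := G2 (by linarith)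
          right; right; right
          linarith
  · have e : j = x := by rw [hj]; exact max_eq_left hx0
    clear hj
    subst e
    rw [logCoeff_of_nonneg hx0]
    have n3 := mul_nonneg k1 hx0
    have n4 := mul_nonneg k2 hx0
    have n5 := mul_nonneg k1 (sub_nonneg.2 hx)
    have n6 := mul_nonneg k2 (sub_nonneg.2 hx)
    have H1 : a₁ ≤ 4 * j₁ → s * j₁ + 3 / 4 * a₁ ≤ logWeight s j₁ a₁ := fun h => by
      have := logWeight_ge_of_le (K := 0) hs hs' hj₁ le_rfl (by linarith : a₁ ≤ 4 * j₁ + 0)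
      linarith
    by_cases co : j + 4 * j₂ - 2 * K ≤ a
    · left
      linarith
    · have hin : a ≤ j + 4 * j₂ - 2 * K := (not_le.1 co).le
      rcases le_or_gt a₂ (4 * j₂ - 20 * K) with c2 | c2
      · have d1 : f ≤ a₁ + K := by rcases hmax with h | h | h <;> linarith
        have d2 : a₁ ≤ f + K := by rcases hmax₁ with h | h | h <;> linarith
        have w1 := logWeight_ge_of_near (K := 6 * K) (m := j) hs hs' hj₁ (by linarith) hx0
          (by linarith) (by linarith) (by linarith : a₁ ≤ 4 * j₁ + j + 6 * K)
        right; left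
        linarith
      · rcases le_or_gt a₁ (4 * j₂ - 20 * K) with c1 | c1
        · have d1 : f ≤ a₂ + K := by rcases hmax with h | h | h <;> linarith
          have d2 : a₂ ≤ f + K := by rcases hmax₂ with h | h | h <;> linarith
          have w2 := logWeight_ge_of_near (K := 6 * K) (m := j) hs hs' hj₂ (by linarith) hx0
            (by linarith) (by linarith) (by linarith : a₂ ≤ 4 * j₂ + j + 6 * K)
          right; right; left
          linarith
        · have := G1 c1.le
          have := G2 c2.le
          right; right; right
          linarith

lemma logCoeff_ge (hK : 0 ≤ K) : -(5 / 8) * max m 0 - K ≤ logCoeff m := by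
  rcases le_total m 0 with hm | hm
  · rw [logCoeff_of_nonpos hm, max_eq_right hm]; linarith
  · rw [logCoeff_of_nonneg hm, max_eq_left hm]; linarith

/-- Half a power of the resonance is worth 2j + m/2, which more than compensates the derivative.
With all frequencies bounded below the triangle inequality is enough, hence the three `False`. -/
lemma multiplier_highLow_half (hK : 0 ≤ K) (hj : 0 ≤ j) (h₁ : j₁ ≤ j + K)
    (hx : x ≤ j) (hj₂ : j₂ = max m 0) (hm : m ≤ j + K) (hm' : -K ≤ m) (hf : m + 4 * j - K ≤ f)
    (ha : 0 ≤ a) (ha₁ : 0 ≤ a₁) (ha₂ : 0 ≤ a₂) (hmax : f ≤ a + K ∨ f ≤ a₁ + K ∨ f ≤ a₂ + K) :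
    MultiplierAlt (100 * K) (logCoeff m) (x + logWeight (-(3 / 2)) j a - a) a a₁ a₂
      (-j₁ + a₁ / 2) (-j₂ + a₂ / 2) (-j₁) (-j₂) False False False ∧
    MultiplierAltL1 (100 * K) (logCoeff m) (x + -(3 / 2) * j - a) a
      (-j₁ + a₁ / 2) (-j₂ + a₂ / 2) (-j₁) (-j₂) := by
  have hc := logCoeff_ge (m := m) hK
  rw [← hj₂] at hc
  have e1 : m ≤ j₂ := hj₂ ▸ le_max_left _ _
  have e2 : j₂ ≤ m + K := by rw [hj₂]; exact max_le (by linarith) (by linarith)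
  have e3 : 0 ≤ j₂ := hj₂ ▸ le_max_right _ _
  clear hj₂
  have u := logWeight_sub_le (a := a) (s := -(3 / 2)) le_rfl (by norm_num) hj
  unfold MultiplierAlt MultiplierAltL1
  rcases hmax with h | h | h
  · have v := logWeight_output_le (s := -(3 / 2)) (m := j₂) (K := 4 * K) le_rfl (by norm_num) hj
      (by linarith) e3 (by linarith) (by linarith : 4 * j + j₂ - 4 * K ≤ a)
    exact ⟨.inl (by linarith), .inl (by linarith)⟩
  · exact ⟨.inl (by linarith), .inr (.inl (by linarith))⟩
  · exact ⟨.inr (.inl (by linarith)), .inr (.inr (.inl (by linarith)))⟩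

lemma multiplier_highHigh_half (hK : 0 ≤ K) (h₁ : j₁ ≤ j₂ + K) (hj : j = max x 0)
    (hx : x ≤ j₂ + K) (hx' : -K ≤ x) (hf : x + 4 * j₂ - K ≤ f)
    (ha : 0 ≤ a) (ha₁ : 0 ≤ a₁) (ha₂ : 0 ≤ a₂) (hmax : f ≤ a + K ∨ f ≤ a₁ + K ∨ f ≤ a₂ + K) :
    MultiplierAlt (100 * K) (logCoeff x) (x + logWeight (-(3 / 2)) j a - a) a a₁ a₂
      (-j₁ + a₁ / 2) (-j₂ + a₂ / 2) (-j₁) (-j₂) False False False ∧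
    MultiplierAltL1 (100 * K) (logCoeff x) (x + -(3 / 2) * j - a) a
      (-j₁ + a₁ / 2) (-j₂ + a₂ / 2) (-j₁) (-j₂) := by
  have hc := logCoeff_ge (m := x) hK
  rw [← hj] at hc
  have e1 : x ≤ j := hj ▸ le_max_left _ _
  have e2 : j ≤ x + K := by rw [hj]; exact max_le (by linarith) (by linarith)
  have e3 : 0 ≤ j := hj ▸ le_max_right _ _
  clear hj
  have u := logWeight_sub_le (a := a) (s := -(3 / 2)) le_rfl (by norm_num) e3
  unfold MultiplierAlt MultiplierAltL1
  rcases hmax with h | h | h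
  · have v := logWeight_sub_le_of_ge (s := -(3 / 2)) (K := 11 * K) le_rfl (by norm_num) e3
      (by linarith) (by linarith : 5 * j - 11 * K ≤ a)
    exact ⟨.inl (by linarith), .inl (by linarith)⟩
  · exact ⟨.inl (by linarith), .inr (.inl (by linarith))⟩
  · exact ⟨.inr (.inl (by linarith)), .inr (.inr (.inl (by linarith)))⟩

end Multiplier

end

/-! ### Brackets and the size of the resonance function -/

/-- The bracket `max 1 |ξ|` of a frequency. -/
def freqBr (ξ : ℝ) : ℝ := max 1 |ξ|

/-- The bracket `1 + |σ|` of a modulation. -/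
def modBr (σ : ℝ) : ℝ := 1 + |σ|

/-- The weight of the modified Bourgain space. -/
def zWeight (s ξ σ : ℝ) : ℝ := Real.exp (logWeight s (Real.log (freqBr ξ)) (Real.log (modBr σ)))

/-- The coefficient of the lowest frequency of an interaction. -/
def lowCoeff (ξ : ℝ) : ℝ := Real.exp (logCoeff (Real.log |ξ|))

/-- The dispersion relation for a real frequency. -/
def phase (A B z : ℝ) : ℝ := -A * z ^ 5 + B * z ^ 3

/-- The resonance function of the interaction `ξ₁ + ξ₂ → ξ`. -/
def resonance (A B ξ ξ₁ ξ₂ : ℝ) : ℝ := phase A B ξ - phase A B ξ₁ - phase A B ξ₂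

/-- The largest frequency of an interaction. -/
def maxFreq (ξ ξ₁ ξ₂ : ℝ) : ℝ := max |ξ| (max |ξ₁| |ξ₂|)

lemma one_le_freqBr (ξ : ℝ) : 1 ≤ freqBr ξ := le_max_left _ _
lemma abs_le_freqBr (ξ : ℝ) : |ξ| ≤ freqBr ξ := le_max_right _ _
lemma freqBr_pos (ξ : ℝ) : 0 < freqBr ξ := zero_lt_one.trans_le (one_le_freqBr ξ)
lemma one_le_modBr (σ : ℝ) : 1 ≤ modBr σ := by unfold modBr; linarith [abs_nonneg σ]
lemma modBr_pos (σ : ℝ) : 0 < modBr σ := zero_lt_one.trans_le (one_le_modBr σ)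
lemma log_freqBr_nonneg (ξ : ℝ) : 0 ≤ Real.log (freqBr ξ) := Real.log_nonneg (one_le_freqBr ξ)
lemma log_modBr_nonneg (σ : ℝ) : 0 ≤ Real.log (modBr σ) := Real.log_nonneg (one_le_modBr σ)

lemma log_freqBr {ξ : ℝ} (h : ξ ≠ 0) : Real.log (freqBr ξ) = max (Real.log |ξ|) 0 := by
  have h0 := abs_pos.2 h
  unfold freqBr
  rcases le_total 1 |ξ| with h1 | h1
  · rw [max_eq_right h1, max_eq_left (Real.log_nonneg h1)]
  · rw [max_eq_left h1, Real.log_one, max_eq_right (Real.log_nonpos h0.le h1)]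

/-- The algebra behind the smoothing effect: all three frequencies split off, and the remaining
factor is a definite quadratic form up to the constant 3B. -/
lemma resonance_eq (A B ξ₁ ξ₂ : ℝ) : resonance A B (ξ₁ + ξ₂) ξ₁ ξ₂ =
    (ξ₁ + ξ₂) * ξ₁ * ξ₂ *
      (-(5 / 2 * A) * ((ξ₁ + ξ₂) ^ 2 + ξ₁ ^ 2 + ξ₂ ^ 2) + 3 * B) := by
  unfold resonance phase; ring

/-- Frequencies above this bound obey the resonance estimate. -/
def resBound (A B : ℝ) : ℝ := 2 + 6 * |B| / |A|

lemma two_le_resBound (A B : ℝ) : 2 ≤ resBound A B := by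
  unfold resBound
  have : 0 ≤ 6 * |B| / |A| := by positivity
  linarith

lemma maxFreq_sq_le (ξ₁ ξ₂ : ℝ) :
    maxFreq (ξ₁ + ξ₂) ξ₁ ξ₂ ^ 2 ≤ (ξ₁ + ξ₂) ^ 2 + ξ₁ ^ 2 + ξ₂ ^ 2 ∧
    (ξ₁ + ξ₂) ^ 2 + ξ₁ ^ 2 + ξ₂ ^ 2 ≤ 3 * maxFreq (ξ₁ + ξ₂) ξ₁ ξ₂ ^ 2 := by
  have e : ∀ x : ℝ, x ^ 2 = |x| ^ 2 := fun x => (sq_abs x).symm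
  have h1 : |ξ₁ + ξ₂| ≤ maxFreq (ξ₁ + ξ₂) ξ₁ ξ₂ := le_max_left _ _
  have h2 : |ξ₁| ≤ maxFreq (ξ₁ + ξ₂) ξ₁ ξ₂ := (le_max_left _ _).trans (le_max_right _ _)
  have h3 : |ξ₂| ≤ maxFreq (ξ₁ + ξ₂) ξ₁ ξ₂ := (le_max_right _ _).trans (le_max_right _ _)
  have p1 := pow_le_pow_left₀ (abs_nonneg _) h1 2
  have p2 := pow_le_pow_left₀ (abs_nonneg _) h2 2
  have p3 := pow_le_pow_left₀ (abs_nonneg _) h3 2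
  simp only [sq_abs] at p1 p2 p3
  refine ⟨?_, by linarith⟩
  have q1 := sq_nonneg (ξ₁ + ξ₂)
  have q2 := sq_nonneg ξ₁
  have q3 := sq_nonneg ξ₂
  unfold maxFreq
  rcases max_choice |ξ₁ + ξ₂| (max |ξ₁| |ξ₂|) with h | h <;> rw [h]
  · rw [sq_abs]; linarith
  · rcases max_choice |ξ₁| |ξ₂| with h | h <;> rw [h, sq_abs] <;> linarith

/-- The quadratic form contributes between (5/2)|A|N² and (15/2)|A|N², and above `resBound` the term
3|B'| is at most |A|N². The estimate is uniform over |B'| ≤ |B| because the coefficient at scale λ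
is β/λ². -/
lemma resonance_bounds {A B B' ξ₁ ξ₂ : ℝ} (hA : A ≠ 0) (hB : |B'| ≤ |B|)
    (hN : resBound A B ≤ maxFreq (ξ₁ + ξ₂) ξ₁ ξ₂) :
    |A| * (|ξ₁ + ξ₂| * |ξ₁| * |ξ₂| * maxFreq (ξ₁ + ξ₂) ξ₁ ξ₂ ^ 2)
      ≤ |resonance A B' (ξ₁ + ξ₂) ξ₁ ξ₂| ∧
    |resonance A B' (ξ₁ + ξ₂) ξ₁ ξ₂| ≤
      10 * |A| * (|ξ₁ + ξ₂| * |ξ₁| * |ξ₂| * maxFreq (ξ₁ + ξ₂) ξ₁ ξ₂ ^ 2) := by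
  set N := maxFreq (ξ₁ + ξ₂) ξ₁ ξ₂
  obtain ⟨q1, q2⟩ := maxFreq_sq_le ξ₁ ξ₂
  have hA' := abs_pos.2 hA
  have hN2 := (two_le_resBound A B).trans hN
  have hBN : 3 * |B'| ≤ |A| * N ^ 2 := by
    have : 6 * |B| / |A| ≤ N := by unfold resBound at hN; linarith
    rw [div_le_iff₀ hA'] at this
    nlinarith [mul_nonneg (mul_nonneg hA'.le (by linarith : 0 ≤ N)) (sub_nonneg.2 hN2)]
  set Q := (ξ₁ + ξ₂) ^ 2 + ξ₁ ^ 2 + ξ₂ ^ 2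
  have hQ : 0 ≤ Q := by positivity
  rw [resonance_eq, abs_mul, abs_mul, abs_mul]
  have hE : 0 ≤ |ξ₁ + ξ₂| * |ξ₁| * |ξ₂| := by positivity
  have t1 : |-(5 / 2 * A) * Q| = 5 / 2 * |A| * Q := by
    rw [abs_mul, abs_neg, abs_mul, abs_of_nonneg hQ]; norm_num
  have t2 : |3 * B'| = 3 * |B'| := by rw [abs_mul]; norm_num
  have t3 := abs_add_le (-(5 / 2 * A) * Q) (3 * B')
  have t4 : |-(5 / 2 * A) * Q| - |3 * B'| ≤ |-(5 / 2 * A) * Q + 3 * B'| := by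
    have := abs_sub_abs_le_abs_sub (-(5 / 2 * A) * Q) (-(3 * B'))
    rwa [abs_neg, sub_neg_eq_add] at this
  have r1 := mul_le_mul_of_nonneg_left q1 hA'.le
  have r2 := mul_le_mul_of_nonneg_left q2 hA'.le
  have r3 : 0 ≤ |A| * N ^ 2 := by positivity
  constructor
  · calc _ = |ξ₁ + ξ₂| * |ξ₁| * |ξ₂| * (|A| * N ^ 2) := by ring
      _ ≤ _ := mul_le_mul_of_nonneg_left (by linarith) hE
  · calc _ ≤ |ξ₁ + ξ₂| * |ξ₁| * |ξ₂| * (10 * (|A| * N ^ 2)) :=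
        mul_le_mul_of_nonneg_left (by linarith) hE
      _ = _ := by ring

/-- The largest of three summands is at least a third of the sum, and log 3 ≤ 2. -/
lemma log_le_of_le_add {p q r t : ℝ} (hp : 0 < p) (hq : 0 < q) (hr : 0 < r) (ht : 0 < t)
    (h : p ≤ q + r + t) : Real.log p ≤ Real.log q + 2 ∨ Real.log p ≤ Real.log r + 2 ∨
      Real.log p ≤ Real.log t + 2 := by
  have key : ∀ {u : ℝ}, 0 < u → p ≤ 3 * u → Real.log p ≤ Real.log u + 2 := by
    intro u hu hpu
    have h1 := Real.log_le_log hp hpu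
    rw [Real.log_mul (by norm_num) hu.ne'] at h1
    have h2 : Real.log 3 ≤ 2 := by
      have := Real.log_le_sub_one_of_pos (show (0 : ℝ) < 3 by norm_num)
      linarith
    linarith
  by_cases h1 : p ≤ 3 * q
  · exact .inl (key hq h1)
  by_cases h2 : p ≤ 3 * r
  · exact .inr (.inl (key hr h2))
  exact .inr (.inr (key ht (by linarith)))

/-- The logarithmic size of the modulations of an interaction. -/
lemma log_modulations {A B B' ξ₁ ξ₂ σ σ₁ σ₂ : ℝ} (hA : A ≠ 0) (hB : |B'| ≤ |B|)
    (hξ : ξ₁ + ξ₂ ≠ 0) (hξ₁ : ξ₁ ≠ 0) (hξ₂ : ξ₂ ≠ 0)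
    (hN : resBound A B ≤ maxFreq (ξ₁ + ξ₂) ξ₁ ξ₂)
    (hσ : σ + resonance A B' (ξ₁ + ξ₂) ξ₁ ξ₂ = σ₁ + σ₂) :
    ∃ f, |f - (Real.log |ξ₁ + ξ₂| + Real.log |ξ₁| + Real.log |ξ₂| +
        2 * Real.log (maxFreq (ξ₁ + ξ₂) ξ₁ ξ₂))| ≤ abs (Real.log |A|) + 9 ∧
      (f ≤ Real.log (modBr σ) + 2 ∨ f ≤ Real.log (modBr σ₁) + 2 ∨
        f ≤ Real.log (modBr σ₂) + 2) ∧
      (Real.log (modBr σ₁) ≤ Real.log (modBr σ) + 2 ∨ Real.log (modBr σ₁) ≤ f + 2 ∨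
        Real.log (modBr σ₁) ≤ Real.log (modBr σ₂) + 2) ∧
      (Real.log (modBr σ₂) ≤ Real.log (modBr σ) + 2 ∨ Real.log (modBr σ₂) ≤ f + 2 ∨
        Real.log (modBr σ₂) ≤ Real.log (modBr σ₁) + 2) := by
  obtain ⟨h1, h2⟩ := resonance_bounds hA hB hN
  set N := maxFreq (ξ₁ + ξ₂) ξ₁ ξ₂
  set R := resonance A B' (ξ₁ + ξ₂) ξ₁ ξ₂
  have hN0 : 0 < N := by linarith [(two_le_resBound A B).trans hN]
  have hA' := abs_pos.2 hA
  have a0 := abs_pos.2 hξ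
  have a1 := abs_pos.2 hξ₁
  have a2 := abs_pos.2 hξ₂
  have hE : 0 < |ξ₁ + ξ₂| * |ξ₁| * |ξ₂| * N ^ 2 := by positivity
  have hR : 0 < |R| := lt_of_lt_of_le (by positivity) h1
  have lE : Real.log (|ξ₁ + ξ₂| * |ξ₁| * |ξ₂| * N ^ 2) =
      Real.log |ξ₁ + ξ₂| + Real.log |ξ₁| + Real.log |ξ₂| + 2 * Real.log N := by
    rw [Real.log_mul (by positivity) (by positivity), Real.log_mul (by positivity) (by positivity),
      Real.log_mul (by positivity) (by positivity), Real.log_pow]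
    norm_num
  have l1 := Real.log_le_log (by positivity) h1
  have l2 := Real.log_le_log hR h2
  rw [Real.log_mul (by positivity) hE.ne', lE] at l1
  rw [Real.log_mul (by positivity) hE.ne', Real.log_mul (by norm_num) hA'.ne', lE] at l2
  have l10 : Real.log 10 ≤ 9 := by
    have := Real.log_le_sub_one_of_pos (show (0 : ℝ) < 10 by norm_num)
    linarith
  have lA := le_abs_self (Real.log |A|)
  have lA' := neg_abs_le (Real.log |A|)
  have eR : |R| = |σ₁ + σ₂ - σ| := by congr 1; linarith
  refine ⟨Real.log |R|, abs_le.2 ⟨by linarith, by linarith⟩, ?_, ?_, ?_⟩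
  · apply log_le_of_le_add hR (modBr_pos _) (modBr_pos _) (modBr_pos _)
    unfold modBr
    rw [eR]
    linarith [abs_sub (σ₁ + σ₂) σ, abs_add_le σ₁ σ₂]
  · apply log_le_of_le_add (modBr_pos _) (modBr_pos _) hR (modBr_pos _)
    unfold modBr
    have : σ₁ = σ + R - σ₂ := by linarith
    linarith [abs_sub (σ + R) σ₂, abs_add_le σ R, congrArg abs this]
  · apply log_le_of_le_add (modBr_pos _) (modBr_pos _) hR (modBr_pos _)
    unfold modBr
    have : σ₂ = σ + R - σ₁ := by linarith
    linarith [abs_sub (σ + R) σ₁, abs_add_le σ R, congrArg abs this]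

/-! ### From logarithms back to multipliers -/

section

open Classical in
/-- The indicator of a proposition. -/
def ind (p : Prop) : ℝ := if p then 1 else 0

lemma ind_nonneg (p : Prop) : 0 ≤ ind p := by unfold ind; split_ifs <;> norm_num

lemma ind_of {p : Prop} (h : p) : ind p = 1 := by simp [ind, h]

/-- The bound for the multiplier in the `L²` estimate. -/
def multBound (c y₁ y₂ W₁ W₂ S S₁ S₂ i i₁ i₂ : ℝ) : ℝ :=
  c * (W₁ * y₂ + y₁ * W₂ + S ^ (-(5 / 8) : ℝ) * W₁ * W₂) +
    W₁ * W₂ * (i * (S₁ ^ (-(3 / 4) : ℝ) * S₂ ^ (-(3 / 4) : ℝ)) +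
      i₁ * (S ^ (-(1 / 4) : ℝ) * S₂ ^ (-(3 / 4) : ℝ)) +
      i₂ * (S ^ (-(1 / 4) : ℝ) * S₁ ^ (-(3 / 4) : ℝ)))

/-- The bound for the multiplier in the `L¹` estimate. -/
def multBoundL1 (c y₁ y₂ W₁ W₂ S : ℝ) : ℝ :=
  c * (y₁ * y₂ + S ^ (-(5 / 8) : ℝ) * (W₁ * y₂ + y₁ * W₂) + S ^ (-(5 / 4) : ℝ) * W₁ * W₂)

lemma multBound_comm (c y₁ y₂ W₁ W₂ S S₁ S₂ i i₁ i₂ : ℝ) :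
    multBound c y₁ y₂ W₁ W₂ S S₁ S₂ i i₁ i₂ = multBound c y₂ y₁ W₂ W₁ S S₂ S₁ i i₂ i₁ := by
  unfold multBound; ring

lemma multBoundL1_comm (c y₁ y₂ W₁ W₂ S : ℝ) :
    multBoundL1 c y₁ y₂ W₁ W₂ S = multBoundL1 c y₂ y₁ W₂ W₁ S := by
  unfold multBoundL1; ring

section

variable {C κ A W₁ W₂ y₁ y₂ S S₁ S₂ c : ℝ} {p q₁ q₂ : Prop}

/-- Each alternative exponentiates to one summand of the bound; the other summands are nonnegative.
-/
lemma MultiplierAlt.le (hS : 0 < S) (hS₁ : 0 < S₁) (hS₂ : 0 < S₂)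
    (h : MultiplierAlt C κ A (Real.log S) (Real.log S₁) (Real.log S₂) W₁ W₂ y₁ y₂ p q₁ q₂)
    (hc : Real.exp κ ≤ c) :
    Real.exp A ≤ Real.exp C * multBound c (Real.exp y₁) (Real.exp y₂) (Real.exp W₁)
      (Real.exp W₂) S S₁ S₂ (ind p) (ind q₁) (ind q₂) := by
  have hc0 : 0 ≤ c := (Real.exp_pos κ).le.trans hc
  have i0 := ind_nonneg p
  have i1 := ind_nonneg q₁
  have i2 := ind_nonneg q₂
  rw [← sub_nonneg]
  unfold multBound
  rw [Real.rpow_def_of_pos hS, Real.rpow_def_of_pos hS, Real.rpow_def_of_pos hS₁,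
    Real.rpow_def_of_pos hS₂]
  have key : ∀ {u v : ℝ}, A ≤ C + κ + v → Real.exp v ≤ u → Real.exp A ≤ Real.exp C * (c * u) := by
    intro u v h h'
    calc Real.exp A ≤ Real.exp (C + κ + v) := Real.exp_le_exp.2 h
      _ = Real.exp C * (Real.exp κ * Real.exp v) := by rw [Real.exp_add, Real.exp_add]; ring
      _ ≤ _ := by gcongr
  have key2 : ∀ {u v : ℝ}, A ≤ C + v → Real.exp v ≤ u → Real.exp A ≤ Real.exp C * u := by
    intro u v h h'
    calc Real.exp A ≤ Real.exp (C + v) := Real.exp_le_exp.2 h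
      _ = Real.exp C * Real.exp v := by rw [Real.exp_add]
      _ ≤ _ := by gcongr
  set E1 := Real.exp W₁ with hE1
  set E2 := Real.exp W₂ with hE2
  have p1 : 0 < E1 := Real.exp_pos _
  have p2 : 0 < E2 := Real.exp_pos _
  have p3 := Real.exp_pos C
  have p4 := Real.exp_pos y₁
  have p5 := Real.exp_pos y₂
  have p6 := Real.exp_pos (Real.log S * (-(5 / 8)))
  have p7 := Real.exp_pos (Real.log S * (-(1 / 4)))
  have p8 := Real.exp_pos (Real.log S₁ * (-(3 / 4)))
  have p9 := Real.exp_pos (Real.log S₂ * (-(3 / 4)))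
  have m1 : 0 ≤ E1 * E2 := by positivity
  have t1 : 0 ≤ Real.exp C * (c * (E1 * Real.exp y₂)) := by positivity
  have t2 : 0 ≤ Real.exp C * (c * (Real.exp y₁ * E2)) := by positivity
  have t3 : 0 ≤ Real.exp C * (c * (Real.exp (Real.log S * (-(5 / 8))) * E1 * E2)) := by positivity
  have t4 : 0 ≤ Real.exp C * (E1 * E2 * (ind p * (Real.exp (Real.log S₁ * (-(3 / 4))) *
    Real.exp (Real.log S₂ * (-(3 / 4)))))) := by positivity
  have t5 : 0 ≤ Real.exp C * (E1 * E2 * (ind q₁ * (Real.exp (Real.log S * (-(1 / 4))) *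
    Real.exp (Real.log S₂ * (-(3 / 4)))))) := by positivity
  have t6 : 0 ≤ Real.exp C * (E1 * E2 * (ind q₂ * (Real.exp (Real.log S * (-(1 / 4))) *
    Real.exp (Real.log S₁ * (-(3 / 4)))))) := by positivity
  rcases h with h | h | h | ⟨hp, h⟩ | ⟨hp, h⟩ | ⟨hp, h⟩
  · have := key (u := E1 * Real.exp y₂) (v := W₁ + y₂) (by linarith) (by rw [Real.exp_add])
    linarith
  · have := key (u := Real.exp y₁ * E2) (v := y₁ + W₂) (by linarith) (by rw [Real.exp_add])
    linarith
  · have := key (u := Real.exp (Real.log S * (-(5 / 8))) * E1 * E2)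
      (v := Real.log S * (-(5 / 8)) + W₁ + W₂) (by linarith)
      (by rw [Real.exp_add, Real.exp_add])
    linarith
  · have := key2 (u := E1 * E2 * (ind p * (Real.exp (Real.log S₁ * (-(3 / 4))) *
        Real.exp (Real.log S₂ * (-(3 / 4))))))
      (v := W₁ + W₂ + (Real.log S₁ * (-(3 / 4)) + Real.log S₂ * (-(3 / 4)))) (by linarith)
      (by rw [Real.exp_add, Real.exp_add, Real.exp_add, ind_of hp, one_mul])
    linarith
  · have := key2 (u := E1 * E2 * (ind q₁ * (Real.exp (Real.log S * (-(1 / 4))) *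
        Real.exp (Real.log S₂ * (-(3 / 4))))))
      (v := W₁ + W₂ + (Real.log S * (-(1 / 4)) + Real.log S₂ * (-(3 / 4)))) (by linarith)
      (by rw [Real.exp_add, Real.exp_add, Real.exp_add, ind_of hp, one_mul])
    linarith
  · have := key2 (u := E1 * E2 * (ind q₂ * (Real.exp (Real.log S * (-(1 / 4))) *
        Real.exp (Real.log S₁ * (-(3 / 4))))))
      (v := W₁ + W₂ + (Real.log S * (-(1 / 4)) + Real.log S₁ * (-(3 / 4)))) (by linarith)
      (by rw [Real.exp_add, Real.exp_add, Real.exp_add, ind_of hp, one_mul])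
    linarith

lemma MultiplierAltL1.le (hS : 0 < S)
    (h : MultiplierAltL1 C κ A (Real.log S) W₁ W₂ y₁ y₂) (hc : Real.exp κ ≤ c) :
    Real.exp A ≤ Real.exp C * multBoundL1 c (Real.exp y₁) (Real.exp y₂) (Real.exp W₁)
      (Real.exp W₂) S := by
  have hc0 : 0 ≤ c := (Real.exp_pos κ).le.trans hc
  unfold multBoundL1
  rw [Real.rpow_def_of_pos hS, Real.rpow_def_of_pos hS]
  have key : ∀ {u v : ℝ}, A ≤ C + κ + v → Real.exp v ≤ u → Real.exp A ≤ Real.exp C * (c * u) := by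
    intro u v h h'
    calc Real.exp A ≤ Real.exp (C + κ + v) := Real.exp_le_exp.2 h
      _ = Real.exp C * (Real.exp κ * Real.exp v) := by rw [Real.exp_add, Real.exp_add]; ring
      _ ≤ _ := by gcongr
  have p1 := Real.exp_pos W₁
  have p2 := Real.exp_pos W₂
  have p4 := Real.exp_pos y₁
  have p5 := Real.exp_pos y₂
  have p6 := Real.exp_pos (Real.log S * (-(5 / 8)))
  have p7 := Real.exp_pos (Real.log S * (-(5 / 4)))
  have t1 := mul_pos p4 p5
  have t2 := mul_pos p6 (mul_pos p1 p5)
  have t3 := mul_pos p6 (mul_pos p4 p2)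
  have t4 := mul_pos (mul_pos p7 p1) p2
  rcases h with h | h | h | h
  · exact key (v := y₁ + y₂) (by linarith) (by rw [Real.exp_add]; linarith)
  · exact key (v := Real.log S * (-(5 / 8)) + (W₁ + y₂)) (by linarith)
      (by rw [Real.exp_add, Real.exp_add]; linarith)
  · exact key (v := Real.log S * (-(5 / 8)) + (y₁ + W₂)) (by linarith)
      (by rw [Real.exp_add, Real.exp_add]; linarith)
  · exact key (v := Real.log S * (-(5 / 4)) + W₁ + W₂) (by linarith)
      (by rw [Real.exp_add, Real.exp_add]; linarith)

end

/-- The region in which a frequency may be fixed in the Cauchy-Schwarz argument. -/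
def Resonant (A B ξ ξ₁ ξ₂ z : ℝ) : Prop := resBound A B ≤ maxFreq ξ ξ₁ ξ₂ ∧ 1 ≤ |z|

lemma maxFreq_comm (ξ ξ₁ ξ₂ : ℝ) : maxFreq ξ ξ₁ ξ₂ = maxFreq ξ ξ₂ ξ₁ := by
  unfold maxFreq; rw [max_comm |ξ₁|]

lemma abs_le_maxFreq (ξ ξ₁ ξ₂ : ℝ) : |ξ| ≤ maxFreq ξ ξ₁ ξ₂ ∧ |ξ₁| ≤ maxFreq ξ ξ₁ ξ₂ ∧
    |ξ₂| ≤ maxFreq ξ ξ₁ ξ₂ :=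
  ⟨le_max_left _ _, (le_max_left _ _).trans (le_max_right _ _),
    (le_max_right _ _).trans (le_max_right _ _)⟩

/-- Sum of the low-frequency coefficients of an interaction. -/
def lowSum (ξ ξ₁ ξ₂ : ℝ) : ℝ := lowCoeff ξ + lowCoeff ξ₁ + lowCoeff ξ₂

lemma log_two_le : Real.log 2 ≤ 1 := by
  have := Real.log_le_sub_one_of_pos (show (0 : ℝ) < 2 by norm_num)
  linarith

lemma log_le_log_add_one {u v : ℝ} (hu : 0 < u) (hv : 0 < v) (h : u ≤ 2 * v) :
    Real.log u ≤ Real.log v + 1 := by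
  have h1 := Real.log_le_log hu h
  rw [Real.log_mul (by norm_num) hv.ne'] at h1
  linarith [log_two_le]

lemma freqBr_rpow (s ξ : ℝ) : freqBr ξ ^ s = Real.exp (s * Real.log (freqBr ξ)) := by
  rw [Real.rpow_def_of_pos (freqBr_pos ξ), mul_comm]

lemma mul_zWeight_div {ξ : ℝ} (hξ : ξ ≠ 0) (s σ : ℝ) :
    |ξ| * zWeight s ξ σ / modBr σ = Real.exp (Real.log |ξ| +
      logWeight s (Real.log (freqBr ξ)) (Real.log (modBr σ)) - Real.log (modBr σ)) := by
  rw [Real.exp_sub, Real.exp_add, Real.exp_log (abs_pos.2 hξ), Real.exp_log (modBr_pos σ)]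
  rfl

lemma mul_rpow_div {ξ : ℝ} (hξ : ξ ≠ 0) (s σ : ℝ) :
    |ξ| * freqBr ξ ^ s / modBr σ = Real.exp (Real.log |ξ| +
      s * Real.log (freqBr ξ) - Real.log (modBr σ)) := by
  rw [Real.exp_sub, Real.exp_add, Real.exp_log (abs_pos.2 hξ), Real.exp_log (modBr_pos σ),
    freqBr_rpow]

lemma ind_mono {p q : Prop} (h : p → q) : ind p ≤ ind q := by
  by_cases hp : p
  · rw [ind_of hp, ind_of (h hp)]
  · simp only [ind, hp, if_false]; exact ind_nonneg q

lemma multBound_mono {c c' y₁ y₂ W₁ W₂ S S₁ S₂ i i₁ i₂ i' i₁' i₂' : ℝ} (hc : c ≤ c')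
    (hy₁ : 0 ≤ y₁) (hy₂ : 0 ≤ y₂) (hW₁ : 0 ≤ W₁) (hW₂ : 0 ≤ W₂) (hS : 0 ≤ S) (hS₁ : 0 ≤ S₁)
    (hS₂ : 0 ≤ S₂) (hi : i ≤ i') (hi₁ : i₁ ≤ i₁') (hi₂ : i₂ ≤ i₂') :
    multBound c y₁ y₂ W₁ W₂ S S₁ S₂ i i₁ i₂ ≤ multBound c' y₁ y₂ W₁ W₂ S S₁ S₂ i' i₁' i₂' := by
  unfold multBound
  gcongr

/-- The case distinction behind both multiplier estimates: high-low and high-high interactions. -/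
lemma frequency_cases {A B ξ₁ ξ₂ : ℝ} (hξ : ξ₁ + ξ₂ ≠ 0) (hξ₁ : ξ₁ ≠ 0) (hξ₂ : ξ₂ ≠ 0)
    (h : |ξ₂| ≤ |ξ₁|) (hN : resBound A B ≤ maxFreq (ξ₁ + ξ₂) ξ₁ ξ₂) :
    (|ξ₂| ≤ |ξ₁ + ξ₂| ∧ 1 ≤ |ξ₁ + ξ₂| ∧ 1 ≤ |ξ₁| ∧
      Real.log |ξ₁| ≤ Real.log |ξ₁ + ξ₂| + 1 ∧ Real.log |ξ₁ + ξ₂| ≤ Real.log |ξ₁| + 1 ∧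
      Real.log |ξ₁ + ξ₂| ≤ Real.log (maxFreq (ξ₁ + ξ₂) ξ₁ ξ₂) ∧
      Real.log (maxFreq (ξ₁ + ξ₂) ξ₁ ξ₂) ≤ Real.log |ξ₁ + ξ₂| + 1 ∧
      Real.log |ξ₂| ≤ Real.log |ξ₁ + ξ₂|) ∨
    (|ξ₁ + ξ₂| ≤ |ξ₂| ∧ 1 ≤ |ξ₁| ∧ 1 ≤ |ξ₂| ∧
      Real.log |ξ₁| ≤ Real.log |ξ₂| + 1 ∧ Real.log |ξ₂| ≤ Real.log |ξ₁| ∧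
      Real.log (maxFreq (ξ₁ + ξ₂) ξ₁ ξ₂) = Real.log |ξ₁| ∧
      Real.log |ξ₁ + ξ₂| ≤ Real.log |ξ₂|) := by
  have hN2 := (two_le_resBound A B).trans hN
  have a0 := abs_pos.2 hξ
  have a1 := abs_pos.2 hξ₁
  have a2 := abs_pos.2 hξ₂
  have q1 : |ξ₁| ≤ |ξ₁ + ξ₂| + |ξ₂| := by
    have := abs_sub (ξ₁ + ξ₂) ξ₂
    simpa using this
  have q0 := abs_add_le ξ₁ ξ₂
  rcases le_total |ξ₂| |ξ₁ + ξ₂| with h1 | h1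
  · left
    have hM : maxFreq (ξ₁ + ξ₂) ξ₁ ξ₂ ≤ 2 * |ξ₁ + ξ₂| :=
      max_le (by linarith) (max_le (by linarith) (by linarith))
    have hM' : maxFreq (ξ₁ + ξ₂) ξ₁ ξ₂ ≤ 2 * |ξ₁| :=
      max_le (by linarith) (max_le (by linarith) (by linarith))
    exact ⟨h1, by linarith, by linarith, log_le_log_add_one a1 a0 (by linarith),
      log_le_log_add_one a0 a1 (by linarith), Real.log_le_log a0 (le_max_left _ _),
      log_le_log_add_one (by linarith) a0 hM, Real.log_le_log a2 h1⟩
  · right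
    have hM : maxFreq (ξ₁ + ξ₂) ξ₁ ξ₂ = |ξ₁| := by
      unfold maxFreq
      rw [max_eq_left h, max_eq_right (h1.trans h)]
    rw [hM] at hN2 ⊢
    exact ⟨h1, by linarith, by linarith, log_le_log_add_one a1 a2 (by linarith),
      Real.log_le_log a2 h, rfl, Real.log_le_log a0 h1⟩

lemma lowCoeff_pos (ξ : ℝ) : 0 < lowCoeff ξ := Real.exp_pos _

section

variable {A B s : ℝ}

lemma zWeight_pos (s ξ σ : ℝ) : 0 < zWeight s ξ σ := Real.exp_pos _

/-- Both multiplier estimates for interactions of low frequencies. -/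
lemma multiplier_low {K ξ₁ ξ₂ : ℝ} (hs : -(3 / 2) ≤ s) (hs' : s ≤ -1) (hK : 0 ≤ K)
    (hξ : ξ₁ + ξ₂ ≠ 0) (hξ₁ : ξ₁ ≠ 0) (hξ₂ : ξ₂ ≠ 0)
    (hN : Real.log (maxFreq (ξ₁ + ξ₂) ξ₁ ξ₂) ≤ K) (σ σ₁ σ₂ : ℝ) :
    MultiplierAlt (100 * K) (logCoeff (Real.log |ξ₂|)) (Real.log |ξ₁ + ξ₂| +
      logWeight s (Real.log (freqBr (ξ₁ + ξ₂))) (Real.log (modBr σ)) - Real.log (modBr σ))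
      (Real.log (modBr σ)) (Real.log (modBr σ₁)) (Real.log (modBr σ₂))
      (logWeight s (Real.log (freqBr ξ₁)) (Real.log (modBr σ₁)))
      (logWeight s (Real.log (freqBr ξ₂)) (Real.log (modBr σ₂)))
      (s * Real.log (freqBr ξ₁)) (s * Real.log (freqBr ξ₂)) False False False ∧
    MultiplierAltL1 (100 * K) (logCoeff (Real.log |ξ₂|))
      (Real.log |ξ₁ + ξ₂| + s * Real.log (freqBr (ξ₁ + ξ₂)) - Real.log (modBr σ))
      (Real.log (modBr σ))
      (logWeight s (Real.log (freqBr ξ₁)) (Real.log (modBr σ₁)))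
      (logWeight s (Real.log (freqBr ξ₂)) (Real.log (modBr σ₂)))
      (s * Real.log (freqBr ξ₁)) (s * Real.log (freqBr ξ₂)) := by
  obtain ⟨n0, n1, n2⟩ := abs_le_maxFreq (ξ₁ + ξ₂) ξ₁ ξ₂
  have l0 := (Real.log_le_log (abs_pos.2 hξ) n0).trans hN
  have l1 := (Real.log_le_log (abs_pos.2 hξ₁) n1).trans hN
  have l2 := (Real.log_le_log (abs_pos.2 hξ₂) n2).trans hN
  have j0 : Real.log (freqBr (ξ₁ + ξ₂)) ≤ K := by rw [log_freqBr hξ]; exact max_le l0 hK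
  have j1 : Real.log (freqBr ξ₁) ≤ K := by rw [log_freqBr hξ₁]; exact max_le l1 hK
  have j2 : Real.log (freqBr ξ₂) ≤ K := by rw [log_freqBr hξ₂]; exact max_le l2 hK
  have p0 := log_freqBr_nonneg (ξ₁ + ξ₂)
  have p1 := log_freqBr_nonneg ξ₁
  have p2 := log_freqBr_nonneg ξ₂
  have r0 := log_modBr_nonneg σ
  have r1 := log_modBr_nonneg σ₁
  have u := logWeight_sub_le (a := Real.log (modBr σ)) hs hs' p0
  have u1 := logWeight_ge hs hs' p1 r1
  have hk : -(5 / 8) * K ≤ logCoeff (Real.log |ξ₂|) :=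
    le_min (by linarith) (by linarith)
  have s0 : s * Real.log (freqBr (ξ₁ + ξ₂)) ≤ 0 := by nlinarith
  have s1 : -(3 / 2) * K ≤ s * Real.log (freqBr ξ₁) := by nlinarith
  have s2 : -(3 / 2) * K ≤ s * Real.log (freqBr ξ₂) := by nlinarith
  exact ⟨.inl (by linarith), .inr (.inl (by linarith))⟩

end

end

/-! ### The multiplier estimates -/

section

section

variable {A B s : ℝ}

/-- The multiplier estimates in `L²` and `L¹` for an interaction with `L²` weights `W₁, W₂`
and `L¹` weights `y₁, y₂`. -/
def MultiplierEstimate (A B s C ξ₁ ξ₂ σ W₁ W₂ y₁ y₂ S₁ S₂ : ℝ) : Prop :=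
  |ξ₁ + ξ₂| * zWeight s (ξ₁ + ξ₂) σ / modBr σ ≤
    C * multBound (lowSum (ξ₁ + ξ₂) ξ₁ ξ₂) y₁ y₂ W₁ W₂ (modBr σ) S₁ S₂
      (ind (Resonant A B (ξ₁ + ξ₂) ξ₁ ξ₂ (ξ₁ + ξ₂))) (ind (Resonant A B (ξ₁ + ξ₂) ξ₁ ξ₂ ξ₁))
      (ind (Resonant A B (ξ₁ + ξ₂) ξ₁ ξ₂ ξ₂)) ∧
  |ξ₁ + ξ₂| * freqBr (ξ₁ + ξ₂) ^ s / modBr σ ≤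
    C * multBoundL1 (lowSum (ξ₁ + ξ₂) ξ₁ ξ₂) y₁ y₂ W₁ W₂ (modBr σ) +
      modBr σ ^ (-(3 / 4) : ℝ) * (|ξ₁ + ξ₂| * zWeight s (ξ₁ + ξ₂) σ / modBr σ)

lemma resonant_comm {ξ ξ₁ ξ₂ z : ℝ} : Resonant A B ξ ξ₁ ξ₂ z ↔ Resonant A B ξ ξ₂ ξ₁ z := by
  unfold Resonant; rw [maxFreq_comm]

lemma MultiplierEstimate.comm {C ξ₁ ξ₂ σ W₁ W₂ y₁ y₂ S₁ S₂ : ℝ}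
    (h : MultiplierEstimate A B s C ξ₁ ξ₂ σ W₁ W₂ y₁ y₂ S₁ S₂) :
    MultiplierEstimate A B s C ξ₂ ξ₁ σ W₂ W₁ y₂ y₁ S₂ S₁ := by
  unfold MultiplierEstimate at h ⊢
  rw [add_comm ξ₂ ξ₁, multBound_comm, multBoundL1_comm]
  have e : lowSum (ξ₁ + ξ₂) ξ₂ ξ₁ = lowSum (ξ₁ + ξ₂) ξ₁ ξ₂ := by unfold lowSum; ring
  rw [e]
  simpa only [resonant_comm (ξ₁ := ξ₂) (ξ₂ := ξ₁)] using h

lemma lowCoeff_le_lowSum (ξ ξ₁ ξ₂ : ℝ) : lowCoeff ξ ≤ lowSum ξ ξ₁ ξ₂ ∧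
    lowCoeff ξ₁ ≤ lowSum ξ ξ₁ ξ₂ ∧ lowCoeff ξ₂ ≤ lowSum ξ ξ₁ ξ₂ := by
  have h0 := lowCoeff_pos ξ
  have h1 := lowCoeff_pos ξ₁
  have h2 := lowCoeff_pos ξ₂
  unfold lowSum
  exact ⟨by linarith, by linarith, by linarith⟩

lemma multBoundL1_nonneg {c y₁ y₂ W₁ W₂ S : ℝ} (hc : 0 ≤ c) (hy₁ : 0 ≤ y₁) (hy₂ : 0 ≤ y₂)
    (hW₁ : 0 ≤ W₁) (hW₂ : 0 ≤ W₂) (hS : 0 ≤ S) : 0 ≤ multBoundL1 c y₁ y₂ W₁ W₂ S := by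
  unfold multBoundL1; positivity

lemma lowSum_pos (ξ ξ₁ ξ₂ : ℝ) : 0 < lowSum ξ ξ₁ ξ₂ :=
  add_pos (add_pos (lowCoeff_pos _) (lowCoeff_pos _)) (lowCoeff_pos _)

/-- From the logarithmic alternatives to the multiplier estimates. -/
lemma multiplierEstimate_of_alt {C κ ξ₁ ξ₂ σ W₁ W₂ y₁ y₂ S₁ S₂ : ℝ} {p q₁ q₂ : Prop}
    (hξ : ξ₁ + ξ₂ ≠ 0) (hS₁ : 0 < S₁) (hS₂ : 0 < S₂)
    (hκ : Real.exp κ ≤ lowSum (ξ₁ + ξ₂) ξ₁ ξ₂)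
    (h : MultiplierAlt C κ (Real.log |ξ₁ + ξ₂| +
      logWeight s (Real.log (freqBr (ξ₁ + ξ₂))) (Real.log (modBr σ)) - Real.log (modBr σ))
      (Real.log (modBr σ)) (Real.log S₁) (Real.log S₂) W₁ W₂ y₁ y₂ p q₁ q₂)
    (hp : p → Resonant A B (ξ₁ + ξ₂) ξ₁ ξ₂ (ξ₁ + ξ₂))
    (hq₁ : q₁ → Resonant A B (ξ₁ + ξ₂) ξ₁ ξ₂ ξ₁) (hq₂ : q₂ → Resonant A B (ξ₁ + ξ₂) ξ₁ ξ₂ ξ₂)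
    (h' : 4 * Real.log (freqBr (ξ₁ + ξ₂)) ≤ Real.log (modBr σ) →
      MultiplierAltL1 C κ (Real.log |ξ₁ + ξ₂| +
        s * Real.log (freqBr (ξ₁ + ξ₂)) - Real.log (modBr σ)) (Real.log (modBr σ)) W₁ W₂ y₁ y₂) :
    MultiplierEstimate A B s (Real.exp C) ξ₁ ξ₂ σ (Real.exp W₁) (Real.exp W₂) (Real.exp y₁)
      (Real.exp y₂) S₁ S₂ := by
  have hS := modBr_pos σ
  have e1 := Real.exp_pos W₁
  have e2 := Real.exp_pos W₂
  have e3 := Real.exp_pos y₁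
  have e4 := Real.exp_pos y₂
  refine ⟨?_, ?_⟩
  · rw [mul_zWeight_div hξ]
    refine (h.le hS hS₁ hS₂ hκ).trans (mul_le_mul_of_nonneg_left ?_ (Real.exp_pos C).le)
    exact multBound_mono le_rfl e3.le e4.le e1.le e2.le hS.le hS₁.le hS₂.le (ind_mono hp)
      (ind_mono hq₁) (ind_mono hq₂)
  · have nn : 0 ≤ modBr σ ^ (-(3 / 4) : ℝ) *
        (|ξ₁ + ξ₂| * zWeight s (ξ₁ + ξ₂) σ / modBr σ) := by
      have := zWeight_pos s (ξ₁ + ξ₂) σ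
      positivity
    -- Below this threshold the L² weight is in its first piece, so ⟨σ⟩^{-3/4} times it is exactly
    -- the L¹ weight, and the second summand alone suffices.
    by_cases ha : 4 * Real.log (freqBr (ξ₁ + ξ₂)) ≤ Real.log (modBr σ)
    · have := (h' ha).le hS hκ
      rw [mul_rpow_div hξ]
      linarith
    · have t := multBoundL1_nonneg (lowSum_pos (ξ₁ + ξ₂) ξ₁ ξ₂).le e3.le e4.le e1.le e2.le hS.le
      have t' := mul_nonneg (Real.exp_pos C).le t
      refine le_add_of_nonneg_of_le t' ?_
      rw [mul_rpow_div hξ, mul_zWeight_div hξ, Real.rpow_def_of_pos hS, ← Real.exp_add]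
      apply Real.exp_le_exp.2
      unfold logWeight
      rw [if_pos (not_le.1 ha).le]
      linarith

/-- The multiplier estimate behind the bilinear estimate in the modified Bourgain space. -/
theorem exists_multiplierEstimate (hA : A ≠ 0) (hs : -(3 / 2) ≤ s) (hs' : s ≤ -1) :
    ∃ C, 0 < C ∧ ∀ B', |B'| ≤ |B| → ∀ ξ₁ ξ₂ : ℝ, ξ₁ + ξ₂ ≠ 0 → ξ₁ ≠ 0 → ξ₂ ≠ 0 → ∀ σ σ₁ σ₂ : ℝ,
      σ + resonance A B' (ξ₁ + ξ₂) ξ₁ ξ₂ = σ₁ + σ₂ →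
      MultiplierEstimate A B s C ξ₁ ξ₂ σ (zWeight s ξ₁ σ₁) (zWeight s ξ₂ σ₂) (freqBr ξ₁ ^ s)
        (freqBr ξ₂ ^ s) (modBr σ₁) (modBr σ₂) := by
  -- K covers the error |log|A|| + 9 in `log_modulations`, the errors from comparable frequencies,
  -- and all frequencies below `resBound`.
  set K : ℝ := abs (Real.log |A|) + 20 + Real.log (resBound A B) with hK
  have hR0 : 0 ≤ Real.log (resBound A B) :=
    Real.log_nonneg (by linarith [two_le_resBound A B])
  have hA0 := abs_nonneg (Real.log |A|)
  refine ⟨Real.exp (200 * K), Real.exp_pos _, fun B' hB => ?_⟩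
  have key : ∀ ξ₁ ξ₂ : ℝ, ξ₁ + ξ₂ ≠ 0 → ξ₁ ≠ 0 → ξ₂ ≠ 0 → |ξ₂| ≤ |ξ₁| → ∀ σ σ₁ σ₂ : ℝ,
      σ + resonance A B' (ξ₁ + ξ₂) ξ₁ ξ₂ = σ₁ + σ₂ →
      MultiplierEstimate A B s (Real.exp (200 * K)) ξ₁ ξ₂ σ (zWeight s ξ₁ σ₁) (zWeight s ξ₂ σ₂)
        (freqBr ξ₁ ^ s) (freqBr ξ₂ ^ s) (modBr σ₁) (modBr σ₂) := by
    intro ξ₁ ξ₂ hξ hξ₁ hξ₂ hle σ σ₁ σ₂ hσ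
    obtain ⟨c0, c1, c2⟩ := lowCoeff_le_lowSum (ξ₁ + ξ₂) ξ₁ ξ₂
    have r0 := log_modBr_nonneg σ
    have r1 := log_modBr_nonneg σ₁
    have r2 := log_modBr_nonneg σ₂
    rw [freqBr_rpow, freqBr_rpow]
    unfold zWeight
    rcases lt_or_ge (maxFreq (ξ₁ + ξ₂) ξ₁ ξ₂) (resBound A B) with hN | hN
    · have hN' : Real.log (maxFreq (ξ₁ + ξ₂) ξ₁ ξ₂) ≤ 2 * K := by
        have h0 : 0 < maxFreq (ξ₁ + ξ₂) ξ₁ ξ₂ := (abs_pos.2 hξ).trans_le (le_max_left _ _)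
        have := Real.log_le_log h0 hN.le
        linarith
      -- Used with 2K in place of K, so that the constant 100 · 2K agrees with the 200K of the
      -- high-high case.
      obtain ⟨h1, h2⟩ := multiplier_low hs hs' (by linarith) hξ hξ₁ hξ₂ hN' σ σ₁ σ₂
      rw [← mul_assoc] at h1 h2
      norm_num only at h1 h2
      exact multiplierEstimate_of_alt hξ (modBr_pos _) (modBr_pos _) c2 h1 False.elim
        False.elim False.elim fun _ => h2
    · obtain ⟨f, hf, hm0, hm1, hm2⟩ := log_modulations hA hB hξ hξ₁ hξ₂ hN hσ
      obtain ⟨hf1, hf2⟩ := abs_le.1 hf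
      rcases frequency_cases hξ hξ₁ hξ₂ hle hN with
        ⟨g1, g2, g3, g4, g5, g6, g7, g8⟩ | ⟨g1, g2, g3, g4, g5, g6, g7⟩
      · have j0 : Real.log (freqBr (ξ₁ + ξ₂)) = Real.log |ξ₁ + ξ₂| := by
          rw [freqBr, max_eq_right g2]
        have j1 : Real.log (freqBr ξ₁) = Real.log |ξ₁| := by rw [freqBr, max_eq_right g3]
        have p0 := Real.log_nonneg g2
        have p1 := Real.log_nonneg g3
        have hm0' : f ≤ Real.log (modBr σ) + 2 * K ∨ f ≤ Real.log (modBr σ₁) + 2 * K ∨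
            f ≤ Real.log (modBr σ₂) + 2 * K := by
          rcases hm0 with h | h | h
          exacts [.inl (by linarith), .inr (.inl (by linarith)), .inr (.inr (by linarith))]
        have M := multiplier_highLow (K := 2 * K) (x := Real.log |ξ₁ + ξ₂|)
          (j := Real.log (freqBr (ξ₁ + ξ₂)))
          (j₁ := Real.log (freqBr ξ₁)) (j₂ := Real.log (freqBr ξ₂)) (m := Real.log |ξ₂|) hs hs'
          (by linarith) (by linarith) (by linarith) (by linarith) (by linarith) (by linarith)
          (log_freqBr hξ₂) (by linarith) (by linarith : _ ≤ f) r0 r1 r2 hm0'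
        have M1 := fun ha => multiplierL1_highLow (K := 2 * K) (x := Real.log |ξ₁ + ξ₂|)
          (j := Real.log (freqBr (ξ₁ + ξ₂))) (a := Real.log (modBr σ))
          (j₁ := Real.log (freqBr ξ₁)) (j₂ := Real.log (freqBr ξ₂)) (m := Real.log |ξ₂|)
          (W₁ := logWeight s (Real.log (freqBr ξ₁)) (Real.log (modBr σ₁)))
          (W₂ := logWeight s (Real.log (freqBr ξ₂)) (Real.log (modBr σ₂))) hs hs'
          (by linarith) (by linarith) (by linarith) (by linarith)
          (log_freqBr hξ₂) (by linarith) ha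
        rw [← mul_assoc] at M M1
        norm_num only at M M1
        refine multiplierEstimate_of_alt hξ (modBr_pos _) (modBr_pos _) c2 M (fun _ => ⟨hN, g2⟩)
          (fun _ => ⟨hN, g3⟩) (fun h => ⟨hN, ?_⟩) M1
        have := Real.exp_le_exp.2 h
        rwa [Real.exp_log (abs_pos.2 hξ₂), Real.exp_zero] at this
      · have j1 : Real.log (freqBr ξ₁) = Real.log |ξ₁| := by rw [freqBr, max_eq_right g2]
        have j2 : Real.log (freqBr ξ₂) = Real.log |ξ₂| := by rw [freqBr, max_eq_right g3]
        have p1 := Real.log_nonneg g2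
        have p2 := Real.log_nonneg g3
        have hm0' : f ≤ Real.log (modBr σ) + K ∨ f ≤ Real.log (modBr σ₁) + K ∨
            f ≤ Real.log (modBr σ₂) + K := by
          rcases hm0 with h | h | h
          exacts [.inl (by linarith), .inr (.inl (by linarith)), .inr (.inr (by linarith))]
        have hm1' : Real.log (modBr σ₁) ≤ Real.log (modBr σ) + K ∨
            Real.log (modBr σ₁) ≤ f + K ∨ Real.log (modBr σ₁) ≤ Real.log (modBr σ₂) + K := by
          rcases hm1 with h | h | h
          exacts [.inl (by linarith), .inr (.inl (by linarith)), .inr (.inr (by linarith))]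
        have hm2' : Real.log (modBr σ₂) ≤ Real.log (modBr σ) + K ∨
            Real.log (modBr σ₂) ≤ f + K ∨ Real.log (modBr σ₂) ≤ Real.log (modBr σ₁) + K := by
          rcases hm2 with h | h | h
          exacts [.inl (by linarith), .inr (.inl (by linarith)), .inr (.inr (by linarith))]
        have M := multiplier_highHigh (K := K) (x := Real.log |ξ₁ + ξ₂|)
          (j := Real.log (freqBr (ξ₁ + ξ₂)))
          (j₁ := Real.log (freqBr ξ₁)) (j₂ := Real.log (freqBr ξ₂)) hs hs'
          (by linarith) (by linarith) (by linarith) (by linarith) (by linarith)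
          (log_freqBr hξ) (by linarith) (by linarith : _ ≤ f) (by linarith) r0 r1 r2 hm0' hm1' hm2'
        have M1 := fun ha => multiplierL1_highHigh (K := K) (x := Real.log |ξ₁ + ξ₂|)
          (j := Real.log (freqBr (ξ₁ + ξ₂)))
          (j₁ := Real.log (freqBr ξ₁)) (j₂ := Real.log (freqBr ξ₂)) hs hs'
          (by linarith) (by linarith) (by linarith) (by linarith) (by linarith)
          (log_freqBr hξ) (by linarith) (by linarith : _ ≤ f) (by linarith) r0 hm0' hm1' hm2' ha
        refine multiplierEstimate_of_alt hξ (modBr_pos _) (modBr_pos _) c0 M (fun h => ⟨hN, ?_⟩)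
          (fun _ => ⟨hN, g2⟩) (fun _ => ⟨hN, g3⟩) M1
        have := Real.exp_le_exp.2 h
        rwa [Real.exp_log (abs_pos.2 hξ), Real.exp_zero] at this
  intro ξ₁ ξ₂ hξ hξ₁ hξ₂ σ σ₁ σ₂ hσ
  rcases le_total |ξ₂| |ξ₁| with h | h
  · exact key ξ₁ ξ₂ hξ hξ₁ hξ₂ h σ σ₁ σ₂ hσ
  · have e : resonance A B' (ξ₁ + ξ₂) ξ₁ ξ₂ = resonance A B' (ξ₂ + ξ₁) ξ₂ ξ₁ := by
      unfold resonance phase; ring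
    exact (key ξ₂ ξ₁ (by rwa [add_comm]) hξ₂ hξ₁ h σ σ₂ σ₁ (by rw [← e]; linarith)).comm

/-- The weight `⟨k⟩^{-1} ⟨τ - p k⟩^{1/2}`. -/
def halfWeight (ξ σ : ℝ) : ℝ :=
  Real.exp (-Real.log (freqBr ξ) + Real.log (modBr σ) / 2)

/-- The multiplier estimate behind the bilinear estimate from `X^{-1,1/2}` into the modified
Bourgain space of order `-3/2`, for frequencies bounded away from zero. -/
theorem exists_multiplierEstimate_half (hA : A ≠ 0) (L : ℝ) :
    ∃ C, 0 < C ∧ ∀ B', |B'| ≤ |B| → ∀ ξ₁ ξ₂ : ℝ, ξ₁ + ξ₂ ≠ 0 → ξ₁ ≠ 0 → ξ₂ ≠ 0 →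
      -L ≤ Real.log |ξ₁ + ξ₂| → -L ≤ Real.log |ξ₁| → -L ≤ Real.log |ξ₂| → ∀ σ σ₁ σ₂ : ℝ,
      σ + resonance A B' (ξ₁ + ξ₂) ξ₁ ξ₂ = σ₁ + σ₂ →
      MultiplierEstimate A B (-(3 / 2)) C ξ₁ ξ₂ σ (halfWeight ξ₁ σ₁) (halfWeight ξ₂ σ₂)
        (freqBr ξ₁ ^ (-1 : ℝ)) (freqBr ξ₂ ^ (-1 : ℝ)) (modBr σ₁) (modBr σ₂) := by
  set K : ℝ := abs (Real.log |A|) + 20 + Real.log (resBound A B) + |L| with hK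
  have hR0 : 0 ≤ Real.log (resBound A B) :=
    Real.log_nonneg (by linarith [two_le_resBound A B])
  have hA0 := abs_nonneg (Real.log |A|)
  have hL0 := abs_nonneg L
  have hL1 := le_abs_self L
  refine ⟨Real.exp (100 * K), Real.exp_pos _, fun B' hB => ?_⟩
  have key : ∀ ξ₁ ξ₂ : ℝ, ξ₁ + ξ₂ ≠ 0 → ξ₁ ≠ 0 → ξ₂ ≠ 0 →
      -L ≤ Real.log |ξ₁ + ξ₂| → -L ≤ Real.log |ξ₂| → |ξ₂| ≤ |ξ₁| → ∀ σ σ₁ σ₂ : ℝ,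
      σ + resonance A B' (ξ₁ + ξ₂) ξ₁ ξ₂ = σ₁ + σ₂ →
      MultiplierEstimate A B (-(3 / 2)) (Real.exp (100 * K)) ξ₁ ξ₂ σ (halfWeight ξ₁ σ₁)
        (halfWeight ξ₂ σ₂) (freqBr ξ₁ ^ (-1 : ℝ)) (freqBr ξ₂ ^ (-1 : ℝ)) (modBr σ₁)
        (modBr σ₂) := by
    intro ξ₁ ξ₂ hξ hξ₁ hξ₂ L0 L2 hle σ σ₁ σ₂ hσ
    obtain ⟨c0, c1, c2⟩ := lowCoeff_le_lowSum (ξ₁ + ξ₂) ξ₁ ξ₂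
    have r0 := log_modBr_nonneg σ
    have r1 := log_modBr_nonneg σ₁
    have r2 := log_modBr_nonneg σ₂
    rw [freqBr_rpow, freqBr_rpow, neg_one_mul, neg_one_mul]
    unfold halfWeight
    rcases lt_or_ge (maxFreq (ξ₁ + ξ₂) ξ₁ ξ₂) (resBound A B) with hN | hN
    · have h0 : 0 < maxFreq (ξ₁ + ξ₂) ξ₁ ξ₂ := (abs_pos.2 hξ).trans_le (le_max_left _ _)
      have hN' : Real.log (maxFreq (ξ₁ + ξ₂) ξ₁ ξ₂) ≤ K := by
        have := Real.log_le_log h0 hN.le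
        linarith
      obtain ⟨n0, n1, n2⟩ := abs_le_maxFreq (ξ₁ + ξ₂) ξ₁ ξ₂
      have l0 := (Real.log_le_log (abs_pos.2 hξ) n0).trans hN'
      have l1 := (Real.log_le_log (abs_pos.2 hξ₁) n1).trans hN'
      have l2 := (Real.log_le_log (abs_pos.2 hξ₂) n2).trans hN'
      have j1 : Real.log (freqBr ξ₁) ≤ K := by
        rw [log_freqBr hξ₁]; exact max_le l1 (by linarith)
      have j2 : Real.log (freqBr ξ₂) ≤ K := by
        rw [log_freqBr hξ₂]; exact max_le l2 (by linarith)
      have p0 := log_freqBr_nonneg (ξ₁ + ξ₂)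
      have u := logWeight_sub_le (s := -(3 / 2)) (a := Real.log (modBr σ)) le_rfl (by norm_num) p0
      have hk : -(5 / 8) * K ≤ logCoeff (Real.log |ξ₂|) :=
        le_min (by linarith) (by linarith)
      exact multiplierEstimate_of_alt (p := False) (q₁ := False) (q₂ := False) hξ (modBr_pos _)
        (modBr_pos _) c2 (.inl (by linarith)) False.elim False.elim False.elim
        fun _ => .inr (.inl (by linarith))
    · obtain ⟨f, hf, hm0, -, -⟩ := log_modulations hA hB hξ hξ₁ hξ₂ hN hσ
      obtain ⟨hf1, hf2⟩ := abs_le.1 hf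
      have hm0' : f ≤ Real.log (modBr σ) + K ∨ f ≤ Real.log (modBr σ₁) + K ∨
          f ≤ Real.log (modBr σ₂) + K := by
        rcases hm0 with h | h | h
        exacts [.inl (by linarith), .inr (.inl (by linarith)), .inr (.inr (by linarith))]
      rcases frequency_cases hξ hξ₁ hξ₂ hle hN with
        ⟨g1, g2, g3, g4, g5, g6, g7, g8⟩ | ⟨g1, g2, g3, g4, g5, g6, g7⟩
      · have j0 : Real.log (freqBr (ξ₁ + ξ₂)) = Real.log |ξ₁ + ξ₂| := by
          rw [freqBr, max_eq_right g2]
        have j1 : Real.log (freqBr ξ₁) = Real.log |ξ₁| := by rw [freqBr, max_eq_right g3]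
        have p0 := Real.log_nonneg g2
        obtain ⟨M, M1⟩ := multiplier_highLow_half (K := K) (x := Real.log |ξ₁ + ξ₂|)
          (j := Real.log (freqBr (ξ₁ + ξ₂)))
          (j₁ := Real.log (freqBr ξ₁)) (j₂ := Real.log (freqBr ξ₂)) (m := Real.log |ξ₂|)
          (by linarith) (by linarith) (by linarith) (by linarith)
          (log_freqBr hξ₂) (by linarith) (by linarith) (by linarith : _ ≤ f) r0 r1 r2 hm0'
        exact multiplierEstimate_of_alt hξ (modBr_pos _) (modBr_pos _) c2 M False.elim False.elim
          False.elim fun _ => M1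
      · have j1 : Real.log (freqBr ξ₁) = Real.log |ξ₁| := by rw [freqBr, max_eq_right g2]
        have j2 : Real.log (freqBr ξ₂) = Real.log |ξ₂| := by rw [freqBr, max_eq_right g3]
        have p1 := Real.log_nonneg g2
        obtain ⟨M, M1⟩ := multiplier_highHigh_half (K := K) (x := Real.log |ξ₁ + ξ₂|)
          (j := Real.log (freqBr (ξ₁ + ξ₂)))
          (j₁ := Real.log (freqBr ξ₁)) (j₂ := Real.log (freqBr ξ₂))
          (by linarith) (by linarith)
          (log_freqBr hξ) (by linarith) (by linarith) (by linarith : _ ≤ f) r0 r1 r2 hm0'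
        exact multiplierEstimate_of_alt hξ (modBr_pos _) (modBr_pos _) c0 M False.elim False.elim
          False.elim fun _ => M1
  intro ξ₁ ξ₂ hξ hξ₁ hξ₂ L0 L1 L2 σ σ₁ σ₂ hσ
  rcases le_total |ξ₂| |ξ₁| with h | h
  · exact key ξ₁ ξ₂ hξ hξ₁ hξ₂ L0 L2 h σ σ₁ σ₂ hσ
  · have e : resonance A B' (ξ₁ + ξ₂) ξ₁ ξ₂ = resonance A B' (ξ₂ + ξ₁) ξ₂ ξ₁ := by
      unfold resonance phase; ring
    exact (key ξ₂ ξ₁ (by rwa [add_comm]) hξ₂ hξ₁ (by rwa [add_comm]) L1 h σ σ₂ σ₁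
      (by rw [← e]; linarith)).comm

end

end

/-! ### Sums over a lattice -/

/-- By monotonicity the value at the right end of a cell of length 1/λ is at most the mean over that
cell. -/
lemma tsum_lattice_le_lintegral {f : ℝ → ℝ≥0∞} (hf : AntitoneOn f (Ioi 0)) {lam : ℝ}
    (hl : 0 < lam) :
    ∑' n : ℕ, f ((n + 1) / lam) ≤ ENNReal.ofReal lam * ∫⁻ x in Ioi 0, f x := by
  have hd : Pairwise (Function.onFun Disjoint fun n : ℕ => Ioc ((n : ℝ) / lam) ((n + 1) / lam)) := by
    have hm : Monotone fun n : ℕ => (n : ℝ) / lam := fun a b h => by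
      show (a : ℝ) / lam ≤ b / lam
      gcongr
    have := hm.pairwise_disjoint_on_Ioc_succ
    simpa [Function.onFun, Order.succ_eq_add_one] using this
  have hsub : (⋃ n : ℕ, Ioc ((n : ℝ) / lam) ((n + 1) / lam)) ⊆ Ioi 0 := by
    refine iUnion_subset fun n x hx => ?_
    exact lt_of_le_of_lt (by positivity) hx.1
  calc ∑' n : ℕ, f ((n + 1) / lam)
      ≤ ∑' n : ℕ, ENNReal.ofReal lam * ∫⁻ x in Ioc ((n : ℝ) / lam) ((n + 1) / lam), f x := by
        refine ENNReal.tsum_le_tsum fun n => ?_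
        have h1 : ∫⁻ _ in Ioc ((n : ℝ) / lam) ((n + 1) / lam), f ((n + 1) / lam) ≤
            ∫⁻ x in Ioc ((n : ℝ) / lam) ((n + 1) / lam), f x := by
          refine setLIntegral_mono' measurableSet_Ioc fun x hx => ?_
          exact hf (lt_of_le_of_lt (by positivity) hx.1) (show (0 : ℝ) < (n + 1) / lam by positivity)
            hx.2
        rw [setLIntegral_const, Real.volume_Ioc] at h1
        have h2 : ((n : ℝ) + 1) / lam - n / lam = lam⁻¹ := by field_simp; ring
        rw [h2] at h1
        calc f ((n + 1) / lam) = ENNReal.ofReal lam * (f ((n + 1) / lam) * ENNReal.ofReal lam⁻¹) := by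
              rw [mul_left_comm, ← ENNReal.ofReal_mul hl.le, mul_inv_cancel₀ hl.ne',
                ENNReal.ofReal_one, mul_one]
          _ ≤ _ := by gcongr
    _ = ENNReal.ofReal lam * ∫⁻ x in ⋃ n : ℕ, Ioc ((n : ℝ) / lam) ((n + 1) / lam), f x := by
        rw [ENNReal.tsum_mul_left, lintegral_iUnion (fun _ => measurableSet_Ioc) hd]
    _ ≤ _ := by gcongr

/-- The single term at zero is not controlled by the integral; it is absorbed into the factor λ
because λ ≥ 1. -/
lemma tsum_int_even_le {f : ℝ → ℝ≥0∞} (hf : AntitoneOn f (Ioi 0)) (he : ∀ x, f (-x) = f x)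
    {lam : ℝ} (hl : 1 ≤ lam) : ∑' n : ℤ, f (n / lam) ≤
      ENNReal.ofReal lam * (2 * (∫⁻ x in Ioi 0, f x) + f 0) := by
  have hl0 : 0 < lam := by linarith
  have h := tsum_lattice_le_lintegral hf hl0
  have h1 : (1 : ℝ≥0∞) ≤ ENNReal.ofReal lam := by simpa using hl
  rw [tsum_of_nat_of_neg_add_one ENNReal.summable ENNReal.summable,
    tsum_eq_zero_add' ENNReal.summable]
  have e1 : ∀ n : ℕ, f (((n + 1 : ℕ) : ℤ) / lam) = f ((n + 1) / lam) := fun n => by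
    push_cast; rfl
  have e2 : ∀ n : ℕ, f (((-((n : ℤ) + 1) : ℤ) : ℝ) / lam) = f ((n + 1) / lam) := fun n => by
    rw [← he]; congr 1; push_cast; ring
  simp_rw [e1, e2]
  simp only [Nat.cast_zero, Int.cast_zero, zero_div]
  calc f 0 + ∑' n : ℕ, f ((n + 1) / lam) + ∑' n : ℕ, f ((n + 1) / lam)
      = 2 * (∑' n : ℕ, f ((n + 1) / lam)) + 1 * f 0 := by ring
    _ ≤ 2 * (ENNReal.ofReal lam * ∫⁻ x in Ioi 0, f x) + ENNReal.ofReal lam * f 0 := by gcongr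
    _ = _ := by ring

/-- This explains the two exponents in the coefficient: its square behaves like x^{-1/2} at zero and
like x^{-5/4} at infinity, hence it is integrable on the half line. -/
lemma lowCoeff_sq_le {x : ℝ} (hx : 0 < x) :
    lowCoeff x ^ 2 = min (x ^ (-(1 / 2) : ℝ)) (x ^ (-(5 / 4) : ℝ)) := by
  rw [lowCoeff, logCoeff, abs_of_pos hx, Real.rpow_def_of_pos hx, Real.rpow_def_of_pos hx,
    ← Real.exp_monotone.map_min, ← Real.exp_nat_mul]
  congr 1
  push_cast
  rw [mul_min_of_nonneg _ _ (by norm_num : (0 : ℝ) ≤ 2)]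
  congr 1 <;> ring

lemma exists_tsum_lowCoeff_le : ∃ C : ℝ≥0, ∀ lam : ℝ, 1 ≤ lam →
    ∑' n : ℤ, ENNReal.ofReal (lowCoeff (n / lam)) ^ 2 ≤ C * ENNReal.ofReal lam := by
  set f : ℝ → ℝ≥0∞ := fun x => ENNReal.ofReal (lowCoeff x) ^ 2 with hf
  have hanti : AntitoneOn f (Ioi 0) := by
    intro x hx y hy hxy
    have hx : 0 < x := hx
    have hy : 0 < y := hy
    simp only [hf]
    rw [← ENNReal.ofReal_pow (lowCoeff_pos _).le, ← ENNReal.ofReal_pow (lowCoeff_pos _).le,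
      lowCoeff_sq_le hx, lowCoeff_sq_le hy]
    apply ENNReal.ofReal_le_ofReal
    exact min_le_min (Real.rpow_le_rpow_of_nonpos hx hxy (by norm_num))
      (Real.rpow_le_rpow_of_nonpos hx hxy (by norm_num))
  have heven : ∀ x, f (-x) = f x := fun x => by simp only [hf, lowCoeff, abs_neg]
  have hint : ∫⁻ x in Ioi 0, f x < ∞ := by
    rw [← Ioc_union_Ioi_eq_Ioi (zero_le_one' ℝ)]
    refine (lintegral_union_le _ _ _).trans_lt (ENNReal.add_lt_top.2 ⟨?_, ?_⟩)
    · have h1 : IntegrableOn (fun x : ℝ => x ^ (-(1 / 2) : ℝ)) (Ioc 0 1) :=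
        (intervalIntegrable_iff_integrableOn_Ioc_of_le zero_le_one).1
          (intervalIntegral.intervalIntegrable_rpow' (by norm_num))
      refine lt_of_le_of_lt (setLIntegral_mono' measurableSet_Ioc fun x hx => ?_)
        h1.lintegral_lt_top
      simp only [hf]
      rw [← ENNReal.ofReal_pow (lowCoeff_pos _).le, lowCoeff_sq_le hx.1]
      exact ENNReal.ofReal_le_ofReal (min_le_left _ _)
    · have h1 : IntegrableOn (fun x : ℝ => x ^ (-(5 / 4) : ℝ)) (Ioi 1) :=
        integrableOn_Ioi_rpow_of_lt (by norm_num) one_pos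
      refine lt_of_le_of_lt (setLIntegral_mono' measurableSet_Ioi fun x hx => ?_)
        h1.lintegral_lt_top
      simp only [hf]
      rw [← ENNReal.ofReal_pow (lowCoeff_pos _).le, lowCoeff_sq_le (one_pos.trans hx)]
      exact ENNReal.ofReal_le_ofReal (min_le_right _ _)
  -- At zero the coefficient is finite; it equals 1 by the convention `Real.log 0 = 0`.
  have hfin : 2 * (∫⁻ x in Ioi 0, f x) + f 0 ≠ ∞ := by
    refine ENNReal.add_ne_top.2 ⟨ENNReal.mul_ne_top (by norm_num) hint.ne, ?_⟩
    simp only [hf]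
    exact ENNReal.pow_ne_top ENNReal.ofReal_ne_top
  refine ⟨(2 * (∫⁻ x in Ioi 0, f x) + f 0).toNNReal, fun lam hl => ?_⟩
  rw [ENNReal.coe_toNNReal hfin, mul_comm]
  exact tsum_int_even_le hanti heven hl

lemma exists_tsum_inv_one_add_sq_le : ∃ C : ℝ≥0, ∀ lam : ℝ, 1 ≤ lam →
    ∑' n : ℤ, ENNReal.ofReal (1 + (n / lam : ℝ) ^ 2)⁻¹ ≤ C * ENNReal.ofReal lam := by
  set f : ℝ → ℝ≥0∞ := fun x => ENNReal.ofReal (1 + x ^ 2)⁻¹ with hf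
  have hanti : AntitoneOn f (Ioi 0) := by
    intro x hx y hy hxy
    have hx : 0 < x := hx
    have hy : 0 < y := hy
    simp only [hf]
    gcongr
  have hfin : 2 * (∫⁻ x in Ioi 0, f x) + f 0 ≠ ∞ := by
    refine ENNReal.add_ne_top.2 ⟨ENNReal.mul_ne_top (by norm_num) ?_, ENNReal.ofReal_ne_top⟩
    exact ((setLIntegral_le_lintegral _ _).trans_lt integrable_inv_one_add_sq.lintegral_lt_top).ne
  refine ⟨(2 * (∫⁻ x in Ioi 0, f x) + f 0).toNNReal, fun lam hl => ?_⟩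
  rw [ENNReal.coe_toNNReal hfin, mul_comm]
  exact tsum_int_even_le hanti (fun x => by simp only [hf, neg_sq]) hl

/-! ### Counting resonant interactions -/

lemma three_abs_le {A B B' N : ℝ} (hA : A ≠ 0) (hB : |B'| ≤ |B|) (hN : resBound A B ≤ N) :
    3 * |B'| ≤ |A| * N ^ 2 := by
  have hA' := abs_pos.2 hA
  have hN2 := (two_le_resBound A B).trans hN
  have : 6 * |B| / |A| ≤ N := by unfold resBound at hN; linarith
  rw [div_le_iff₀ hA'] at this
  nlinarith [mul_nonneg (mul_nonneg hA'.le (by linarith : 0 ≤ N)) (sub_nonneg.2 hN2)]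

/-- The resonance function separates the frequencies when the frequency `z` is fixed. -/
lemma resonance_separated {A B B' z x x' : ℝ} (hA : A ≠ 0) (hB : |B'| ≤ |B|) (hz : 1 ≤ |z|)
    (hN : resBound A B ≤ maxFreq z x (z - x)) (hN' : resBound A B ≤ maxFreq z x' (z - x')) :
    min 1 |A| / 2 * (1 + (|x - z / 2| - |x' - z / 2|) ^ 2) ^ 2 ≤
      1 + |resonance A B' z x (z - x) - resonance A B' z x' (z - x')| := by
  have hA' := abs_pos.2 hA
  set y := (x - z / 2) ^ 2 with hy
  set y' := (x' - z / 2) ^ 2 with hy'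
  -- By the symmetry between x and z - x, the resonance function depends on x only through y = (x -
  -- z/2)², and it is quadratic in y.
  have e : resonance A B' z x (z - x) - resonance A B' z x' (z - x') =
      z * ((y - y') * (5 / 2 * A * (z ^ 2 + 2 * (y + y')) - 3 * B')) := by
    rw [hy, hy']; unfold resonance phase; ring
  have b1 := three_abs_le hA hB hN
  have b2 := three_abs_le hA hB hN'
  have m1 := (maxFreq_sq_le x (z - x)).1
  have m2 := (maxFreq_sq_le x' (z - x')).1
  rw [add_sub_cancel] at m1 m2
  have c1 : z ^ 2 + x ^ 2 + (z - x) ^ 2 = 3 / 2 * z ^ 2 + 2 * y := by rw [hy]; ring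
  have c2 : z ^ 2 + x' ^ 2 + (z - x') ^ 2 = 3 / 2 * z ^ 2 + 2 * y' := by rw [hy']; ring
  have d1 := mul_le_mul_of_nonneg_left m1 hA'.le
  have d2 := mul_le_mul_of_nonneg_left m2 hA'.le
  rw [c1] at d1
  rw [c2] at d2
  have y0 : 0 ≤ y := sq_nonneg _
  have y0' : 0 ≤ y' := sq_nonneg _
  have z1 : 1 ≤ z ^ 2 := by rw [← sq_abs]; nlinarith
  -- The mean of the two frequency conditions gives 3|B'| ≤ |A|((3/2)z² + y + y'), which leaves
  -- |A|(z² + 4(y + y')) of the leading term.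
  have low : |A| * (1 + 4 * (y + y')) ≤ |5 / 2 * A * (z ^ 2 + 2 * (y + y')) - 3 * B'| := by
    have t := abs_sub_abs_le_abs_sub (5 / 2 * A * (z ^ 2 + 2 * (y + y'))) (3 * B')
    have t1 : |5 / 2 * A * (z ^ 2 + 2 * (y + y'))| = 5 / 2 * |A| * (z ^ 2 + 2 * (y + y')) := by
      rw [abs_mul, abs_mul, abs_of_nonneg (by positivity : 0 ≤ z ^ 2 + 2 * (y + y'))]; norm_num
    have t2 : |3 * B'| = 3 * |B'| := by rw [abs_mul]; norm_num
    have : |A| * 1 ≤ |A| * z ^ 2 := mul_le_mul_of_nonneg_left z1 hA'.le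
    linarith
  set d := |x - z / 2| - |x' - z / 2| with hd
  have s1 : y - y' = d * (|x - z / 2| + |x' - z / 2|) := by
    rw [hy, hy', hd, ← sq_abs (x - z / 2), ← sq_abs (x' - z / 2)]; ring
  have p1 := abs_nonneg (x - z / 2)
  have p2 := abs_nonneg (x' - z / 2)
  have dle : |d| ≤ |x - z / 2| + |x' - z / 2| := by
    rw [hd]; exact abs_le.2 ⟨by linarith, by linarith⟩
  have s2 : d ^ 2 ≤ |y - y'| := by
    rw [s1, abs_mul, abs_of_nonneg (add_nonneg p1 p2), ← sq_abs, sq]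
    exact mul_le_mul_of_nonneg_left dle (abs_nonneg _)
  have s3 : d ^ 2 ≤ 2 * (y + y') := by
    have := pow_le_pow_left₀ (abs_nonneg d) dle 2
    rw [sq_abs] at this
    rw [hy, hy', ← sq_abs (x - z / 2), ← sq_abs (x' - z / 2)]
    nlinarith [sq_nonneg (|x - z / 2| - |x' - z / 2|)]
  have big : |A| * (d ^ 2 + 2 * d ^ 4) ≤
      |resonance A B' z x (z - x) - resonance A B' z x' (z - x')| := by
    rw [e, abs_mul, abs_mul]
    have h1 : d ^ 2 * (|A| * (1 + 2 * d ^ 2)) ≤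
        |y - y'| * |5 / 2 * A * (z ^ 2 + 2 * (y + y')) - 3 * B'| := by
      refine mul_le_mul s2 (le_trans ?_ low) (by positivity) (abs_nonneg _)
      exact mul_le_mul_of_nonneg_left (by linarith) hA'.le
    have h2 : 0 ≤ |y - y'| * |5 / 2 * A * (z ^ 2 + 2 * (y + y')) - 3 * B'| := by positivity
    have h3 := le_mul_of_one_le_left h2 hz
    have h4 : d ^ 2 * (|A| * (1 + 2 * d ^ 2)) = |A| * (d ^ 2 + 2 * d ^ 4) := by ring
    linarith
  have m0 : 0 ≤ min 1 |A| := le_min zero_le_one hA'.le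
  have m1 : min 1 |A| ≤ 1 := min_le_left _ _
  have m2 : min 1 |A| * (d ^ 2 + 2 * d ^ 4) ≤ |A| * (d ^ 2 + 2 * d ^ 4) :=
    mul_le_mul_of_nonneg_right (min_le_right _ _) (by positivity)
  have m3 : min 1 |A| / 2 * (1 + d ^ 2) ^ 2 =
      min 1 |A| / 2 + min 1 |A| * d ^ 2 + min 1 |A| * d ^ 4 / 2 := by ring
  have m4 := mul_nonneg m0 (by positivity : 0 ≤ d ^ 4)
  linarith

/-- An error of 1 is admissible, since the result is only used inside the bracket 1 + |·|; the
infimum need not be attained. -/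
lemma exists_near_minimizer {ι : Type*} {P : ι → Prop} (f : ι → ℝ) (hf : ∀ i, 0 ≤ f i)
    (h : ∃ i, P i) : ∃ i, P i ∧ ∀ j, P j → f i ≤ f j + 1 := by
  have hne : (f '' {i | P i}).Nonempty := h.elim fun i hi => ⟨f i, i, hi, rfl⟩
  have hb : BddBelow (f '' {i | P i}) := ⟨0, by rintro _ ⟨i, -, rfl⟩; exact hf i⟩
  obtain ⟨_, ⟨i, hi, rfl⟩, hlt⟩ := exists_lt_of_csInf_lt hne (lt_add_one (sInf (f '' {i | P i})))
  exact ⟨i, hi, fun j hj => by linarith [csInf_le hb ⟨j, hj, rfl⟩]⟩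

/-- The number of resonant interactions with a fixed frequency `l / lam`. -/
theorem exists_tsum_resonance_le {A : ℝ} (hA : A ≠ 0) (B : ℝ) : ∃ C : ℝ≥0, ∀ B', |B'| ≤ |B| →
    ∀ lam : ℝ, 1 ≤ lam → ∀ l : ℤ, ∀ a : ℝ,
    ∑' j : ℤ, ENNReal.ofReal (ind (Resonant A B (l / lam) (j / lam) (l / lam - j / lam) (l / lam)) *
      modBr (a + resonance A B' (l / lam) (j / lam) (l / lam - j / lam)) ^ (-(1 / 2) : ℝ)) ≤
      C * ENNReal.ofReal lam := by
  obtain ⟨C, hC⟩ := exists_tsum_inv_one_add_sq_le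
  have hA' := abs_pos.2 hA
  set m := min 1 |A| with hm
  have m0 : 0 < m := lt_min one_pos hA'
  set D : ℝ := (m / 4) ^ (-(1 / 2) : ℝ) with hD
  have D0 : 0 < D := by positivity
  refine ⟨Real.toNNReal D * (2 * C), fun B' hB lam hl l a => ?_⟩
  have hl0 : 0 < lam := by linarith
  by_cases hex : ∃ j : ℤ, Resonant A B (l / lam) (j / lam) (l / lam - j / lam) (l / lam)
  swap
  · have : ∀ j : ℤ, ind (Resonant A B (l / lam) (j / lam) (l / lam - j / lam) (l / lam)) = 0 :=
      fun j => by simp only [ind, if_neg (fun h => hex ⟨j, h⟩)]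
    simp [this]
  set R : ℤ → ℝ := fun j => resonance A B' (l / lam) (j / lam) (l / lam - j / lam) with hR
  -- The lattice point i is almost closest to the resonance a + Φ = 0. Every other admissible point
  -- is separated from i, and this gives decay uniformly in a.
  obtain ⟨i, hi, hmin⟩ := exists_near_minimizer (fun j => |a + R j|) (fun _ => abs_nonneg _) hex
  have key : ∀ j : ℤ, ENNReal.ofReal
      (ind (Resonant A B (l / lam) (j / lam) (l / lam - j / lam) (l / lam)) *
        modBr (a + R j) ^ (-(1 / 2) : ℝ)) ≤ ENNReal.ofReal D *
      (ENNReal.ofReal (1 + (((j - i : ℤ) : ℝ) / lam) ^ 2)⁻¹ +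
        ENNReal.ofReal (1 + (((j + i - l : ℤ) : ℝ) / lam) ^ 2)⁻¹) := by
    intro j
    by_cases hj : Resonant A B (l / lam) (j / lam) (l / lam - j / lam) (l / lam)
    swap
    · simp only [ind, if_neg hj, zero_mul, ENNReal.ofReal_zero]; exact zero_le
    rw [ind_of hj, one_mul, ← ENNReal.ofReal_add (by positivity) (by positivity),
      ← ENNReal.ofReal_mul D0.le]
    apply ENNReal.ofReal_le_ofReal
    have sep := resonance_separated (x := j / lam) (x' := i / lam) hA hB hj.2 hj.1 hi.1
    rw [← hm] at sep
    have hdist : |R j - R i| ≤ 2 * |a + R j| + 1 := by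
      have h1 := hmin j hj
      have h2 := abs_sub (a + R j) (a + R i)
      rw [add_sub_add_left_eq_sub] at h2
      linarith
    set d := |(j : ℝ) / lam - l / lam / 2| - |(i : ℝ) / lam - l / lam / 2| with hd
    have hlow : m / 4 * (1 + d ^ 2) ^ 2 ≤ modBr (a + R j) := by
      unfold modBr
      simp only [hR] at hdist ⊢
      linarith
    have h3 : modBr (a + R j) ^ (-(1 / 2) : ℝ) ≤ D * (1 + d ^ 2)⁻¹ := by
      calc modBr (a + R j) ^ (-(1 / 2) : ℝ) ≤ (m / 4 * (1 + d ^ 2) ^ 2) ^ (-(1 / 2) : ℝ) :=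
            Real.rpow_le_rpow_of_nonpos (by positivity) hlow (by norm_num)
        _ = D * (1 + d ^ 2)⁻¹ := by
            rw [Real.mul_rpow (by positivity) (by positivity), ← Real.rpow_natCast (1 + d ^ 2) 2,
              ← Real.rpow_mul (by positivity)]
            norm_num
            rw [Real.rpow_neg_one]
    refine h3.trans (mul_le_mul_of_nonneg_left ?_ D0.le)
    -- The signs of the two shifted frequencies decide whether the distance is measured from j to i
    -- or to its mirror image l - i.
    have hdd : d ^ 2 = (((j - i : ℤ) : ℝ) / lam) ^ 2 ∨ d ^ 2 = (((j + i - l : ℤ) : ℝ) / lam) ^ 2 := by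
      rw [hd]
      push_cast
      rcases abs_choice ((j : ℝ) / lam - l / lam / 2) with h | h <;>
      rcases abs_choice ((i : ℝ) / lam - l / lam / 2) with h' | h' <;> rw [h, h']
      · left; ring
      · right; ring
      · right; ring
      · left; ring
    rcases hdd with h | h
    · rw [h]; exact le_add_of_nonneg_right (by positivity)
    · rw [h]; exact le_add_of_nonneg_left (by positivity)
  refine (ENNReal.tsum_le_tsum key).trans ?_
  rw [ENNReal.tsum_mul_left, ENNReal.tsum_add]
  have s1 : ∑' j : ℤ, ENNReal.ofReal (1 + (((j - i : ℤ) : ℝ) / lam) ^ 2)⁻¹ ≤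
      C * ENNReal.ofReal lam := by
    exact ((Equiv.subRight i).tsum_eq
      (fun n : ℤ => ENNReal.ofReal (1 + ((n : ℝ) / lam) ^ 2)⁻¹)).trans_le (hC lam hl)
  have s2 : ∑' j : ℤ, ENNReal.ofReal (1 + (((j + i - l : ℤ) : ℝ) / lam) ^ 2)⁻¹ ≤
      C * ENNReal.ofReal lam := by
    simp_rw [add_sub_assoc]
    exact ((Equiv.addRight (i - l)).tsum_eq
      (fun n : ℤ => ENNReal.ofReal (1 + ((n : ℝ) / lam) ^ 2)⁻¹)).trans_le (hC lam hl)
  calc ENNReal.ofReal D * _ ≤ ENNReal.ofReal D *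
        (C * ENNReal.ofReal lam + C * ENNReal.ofReal lam) := by gcongr
    _ = _ := by
      push_cast
      rw [ENNReal.ofReal]
      ring

section

/-! ### Inequalities for `[0,∞]`-valued functions -/

lemma ennreal_add_sq_le (x y : ℝ≥0∞) : (x + y) ^ 2 ≤ 2 * (x ^ 2 + y ^ 2) := by
  have h := ENNReal.rpow_add_le_mul_rpow_add_rpow x y (show (1 : ℝ) ≤ 2 by norm_num)
  norm_num at h
  exact_mod_cast h

lemma ennreal_add_three_sq_le (x y z : ℝ≥0∞) : (x + y + z) ^ 2 ≤ 4 * (x ^ 2 + y ^ 2 + z ^ 2) := by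
  calc (x + y + z) ^ 2 ≤ 2 * ((x + y) ^ 2 + z ^ 2) := ennreal_add_sq_le _ _
    _ ≤ 2 * (2 * (x ^ 2 + y ^ 2) + 2 * z ^ 2) := by
        gcongr
        · exact ennreal_add_sq_le _ _
        · exact le_mul_of_one_le_left' (by norm_num)
    _ = _ := by ring

/-- The `L²` norm of a function with values in `[0,∞]`. -/
def l2 {α : Type*} [MeasurableSpace α] (μ : Measure α) (f : α → ℝ≥0∞) : ℝ≥0∞ :=
  (∫⁻ x, f x ^ 2 ∂μ) ^ (1 / 2 : ℝ)

section

variable {α : Type*} [MeasurableSpace α] {μ : Measure α} {f g : α → ℝ≥0∞}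

lemma l2_sq : l2 μ f ^ 2 = ∫⁻ x, f x ^ 2 ∂μ := by
  rw [l2, ← ENNReal.rpow_natCast, ← ENNReal.rpow_mul]; norm_num

lemma le_l2_iff {c : ℝ≥0∞} : l2 μ f ≤ c ↔ ∫⁻ x, f x ^ 2 ∂μ ≤ c ^ 2 := by
  rw [l2, one_div, ENNReal.rpow_inv_le_iff two_pos, ENNReal.rpow_two]

lemma lintegral_mul_le_l2 (hf : AEMeasurable f μ) (hg : AEMeasurable g μ) :
    ∫⁻ x, f x * g x ∂μ ≤ l2 μ f * l2 μ g := by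
  have h := ENNReal.lintegral_mul_le_Lp_mul_Lq μ Real.HolderConjugate.two_two hf hg
  simp only [Pi.mul_apply, ENNReal.rpow_two] at h
  exact h

lemma lintegral_mul_sq_le (hf : AEMeasurable f μ) (hg : AEMeasurable g μ) :
    (∫⁻ x, f x * g x ∂μ) ^ 2 ≤ (∫⁻ x, f x ^ 2 ∂μ) * ∫⁻ x, g x ^ 2 ∂μ := by
  rw [← l2_sq (f := f), ← l2_sq (f := g), ← mul_pow]
  gcongr
  exact lintegral_mul_le_l2 hf hg

lemma tsum_mul_sq_le {ι : Type*} (f g : ι → ℝ≥0∞) :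
    (∑' i, f i * g i) ^ 2 ≤ (∑' i, f i ^ 2) * ∑' i, g i ^ 2 := by
  let _ : MeasurableSpace ι := ⊤
  have := lintegral_mul_sq_le (μ := Measure.count) (f := f) (g := g)
    (measurable_from_top.aemeasurable) (measurable_from_top.aemeasurable)
  simpa only [lintegral_count' measurable_from_top] using this

/-- Minkowski's inequality for countable sums: expand the square and apply Cauchy-Schwarz to every
pair of summands. -/
lemma l2_tsum_le {ι : Type*} [Countable ι] {P : ι → α → ℝ≥0∞} (hP : ∀ i, AEMeasurable (P i) μ) :
    l2 μ (fun x => ∑' i, P i x) ≤ ∑' i, l2 μ (P i) := by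
  rw [le_l2_iff]
  have e : ∀ x, (∑' i, P i x) ^ 2 = ∑' i, ∑' j, P i x * P j x := fun x => by
    rw [sq, ← ENNReal.tsum_mul_right]
    simp_rw [ENNReal.tsum_mul_left]
  simp_rw [e]
  have hm : ∀ i j, AEMeasurable (fun x => P i x * P j x) μ := fun i j => (hP i).mul (hP j)
  rw [lintegral_tsum fun i => AEMeasurable.tsum fun j => hm i j]
  rw [sq, ← ENNReal.tsum_mul_right]
  refine ENNReal.tsum_le_tsum fun i => ?_
  rw [lintegral_tsum fun j => hm i j, ← ENNReal.tsum_mul_left]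
  exact ENNReal.tsum_le_tsum fun j => lintegral_mul_le_l2 (hP i) (hP j)

lemma l2_add_le (hf : AEMeasurable f μ) (hg : AEMeasurable g μ) :
    l2 μ (fun x => f x + g x) ≤ l2 μ f + l2 μ g := by
  have h := ENNReal.lintegral_Lp_add_le hf hg (show (1 : ℝ) ≤ 2 by norm_num)
  simp only [Pi.add_apply, ENNReal.rpow_two] at h
  exact h

lemma l2_mono (h : ∀ x, f x ≤ g x) : l2 μ f ≤ l2 μ g := by
  unfold l2; gcongr with x; exact h x

lemma l2_const_mul (hf : AEMeasurable f μ) (c : ℝ≥0∞) :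
    l2 μ (fun x => c * f x) = c * l2 μ f := by
  unfold l2
  simp_rw [mul_pow]
  rw [lintegral_const_mul'' _ (hf.pow_const 2), ENNReal.mul_rpow_of_nonneg _ _ (by norm_num),
    ← ENNReal.rpow_two, ← ENNReal.rpow_mul]
  norm_num

end

lemma lintegral_comp_sub (f : ℝ → ℝ≥0∞) (a : ℝ) : ∫⁻ s, f (a - s) = ∫⁻ s, f s :=
  lintegral_sub_left_eq_self f a

/-- Young's inequality for the convolution of `L²` and `L¹`. -/
lemma lintegral_conv_sq_le {F E : ℝ → ℝ≥0∞} (hF : Measurable F) (hE : Measurable E) (c : ℝ) :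
    ∫⁻ σ, (∫⁻ s, F s * E (σ + c - s)) ^ 2 ≤ (∫⁻ s, F s ^ 2) * (∫⁻ s, E s) ^ 2 := by
  -- Cauchy-Schwarz for the splitting of F E into F E^{1/2} and E^{1/2}.
  have h1 : ∀ σ, (∫⁻ s, F s * E (σ + c - s)) ^ 2 ≤
      (∫⁻ s, F s ^ 2 * E (σ + c - s)) * ∫⁻ s, E s := fun σ => by
    have e : ∀ x : ℝ≥0∞, (x ^ (1 / 2 : ℝ)) ^ 2 = x := fun x => by
      rw [← ENNReal.rpow_natCast, ← ENNReal.rpow_mul]; norm_num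
    have hm : Measurable fun s => E (σ + c - s) ^ (1 / 2 : ℝ) := by fun_prop
    have := lintegral_mul_sq_le (μ := volume) (f := fun s => F s * E (σ + c - s) ^ (1 / 2 : ℝ))
      (g := fun s => E (σ + c - s) ^ (1 / 2 : ℝ)) (by fun_prop) hm.aemeasurable
    simp_rw [mul_pow, e, mul_assoc, ← sq, e, lintegral_comp_sub] at this
    exact this
  calc ∫⁻ σ, (∫⁻ s, F s * E (σ + c - s)) ^ 2
      ≤ ∫⁻ σ, (∫⁻ s, F s ^ 2 * E (σ + c - s)) * ∫⁻ s, E s := lintegral_mono h1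
    _ = (∫⁻ σ, ∫⁻ s, F s ^ 2 * E (σ + c - s)) * ∫⁻ s, E s := by
        rw [lintegral_mul_const]
        exact Measurable.lintegral_prod_right (by fun_prop)
    _ = (∫⁻ s, F s ^ 2) * (∫⁻ s, E s) ^ 2 := by
        rw [lintegral_lintegral_swap (by fun_prop), sq, ← mul_assoc]
        congr 1
        rw [← lintegral_mul_const _ (by fun_prop)]
        congr 1 with s
        rw [lintegral_const_mul _ (by fun_prop)]
        congr 1
        simp_rw [add_sub_assoc]
        exact lintegral_add_right_eq_self E (c - s)

lemma lintegral_conv (F E : ℝ → ℝ≥0∞) (hF : Measurable F) (hE : Measurable E) (c : ℝ) :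
    ∫⁻ σ, ∫⁻ s, F s * E (σ + c - s) = (∫⁻ s, F s) * ∫⁻ s, E s := by
  rw [lintegral_lintegral_swap (by fun_prop), ← lintegral_mul_const _ hF]
  congr 1 with s
  rw [lintegral_const_mul _ (by fun_prop)]
  congr 1
  simp_rw [add_sub_assoc]
  exact lintegral_add_right_eq_self E (c - s)

/-- Discrete Cauchy-Schwarz: the coefficient may depend on any of the three frequencies. -/
lemma tsum_sq_coeff_le {c a b : ℤ → ℝ≥0∞} {Λ : ℝ≥0∞} (hc : ∑' k, c k ^ 2 ≤ Λ) :
    ∑' k, (∑' k₁, (c k + c k₁ + c (k - k₁)) * (a k₁ * b (k - k₁))) ^ 2 ≤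
      12 * Λ * ((∑' k, a k ^ 2) * ∑' k, b k ^ 2) := by
  have shift : ∀ (k : ℤ) (f : ℤ → ℝ≥0∞), ∑' k₁, f (k - k₁) = ∑' k₁, f k₁ := fun k f =>
    (Equiv.subLeft k).tsum_eq f
  have shift' : ∀ (k : ℤ) (f : ℤ → ℝ≥0∞), ∑' k₁, f (k₁ - k) = ∑' k₁, f k₁ := fun k f =>
    (Equiv.subRight k).tsum_eq f
  have dbl : ∑' k, ∑' k₁, (a k₁ * b (k - k₁)) ^ 2 = (∑' k, a k ^ 2) * ∑' k, b k ^ 2 := by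
    rw [ENNReal.tsum_comm, ← ENNReal.tsum_mul_right]
    congr 1 with k₁
    simp_rw [mul_pow]
    rw [ENNReal.tsum_mul_left, shift' k₁ fun k => b k ^ 2]
  -- A coefficient of the output is summed after Cauchy-Schwarz in k₁; a coefficient of an input is
  -- itself one of the two factors in Cauchy-Schwarz.
  have h1 : ∑' k, (∑' k₁, c k * (a k₁ * b (k - k₁))) ^ 2 ≤
      Λ * ((∑' k, a k ^ 2) * ∑' k, b k ^ 2) := by
    calc _ ≤ ∑' k, c k ^ 2 * ((∑' k, a k ^ 2) * ∑' k, b k ^ 2) := by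
          refine ENNReal.tsum_le_tsum fun k => ?_
          rw [ENNReal.tsum_mul_left, mul_pow]
          gcongr
          refine (tsum_mul_sq_le _ _).trans_eq ?_
          rw [shift k fun k => b k ^ 2]
      _ ≤ _ := by rw [ENNReal.tsum_mul_right]; gcongr
  have h2 : ∑' k, (∑' k₁, c k₁ * (a k₁ * b (k - k₁))) ^ 2 ≤
      Λ * ((∑' k, a k ^ 2) * ∑' k, b k ^ 2) := by
    calc _ ≤ ∑' k, Λ * ∑' k₁, (a k₁ * b (k - k₁)) ^ 2 := by
          refine ENNReal.tsum_le_tsum fun k => ?_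
          refine (tsum_mul_sq_le _ _).trans ?_
          gcongr
      _ = _ := by rw [ENNReal.tsum_mul_left, dbl]
  have h3 : ∑' k, (∑' k₁, c (k - k₁) * (a k₁ * b (k - k₁))) ^ 2 ≤
      Λ * ((∑' k, a k ^ 2) * ∑' k, b k ^ 2) := by
    calc _ ≤ ∑' k, Λ * ∑' k₁, (a k₁ * b (k - k₁)) ^ 2 := by
          refine ENNReal.tsum_le_tsum fun k => ?_
          refine (tsum_mul_sq_le _ _).trans ?_
          rw [shift k fun k => c k ^ 2]
          gcongr
      _ = _ := by rw [ENNReal.tsum_mul_left, dbl]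
  calc _ ≤ ∑' k, 4 * ((∑' k₁, c k * (a k₁ * b (k - k₁))) ^ 2 +
        (∑' k₁, c k₁ * (a k₁ * b (k - k₁))) ^ 2 +
        (∑' k₁, c (k - k₁) * (a k₁ * b (k - k₁))) ^ 2) := by
        refine ENNReal.tsum_le_tsum fun k => ?_
        simp_rw [add_mul]
        rw [ENNReal.tsum_add, ENNReal.tsum_add]
        exact ennreal_add_three_sq_le _ _ _
    _ ≤ 4 * (Λ * ((∑' k, a k ^ 2) * ∑' k, b k ^ 2) + Λ * ((∑' k, a k ^ 2) * ∑' k, b k ^ 2) +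
          Λ * ((∑' k, a k ^ 2) * ∑' k, b k ^ 2)) := by
        rw [ENNReal.tsum_mul_left, ENNReal.tsum_add, ENNReal.tsum_add]
        gcongr
    _ = _ := by ring

/-! ### The bilinear estimate for nonnegative functions -/

/-- A power of the bracket of the modulation, as a function with values in `[0,∞]`. -/
def modPow (r σ : ℝ) : ℝ≥0∞ := ENNReal.ofReal (modBr σ ^ r)

@[fun_prop] lemma measurable_modBr : Measurable modBr := by unfold modBr; fun_prop

@[fun_prop] lemma measurable_modPow (r : ℝ) : Measurable (modPow r) := by unfold modPow; fun_prop

lemma modPow_sq (r σ : ℝ) : modPow r σ ^ 2 = modPow (2 * r) σ := by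
  rw [modPow, modPow, ← ENNReal.ofReal_pow (by have := modBr_pos σ; positivity),
    ← Real.rpow_natCast, ← Real.rpow_mul (modBr_pos σ).le]
  congr 2; push_cast; ring

lemma modPow_mono {r r' : ℝ} (h : r ≤ r') (σ : ℝ) : modPow r σ ≤ modPow r' σ :=
  ENNReal.ofReal_le_ofReal (Real.rpow_le_rpow_of_exponent_le (one_le_modBr σ) h)

lemma lintegral_modPow_lt_top {r : ℝ} (hr : r < -1) : ∫⁻ σ, modPow r σ < ∞ := by
  have : Integrable (fun x : ℝ => (1 + ‖x‖) ^ (-(-r))) volume :=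
    integrable_one_add_norm (by simp; linarith)
  simp only [neg_neg] at this
  exact this.lintegral_lt_top

/-- The norm of one Fourier mode: weighted `L²` plus weighted `L¹`. -/
def modeNorm (v : ℝ → ℝ≥0∞) (y : ℝ≥0∞) (f : ℝ → ℝ≥0∞) : ℝ≥0∞ :=
  l2 volume (fun s => v s * f s) + y * ∫⁻ s, f s

/-- The square of the norm of a sequence of Fourier modes. -/
def sqNorm (v : ℤ → ℝ → ℝ≥0∞) (y : ℤ → ℝ≥0∞) (f : ℤ → ℝ → ℝ≥0∞) : ℝ≥0∞ :=
  ∑' k, modeNorm (v k) (y k) (f k) ^ 2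

/-- The quadratic interaction of two sequences of Fourier modes. -/
def interact (Φ : ℤ → ℤ → ℝ) (G H : ℤ → ℝ → ℝ≥0∞) (k : ℤ) (σ : ℝ) : ℝ≥0∞ :=
  ∑' k₁, ∫⁻ s, G k₁ s * H (k - k₁) (σ + Φ k k₁ - s)

/-- Coefficients which are admissible in the bilinear estimate. -/
structure Admissible (Φ : ℤ → ℤ → ℝ) (Λ : ℝ≥0∞) (c : ℤ → ℝ≥0∞) (e₀ e₁ e₂ : ℤ → ℤ → ℝ≥0∞) :
    Prop where
  sum_coeff : ∑' k, c k ^ 2 ≤ Λ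
  sum_fst : ∀ k a, ∑' k₁, e₀ k k₁ ^ 2 * modPow (-(1 / 4)) (a + Φ k k₁) ^ 2 ≤ Λ
  sum_snd : ∀ k₁ a, ∑' k, e₁ k k₁ ^ 2 * modPow (-(1 / 4)) (a - Φ k k₁) ^ 2 ≤ Λ
  sum_trd : ∀ k₂ a, ∑' k, e₂ k (k - k₂) ^ 2 * modPow (-(1 / 4)) (a - Φ k (k - k₂)) ^ 2 ≤ Λ

section Bilinear

variable {Φ : ℤ → ℤ → ℝ} {Λ : ℝ≥0∞} {c : ℤ → ℝ≥0∞} {e₀ e₁ e₂ : ℤ → ℤ → ℝ≥0∞}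

/-- The square of the `L²` norm of the bracket to the power `-3/4`. -/
def thetaMass : ℝ≥0∞ := ∫⁻ σ, modPow (-(3 / 4)) σ ^ 2

lemma thetaMass_lt_top : thetaMass < ∞ := by
  unfold thetaMass
  simp_rw [modPow_sq]
  exact lintegral_modPow_lt_top (by norm_num)

/-- The square of the `L²` norm of the bracket to the power `-5/8`. -/
def nuMass : ℝ≥0∞ := ∫⁻ σ, modPow (-(5 / 8)) σ ^ 2

lemma nuMass_lt_top : nuMass < ∞ := by
  unfold nuMass
  simp_rw [modPow_sq]
  exact lintegral_modPow_lt_top (by norm_num)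

/-- Cauchy-Schwarz with the output frequency fixed. -/
lemma tsum_sq_fst_le (hΛ : ∀ k a, ∑' k₁, e₀ k k₁ ^ 2 * modPow (-(1 / 4)) (a + Φ k k₁) ^ 2 ≤ Λ)
    {F E : ℤ → ℝ → ℝ≥0∞} (hF : ∀ k, Measurable (F k)) (hE : ∀ k, Measurable (E k)) :
    ∑' k, ∫⁻ σ, (∑' k₁, ∫⁻ s, (e₀ k k₁ * (modPow (-(3 / 4)) s *
      modPow (-(3 / 4)) (σ + Φ k k₁ - s))) * (F k₁ s * E (k - k₁) (σ + Φ k k₁ - s))) ^ 2 ≤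
      thetaMass * Λ * ((∑' k, ∫⁻ s, F k s ^ 2) * ∑' k, ∫⁻ s, E k s ^ 2) := by
  have h1 : ∀ k σ, (∑' k₁, ∫⁻ s, (e₀ k k₁ * (modPow (-(3 / 4)) s *
      modPow (-(3 / 4)) (σ + Φ k k₁ - s))) * (F k₁ s * E (k - k₁) (σ + Φ k k₁ - s))) ^ 2 ≤
      thetaMass * Λ * ∑' k₁, ∫⁻ s, F k₁ s ^ 2 * E (k - k₁) (σ + Φ k k₁ - s) ^ 2 := by
    intro k σ
    calc _ ≤ (∑' k₁, l2 volume (fun s => e₀ k k₁ * (modPow (-(3 / 4)) s *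
            modPow (-(3 / 4)) (σ + Φ k k₁ - s))) *
            l2 volume (fun s => F k₁ s * E (k - k₁) (σ + Φ k k₁ - s))) ^ 2 := by
          gcongr with k₁
          have := hF k₁
          have := hE (k - k₁)
          exact lintegral_mul_le_l2 (by fun_prop) (by fun_prop)
      _ ≤ (∑' k₁, ∫⁻ s, (e₀ k k₁ * (modPow (-(3 / 4)) s *
            modPow (-(3 / 4)) (σ + Φ k k₁ - s))) ^ 2) *
            ∑' k₁, ∫⁻ s, (F k₁ s * E (k - k₁) (σ + Φ k k₁ - s)) ^ 2 := by
          refine (tsum_mul_sq_le _ _).trans_eq ?_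
          simp_rw [l2_sq]
      _ ≤ _ := by
          simp_rw [mul_pow]
          gcongr
          rw [← lintegral_tsum fun k₁ => by fun_prop]
          rw [thetaMass, ← lintegral_mul_const _ (by fun_prop)]
          refine lintegral_mono fun s => ?_
          calc _ = modPow (-(3 / 4)) s ^ 2 * ∑' k₁, e₀ k k₁ ^ 2 *
                modPow (-(3 / 4)) (σ + Φ k k₁ - s) ^ 2 := by
                rw [← ENNReal.tsum_mul_left]; congr 1 with k₁; ring
            _ ≤ modPow (-(3 / 4)) s ^ 2 * Λ := by
                gcongr
                refine le_trans (ENNReal.tsum_le_tsum fun k₁ => ?_) (hΛ k (σ - s))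
                rw [sub_add_eq_add_sub]
                gcongr
                -- Of the available decay ⟨·⟩^{-3/2} only ⟨·⟩^{-1/2} is needed to count resonances.
                exact modPow_mono (by norm_num) _
  calc _ ≤ ∑' k, ∫⁻ σ, thetaMass * Λ *
        ∑' k₁, ∫⁻ s, F k₁ s ^ 2 * E (k - k₁) (σ + Φ k k₁ - s) ^ 2 :=
        ENNReal.tsum_le_tsum fun k => lintegral_mono (h1 k)
    _ = thetaMass * Λ * ∑' k, ∑' k₁, (∫⁻ s, F k₁ s ^ 2) * ∫⁻ s, E (k - k₁) s ^ 2 := by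
        rw [← ENNReal.tsum_mul_left]
        congr 1 with k
        have hm : ∀ k₁, Measurable fun σ => ∫⁻ s, F k₁ s ^ 2 * E (k - k₁) (σ + Φ k k₁ - s) ^ 2 := by
          intro k₁
          have := hF k₁
          have := hE (k - k₁)
          exact Measurable.lintegral_prod_right (by fun_prop)
        rw [lintegral_const_mul _ (Measurable.tsum hm), lintegral_tsum fun k₁ =>
          (hm k₁).aemeasurable]
        congr 2 with k₁
        exact lintegral_conv (fun s => F k₁ s ^ 2) (fun s => E (k - k₁) s ^ 2) ((hF k₁).pow_const 2)
          ((hE _).pow_const 2) _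
    _ = _ := by
        congr 1
        rw [ENNReal.tsum_comm, ← ENNReal.tsum_mul_right]
        congr 1 with k₁
        rw [ENNReal.tsum_mul_left]
        congr 1
        exact (Equiv.subRight k₁).tsum_eq fun k => ∫⁻ s, E k s ^ 2

/-- Cauchy-Schwarz with an input frequency fixed. -/
lemma tsum_sq_snd_le (hΛ : ∀ k₁ a, ∑' k, e₁ k k₁ ^ 2 * modPow (-(1 / 4)) (a - Φ k k₁) ^ 2 ≤ Λ)
    {F E : ℤ → ℝ → ℝ≥0∞} (hF : ∀ k, Measurable (F k)) (hE : ∀ k, Measurable (E k)) :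
    ∑' k, ∫⁻ σ, (∑' k₁, ∫⁻ s, (e₁ k k₁ * (modPow (-(1 / 4)) σ *
      modPow (-(3 / 4)) (σ + Φ k k₁ - s))) * (F k₁ s * E (k - k₁) (σ + Φ k k₁ - s))) ^ 2 ≤
      thetaMass * Λ * ((∑' k, ∫⁻ s, F k s ^ 2) * ∑' k, ∫⁻ s, E k s ^ 2) := by
  set M : ℤ → ℤ → ℝ → ℝ → ℝ≥0∞ := fun k k₁ σ s =>
    e₁ k k₁ ^ 2 * (modPow (-(1 / 4)) σ ^ 2 * modPow (-(3 / 4)) (σ + Φ k k₁ - s) ^ 2) *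
      F k₁ s ^ 2 with hM
  have hMm : ∀ k k₁, Measurable (Function.uncurry (M k k₁)) := fun k k₁ => by
    have := hF k₁
    simp only [hM, Function.uncurry_def]
    fun_prop
  have h1 : ∀ k σ, (∑' k₁, ∫⁻ s, (e₁ k k₁ * (modPow (-(1 / 4)) σ *
      modPow (-(3 / 4)) (σ + Φ k k₁ - s))) * (F k₁ s * E (k - k₁) (σ + Φ k k₁ - s))) ^ 2 ≤
      (∑' k₁, ∫⁻ s, M k k₁ σ s) * ∑' k, ∫⁻ s, E k s ^ 2 := by
    intro k σ
    calc _ ≤ (∑' k₁, l2 volume (fun s => e₁ k k₁ * (modPow (-(1 / 4)) σ *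
            modPow (-(3 / 4)) (σ + Φ k k₁ - s)) * F k₁ s) *
            l2 volume (fun s => E (k - k₁) (σ + Φ k k₁ - s))) ^ 2 := by
          gcongr with k₁
          have := hF k₁
          have := hE (k - k₁)
          simp_rw [← mul_assoc]
          exact lintegral_mul_le_l2 (by fun_prop) (by fun_prop)
      _ ≤ _ := by
          refine (tsum_mul_sq_le _ _).trans_eq ?_
          simp_rw [l2_sq, mul_pow, hM]
          congr 1
          have : ∀ k₁, ∫⁻ s, E (k - k₁) (σ + Φ k k₁ - s) ^ 2 = ∫⁻ s, E (k - k₁) s ^ 2 :=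
            fun k₁ => lintegral_comp_sub (fun s => E (k - k₁) s ^ 2) _
          simp_rw [this]
          exact (Equiv.subLeft k).tsum_eq fun k => ∫⁻ s, E k s ^ 2
  calc _ ≤ ∑' k, ∫⁻ σ, (∑' k₁, ∫⁻ s, M k k₁ σ s) * ∑' k, ∫⁻ s, E k s ^ 2 :=
        ENNReal.tsum_le_tsum fun k => lintegral_mono (h1 k)
    _ = (∑' k, ∑' k₁, ∫⁻ s, ∫⁻ σ, M k k₁ σ s) * ∑' k, ∫⁻ s, E k s ^ 2 := by
        rw [← ENNReal.tsum_mul_right]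
        congr 1 with k
        have hm : ∀ k₁, Measurable fun σ => ∫⁻ s, M k k₁ σ s := fun k₁ =>
          (hMm k k₁).lintegral_prod_right
        rw [lintegral_mul_const _ (Measurable.tsum hm), lintegral_tsum fun k₁ =>
          (hm k₁).aemeasurable]
        congr 2 with k₁
        exact lintegral_lintegral_swap (hMm k k₁).aemeasurable
    _ ≤ (thetaMass * Λ * ∑' k, ∫⁻ s, F k s ^ 2) * ∑' k, ∫⁻ s, E k s ^ 2 := by
        gcongr
        rw [ENNReal.tsum_comm, ← ENNReal.tsum_mul_left]
        refine ENNReal.tsum_le_tsum fun k₁ => ?_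
        have hFk := hF k₁
        have hm : ∀ k, Measurable fun s => ∫⁻ σ, M k k₁ σ s := fun k =>
          (hMm k k₁).lintegral_prod_left
        rw [← lintegral_tsum fun k => (hm k).aemeasurable,
          ← lintegral_const_mul _ (by fun_prop)]
        refine lintegral_mono fun s => ?_
        calc ∑' k, ∫⁻ σ, M k k₁ σ s = ∑' k, ∫⁻ t, e₁ k k₁ ^ 2 *
              (modPow (-(1 / 4)) (t + (s - Φ k k₁)) ^ 2 * modPow (-(3 / 4)) t ^ 2) *
                F k₁ s ^ 2 := by
              congr 1 with k
              -- With the modulation t of the other input as variable, Φ occurs only in the output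
              -- modulation t + s - Φ, which is what the counting hypothesis controls.
              rw [← lintegral_add_right_eq_self _ (s - Φ k k₁)]
              congr 1 with t
              simp only [hM]
              congr 5
              ring
          _ = ∫⁻ t, F k₁ s ^ 2 * (modPow (-(3 / 4)) t ^ 2 * ∑' k, e₁ k k₁ ^ 2 *
                modPow (-(1 / 4)) (t + s - Φ k k₁) ^ 2) := by
              rw [← lintegral_tsum fun k => by fun_prop]
              congr 1 with t
              rw [← ENNReal.tsum_mul_left, ← ENNReal.tsum_mul_left]
              congr 1 with k
              rw [add_sub_assoc]
              ring
          _ ≤ ∫⁻ t, F k₁ s ^ 2 * (modPow (-(3 / 4)) t ^ 2 * Λ) := by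
              gcongr with t
              exact hΛ k₁ (t + s)
          _ = thetaMass * Λ * F k₁ s ^ 2 := by
              rw [lintegral_const_mul _ (by fun_prop), lintegral_mul_const _ (by fun_prop),
                thetaMass]
              ring
    _ = _ := by ring

end Bilinear

end

/-! ### The bilinear estimate in L² -/

section

section Bilinear

variable {Φ : ℤ → ℤ → ℝ} {Λ : ℝ≥0∞} {c : ℤ → ℝ≥0∞} {e₀ e₁ e₂ : ℤ → ℤ → ℝ≥0∞}

/-- Cauchy-Schwarz with the other input frequency fixed. -/
lemma tsum_sq_trd_le
    (hΛ : ∀ k₂ a, ∑' k, e₂ k (k - k₂) ^ 2 * modPow (-(1 / 4)) (a - Φ k (k - k₂)) ^ 2 ≤ Λ)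
    {F E : ℤ → ℝ → ℝ≥0∞} (hF : ∀ k, Measurable (F k)) (hE : ∀ k, Measurable (E k)) :
    ∑' k, ∫⁻ σ, (∑' k₁, ∫⁻ s, (e₂ k k₁ * (modPow (-(1 / 4)) σ *
      modPow (-(3 / 4)) s)) * (F k₁ s * E (k - k₁) (σ + Φ k k₁ - s))) ^ 2 ≤
      thetaMass * Λ * ((∑' k, ∫⁻ s, F k s ^ 2) * ∑' k, ∫⁻ s, E k s ^ 2) := by
  -- The substitutions k₁ ↦ k - k₁ and s ↦ σ + Φ - s exchange the two inputs.
  have h := tsum_sq_snd_le (Φ := fun k k₂ => Φ k (k - k₂)) (e₁ := fun k k₂ => e₂ k (k - k₂))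
    hΛ hE hF
  rw [mul_comm (∑' k, ∫⁻ s, F k s ^ 2)]
  refine le_of_eq_of_le ?_ h
  congr 1 with k
  congr 1 with σ
  congr 1
  rw [← (Equiv.subLeft k).tsum_eq]
  congr 1 with k₂
  simp only [Equiv.subLeft_apply, sub_sub_cancel]
  rw [← lintegral_comp_sub _ (σ + Φ k (k - k₂))]
  congr 1 with s
  rw [sub_sub_cancel, mul_comm (F (k - k₂) _)]

variable {v : ℤ → ℝ → ℝ≥0∞} {y : ℤ → ℝ≥0∞} {G H : ℤ → ℝ → ℝ≥0∞}

lemma l2_le_modeNorm (v : ℝ → ℝ≥0∞) (y : ℝ≥0∞) (f : ℝ → ℝ≥0∞) :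
    l2 volume (fun s => v s * f s) ≤ modeNorm v y f := le_self_add

lemma mul_lintegral_le_modeNorm (v : ℝ → ℝ≥0∞) (y : ℝ≥0∞) (f : ℝ → ℝ≥0∞) :
    y * ∫⁻ s, f s ≤ modeNorm v y f := le_add_self

section Pair

variable {v₁ v₂ f g : ℝ → ℝ≥0∞} {y₁ y₂ : ℝ≥0∞}

/-- Young's inequality L² * L¹, with the first input in the weighted L² norm and the second one in
the weighted L¹ norm. -/
lemma l2_conv_left_le (hv₁ : Measurable v₁) (hf : Measurable f) (hg : Measurable g) (a : ℝ) :
    l2 volume (fun σ => ∫⁻ s, v₁ s * y₂ * (f s * g (σ + a - s))) ≤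
      modeNorm v₁ y₁ f * modeNorm v₂ y₂ g := by
  have e : ∀ σ, ∫⁻ s, v₁ s * y₂ * (f s * g (σ + a - s)) =
      ∫⁻ s, (v₁ s * f s) * (y₂ * g (σ + a - s)) := fun σ => by
    congr 1 with s; ring
  simp_rw [e]
  rw [le_l2_iff]
  refine (lintegral_conv_sq_le (hv₁.mul hf) (hg.const_mul y₂) a).trans ?_
  rw [← l2_sq, lintegral_const_mul _ hg, ← mul_pow]
  gcongr
  · exact l2_le_modeNorm _ _ _
  · exact mul_lintegral_le_modeNorm _ _ _

lemma l2_conv_right_le (hv₂ : Measurable v₂) (hf : Measurable f) (hg : Measurable g) (a : ℝ) :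
    l2 volume (fun σ => ∫⁻ s, y₁ * v₂ (σ + a - s) * (f s * g (σ + a - s))) ≤
      modeNorm v₁ y₁ f * modeNorm v₂ y₂ g := by
  rw [mul_comm (modeNorm v₁ y₁ f)]
  refine le_of_eq_of_le ?_ (l2_conv_left_le (v₂ := v₁) (y₂ := y₁) (y₁ := y₂) hv₂ hg hf a)
  congr 1 with σ
  rw [← lintegral_comp_sub _ (σ + a)]
  congr 1 with s
  rw [sub_sub_cancel]
  ring

lemma lintegral_conv_weighted_le (hv₁ : Measurable v₁) (hv₂ : Measurable v₂) (hf : Measurable f)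
    (hg : Measurable g) (a : ℝ) :
    ∫⁻ s, v₁ s * v₂ (a - s) * (f s * g (a - s)) ≤ modeNorm v₁ y₁ f * modeNorm v₂ y₂ g := by
  have e : ∫⁻ s, v₁ s * v₂ (a - s) * (f s * g (a - s)) =
      ∫⁻ s, (v₁ s * f s) * (v₂ (a - s) * g (a - s)) := by
    congr 1 with s; ring
  rw [e]
  refine (lintegral_mul_le_l2 (by fun_prop) (by fun_prop)).trans ?_
  gcongr
  · exact l2_le_modeNorm _ _ _
  · refine le_trans (le_of_eq ?_) (l2_le_modeNorm v₂ y₂ g)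
    unfold l2
    rw [lintegral_comp_sub (fun s => (v₂ s * g s) ^ 2)]

/-- With both inputs in L² the convolution is only bounded; a square integrable factor in the output
modulation brings it back to L². -/
lemma l2_conv_both_le (hv₁ : Measurable v₁) (hv₂ : Measurable v₂) (hf : Measurable f)
    (hg : Measurable g) (a : ℝ) {n : ℝ → ℝ≥0∞} (hn : Measurable n) :
    l2 volume (fun σ => ∫⁻ s, n σ * (v₁ s * v₂ (σ + a - s)) * (f s * g (σ + a - s))) ≤
      l2 volume n * (modeNorm v₁ y₁ f * modeNorm v₂ y₂ g) := by
  rw [mul_comm, ← l2_const_mul hn.aemeasurable]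
  refine l2_mono fun σ => ?_
  simp_rw [mul_assoc (n σ)]
  rw [lintegral_const_mul _ (by fun_prop), mul_comm]
  gcongr
  exact lintegral_conv_weighted_le hv₁ hv₂ hf hg _

end Pair

/-- The part of the multiplier which is estimated with the triangle inequality. -/
def dumbMult (v₁ v₂ : ℝ → ℝ≥0∞) (y₁ y₂ : ℝ≥0∞) (a σ s : ℝ) : ℝ≥0∞ :=
  v₁ s * y₂ + y₁ * v₂ (σ + a - s) + modPow (-(5 / 8)) σ * (v₁ s * v₂ (σ + a - s))

/-- The part of the multiplier which is estimated with the Cauchy-Schwarz inequality. -/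
def resMult (i₀ i₁ i₂ : ℝ≥0∞) (a σ s : ℝ) : ℝ≥0∞ :=
  i₀ * (modPow (-(3 / 4)) s * modPow (-(3 / 4)) (σ + a - s)) +
    i₁ * (modPow (-(1 / 4)) σ * modPow (-(3 / 4)) (σ + a - s)) +
    i₂ * (modPow (-(1 / 4)) σ * modPow (-(3 / 4)) s)

lemma l2_dumb_le {v₁ v₂ f g : ℝ → ℝ≥0∞} {y₁ y₂ : ℝ≥0∞} (hv₁ : Measurable v₁)
    (hv₂ : Measurable v₂) (hf : Measurable f) (hg : Measurable g) (a : ℝ) :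
    l2 volume (fun σ => ∫⁻ s, dumbMult v₁ v₂ y₁ y₂ a σ s * (f s * g (σ + a - s))) ≤
      (2 + l2 volume (modPow (-(5 / 8)))) * (modeNorm v₁ y₁ f * modeNorm v₂ y₂ g) := by
  have e : ∀ σ, ∫⁻ s, dumbMult v₁ v₂ y₁ y₂ a σ s * (f s * g (σ + a - s)) =
      ((∫⁻ s, v₁ s * y₂ * (f s * g (σ + a - s))) +
        (∫⁻ s, y₁ * v₂ (σ + a - s) * (f s * g (σ + a - s)))) +
        ∫⁻ s, modPow (-(5 / 8)) σ * (v₁ s * v₂ (σ + a - s)) * (f s * g (σ + a - s)) := fun σ => by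
    unfold dumbMult
    simp_rw [add_mul]
    rw [lintegral_add_left (by fun_prop), lintegral_add_left (by fun_prop)]
  simp_rw [e]
  have m1 : Measurable fun σ => ∫⁻ s, v₁ s * y₂ * (f s * g (σ + a - s)) :=
    Measurable.lintegral_prod_right (by fun_prop)
  have m2 : Measurable fun σ => ∫⁻ s, y₁ * v₂ (σ + a - s) * (f s * g (σ + a - s)) :=
    Measurable.lintegral_prod_right (by fun_prop)
  have m3 : Measurable fun σ => ∫⁻ s, modPow (-(5 / 8)) σ * (v₁ s * v₂ (σ + a - s)) *
      (f s * g (σ + a - s)) := Measurable.lintegral_prod_right (by fun_prop)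
  have m12 : Measurable fun σ => (∫⁻ s, v₁ s * y₂ * (f s * g (σ + a - s))) +
      (∫⁻ s, y₁ * v₂ (σ + a - s) * (f s * g (σ + a - s))) := m1.add m2
  refine (l2_add_le m12.aemeasurable m3.aemeasurable).trans ?_
  refine (add_le_add_left (l2_add_le m1.aemeasurable m2.aemeasurable) _).trans ?_
  rw [add_mul, two_mul]
  gcongr
  · exact l2_conv_left_le hv₁ hf hg a
  · exact l2_conv_right_le hv₂ hf hg a
  · exact l2_conv_both_le hv₁ hv₂ hf hg a (measurable_modPow _)

lemma tsum_sq_dumb_le (hc : ∑' k, c k ^ 2 ≤ Λ) (hv : ∀ k, Measurable (v k))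
    (hG : ∀ k, Measurable (G k)) (hH : ∀ k, Measurable (H k)) :
    ∑' k, ∫⁻ σ, (∑' k₁, (c k + c k₁ + c (k - k₁)) * ∫⁻ s,
      dumbMult (v k₁) (v (k - k₁)) (y k₁) (y (k - k₁)) (Φ k k₁) σ s *
        (G k₁ s * H (k - k₁) (σ + Φ k k₁ - s))) ^ 2 ≤
      (2 + l2 volume (modPow (-(5 / 8)))) ^ 2 * (12 * Λ * (sqNorm v y G * sqNorm v y H)) := by
  set κ := 2 + l2 volume (modPow (-(5 / 8)))
  refine le_trans ?_ (mul_le_mul_right (tsum_sq_coeff_le hc) _)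
  rw [← ENNReal.tsum_mul_left]
  refine ENNReal.tsum_le_tsum fun k => ?_
  rw [← mul_pow, ← ENNReal.tsum_mul_left, ← le_l2_iff]
  have hm : ∀ k₁, Measurable fun σ => ∫⁻ s,
      dumbMult (v k₁) (v (k - k₁)) (y k₁) (y (k - k₁)) (Φ k k₁) σ s *
        (G k₁ s * H (k - k₁) (σ + Φ k k₁ - s)) := fun k₁ => by
    have h1 := hv k₁
    have h2 := hv (k - k₁)
    have h3 := hG k₁
    have h4 := hH (k - k₁)
    unfold dumbMult
    exact Measurable.lintegral_prod_right (by fun_prop)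
  refine (l2_tsum_le fun k₁ => ((hm k₁).const_mul _).aemeasurable).trans ?_
  refine ENNReal.tsum_le_tsum fun k₁ => ?_
  rw [l2_const_mul (hm k₁).aemeasurable, mul_left_comm]
  gcongr
  exact l2_dumb_le (hv _) (hv _) (hG _) (hH _) _

/-- The constant in the bilinear estimate in `L²`. -/
def bilinearConst : ℝ≥0∞ :=
  8 * (12 * (2 + l2 volume (modPow (-(5 / 8)))) ^ 2 + 3 * thetaMass)

lemma l2_nu_lt_top : l2 volume (modPow (-(5 / 8))) < ∞ :=
  ENNReal.rpow_lt_top_of_nonneg (by norm_num) nuMass_lt_top.ne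

lemma bilinearConst_lt_top : bilinearConst < ∞ := by
  unfold bilinearConst
  have h1 := l2_nu_lt_top
  have h2 := thetaMass_lt_top
  finiteness

/-- The bilinear estimate in `L²` from the estimate of the multiplier. -/
theorem bilinear_l2 (adm : Admissible Φ Λ c e₀ e₁ e₂) (hv : ∀ k, Measurable (v k))
    (hG : ∀ k, Measurable (G k)) (hH : ∀ k, Measurable (H k)) (hG0 : G 0 = 0) (hH0 : H 0 = 0)
    {μ : ℤ → ℝ → ℝ≥0∞} {C : ℝ≥0∞} (hμ0 : μ 0 = 0)
    (hμ : ∀ k k₁, k ≠ 0 → k₁ ≠ 0 → k - k₁ ≠ 0 → ∀ σ s, μ k σ ≤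
      C * ((c k + c k₁ + c (k - k₁)) *
        dumbMult (v k₁) (v (k - k₁)) (y k₁) (y (k - k₁)) (Φ k k₁) σ s +
        v k₁ s * v (k - k₁) (σ + Φ k k₁ - s) *
          resMult (e₀ k k₁) (e₁ k k₁) (e₂ k k₁) (Φ k k₁) σ s)) :
    ∑' k, ∫⁻ σ, (μ k σ * interact Φ G H k σ) ^ 2 ≤
      C ^ 2 * (bilinearConst * Λ * (sqNorm v y G * sqNorm v y H)) := by
  set D : ℤ → ℝ → ℝ≥0∞ := fun k σ => ∑' k₁, (c k + c k₁ + c (k - k₁)) * ∫⁻ s,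
      dumbMult (v k₁) (v (k - k₁)) (y k₁) (y (k - k₁)) (Φ k k₁) σ s *
        (G k₁ s * H (k - k₁) (σ + Φ k k₁ - s)) with hD
  set F : ℤ → ℝ → ℝ≥0∞ := fun k s => v k s * G k s with hF
  set E : ℤ → ℝ → ℝ≥0∞ := fun k s => v k s * H k s with hE
  have hFm : ∀ k, Measurable (F k) := fun k => (hv k).mul (hG k)
  have hEm : ∀ k, Measurable (E k) := fun k => (hv k).mul (hH k)
  set R₀ : ℤ → ℝ → ℝ≥0∞ := fun k σ => ∑' k₁, ∫⁻ s, (e₀ k k₁ * (modPow (-(3 / 4)) s *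
      modPow (-(3 / 4)) (σ + Φ k k₁ - s))) * (F k₁ s * E (k - k₁) (σ + Φ k k₁ - s)) with hR₀
  set R₁ : ℤ → ℝ → ℝ≥0∞ := fun k σ => ∑' k₁, ∫⁻ s, (e₁ k k₁ * (modPow (-(1 / 4)) σ *
      modPow (-(3 / 4)) (σ + Φ k k₁ - s))) * (F k₁ s * E (k - k₁) (σ + Φ k k₁ - s)) with hR₁
  set R₂ : ℤ → ℝ → ℝ≥0∞ := fun k σ => ∑' k₁, ∫⁻ s, (e₂ k k₁ * (modPow (-(1 / 4)) σ *
      modPow (-(3 / 4)) s)) * (F k₁ s * E (k - k₁) (σ + Φ k k₁ - s)) with hR₂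
  have hmD : ∀ k, Measurable (D k) := fun k => by
    refine Measurable.tsum fun k₁ => Measurable.const_mul ?_ _
    have h1 := hv k₁
    have h2 := hv (k - k₁)
    have h3 := hG k₁
    have h4 := hH (k - k₁)
    unfold dumbMult
    exact Measurable.lintegral_prod_right (by fun_prop)
  have hmR₀ : ∀ k, Measurable (R₀ k) := fun k => by
    refine Measurable.tsum fun k₁ => ?_
    have h1 := hFm k₁
    have h2 := hEm (k - k₁)
    exact Measurable.lintegral_prod_right (by fun_prop)
  have hmR₁ : ∀ k, Measurable (R₁ k) := fun k => by
    refine Measurable.tsum fun k₁ => ?_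
    have h1 := hFm k₁
    have h2 := hEm (k - k₁)
    exact Measurable.lintegral_prod_right (by fun_prop)
  have point : ∀ k σ, μ k σ * interact Φ G H k σ ≤ C * (D k σ + (R₀ k σ + R₁ k σ + R₂ k σ)) := by
    intro k σ
    simp only [interact, hD, hR₀, hR₁, hR₂]
    rw [← ENNReal.tsum_add, ← ENNReal.tsum_add, ← ENNReal.tsum_add, ← ENNReal.tsum_mul_left,
      ← ENNReal.tsum_mul_left]
    refine ENNReal.tsum_le_tsum fun k₁ => ?_
    have h1 := hv k₁
    have h2 := hv (k - k₁)
    have h3 := hG k₁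
    have h4 := hH (k - k₁)
    have h5 := hFm k₁
    have h6 := hEm (k - k₁)
    have hdm : Measurable fun s => dumbMult (v k₁) (v (k - k₁)) (y k₁) (y (k - k₁)) (Φ k k₁) σ s *
        (G k₁ s * H (k - k₁) (σ + Φ k k₁ - s)) := by unfold dumbMult; fun_prop
    rw [← lintegral_const_mul _ (by fun_prop), ← lintegral_const_mul _ hdm,
      ← lintegral_add_left (by fun_prop), ← lintegral_add_left (by fun_prop),
      ← lintegral_add_left (hdm.const_mul _), ← lintegral_const_mul _ (by
        refine (hdm.const_mul _).add ?_; fun_prop)]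
    refine lintegral_mono fun s => ?_
    show μ k σ * (G k₁ s * H (k - k₁) (σ + Φ k k₁ - s)) ≤ _
    by_cases hk : k = 0
    · subst hk; rw [hμ0]; simp
    by_cases hk₁ : k₁ = 0
    · subst hk₁; rw [hG0]; simp
    by_cases hk₂ : k - k₁ = 0
    · rw [hk₂, hH0]; simp
    refine (mul_le_mul_left (hμ k k₁ hk hk₁ hk₂ σ s) _).trans_eq ?_
    simp only [hF, hE, resMult]
    ring
  calc _ ≤ ∑' k, ∫⁻ σ, C ^ 2 * (8 * (D k σ ^ 2 + (R₀ k σ ^ 2 + (R₁ k σ ^ 2 + R₂ k σ ^ 2)))) := by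
        refine ENNReal.tsum_le_tsum fun k => lintegral_mono fun σ => ?_
        refine (pow_le_pow_left' (point k σ) 2).trans ?_
        rw [mul_pow]
        gcongr
        refine (ennreal_add_sq_le _ _).trans ?_
        calc _ ≤ 2 * (4 * D k σ ^ 2 + 4 * (R₀ k σ ^ 2 + R₁ k σ ^ 2 + R₂ k σ ^ 2)) := by
              gcongr
              · exact le_mul_of_one_le_left' (by norm_num)
              · exact ennreal_add_three_sq_le _ _ _
          _ = _ := by ring
    _ = C ^ 2 * (8 * ((∑' k, ∫⁻ σ, D k σ ^ 2) + ((∑' k, ∫⁻ σ, R₀ k σ ^ 2) +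
          ((∑' k, ∫⁻ σ, R₁ k σ ^ 2) + ∑' k, ∫⁻ σ, R₂ k σ ^ 2)))) := by
        simp_rw [← ENNReal.tsum_add, ← ENNReal.tsum_mul_left]
        congr 1 with k
        rw [← lintegral_add_left ((hmR₁ k).pow_const 2), ← lintegral_add_left ((hmR₀ k).pow_const 2),
          ← lintegral_add_left ((hmD k).pow_const 2), ← lintegral_const_mul' _ _ (by norm_num)]
        have hmR₂ : Measurable (R₂ k) := by
          refine Measurable.tsum fun k₁ => ?_
          have h1 := hFm k₁
          have h2 := hEm (k - k₁)
          exact Measurable.lintegral_prod_right (by fun_prop)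
        rw [← lintegral_const_mul _ (by
          have := hmD k; have := hmR₀ k; have := hmR₁ k; fun_prop)]
    _ ≤ C ^ 2 * (8 * ((2 + l2 volume (modPow (-(5 / 8)))) ^ 2 *
          (12 * Λ * (sqNorm v y G * sqNorm v y H)) +
          (thetaMass * Λ * (sqNorm v y G * sqNorm v y H) +
          (thetaMass * Λ * (sqNorm v y G * sqNorm v y H) +
            thetaMass * Λ * (sqNorm v y G * sqNorm v y H))))) := by
        have nF : ∑' k, ∫⁻ s, F k s ^ 2 ≤ sqNorm v y G := ENNReal.tsum_le_tsum fun k => by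
          rw [← l2_sq]; gcongr; exact l2_le_modeNorm _ _ _
        have nE : ∑' k, ∫⁻ s, E k s ^ 2 ≤ sqNorm v y H := ENNReal.tsum_le_tsum fun k => by
          rw [← l2_sq]; gcongr; exact l2_le_modeNorm _ _ _
        gcongr
        · exact tsum_sq_dumb_le adm.sum_coeff hv hG hH
        · refine (tsum_sq_fst_le adm.sum_fst hFm hEm).trans ?_
          gcongr
        · refine (tsum_sq_snd_le adm.sum_snd hFm hEm).trans ?_
          gcongr
        · refine (tsum_sq_trd_le adm.sum_trd hFm hEm).trans ?_
          gcongr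
    _ = _ := by unfold bilinearConst; ring

end Bilinear

end

/-! ### The bilinear estimate in L¹ -/

section

section Bilinear

variable {Φ : ℤ → ℤ → ℝ} {Λ : ℝ≥0∞} {c : ℤ → ℝ≥0∞} {e₀ e₁ e₂ : ℤ → ℤ → ℝ≥0∞}
  {v : ℤ → ℝ → ℝ≥0∞} {y : ℤ → ℝ≥0∞} {G H : ℤ → ℝ → ℝ≥0∞}

lemma measurable_interact (hG : ∀ k, Measurable (G k)) (hH : ∀ k, Measurable (H k)) (k : ℤ) :
    Measurable (interact Φ G H k) := by
  unfold interact
  refine Measurable.tsum fun k₁ => ?_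
  have h3 := hG k₁
  have h4 := hH (k - k₁)
  exact Measurable.lintegral_prod_right (by fun_prop)

/-- The part of the multiplier of the `L¹` estimate which is estimated with the triangle
inequality. -/
def dumbMultL1 (v₁ v₂ : ℝ → ℝ≥0∞) (y₁ y₂ : ℝ≥0∞) (a σ s : ℝ) : ℝ≥0∞ :=
  y₁ * y₂ + modPow (-(5 / 8)) σ * (v₁ s * y₂) + modPow (-(5 / 8)) σ * (y₁ * v₂ (σ + a - s)) +
    modPow (-(5 / 8)) σ ^ 2 * (v₁ s * v₂ (σ + a - s))

/-- The four terms are bounded by L¹ * L¹, twice by the pairing of ⟨σ⟩^{-5/8} with L² * L¹, and by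
the mass of ⟨σ⟩^{-5/4} times the supremum of L² * L². -/
lemma lintegral_dumb_le {v₁ v₂ f g : ℝ → ℝ≥0∞} {y₁ y₂ : ℝ≥0∞} (hv₁ : Measurable v₁)
    (hv₂ : Measurable v₂) (hf : Measurable f) (hg : Measurable g) (a : ℝ) :
    ∫⁻ σ, ∫⁻ s, dumbMultL1 v₁ v₂ y₁ y₂ a σ s * (f s * g (σ + a - s)) ≤
      (1 + 2 * l2 volume (modPow (-(5 / 8))) + nuMass) *
        (modeNorm v₁ y₁ f * modeNorm v₂ y₂ g) := by
  have e : ∀ σ, ∫⁻ s, dumbMultL1 v₁ v₂ y₁ y₂ a σ s * (f s * g (σ + a - s)) =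
      y₁ * y₂ * (∫⁻ s, f s * g (σ + a - s)) +
        modPow (-(5 / 8)) σ * (∫⁻ s, v₁ s * y₂ * (f s * g (σ + a - s))) +
        modPow (-(5 / 8)) σ * (∫⁻ s, y₁ * v₂ (σ + a - s) * (f s * g (σ + a - s))) +
        modPow (-(5 / 8)) σ ^ 2 * (∫⁻ s, v₁ s * v₂ (σ + a - s) * (f s * g (σ + a - s))) := fun σ => by
    unfold dumbMultL1
    simp_rw [add_mul]
    rw [lintegral_add_left (by fun_prop), lintegral_add_left (by fun_prop),
      lintegral_add_left (by fun_prop)]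
    simp_rw [mul_assoc (modPow (-(5 / 8)) σ), mul_assoc (modPow (-(5 / 8)) σ ^ 2)]
    rw [lintegral_const_mul _ (by fun_prop), lintegral_const_mul _ (by fun_prop),
      lintegral_const_mul _ (by fun_prop), lintegral_const_mul _ (by fun_prop)]
  simp_rw [e]
  have m0 : Measurable fun σ => ∫⁻ s, f s * g (σ + a - s) :=
    Measurable.lintegral_prod_right (by fun_prop)
  have m1 : Measurable fun σ => ∫⁻ s, v₁ s * y₂ * (f s * g (σ + a - s)) :=
    Measurable.lintegral_prod_right (by fun_prop)
  have m2 : Measurable fun σ => ∫⁻ s, y₁ * v₂ (σ + a - s) * (f s * g (σ + a - s)) :=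
    Measurable.lintegral_prod_right (by fun_prop)
  have hn := measurable_modPow (-(5 / 8))
  have m1' : Measurable fun σ => modPow (-(5 / 8)) σ * (∫⁻ s, v₁ s * y₂ * (f s * g (σ + a - s))) :=
    hn.mul m1
  have m2' : Measurable fun σ => modPow (-(5 / 8)) σ *
      (∫⁻ s, y₁ * v₂ (σ + a - s) * (f s * g (σ + a - s))) := hn.mul m2
  have add_four : ∀ {p q r t : ℝ → ℝ≥0∞}, Measurable p → Measurable q → Measurable r →
      ∫⁻ σ, (p σ + q σ + r σ + t σ) =
        (∫⁻ σ, p σ) + (∫⁻ σ, q σ) + (∫⁻ σ, r σ) + ∫⁻ σ, t σ := fun hp hq hr => by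
    rw [lintegral_add_left (by fun_prop), lintegral_add_left (by fun_prop), lintegral_add_left hp]
  rw [add_four (m0.const_mul _) m1' m2']
  rw [add_mul, add_mul, one_mul, two_mul, add_mul, ← add_assoc]
  gcongr
  · rw [lintegral_const_mul _ m0, lintegral_conv f g hf hg, mul_mul_mul_comm]
    gcongr <;> exact mul_lintegral_le_modeNorm _ _ _
  · refine (lintegral_mul_le_l2 hn.aemeasurable m1.aemeasurable).trans ?_
    gcongr
    exact l2_conv_left_le hv₁ hf hg a
  · refine (lintegral_mul_le_l2 hn.aemeasurable m2.aemeasurable).trans ?_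
    gcongr
    exact l2_conv_right_le hv₂ hf hg a
  · rw [nuMass, ← lintegral_mul_const _ (by fun_prop)]
    gcongr with σ
    exact lintegral_conv_weighted_le hv₁ hv₂ hf hg _

/-- The constant of the bilinear estimate in `L¹`. -/
def bilinearConstL1 : ℝ≥0∞ :=
  2 * (12 * (1 + 2 * l2 volume (modPow (-(5 / 8))) + nuMass) ^ 2 + thetaMass * bilinearConst)

lemma bilinearConstL1_lt_top : bilinearConstL1 < ∞ := by
  unfold bilinearConstL1
  have h1 := l2_nu_lt_top
  have h2 := thetaMass_lt_top
  have h3 := nuMass_lt_top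
  have h4 := bilinearConst_lt_top
  finiteness

/-- The bilinear estimate in `L¹` from the estimate of the multipliers. -/
theorem bilinear_l1 (adm : Admissible Φ Λ c e₀ e₁ e₂) (hv : ∀ k, Measurable (v k))
    (hG : ∀ k, Measurable (G k)) (hH : ∀ k, Measurable (H k)) (hG0 : G 0 = 0) (hH0 : H 0 = 0)
    {μ μ' : ℤ → ℝ → ℝ≥0∞} {C : ℝ≥0∞} (hμ0 : μ 0 = 0) (hμ0' : μ' 0 = 0)
    (hμm : ∀ k, Measurable (μ k))
    (hμ : ∀ k k₁, k ≠ 0 → k₁ ≠ 0 → k - k₁ ≠ 0 → ∀ σ s, μ k σ ≤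
      C * ((c k + c k₁ + c (k - k₁)) *
        dumbMult (v k₁) (v (k - k₁)) (y k₁) (y (k - k₁)) (Φ k k₁) σ s +
        v k₁ s * v (k - k₁) (σ + Φ k k₁ - s) *
          resMult (e₀ k k₁) (e₁ k k₁) (e₂ k k₁) (Φ k k₁) σ s))
    (hμ' : ∀ k k₁, k ≠ 0 → k₁ ≠ 0 → k - k₁ ≠ 0 → ∀ σ s, μ' k σ ≤
      C * ((c k + c k₁ + c (k - k₁)) *
        dumbMultL1 (v k₁) (v (k - k₁)) (y k₁) (y (k - k₁)) (Φ k k₁) σ s) +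
        modPow (-(3 / 4)) σ * μ k σ) :
    ∑' k, (∫⁻ σ, μ' k σ * interact Φ G H k σ) ^ 2 ≤
      C ^ 2 * (bilinearConstL1 * Λ * (sqNorm v y G * sqNorm v y H)) := by
  set κ : ℝ≥0∞ := 1 + 2 * l2 volume (modPow (-(5 / 8))) + nuMass with hκ
  set I : ℤ → ℤ → ℝ → ℝ≥0∞ := fun k k₁ σ => ∫⁻ s,
      dumbMultL1 (v k₁) (v (k - k₁)) (y k₁) (y (k - k₁)) (Φ k k₁) σ s *
        (G k₁ s * H (k - k₁) (σ + Φ k k₁ - s)) with hI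
  have hIm : ∀ k k₁, Measurable (I k k₁) := fun k k₁ => by
    have h1 := hv k₁
    have h2 := hv (k - k₁)
    have h3 := hG k₁
    have h4 := hH (k - k₁)
    simp only [hI]
    unfold dumbMultL1
    exact Measurable.lintegral_prod_right (by fun_prop)
  have point : ∀ k σ, μ' k σ * interact Φ G H k σ ≤
      C * (∑' k₁, (c k + c k₁ + c (k - k₁)) * I k k₁ σ) +
        modPow (-(3 / 4)) σ * (μ k σ * interact Φ G H k σ) := by
    intro k σ
    simp only [interact, hI]
    rw [← ENNReal.tsum_mul_left, ← ENNReal.tsum_mul_left, ← ENNReal.tsum_mul_left,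
      ← ENNReal.tsum_mul_left, ← ENNReal.tsum_add]
    refine ENNReal.tsum_le_tsum fun k₁ => ?_
    have h1 := hv k₁
    have h2 := hv (k - k₁)
    have h3 := hG k₁
    have h4 := hH (k - k₁)
    have hdm : Measurable fun s => dumbMultL1 (v k₁) (v (k - k₁)) (y k₁) (y (k - k₁)) (Φ k k₁) σ s *
        (G k₁ s * H (k - k₁) (σ + Φ k k₁ - s)) := by unfold dumbMultL1; fun_prop
    rw [← lintegral_const_mul _ (by fun_prop), ← lintegral_const_mul _ hdm,
      ← lintegral_const_mul _ (hdm.const_mul _),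
      ← lintegral_const_mul _ (by fun_prop), ← lintegral_const_mul _ (by fun_prop),
      ← lintegral_add_right _ (by fun_prop)]
    refine lintegral_mono fun s => ?_
    by_cases hk : k = 0
    · subst hk; simp [hμ0']
    by_cases hk₁ : k₁ = 0
    · subst hk₁; simp [hG0]
    by_cases hk₂ : k - k₁ = 0
    · simp [hk₂, hH0]
    refine (mul_le_mul_left (hμ' k k₁ hk hk₁ hk₂ σ s) _).trans_eq ?_
    ring
  have step : ∀ k, (∫⁻ σ, μ' k σ * interact Φ G H k σ) ^ 2 ≤
      2 * (C ^ 2 * (κ ^ 2 * (∑' k₁, (c k + c k₁ + c (k - k₁)) *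
        (modeNorm (v k₁) (y k₁) (G k₁) * modeNorm (v (k - k₁)) (y (k - k₁)) (H (k - k₁)))) ^ 2) +
        thetaMass * ∫⁻ σ, (μ k σ * interact Φ G H k σ) ^ 2) := fun k => by
    have hint := measurable_interact (Φ := Φ) hG hH k
    have hμk := hμm k
    have hsm : Measurable fun σ => ∑' k₁, (c k + c k₁ + c (k - k₁)) * I k k₁ σ :=
      Measurable.tsum fun k₁ => (hIm k k₁).const_mul _
    calc _ ≤ (∫⁻ σ, (C * (∑' k₁, (c k + c k₁ + c (k - k₁)) * I k k₁ σ) +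
          modPow (-(3 / 4)) σ * (μ k σ * interact Φ G H k σ))) ^ 2 := by
          gcongr with σ; exact point k σ
      _ = (C * (∑' k₁, (c k + c k₁ + c (k - k₁)) * ∫⁻ σ, I k k₁ σ) +
          ∫⁻ σ, modPow (-(3 / 4)) σ * (μ k σ * interact Φ G H k σ)) ^ 2 := by
          rw [lintegral_add_right _ (by fun_prop), lintegral_const_mul _ hsm,
            lintegral_tsum fun k₁ => ((hIm k k₁).const_mul _).aemeasurable]
          simp_rw [lintegral_const_mul _ (hIm k _)]
      _ ≤ 2 * ((C * (∑' k₁, (c k + c k₁ + c (k - k₁)) * ∫⁻ σ, I k k₁ σ)) ^ 2 +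
          (∫⁻ σ, modPow (-(3 / 4)) σ * (μ k σ * interact Φ G H k σ)) ^ 2) := ennreal_add_sq_le _ _
      _ ≤ _ := by
          gcongr
          · rw [mul_pow]
            gcongr
            rw [← mul_pow]
            gcongr
            rw [← ENNReal.tsum_mul_left]
            refine ENNReal.tsum_le_tsum fun k₁ => ?_
            rw [mul_left_comm]
            gcongr
            exact lintegral_dumb_le (hv _) (hv _) (hG _) (hH _) _
          -- The function ⟨σ⟩^{-3/4} is square integrable, so this part reduces to the L² estimate.
          · exact lintegral_mul_sq_le (by fun_prop) (by fun_prop)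
  calc _ ≤ ∑' k, 2 * (C ^ 2 * (κ ^ 2 * (∑' k₁, (c k + c k₁ + c (k - k₁)) *
        (modeNorm (v k₁) (y k₁) (G k₁) * modeNorm (v (k - k₁)) (y (k - k₁)) (H (k - k₁)))) ^ 2) +
        thetaMass * ∫⁻ σ, (μ k σ * interact Φ G H k σ) ^ 2) := ENNReal.tsum_le_tsum step
    _ ≤ 2 * (C ^ 2 * (κ ^ 2 * (12 * Λ * (sqNorm v y G * sqNorm v y H))) +
        thetaMass * (C ^ 2 * (bilinearConst * Λ * (sqNorm v y G * sqNorm v y H)))) := by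
        rw [ENNReal.tsum_mul_left, ENNReal.tsum_add, ENNReal.tsum_mul_left, ENNReal.tsum_mul_left,
          ENNReal.tsum_mul_left]
        gcongr
        · exact tsum_sq_coeff_le adm.sum_coeff
        · exact bilinear_l2 adm hv hG hH hG0 hH0 hμ0 hμ
    _ = _ := by rw [bilinearConstL1, ← hκ]; ring

end Bilinear

end

/-! ### The bilinear estimate on the lattice of frequencies -/

/-- The resonance function on the lattice of frequencies `k / lam`. -/
def latticeRes (A B lam : ℝ) (k k₁ : ℤ) : ℝ :=
  resonance A B (k / lam) (k₁ / lam) (k / lam - k₁ / lam)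

lemma phase_neg (A B z : ℝ) : phase A B (-z) = -phase A B z := by unfold phase; ring

/-- Since the phase is odd, an interaction with input ξ₁ and output ξ is one with input ξ and output
ξ₁, up to the sign. Counting with an input fixed is thus the same as counting with the output fixed.
-/
lemma resonance_swap (A B ξ ξ₁ : ℝ) :
    resonance A B ξ ξ₁ (ξ - ξ₁) = -resonance A B ξ₁ ξ (ξ₁ - ξ) := by
  unfold resonance
  rw [← neg_sub ξ ξ₁, phase_neg]
  ring

lemma resonance_comm (A B ξ ξ₁ ξ₂ : ℝ) : resonance A B ξ ξ₁ ξ₂ = resonance A B ξ ξ₂ ξ₁ := by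
  unfold resonance; ring

lemma maxFreq_swap (ξ ξ₁ : ℝ) : maxFreq ξ ξ₁ (ξ - ξ₁) = maxFreq ξ₁ ξ (ξ₁ - ξ) := by
  unfold maxFreq
  rw [abs_sub_comm, max_left_comm]

lemma ofReal_ind_sq_mul (p : Prop) (σ : ℝ) :
    ENNReal.ofReal (ind p) ^ 2 * modPow (-(1 / 4)) σ ^ 2 =
      ENNReal.ofReal (ind p * modBr σ ^ (-(1 / 2) : ℝ)) := by
  rw [ENNReal.ofReal_mul (ind_nonneg p), modPow_sq, modPow]
  congr 2
  · unfold ind; split_ifs <;> simp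
  · norm_num

lemma exists_admissible {A : ℝ} (hA : A ≠ 0) (B : ℝ) : ∃ C : ℝ≥0, ∀ B', |B'| ≤ |B| →
    ∀ lam : ℝ, 1 ≤ lam → Admissible (latticeRes A B' lam) (C * ENNReal.ofReal lam)
      (fun k => ENNReal.ofReal (lowCoeff (k / lam)))
      (fun k k₁ => ENNReal.ofReal (ind (Resonant A B (k / lam) (k₁ / lam) (k / lam - k₁ / lam)
        (k / lam))))
      (fun k k₁ => ENNReal.ofReal (ind (Resonant A B (k / lam) (k₁ / lam) (k / lam - k₁ / lam)
        (k₁ / lam))))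
      (fun k k₁ => ENNReal.ofReal (ind (Resonant A B (k / lam) (k₁ / lam) (k / lam - k₁ / lam)
        (k / lam - k₁ / lam)))) := by
  obtain ⟨C₁, h₁⟩ := exists_tsum_lowCoeff_le
  obtain ⟨C₂, h₂⟩ := exists_tsum_resonance_le hA B
  refine ⟨C₁ + C₂, fun B' hB' lam hlam => ?_⟩
  have hle : C₂ * ENNReal.ofReal lam ≤ ↑(C₁ + C₂) * ENNReal.ofReal lam := by
    gcongr; exact le_add_self
  refine ⟨(h₁ lam hlam).trans ?_, fun k a => ?_, fun k₁ a => ?_, fun k₂ a => ?_⟩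
  · gcongr; exact le_self_add
  · simp_rw [ofReal_ind_sq_mul]
    exact (h₂ B' hB' lam hlam k a).trans hle
  · refine le_trans (ENNReal.tsum_le_tsum fun k => ?_) ((h₂ B' hB' lam hlam k₁ a).trans hle)
    rw [ofReal_ind_sq_mul, latticeRes, resonance_swap, sub_neg_eq_add, Resonant, Resonant,
      maxFreq_swap]
  · refine le_trans (ENNReal.tsum_le_tsum fun k => ?_) ((h₂ B' hB' lam hlam k₂ a).trans hle)
    rw [ofReal_ind_sq_mul, latticeRes]
    have e : ((k - k₂ : ℤ) : ℝ) / lam = k / lam - k₂ / lam := by push_cast; ring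
    rw [e, sub_sub_cancel, resonance_comm, resonance_swap, sub_neg_eq_add, Resonant, Resonant,
      maxFreq_comm, maxFreq_swap]

/-- The bilinear estimate from a weighted space into a weighted space, with a gain of one power of
the modulation. -/
def BilinearBound (Φ : ℤ → ℤ → ℝ) (w : ℤ → ℝ≥0∞) (v : ℤ → ℝ → ℝ≥0∞) (y : ℤ → ℝ≥0∞)
    (v' : ℤ → ℝ → ℝ≥0∞) (y' : ℤ → ℝ≥0∞) (K : ℝ≥0∞) : Prop :=
  ∀ G H : ℤ → ℝ → ℝ≥0∞, (∀ k, Measurable (G k)) → (∀ k, Measurable (H k)) → G 0 = 0 → H 0 = 0 →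
    sqNorm v' y' (fun k σ => w k * (modPow (-1) σ * interact Φ G H k σ)) ≤
      K * (sqNorm v y G * sqNorm v y H)

lemma ofReal_multBound {c y₁ y₂ W₁ W₂ i i₁ i₂ C σ σ₁ σ₂ : ℝ} (hC : 0 ≤ C) (hc : 0 ≤ c)
    (hy₁ : 0 ≤ y₁) (hy₂ : 0 ≤ y₂) (hW₁ : 0 ≤ W₁) (hW₂ : 0 ≤ W₂) (hi : 0 ≤ i) (hi₁ : 0 ≤ i₁)
    (hi₂ : 0 ≤ i₂) :
    ENNReal.ofReal (C * multBound c y₁ y₂ W₁ W₂ (modBr σ) (modBr σ₁) (modBr σ₂) i i₁ i₂) =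
      ENNReal.ofReal C * (ENNReal.ofReal c * (ENNReal.ofReal W₁ * ENNReal.ofReal y₂ +
        ENNReal.ofReal y₁ * ENNReal.ofReal W₂ +
        modPow (-(5 / 8)) σ * (ENNReal.ofReal W₁ * ENNReal.ofReal W₂)) +
        ENNReal.ofReal W₁ * ENNReal.ofReal W₂ *
          (ENNReal.ofReal i * (modPow (-(3 / 4)) σ₁ * modPow (-(3 / 4)) σ₂) +
          ENNReal.ofReal i₁ * (modPow (-(1 / 4)) σ * modPow (-(3 / 4)) σ₂) +
          ENNReal.ofReal i₂ * (modPow (-(1 / 4)) σ * modPow (-(3 / 4)) σ₁))) := by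
  have h0 := modBr_pos σ
  have h1 := modBr_pos σ₁
  have h2 := modBr_pos σ₂
  unfold multBound modPow
  simp (discharger := positivity) only [ENNReal.ofReal_mul, ENNReal.ofReal_add]
  ring

lemma ofReal_multBoundL1 {c y₁ y₂ W₁ W₂ C σ m : ℝ} (hC : 0 ≤ C) (hc : 0 ≤ c)
    (hy₁ : 0 ≤ y₁) (hy₂ : 0 ≤ y₂) (hW₁ : 0 ≤ W₁) (hW₂ : 0 ≤ W₂) (hm : 0 ≤ m) :
    ENNReal.ofReal (C * multBoundL1 c y₁ y₂ W₁ W₂ (modBr σ) + modBr σ ^ (-(3 / 4) : ℝ) * m) =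
      ENNReal.ofReal C * (ENNReal.ofReal c * (ENNReal.ofReal y₁ * ENNReal.ofReal y₂ +
        modPow (-(5 / 8)) σ * (ENNReal.ofReal W₁ * ENNReal.ofReal y₂) +
        modPow (-(5 / 8)) σ * (ENNReal.ofReal y₁ * ENNReal.ofReal W₂) +
        modPow (-(5 / 8)) σ ^ 2 * (ENNReal.ofReal W₁ * ENNReal.ofReal W₂))) +
        modPow (-(3 / 4)) σ * ENNReal.ofReal m := by
  have h0 := modBr_pos σ
  rw [modPow_sq, show 2 * (-(5 / 8) : ℝ) = -(5 / 4) by norm_num]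
  unfold multBoundL1 modPow
  simp (discharger := positivity) only [ENNReal.ofReal_mul, ENNReal.ofReal_add]
  ring

/-- The bilinear estimate from the multiplier estimate for real weights. -/
theorem bilinearBound_of_multiplier {Φ : ℤ → ℤ → ℝ} {Λ : ℝ≥0∞} {c X Y Y' : ℤ → ℝ}
    {i i₁ i₂ : ℤ → ℤ → ℝ} {W V : ℤ → ℝ → ℝ} {C : ℝ}
    (adm : Admissible Φ Λ (fun k => ENNReal.ofReal (c k)) (fun k k₁ => ENNReal.ofReal (i k k₁))
      (fun k k₁ => ENNReal.ofReal (i₁ k k₁)) (fun k k₁ => ENNReal.ofReal (i₂ k k₁)))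
    (hC : 0 ≤ C) (hc : ∀ k, 0 ≤ c k) (hX : ∀ k, 0 ≤ X k) (hX0 : X 0 = 0) (hY : ∀ k, 0 ≤ Y k)
    (hW : ∀ k σ, 0 ≤ W k σ) (hV : ∀ k σ, 0 ≤ V k σ) (hi : ∀ k k₁, 0 ≤ i k k₁)
    (hi₁ : ∀ k k₁, 0 ≤ i₁ k k₁) (hi₂ : ∀ k k₁, 0 ≤ i₂ k k₁)
    (hWm : ∀ k, Measurable (W k)) (hVm : ∀ k, Measurable (V k))
    (h : ∀ k k₁, k ≠ 0 → k₁ ≠ 0 → k - k₁ ≠ 0 → ∀ σ s,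
      X k * V k σ / modBr σ ≤ C * multBound (c k + c k₁ + c (k - k₁)) (Y k₁) (Y (k - k₁)) (W k₁ s)
        (W (k - k₁) (σ + Φ k k₁ - s)) (modBr σ) (modBr s) (modBr (σ + Φ k k₁ - s))
        (i k k₁) (i₁ k k₁) (i₂ k k₁) ∧
      X k * Y' k / modBr σ ≤ C * multBoundL1 (c k + c k₁ + c (k - k₁)) (Y k₁) (Y (k - k₁)) (W k₁ s)
        (W (k - k₁) (σ + Φ k k₁ - s)) (modBr σ) +
        modBr σ ^ (-(3 / 4) : ℝ) * (X k * V k σ / modBr σ)) :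
    BilinearBound Φ (fun k => ENNReal.ofReal (X k)) (fun k σ => ENNReal.ofReal (W k σ))
      (fun k => ENNReal.ofReal (Y k)) (fun k σ => ENNReal.ofReal (V k σ))
      (fun k => ENNReal.ofReal (Y' k))
      (2 * (ENNReal.ofReal C ^ 2 * ((bilinearConst + bilinearConstL1) * Λ))) := by
  intro G H hG hH hG0 hH0
  set μ : ℤ → ℝ → ℝ≥0∞ := fun k σ => ENNReal.ofReal (X k * V k σ / modBr σ) with hμ
  set μ' : ℤ → ℝ → ℝ≥0∞ := fun k σ => ENNReal.ofReal (X k * Y' k / modBr σ) with hμ'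
  have hvm : ∀ k, Measurable fun σ => ENNReal.ofReal (W k σ) := fun k => (hWm k).ennreal_ofReal
  have hμm : ∀ k, Measurable (μ k) := fun k => by
    have := hVm k
    simp only [hμ]
    fun_prop
  have hμ0 : μ 0 = 0 := by ext σ; simp [hμ, hX0]
  have hμ0' : μ' 0 = 0 := by ext σ; simp [hμ', hX0]
  have cc : ∀ k k₁, ENNReal.ofReal (c k + c k₁ + c (k - k₁)) =
      ENNReal.ofReal (c k) + ENNReal.ofReal (c k₁) + ENNReal.ofReal (c (k - k₁)) := fun k k₁ => by
    rw [ENNReal.ofReal_add (add_nonneg (hc _) (hc _)) (hc _), ENNReal.ofReal_add (hc _) (hc _)]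
  have c0 : ∀ k k₁, 0 ≤ c k + c k₁ + c (k - k₁) := fun k k₁ =>
    add_nonneg (add_nonneg (hc _) (hc _)) (hc _)
  have key : ∀ k k₁, k ≠ 0 → k₁ ≠ 0 → k - k₁ ≠ 0 → ∀ σ s, μ k σ ≤ ENNReal.ofReal C *
      ((ENNReal.ofReal (c k) + ENNReal.ofReal (c k₁) + ENNReal.ofReal (c (k - k₁))) *
        dumbMult (fun σ => ENNReal.ofReal (W k₁ σ)) (fun σ => ENNReal.ofReal (W (k - k₁) σ))
          (ENNReal.ofReal (Y k₁)) (ENNReal.ofReal (Y (k - k₁))) (Φ k k₁) σ s +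
        ENNReal.ofReal (W k₁ s) * ENNReal.ofReal (W (k - k₁) (σ + Φ k k₁ - s)) *
          resMult (ENNReal.ofReal (i k k₁)) (ENNReal.ofReal (i₁ k k₁)) (ENNReal.ofReal (i₂ k k₁))
            (Φ k k₁) σ s) := fun k k₁ hk hk₁ hk₂ σ s => by
    refine (ENNReal.ofReal_le_ofReal (h k k₁ hk hk₁ hk₂ σ s).1).trans_eq ?_
    rw [ofReal_multBound hC (c0 _ _) (hY _) (hY _) (hW _ _) (hW _ _) (hi _ _) (hi₁ _ _)
      (hi₂ _ _), cc]
    rfl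
  have key' : ∀ k k₁, k ≠ 0 → k₁ ≠ 0 → k - k₁ ≠ 0 → ∀ σ s, μ' k σ ≤ ENNReal.ofReal C *
      ((ENNReal.ofReal (c k) + ENNReal.ofReal (c k₁) + ENNReal.ofReal (c (k - k₁))) *
        dumbMultL1 (fun σ => ENNReal.ofReal (W k₁ σ)) (fun σ => ENNReal.ofReal (W (k - k₁) σ))
          (ENNReal.ofReal (Y k₁)) (ENNReal.ofReal (Y (k - k₁))) (Φ k k₁) σ s) +
        modPow (-(3 / 4)) σ * μ k σ := fun k k₁ hk hk₁ hk₂ σ s => by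
    refine (ENNReal.ofReal_le_ofReal (h k k₁ hk hk₁ hk₂ σ s).2).trans_eq ?_
    rw [ofReal_multBoundL1 hC (c0 _ _) (hY _) (hY _) (hW _ _) (hW _ _)
      (div_nonneg (mul_nonneg (hX _) (hV _ _)) (modBr_pos _).le), cc]
    rfl
  have b2 := bilinear_l2 adm hvm hG hH hG0 hH0 hμ0 key
  have b1 := bilinear_l1 adm hvm hG hH hG0 hH0 hμ0 hμ0' hμm key key'
  have inv : ∀ σ, modPow (-1) σ = ENNReal.ofReal (modBr σ)⁻¹ := fun σ => by
    rw [modPow, Real.rpow_neg_one]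
  calc _ ≤ ∑' k, 2 * ((∫⁻ σ, (μ k σ * interact Φ G H k σ) ^ 2) +
        (∫⁻ σ, μ' k σ * interact Φ G H k σ) ^ 2) := by
        refine ENNReal.tsum_le_tsum fun k => (ennreal_add_sq_le _ _).trans_eq ?_
        congr 2
        · rw [l2_sq]
          congr 1 with σ
          simp only [hμ]
          rw [inv, div_eq_mul_inv, ENNReal.ofReal_mul (mul_nonneg (hX _) (hV _ _)),
            ENNReal.ofReal_mul (hX _)]
          ring
        · congr 1
          rw [← lintegral_const_mul' _ _ ENNReal.ofReal_ne_top]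
          congr 1 with σ
          simp only [hμ']
          rw [inv, mul_div_assoc, div_eq_mul_inv, ENNReal.ofReal_mul (hX _),
            ENNReal.ofReal_mul' (inv_nonneg.2 (modBr_pos σ).le)]
          ring
    _ ≤ 2 * (ENNReal.ofReal C ^ 2 * (bilinearConst * Λ *
          (sqNorm (fun k σ => ENNReal.ofReal (W k σ)) (fun k => ENNReal.ofReal (Y k)) G *
            sqNorm (fun k σ => ENNReal.ofReal (W k σ)) (fun k => ENNReal.ofReal (Y k)) H)) +
          ENNReal.ofReal C ^ 2 * (bilinearConstL1 * Λ *
          (sqNorm (fun k σ => ENNReal.ofReal (W k σ)) (fun k => ENNReal.ofReal (Y k)) G *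
            sqNorm (fun k σ => ENNReal.ofReal (W k σ)) (fun k => ENNReal.ofReal (Y k)) H))) := by
        rw [ENNReal.tsum_mul_left, ENNReal.tsum_add]
        gcongr
    _ = _ := by ring

/-! ### The weights on the lattice -/

/-- The weight of a mode in `L²`. -/
def latticeWeight (s ρ lam : ℝ) (k : ℤ) (σ : ℝ) : ℝ≥0∞ :=
  ENNReal.ofReal (freqBr (k / lam) ^ ρ * zWeight s (k / lam) σ)

/-- The weight of a mode in `L¹`, and of the initial data. -/
def latticeBr (r lam : ℝ) (k : ℤ) : ℝ≥0∞ := ENNReal.ofReal (freqBr (k / lam) ^ r)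

/-- The weight of a mode in `X^{-1,1/2}`. -/
def latticeHalf (lam : ℝ) (k : ℤ) (σ : ℝ) : ℝ≥0∞ := ENNReal.ofReal (halfWeight (k / lam) σ)

/-- The size of a frequency. -/
def latticeAbs (lam : ℝ) (k : ℤ) : ℝ≥0∞ := ENNReal.ofReal |(k : ℝ) / lam|

@[fun_prop] lemma measurable_zWeight (s ξ : ℝ) : Measurable (zWeight s ξ) := by
  unfold zWeight logWeight
  refine Real.measurable_exp.comp (Measurable.ite (measurableSet_le (by fun_prop) (by fun_prop))
    (by fun_prop) (Measurable.ite (measurableSet_le (by fun_prop) (by fun_prop)) (by fun_prop)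
      (by fun_prop)))

@[fun_prop] lemma measurable_halfWeight (ξ : ℝ) : Measurable (halfWeight ξ) := by
  unfold halfWeight; fun_prop

lemma freqBr_add_le (ξ₁ ξ₂ : ℝ) : freqBr (ξ₁ + ξ₂) ≤ 2 * (freqBr ξ₁ * freqBr ξ₂) := by
  have h1 := one_le_freqBr ξ₁
  have h2 := one_le_freqBr ξ₂
  have h3 := abs_le_freqBr ξ₁
  have h4 := abs_le_freqBr ξ₂
  refine max_le (by nlinarith) ((abs_add_le _ _).trans ?_)
  nlinarith

/-- The main bilinear estimate. -/
theorem exists_bilinearBound {A : ℝ} (hA : A ≠ 0) (B : ℝ) {s ρ : ℝ} (hs : -(3 / 2) ≤ s)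
    (hs' : s ≤ -1) (hρ : 0 ≤ ρ) : ∃ C : ℝ≥0, ∀ B', |B'| ≤ |B| → ∀ lam : ℝ, 1 ≤ lam →
    BilinearBound (latticeRes A B' lam) (latticeAbs lam) (latticeWeight s ρ lam)
      (latticeBr (s + ρ) lam) (latticeWeight s ρ lam) (latticeBr (s + ρ) lam)
      (C * ENNReal.ofReal lam) := by
  obtain ⟨Λ, hΛ⟩ := exists_admissible hA B
  obtain ⟨C, hC, h⟩ := exists_multiplierEstimate (B := B) hA hs hs'
  have hfin : 2 * (ENNReal.ofReal (2 ^ ρ * C) ^ 2 * ((bilinearConst + bilinearConstL1) * Λ)) ≠ ∞ := by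
    have h1 := bilinearConst_lt_top
    have h2 := bilinearConstL1_lt_top
    finiteness
  refine ⟨(2 * (ENNReal.ofReal (2 ^ ρ * C) ^ 2 * ((bilinearConst + bilinearConstL1) * Λ))).toNNReal,
    fun B' hB' lam hlam => ?_⟩
  have hlam0 : 0 < lam := by linarith
  rw [ENNReal.coe_toNNReal hfin]
  have J0 : ∀ ξ (r : ℝ), 0 ≤ freqBr ξ ^ r := fun ξ r => Real.rpow_nonneg (freqBr_pos ξ).le r
  have Z0 : ∀ ξ σ, 0 ≤ zWeight s ξ σ := fun ξ σ => (Real.exp_pos _).le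
  have := bilinearBound_of_multiplier (X := fun k : ℤ => |(k : ℝ) / lam|)
    (Y := fun k => freqBr (k / lam) ^ (s + ρ)) (Y' := fun k => freqBr (k / lam) ^ (s + ρ))
    (W := fun k σ => freqBr (k / lam) ^ ρ * zWeight s (k / lam) σ)
    (V := fun k σ => freqBr (k / lam) ^ ρ * zWeight s (k / lam) σ)
    (C := 2 ^ ρ * C) (hΛ B' hB' lam hlam) (by positivity) (fun k => (lowCoeff_pos _).le)
    (fun k => abs_nonneg _) (by simp) (fun k => J0 _ _) (fun k σ => mul_nonneg (J0 _ _) (Z0 _ _))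
    (fun k σ => mul_nonneg (J0 _ _) (Z0 _ _)) (fun k k₁ => ind_nonneg _) (fun k k₁ => ind_nonneg _)
    (fun k k₁ => ind_nonneg _) (fun k => by fun_prop) (fun k => by fun_prop) ?_
  · rw [mul_assoc, mul_assoc, mul_assoc]
    exact this
  intro k k₁ hk hk₁ hk₂ σ t
  have e : ((k - k₁ : ℤ) : ℝ) / lam = k / lam - k₁ / lam := by push_cast; ring
  have ne : ∀ {n : ℤ}, n ≠ 0 → (n : ℝ) / lam ≠ 0 := fun hn =>
    div_ne_zero (by exact_mod_cast hn) hlam0.ne'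
  have n2 := ne hk₂
  rw [e] at n2
  have es : (k₁ : ℝ) / lam + (k / lam - k₁ / lam) = k / lam := by ring
  have est := h B' hB' (k₁ / lam) (k / lam - k₁ / lam) (by rw [es]; exact ne hk) (ne hk₁) n2 σ t
    (σ + latticeRes A B' lam k k₁ - t) (by rw [es, latticeRes]; ring)
  unfold MultiplierEstimate at est
  rw [es] at est
  rw [e]
  -- The ρ ≥ 0 additional derivatives pass to both inputs through ⟨ξ₁ + ξ₂⟩ ≤ 2⟨ξ₁⟩⟨ξ₂⟩. This
  -- reduces all s > -1 to s = -1.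
  have hJ : freqBr (k / lam) ^ ρ ≤
      2 ^ ρ * (freqBr (k₁ / lam) ^ ρ * freqBr (k / lam - k₁ / lam) ^ ρ) := by
    have h1 := freqBr_pos (k₁ / lam)
    have h2 := freqBr_pos (k / lam - k₁ / lam)
    rw [← Real.mul_rpow h1.le h2.le, ← Real.mul_rpow (by norm_num) (by positivity)]
    refine Real.rpow_le_rpow (freqBr_pos _).le ?_ hρ
    have := freqBr_add_le (k₁ / lam) (k / lam - k₁ / lam)
    rwa [es] at this
  have hsplit : ∀ ξ, freqBr ξ ^ (s + ρ) = freqBr ξ ^ ρ * freqBr ξ ^ s := fun ξ => by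
    rw [Real.rpow_add (freqBr_pos ξ), mul_comm]
  have S0 : ∀ τ (r : ℝ), 0 ≤ modBr τ ^ r := fun τ r => Real.rpow_nonneg (modBr_pos τ).le r
  have L0 : 0 ≤ lowSum (k / lam) (k₁ / lam) (k / lam - k₁ / lam) :=
    add_nonneg (add_nonneg (lowCoeff_pos _).le (lowCoeff_pos _).le) (lowCoeff_pos _).le
  simp_rw [hsplit]
  obtain ⟨e1, e2⟩ := est
  set J := freqBr (k / lam) ^ ρ
  set J₁ := freqBr (k₁ / lam) ^ ρ with hJ₁
  set J₂ := freqBr (k / lam - k₁ / lam) ^ ρ with hJ₂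
  have j0 : 0 ≤ J := J0 _ _
  have j1 : 0 ≤ J₁ := J0 _ _
  have j2 : 0 ≤ J₂ := J0 _ _
  have Z1 := Z0 (k₁ / lam) t
  have Z2 := Z0 (k / lam - k₁ / lam) (σ + latticeRes A B' lam k k₁ - t)
  have Y1 := J0 (k₁ / lam) s
  have Y2 := J0 (k / lam - k₁ / lam) s
  constructor
  · calc |(k : ℝ) / lam| * (J * zWeight s (k / lam) σ) / modBr σ
        = J * (|(k : ℝ) / lam| * zWeight s (k / lam) σ / modBr σ) := by ring
      _ ≤ (2 ^ ρ * (J₁ * J₂)) * (|(k : ℝ) / lam| * zWeight s (k / lam) σ / modBr σ) := by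
          gcongr
          exact div_nonneg (mul_nonneg (abs_nonneg _) (Z0 _ _)) (modBr_pos _).le
      _ ≤ (2 ^ ρ * (J₁ * J₂)) * _ := mul_le_mul_of_nonneg_left e1 (by positivity)
      _ = _ := by unfold multBound lowSum; ring
  · calc |(k : ℝ) / lam| * (J * freqBr (k / lam) ^ s) / modBr σ
        = J * (|(k : ℝ) / lam| * freqBr (k / lam) ^ s / modBr σ) := by ring
      _ ≤ J * _ := mul_le_mul_of_nonneg_left e2 j0
      _ = J * (C * multBoundL1 (lowSum (k / lam) (k₁ / lam) (k / lam - k₁ / lam))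
            (freqBr (k₁ / lam) ^ s) (freqBr (k / lam - k₁ / lam) ^ s) (zWeight s (k₁ / lam) t)
            (zWeight s (k / lam - k₁ / lam) (σ + latticeRes A B' lam k k₁ - t)) (modBr σ)) +
          modBr σ ^ (-(3 / 4) : ℝ) * (|(k : ℝ) / lam| * (J * zWeight s (k / lam) σ) / modBr σ) := by
          ring
      _ ≤ (2 ^ ρ * (J₁ * J₂)) * (C * multBoundL1 (lowSum (k / lam) (k₁ / lam) (k / lam - k₁ / lam))
            (freqBr (k₁ / lam) ^ s) (freqBr (k / lam - k₁ / lam) ^ s) (zWeight s (k₁ / lam) t)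
            (zWeight s (k / lam - k₁ / lam) (σ + latticeRes A B' lam k k₁ - t)) (modBr σ)) +
          modBr σ ^ (-(3 / 4) : ℝ) * (|(k : ℝ) / lam| * (J * zWeight s (k / lam) σ) / modBr σ) := by
          have : 0 ≤ C * multBoundL1 (lowSum (k / lam) (k₁ / lam) (k / lam - k₁ / lam))
            (freqBr (k₁ / lam) ^ s) (freqBr (k / lam - k₁ / lam) ^ s) (zWeight s (k₁ / lam) t)
            (zWeight s (k / lam - k₁ / lam) (σ + latticeRes A B' lam k k₁ - t)) (modBr σ) := by
            have := S0 σ (-(5 / 8))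
            have := S0 σ (-(5 / 4))
            unfold multBoundL1
            positivity
          gcongr
      _ = _ := by unfold multBoundL1 lowSum; ring

/-- The bilinear estimate from `X^{-1,1/2}` into the modified Bourgain space of order `-3/2`. -/
theorem exists_bilinearBound_half {A : ℝ} (hA : A ≠ 0) (B : ℝ) {lam : ℝ} (hlam : 1 ≤ lam) :
    ∃ C : ℝ≥0, ∀ B', |B'| ≤ |B| →
    BilinearBound (latticeRes A B' lam) (latticeAbs lam) (latticeHalf lam) (latticeBr (-1) lam)
      (latticeWeight (-(3 / 2)) 0 lam) (latticeBr (-(3 / 2)) lam) C := by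
  obtain ⟨Λ, hΛ⟩ := exists_admissible hA B
  obtain ⟨C, hC, h⟩ := exists_multiplierEstimate_half (B := B) hA (Real.log lam)
  have hfin : 2 * (ENNReal.ofReal C ^ 2 * ((bilinearConst + bilinearConstL1) *
      (Λ * ENNReal.ofReal lam))) ≠ ∞ := by
    have h1 := bilinearConst_lt_top
    have h2 := bilinearConstL1_lt_top
    finiteness
  refine ⟨(2 * (ENNReal.ofReal C ^ 2 * ((bilinearConst + bilinearConstL1) *
    (Λ * ENNReal.ofReal lam)))).toNNReal, fun B' hB' => ?_⟩
  have hlam0 : 0 < lam := by linarith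
  rw [ENNReal.coe_toNNReal hfin]
  have J0 : ∀ ξ (r : ℝ), 0 ≤ freqBr ξ ^ r := fun ξ r => Real.rpow_nonneg (freqBr_pos ξ).le r
  have := bilinearBound_of_multiplier (X := fun k : ℤ => |(k : ℝ) / lam|)
    (Y := fun k => freqBr (k / lam) ^ (-1 : ℝ)) (Y' := fun k => freqBr (k / lam) ^ (-(3 / 2) : ℝ))
    (W := fun k σ => halfWeight (k / lam) σ)
    (V := fun k σ => freqBr (k / lam) ^ (0 : ℝ) * zWeight (-(3 / 2)) (k / lam) σ)
    (C := C) (hΛ B' hB' lam hlam) hC.le (fun k => (lowCoeff_pos _).le)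
    (fun k => abs_nonneg _) (by simp) (fun k => J0 _ _) (fun k σ => (Real.exp_pos _).le)
    (fun k σ => mul_nonneg (J0 _ _) (Real.exp_pos _).le) (fun k k₁ => ind_nonneg _)
    (fun k k₁ => ind_nonneg _)
    (fun k k₁ => ind_nonneg _) (fun k => by fun_prop) (fun k => by fun_prop) ?_
  · exact this
  intro k k₁ hk hk₁ hk₂ σ t
  have e : ((k - k₁ : ℤ) : ℝ) / lam = k / lam - k₁ / lam := by push_cast; ring
  have ne : ∀ {n : ℤ}, n ≠ 0 → (n : ℝ) / lam ≠ 0 := fun hn =>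
    div_ne_zero (by exact_mod_cast hn) hlam0.ne'
  -- Nonzero lattice frequencies are at least 1/λ. The constant therefore depends on λ, which is
  -- harmless, since this estimate is only used to show that a norm is finite.
  have lo : ∀ {n : ℤ}, n ≠ 0 → -Real.log lam ≤ Real.log |(n : ℝ) / lam| := fun {n} hn => by
    rw [abs_div, abs_of_pos hlam0, Real.log_div (by simpa using hn) hlam0.ne']
    have : (1 : ℝ) ≤ |(n : ℝ)| := by exact_mod_cast Int.one_le_abs hn
    linarith [Real.log_nonneg this]
  have n2 := ne hk₂
  have l2 := lo hk₂
  rw [e] at n2 l2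
  have es : (k₁ : ℝ) / lam + (k / lam - k₁ / lam) = k / lam := by ring
  have est := h B' hB' (k₁ / lam) (k / lam - k₁ / lam) (by rw [es]; exact ne hk) (ne hk₁) n2
    (by rw [es]; exact lo hk) (lo hk₁) l2 σ t
    (σ + latticeRes A B' lam k k₁ - t) (by rw [es, latticeRes]; ring)
  unfold MultiplierEstimate at est
  rw [es] at est
  rw [e]
  simp only [Real.rpow_zero, one_mul]
  exact est

/-! ### A cutoff in time -/

/-- The oscillation `e^{itσ}`. -/
def osc (t σ : ℝ) : ℂ := Complex.exp (Complex.I * (t : ℂ) * (σ : ℂ))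

@[fun_prop] lemma continuous_osc : Continuous fun z : ℝ × ℝ => osc z.1 z.2 := by
  unfold osc; fun_prop

lemma norm_osc (t σ : ℝ) : ‖osc t σ‖ = 1 := by
  rw [osc, mul_assoc, ← Complex.ofReal_mul, mul_comm, Complex.norm_exp_ofReal_mul_I]

lemma osc_add (t σ σ' : ℝ) : osc t (σ + σ') = osc t σ * osc t σ' := by
  rw [osc, osc, osc, ← Complex.exp_add]; congr 1; push_cast; ring

lemma osc_zero (t : ℝ) : osc t 0 = 1 := by simp [osc]

lemma modBr_rpow_neg_two (σ : ℝ) : modBr σ ^ (-2 : ℝ) = (modBr σ ^ 2)⁻¹ := by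
  rw [Real.rpow_neg (modBr_pos σ).le, Real.rpow_two]

lemma schwartz_decay (f : SchwartzMap ℝ ℂ) (n : ℕ) :
    ∃ C : ℝ, 0 ≤ C ∧ ∀ x, ‖iteratedDeriv n f x‖ ≤ C * modBr x ^ (-2 : ℝ) := by
  refine ⟨2 ^ 2 * (Finset.Iic (2, n)).sup (fun m => SchwartzMap.seminorm ℝ m.1 m.2) f,
    mul_nonneg (by norm_num) (apply_nonneg _ _), fun x => ?_⟩
  have := SchwartzMap.one_add_le_sup_seminorm_apply (𝕜 := ℝ) (m := (2, n)) (k := 2) (n := n) le_rfl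
    le_rfl f x
  rw [norm_iteratedFDeriv_eq_norm_iteratedDeriv] at this
  rw [modBr_rpow_neg_two, ← div_eq_mul_inv, le_div_iff₀ (pow_pos (modBr_pos x) 2), mul_comm]
  exact this

/-- η is a suitably normalized Fourier transform of a bump function which equals 1 on [0,1]. The
Lipschitz bound for |σ'| ≤ 1 serves to divide η(σ - σ') - η(σ) by σ' later on. -/
theorem exists_cutoff : ∃ η : ℝ → ℂ, Continuous η ∧ Integrable η ∧ ∃ C : ℝ, 0 ≤ C ∧
    (∀ σ, ‖η σ‖ ≤ C * modBr σ ^ (-2 : ℝ)) ∧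
    (∀ σ σ', |σ'| ≤ 1 → ‖η (σ - σ') - η σ‖ ≤ C * |σ'| * modBr σ ^ (-2 : ℝ)) ∧
    ∀ t ∈ Icc (0 : ℝ) 1, ∫ σ, osc t σ * η σ = 1 := by
  let b : ContDiffBump (1 / 2 : ℝ) := ⟨1, 2, by norm_num, by norm_num⟩
  let ψ : ℝ → ℂ := fun t => (b t : ℂ)
  have hψs : HasCompactSupport ψ := b.hasCompactSupport.comp_left (g := Complex.ofReal) rfl
  have hψd : ContDiff ℝ ((⊤ : ℕ∞) : WithTop ℕ∞) ψ := Complex.ofRealCLM.contDiff.comp b.contDiff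
  let ψs : SchwartzMap ℝ ℂ := hψs.toSchwartzMap hψd
  let F : SchwartzMap ℝ ℂ := FourierTransform.fourier ψs
  have hπ : (2 * Real.pi) ≠ 0 := by positivity
  have hinv : ∀ t : ℝ, ∫ w : ℝ, Complex.exp (2 * Real.pi * Complex.I * (t * w : ℝ)) * F w = ψ t := by
    intro t
    have h : FourierTransformInv.fourierInv F = ψs := FourierTransform.fourierInv_fourier_eq ψs
    have h2 : (FourierTransformInv.fourierInv F : SchwartzMap ℝ ℂ) t = ψ t := by rw [h]; rfl
    rw [SchwartzMap.fourierInv_coe, Real.fourierInv_eq'] at h2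
    rw [← h2]
    congr 1 with w
    rw [smul_eq_mul]
    congr 2
    simp
    ring
  -- The dilation by 2π passes from the kernel e^{2πitw} to e^{itσ}.
  let L : ℝ ≃L[ℝ] ℝ := ContinuousLinearEquiv.smulLeft (Units.mk0 (2 * Real.pi)⁻¹ (inv_ne_zero hπ))
  let η : SchwartzMap ℝ ℂ := ((2 * Real.pi)⁻¹ : ℝ) • SchwartzMap.compCLMOfContinuousLinearEquiv ℝ L F
  have hη : ∀ σ, η σ = ((2 * Real.pi)⁻¹ : ℝ) * F (σ / (2 * Real.pi)) := fun σ => by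
    have : L σ = σ / (2 * Real.pi) := by
      show (2 * Real.pi)⁻¹ * σ = _
      ring
    simp only [η, smul_apply, SchwartzMap.compCLMOfContinuousLinearEquiv_apply,
      Function.comp_apply, this, Complex.real_smul]
  obtain ⟨C₀, hC₀, h0⟩ := schwartz_decay η 0
  obtain ⟨C₁, hC₁, h1⟩ := schwartz_decay η 1
  refine ⟨η, η.continuous, η.integrable, C₀ + 4 * C₁, by positivity, fun σ => ?_, fun σ σ' hσ' => ?_,
    fun t ht => ?_⟩
  · have := h0 σ
    rw [iteratedDeriv_zero] at this
    refine this.trans (mul_le_mul_of_nonneg_right (by linarith)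
      (Real.rpow_nonneg (modBr_pos σ).le _))
  · have hd : ∀ x ∈ Metric.closedBall σ 1, ‖deriv η x‖ ≤ 4 * C₁ * modBr σ ^ (-2 : ℝ) := by
      intro x hx
      have hx' : |x - σ| ≤ 1 := by simpa [Real.dist_eq] using hx
      have := h1 x
      rw [iteratedDeriv_one] at this
      refine this.trans ?_
      rw [mul_comm 4 C₁, mul_assoc]
      refine mul_le_mul_of_nonneg_left ?_ hC₁
      rw [modBr_rpow_neg_two, modBr_rpow_neg_two, ← div_eq_mul_inv,
        le_div_iff₀ (pow_pos (modBr_pos σ) 2), inv_mul_le_iff₀ (pow_pos (modBr_pos x) 2)]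
      have h3 : modBr σ ≤ 2 * modBr x := by
        unfold modBr
        have : |σ| ≤ |x| + |x - σ| := by
          have := abs_sub_abs_le_abs_sub σ x
          rw [abs_sub_comm] at this
          linarith
        linarith [abs_nonneg x]
      nlinarith [modBr_pos σ]
    have := (convex_closedBall σ 1).norm_image_sub_le_of_norm_deriv_le (f := η)
      (fun x _ => η.differentiableAt) hd (x := σ) (y := σ - σ') (by simp)
      (by simpa [Real.dist_eq] using hσ')
    refine this.trans ?_
    have e : ‖σ - σ' - σ‖ = |σ'| := by rw [Real.norm_eq_abs, sub_sub_cancel_left, abs_neg]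
    rw [e]
    have h4 : 0 ≤ |σ'| * modBr σ ^ (-2 : ℝ) :=
      mul_nonneg (abs_nonneg _) (Real.rpow_nonneg (modBr_pos σ).le _)
    nlinarith
  · have h5 := hinv t
    have h6 : ψ t = 1 := by
      have : b t = 1 := b.one_of_mem_closedBall (by
        rw [Metric.mem_closedBall, Real.dist_eq, abs_le]
        constructor <;> linarith [ht.1, ht.2])
      simp [ψ, this]
    rw [← h6, ← h5]
    have h7 := Measure.integral_comp_div
      (fun w : ℝ => Complex.exp (2 * Real.pi * Complex.I * (t * w : ℝ)) * F w) (2 * Real.pi)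
    rw [abs_of_pos (by positivity : 0 < 2 * Real.pi)] at h7
    have h8 : ∀ σ, osc t σ * η σ = ((2 * Real.pi)⁻¹ : ℝ) • (Complex.exp (2 * Real.pi * Complex.I *
        (t * (σ / (2 * Real.pi)) : ℝ)) * F (σ / (2 * Real.pi))) := fun σ => by
      rw [hη, osc, Complex.real_smul, mul_left_comm]
      congr 3
      have : (Real.pi : ℂ) ≠ 0 := by exact_mod_cast Real.pi_ne_zero
      push_cast
      field_simp
    simp_rw [h8]
    rw [integral_smul, h7, smul_smul, inv_mul_cancel₀ hπ, one_smul]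

/-! ### Slowly varying weights and convolution with the cutoff -/

section

/-- Weights of a single mode which vary slowly in the modulation. -/
structure GoodWeight (v : ℝ → ℝ≥0∞) (y : ℝ≥0∞) : Prop where
  meas : Measurable v
  slow : ∀ σ σ', v σ ≤ v σ' * modPow (3 / 4) (σ - σ')
  zero_le : v 0 ≤ y
  ne_zero : y ≠ 0
  ne_top : y ≠ ∞

lemma modPow_mul (a b σ : ℝ) : modPow a σ * modPow b σ = modPow (a + b) σ := by
  rw [modPow, modPow, modPow, ← ENNReal.ofReal_mul (Real.rpow_nonneg (modBr_pos σ).le _),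
    Real.rpow_add (modBr_pos σ)]

lemma GoodWeight.le {v : ℝ → ℝ≥0∞} {y : ℝ≥0∞} (h : GoodWeight v y) (σ : ℝ) :
    v σ ≤ y * modPow (3 / 4) σ := by
  have := h.slow σ 0
  rw [sub_zero] at this
  exact this.trans (by gcongr; exact h.zero_le)

lemma modeNorm_mono {v : ℝ → ℝ≥0∞} {y : ℝ≥0∞} {f g : ℝ → ℝ≥0∞} (h : ∀ᵐ σ, f σ ≤ g σ) :
    modeNorm v y f ≤ modeNorm v y g := by
  unfold modeNorm l2
  gcongr 1
  · refine ENNReal.rpow_le_rpow (lintegral_mono_ae ?_) (by norm_num)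
    filter_upwards [h] with σ hσ
    gcongr
  · gcongr 1
    exact lintegral_mono_ae h

/-- The mass of the bracket to the power `-5/4`, and its `L²` norm, and the mass of the bracket to
the power `-2`. -/
def tailConst : ℝ≥0∞ := l2 volume (modPow (-(5 / 4))) + ∫⁻ σ, modPow (-2) σ

/-- The constant for convolutions with the bracket to the power `-2`. -/
def convConst : ℝ≥0∞ := (∫⁻ σ, modPow (-(5 / 4)) σ) + ∫⁻ σ, modPow (-2) σ

lemma tailConst_lt_top : tailConst < ∞ := by
  refine ENNReal.add_lt_top.2 ⟨?_, lintegral_modPow_lt_top (by norm_num)⟩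
  refine ENNReal.rpow_lt_top_of_nonneg (by norm_num) ?_
  simp_rw [modPow_sq]
  exact (lintegral_modPow_lt_top (by norm_num)).ne

lemma convConst_lt_top : convConst < ∞ :=
  ENNReal.add_lt_top.2 ⟨lintegral_modPow_lt_top (by norm_num), lintegral_modPow_lt_top (by norm_num)⟩

section

variable {v : ℝ → ℝ≥0∞} {y : ℝ≥0∞}

/-- The weight grows at most like y⟨σ⟩^{3/4}, and ⟨σ⟩^{3/4 - 2} is still square integrable. -/
lemma modeNorm_tail_le (h : GoodWeight v y) (m : ℝ≥0∞) :
    modeNorm v y (fun σ => modPow (-2) σ * m) ≤ tailConst * (y * m) := by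
  unfold modeNorm tailConst
  rw [add_mul]
  refine add_le_add ?_ ?_
  · calc _ ≤ l2 volume fun σ => (y * m) * modPow (-(5 / 4)) σ := by
          refine l2_mono fun σ => ?_
          calc _ ≤ y * modPow (3 / 4) σ * (modPow (-2) σ * m) := by gcongr; exact h.le σ
            _ = y * m * (modPow (3 / 4) σ * modPow (-2) σ) := by ring
            _ = _ := by rw [modPow_mul]; norm_num
      _ = _ := by rw [l2_const_mul (by fun_prop), mul_comm]
  · rw [lintegral_mul_const _ (by fun_prop)]
    exact le_of_eq (by ring)

/-- Slow variation moves the weight from σ to s at the price of ⟨σ - s⟩^{3/4}. The kernel ⟨·⟩^{-5/4}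
that is left is integrable, and Young's inequality applies. -/
lemma modeNorm_conv_le (h : GoodWeight v y) {F : ℝ → ℝ≥0∞} (hF : Measurable F) :
    modeNorm v y (fun σ => ∫⁻ s, F s * modPow (-2) (σ - s)) ≤ convConst * modeNorm v y F := by
  have hv := h.meas
  unfold modeNorm convConst
  rw [add_mul, mul_add, mul_add]
  have h1 : l2 volume (fun σ => v σ * ∫⁻ s, F s * modPow (-2) (σ - s)) ≤
      (∫⁻ σ, modPow (-(5 / 4)) σ) * l2 volume fun s => v s * F s := by
    calc _ ≤ l2 volume fun σ => ∫⁻ s, (v s * F s) * modPow (-(5 / 4)) (σ + 0 - s) := by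
          refine l2_mono fun σ => ?_
          rw [← lintegral_const_mul _ (by fun_prop)]
          refine lintegral_mono fun s => ?_
          rw [add_zero]
          calc _ ≤ v s * modPow (3 / 4) (σ - s) * (F s * modPow (-2) (σ - s)) := by
                gcongr; exact h.slow σ s
            _ = v s * F s * (modPow (3 / 4) (σ - s) * modPow (-2) (σ - s)) := by ring
            _ = _ := by rw [modPow_mul]; norm_num
      _ ≤ _ := by
          rw [le_l2_iff]
          refine (lintegral_conv_sq_le (hv.mul hF) (measurable_modPow _) 0).trans_eq ?_
          rw [mul_pow, l2_sq, mul_comm]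
          rfl
  have h2 : y * ∫⁻ σ, ∫⁻ s, F s * modPow (-2) (σ - s) ≤ (∫⁻ σ, modPow (-2) σ) * (y * ∫⁻ s, F s) := by
    have := lintegral_conv F (modPow (-2)) hF (measurable_modPow _) 0
    simp_rw [add_zero] at this
    rw [this]
    exact le_of_eq (by ring)
  calc _ ≤ _ := add_le_add h1 h2
    _ ≤ _ := by
      gcongr
      · exact le_self_add
      · exact le_add_self

lemma modeNorm_add_le {f g : ℝ → ℝ≥0∞} (hv : Measurable v) (hf : Measurable f) (hg : Measurable g) :
    modeNorm v y (fun σ => f σ + g σ) ≤ modeNorm v y f + modeNorm v y g := by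
  unfold modeNorm
  simp_rw [mul_add]
  rw [lintegral_add_left hf, mul_add, add_add_add_comm]
  gcongr
  exact l2_add_le (hv.mul hf).aemeasurable (hv.mul hg).aemeasurable

lemma modeNorm_const_mul {f : ℝ → ℝ≥0∞} (hv : Measurable v) (hf : Measurable f) (c : ℝ≥0∞) :
    modeNorm v y (fun σ => c * f σ) = c * modeNorm v y f := by
  unfold modeNorm
  simp_rw [mul_left_comm (v _) c]
  rw [l2_const_mul (f := fun s => v s * f s) (hv.mul hf).aemeasurable, lintegral_const_mul _ hf]
  ring

end

/-! ### The Duhamel integral -/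

/-- The time integral of an oscillation. -/
def duhamelInt (t σ : ℝ) : ℂ := ∫ t' in (0 : ℝ)..t, osc t' σ

lemma duhamelInt_eq (t : ℝ) {σ : ℝ} (hσ : σ ≠ 0) :
    duhamelInt t σ = (osc t σ - 1) / (Complex.I * σ) := by
  have hc : Complex.I * σ ≠ 0 := mul_ne_zero Complex.I_ne_zero (by exact_mod_cast hσ)
  have := integral_exp_mul_complex (a := 0) (b := t) hc
  unfold duhamelInt osc
  rw [← show ∫ x in (0 : ℝ)..t, Complex.exp (Complex.I * σ * x) =
    ∫ x in (0 : ℝ)..t, Complex.exp (Complex.I * x * σ) by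
      congr 1 with x; congr 1; ring, this]
  simp [mul_right_comm]

lemma continuous_duhamelInt (t : ℝ) : Continuous (duhamelInt t) := by
  unfold duhamelInt
  refine intervalIntegral.continuous_parametric_intervalIntegral_of_continuous ?_ continuous_const
  unfold osc
  fun_prop

lemma norm_duhamelInt_le {t : ℝ} (ht : t ∈ Icc (0 : ℝ) 1) (σ : ℝ) :
    ‖duhamelInt t σ‖ ≤ 3 * (modBr σ)⁻¹ := by
  rw [← div_eq_mul_inv, le_div_iff₀ (modBr_pos σ), modBr, mul_add, mul_one]
  have h1 : ‖duhamelInt t σ‖ ≤ 1 := by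
    have := intervalIntegral.norm_integral_le_of_norm_le_const (a := 0) (b := t) (C := 1)
      (f := fun t' => osc t' σ) (fun x _ => (norm_osc x σ).le)
    rw [sub_zero, abs_of_nonneg ht.1] at this
    exact this.trans (by linarith [ht.2])
  have h2 : ‖duhamelInt t σ‖ * |σ| ≤ 2 := by
    rcases eq_or_ne σ 0 with rfl | hσ
    · simp
    rw [duhamelInt_eq t hσ, norm_div, norm_mul, Complex.norm_I, one_mul, Complex.norm_real,
      Real.norm_eq_abs, div_mul_cancel₀ _ (abs_ne_zero.2 hσ)]
    refine (norm_sub_le _ _).trans ?_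
    rw [norm_osc, norm_one]
    norm_num
  linarith

lemma integrable_osc_mul {g : ℝ → ℂ} (hg : Integrable g) (t : ℝ) :
    Integrable fun σ => osc t σ * g σ := by
  refine hg.bdd_mul (c := 1) ?_ ?_
  · exact (continuous_osc.comp (Continuous.prodMk_right t)).aestronglyMeasurable
  · exact ae_of_all _ fun σ => (norm_osc t σ).le

/-- The Duhamel integral of an oscillation, multiplied with a cutoff in time. -/
theorem exists_duhamelKernel : ∃ K : ℝ → ℝ → ℂ, Measurable (Function.uncurry K) ∧ ∃ C : ℝ≥0,
    (∀ σ σ', ‖K σ σ'‖ₑ ≤ C * (modPow (-1) σ' * (modPow (-2) (σ - σ') + modPow (-2) σ))) ∧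
    ∀ t ∈ Icc (0 : ℝ) 1, ∀ σ' ≠ 0, ∫ σ, osc t σ * K σ σ' = duhamelInt t σ' := by
  obtain ⟨η, hηc, hηi, C, hC, h1, h2, h3⟩ := exists_cutoff
  -- The time integral of e^{it'σ'} is (e^{itσ'} - 1)/(iσ'), and multiplication with the cutoff
  -- turns e^{itσ'} into η(σ - σ') and 1 into η(σ). The denominator is compensated by the Lipschitz
  -- bound for |σ'| ≤ 1; for |σ'| ≥ 1 it is the gain of one power.
  refine ⟨fun σ σ' => (η (σ - σ') - η σ) / (Complex.I * σ'), ?_, (2 * C).toNNReal,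
    fun σ σ' => ?_, fun t ht σ' hσ' => ?_⟩
  · have := hηc.measurable
    unfold Function.uncurry
    fun_prop
  · have p1 := Real.rpow_nonneg (modBr_pos (σ - σ')).le (-2)
    have p2 := Real.rpow_nonneg (modBr_pos σ).le (-2)
    have key : ‖(η (σ - σ') - η σ) / (Complex.I * σ')‖ ≤
        2 * C * (modBr σ' ^ (-1 : ℝ) * (modBr (σ - σ') ^ (-2 : ℝ) + modBr σ ^ (-2 : ℝ))) := by
      rw [norm_div, norm_mul, Complex.norm_I, one_mul, Complex.norm_real, Real.norm_eq_abs,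
        Real.rpow_neg_one]
      have m' := modBr_pos σ'
      rcases eq_or_ne σ' 0 with rfl | h0
      · rw [abs_zero, div_zero]
        positivity
      have hpos := abs_pos.2 h0
      rw [div_le_iff₀ hpos]
      have hm : |σ'| * (modBr σ')⁻¹ ≤ 1 := by
        rw [← div_eq_mul_inv, div_le_one m', modBr]; linarith
      rcases le_total |σ'| 1 with hs | hs
      · refine (h2 σ σ' hs).trans ?_
        have hm2 : 1 ≤ 2 * (modBr σ')⁻¹ := by
          rw [← div_eq_mul_inv, le_div_iff₀ m', modBr]; linarith
        calc C * |σ'| * modBr σ ^ (-2 : ℝ) = 1 * (C * |σ'| * modBr σ ^ (-2 : ℝ)) := by ring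
          _ ≤ 2 * (modBr σ')⁻¹ * (C * |σ'| * (modBr (σ - σ') ^ (-2 : ℝ) + modBr σ ^ (-2 : ℝ))) := by
              gcongr; linarith
          _ = _ := by ring
      · have hm2 : 1 ≤ 2 * (|σ'| * (modBr σ')⁻¹) := by
          rw [← div_eq_mul_inv, ← mul_div_assoc, le_div_iff₀ m', modBr]; linarith
        calc ‖η (σ - σ') - η σ‖ ≤ C * modBr (σ - σ') ^ (-2 : ℝ) + C * modBr σ ^ (-2 : ℝ) :=
              (norm_sub_le _ _).trans (add_le_add (h1 _) (h1 _))
          _ = 1 * (C * (modBr (σ - σ') ^ (-2 : ℝ) + modBr σ ^ (-2 : ℝ))) := by ring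
          _ ≤ 2 * (|σ'| * (modBr σ')⁻¹) *
              (C * (modBr (σ - σ') ^ (-2 : ℝ) + modBr σ ^ (-2 : ℝ))) := by gcongr
          _ = _ := by ring
    rw [← ofReal_norm, modPow, modPow, modPow, ← ENNReal.ofReal_add p1 p2,
      ← ENNReal.ofReal_mul (Real.rpow_nonneg (modBr_pos σ').le _)]
    show _ ≤ ENNReal.ofReal (2 * C) * _
    rw [← ENNReal.ofReal_mul (by positivity)]
    exact ENNReal.ofReal_le_ofReal key
  · have hi : Integrable fun σ => η (σ - σ') := hηi.comp_sub_right σ'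
    have e : ∀ σ, osc t σ * ((η (σ - σ') - η σ) / (Complex.I * σ')) =
        (osc t σ * η (σ - σ') - osc t σ * η σ) / (Complex.I * σ') := fun σ => by ring
    simp_rw [e]
    rw [integral_div, integral_sub (integrable_osc_mul hi t) (integrable_osc_mul hηi t), h3 t ht,
      duhamelInt_eq t hσ']
    congr 2
    have e2 : ∀ σ, osc t σ * η (σ - σ') = osc t σ' * (osc t (σ - σ') * η (σ - σ')) := fun σ => by
      rw [← mul_assoc, ← osc_add, add_sub_cancel]
    simp_rw [e2]
    rw [integral_const_mul, integral_sub_right_eq_self (fun σ => osc t σ * η σ), h3 t ht, mul_one]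

/-- The Duhamel integral of a mode, extended to the whole real line. -/
theorem exists_duhamelExtension : ∃ C : ℝ≥0, ∀ Q : ℝ → ℂ, Measurable Q →
    ∫⁻ σ, modPow (-1) σ * ‖Q σ‖ₑ ≠ ∞ → ∃ P : ℝ → ℂ, Measurable P ∧
      (∀ t ∈ Icc (0 : ℝ) 1, ∫ σ, osc t σ * P σ = ∫ σ, duhamelInt t σ * Q σ) ∧
      ∀ v y, GoodWeight v y →
        modeNorm v y (fun σ => ‖P σ‖ₑ) ≤ C * modeNorm v y (fun σ => modPow (-1) σ * ‖Q σ‖ₑ) := by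
  obtain ⟨K, hKm, C, hK, hKi⟩ := exists_duhamelKernel
  refine ⟨C * (convConst + tailConst).toNNReal, fun Q hQ hfin => ?_⟩
  set F : ℝ → ℝ≥0∞ := fun σ => modPow (-1) σ * ‖Q σ‖ₑ with hF
  have hFm : Measurable F := by simp only [hF]; fun_prop
  set P : ℝ → ℂ := fun σ => ∫ σ', K σ σ' * Q σ' with hP
  have hKQ : Measurable fun z : ℝ × ℝ => K z.1 z.2 * Q z.2 := hKm.mul (hQ.comp measurable_snd)
  have hPm : Measurable P := (hKQ.stronglyMeasurable.integral_prod_right).measurable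
  have bound : ∀ σ σ', ‖K σ σ' * Q σ'‖ₑ ≤
      C * (F σ' * modPow (-2) (σ - σ') + modPow (-2) σ * F σ') := fun σ σ' => by
    rw [enorm_mul]
    refine (mul_le_mul_left (hK σ σ') _).trans_eq ?_
    simp only [hF]
    ring
  have hPle : ∀ σ, ‖P σ‖ₑ ≤
      C * ((∫⁻ s, F s * modPow (-2) (σ - s)) + modPow (-2) σ * ∫⁻ s, F s) := fun σ => by
    refine (enorm_integral_le_lintegral_enorm _).trans ((lintegral_mono (bound σ)).trans_eq ?_)
    rw [lintegral_const_mul _ (by fun_prop), lintegral_add_left (by fun_prop),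
      lintegral_const_mul _ hFm]
  have hcm : Measurable fun σ => ∫⁻ s, F s * modPow (-2) (σ - s) :=
    Measurable.lintegral_prod_right (by fun_prop)
  refine ⟨P, hPm, fun t ht => ?_, fun v y hv => ?_⟩
  · have hint : Integrable (fun z : ℝ × ℝ => osc t z.1 * (K z.1 z.2 * Q z.2))
        (volume.prod volume) := by
      refine ⟨Measurable.aestronglyMeasurable (Measurable.mul ?_ hKQ), ?_⟩
      · exact (continuous_osc.measurable).comp (measurable_const.prodMk measurable_fst)
      · unfold HasFiniteIntegral
        rw [lintegral_prod _ (by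
          refine AEMeasurable.enorm (Measurable.aemeasurable (Measurable.mul ?_ hKQ))
          exact (continuous_osc.measurable).comp (measurable_const.prodMk measurable_fst))]
        calc _ ≤ ∫⁻ σ, C * ((∫⁻ s, F s * modPow (-2) (σ - s)) + modPow (-2) σ * ∫⁻ s, F s) := by
              refine lintegral_mono fun σ => ?_
              calc _ ≤ ∫⁻ σ', C * (F σ' * modPow (-2) (σ - σ') + modPow (-2) σ * F σ') := by
                    refine lintegral_mono fun σ' => ?_
                    show ‖osc t σ * (K σ σ' * Q σ')‖ₑ ≤ _
                    rw [enorm_mul, ← ofReal_norm (osc t σ), norm_osc, ENNReal.ofReal_one,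
                      one_mul]
                    exact bound σ σ'
                _ = _ := by
                    rw [lintegral_const_mul _ (by fun_prop), lintegral_add_left (by fun_prop),
                      lintegral_const_mul _ hFm]
          _ = C * ((∫⁻ s, F s) * (∫⁻ s, modPow (-2) s) +
                (∫⁻ s, modPow (-2) s) * ∫⁻ s, F s) := by
              rw [lintegral_const_mul _ (by fun_prop), lintegral_add_left hcm,
                lintegral_mul_const _ (by fun_prop)]
              have := lintegral_conv F (modPow (-2)) hFm (measurable_modPow _) 0
              simp_rw [add_zero] at this
              rw [this]
          _ < ∞ := by
              have := (lintegral_modPow_lt_top (show (-2 : ℝ) < -1 by norm_num)).ne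
              finiteness
    have e1 : ∀ σ, osc t σ * P σ = ∫ σ', osc t σ * (K σ σ' * Q σ') := fun σ => by
      rw [integral_const_mul]
    simp_rw [e1]
    rw [integral_integral_swap hint]
    refine integral_congr_ae ?_
    have h0 : ∀ᵐ σ' : ℝ, σ' ≠ 0 := by simp [ae_iff, measure_singleton]
    filter_upwards [h0] with σ' hσ'
    simp_rw [← mul_assoc]
    rw [integral_mul_const, hKi t ht σ' hσ']
  · calc _ ≤ modeNorm v y fun σ =>
          C * ((∫⁻ s, F s * modPow (-2) (σ - s)) + modPow (-2) σ * ∫⁻ s, F s) :=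
          modeNorm_mono (ae_of_all _ hPle)
      _ ≤ C * (convConst * modeNorm v y F + tailConst * (y * ∫⁻ s, F s)) := by
          rw [modeNorm_const_mul hv.meas (by fun_prop)]
          gcongr
          refine (modeNorm_add_le hv.meas hcm (by fun_prop)).trans ?_
          gcongr
          · exact modeNorm_conv_le hv hFm
          · exact modeNorm_tail_le hv _
      _ ≤ C * (convConst * modeNorm v y F + tailConst * modeNorm v y F) := by
          gcongr
          exact mul_lintegral_le_modeNorm _ _ _
      _ = _ := by
          rw [ENNReal.coe_mul, ENNReal.coe_toNNReal (ENNReal.add_lt_top.2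
            ⟨convConst_lt_top, tailConst_lt_top⟩).ne]
          ring

end

section

/-! ### The restriction norm on the unit interval -/

/-- The norm of a sequence of Fourier modes. -/
def seqNorm (v : ℤ → ℝ → ℝ≥0∞) (y : ℤ → ℝ≥0∞) (f : ℤ → ℝ → ℝ≥0∞) : ℝ≥0∞ :=
  sqNorm v y f ^ (1 / 2 : ℝ)

/-- The modes `g` represent the function `a` on the unit interval. -/
structure IsProfile (a : ℝ → ℤ → ℂ) (g : ℤ → ℝ → ℂ) : Prop where
  meas : ∀ k, Measurable (g k)
  zero : g 0 = 0
  eq : ∀ t ∈ Icc (0 : ℝ) 1, ∀ k, a t k = ∫ σ, osc t σ * g k σ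

/-- The infimum of the norms of all representations on the unit interval. -/
def profNorm (v : ℤ → ℝ → ℝ≥0∞) (y : ℤ → ℝ≥0∞) (a : ℝ → ℤ → ℂ) : ℝ≥0∞ :=
  ⨅ (g : ℤ → ℝ → ℂ) (_ : IsProfile a g), seqNorm v y fun k σ => ‖g k σ‖ₑ

variable {v : ℤ → ℝ → ℝ≥0∞} {y : ℤ → ℝ≥0∞}

lemma seqNorm_sq (f : ℤ → ℝ → ℝ≥0∞) : seqNorm v y f ^ 2 = sqNorm v y f := by
  rw [seqNorm, ← ENNReal.rpow_natCast, ← ENNReal.rpow_mul]; norm_num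

lemma seqNorm_le_iff {f : ℤ → ℝ → ℝ≥0∞} {c : ℝ≥0∞} : seqNorm v y f ≤ c ↔ sqNorm v y f ≤ c ^ 2 := by
  rw [seqNorm, one_div, ENNReal.rpow_inv_le_iff two_pos, ENNReal.rpow_two]

lemma seqNorm_eq_l2 (f : ℤ → ℝ → ℝ≥0∞) :
    seqNorm v y f = l2 Measure.count fun k => modeNorm (v k) (y k) (f k) := by
  rw [seqNorm, sqNorm, l2, lintegral_count' measurable_from_top]

lemma modeNorm_le_seqNorm (f : ℤ → ℝ → ℝ≥0∞) (k : ℤ) :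
    modeNorm (v k) (y k) (f k) ≤ seqNorm v y f := by
  have : modeNorm (v k) (y k) (f k) ^ 2 ≤ seqNorm v y f ^ 2 := by
    rw [seqNorm_sq]
    exact ENNReal.le_tsum (f := fun k => modeNorm (v k) (y k) (f k) ^ 2) k
  exact (ENNReal.pow_le_pow_left_iff two_ne_zero).1 this

lemma seqNorm_mono {f g : ℤ → ℝ → ℝ≥0∞}
    (h : ∀ k, modeNorm (v k) (y k) (f k) ≤ modeNorm (v k) (y k) (g k)) :
    seqNorm v y f ≤ seqNorm v y g := by
  unfold seqNorm sqNorm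
  gcongr with k
  exact h k

lemma modeNorm_tsum_le {ι : Type*} [Countable ι] {v : ℝ → ℝ≥0∞} {y : ℝ≥0∞} {f : ι → ℝ → ℝ≥0∞}
    (hv : Measurable v) (hf : ∀ n, Measurable (f n)) :
    modeNorm v y (fun σ => ∑' n, f n σ) ≤ ∑' n, modeNorm v y (f n) := by
  unfold modeNorm
  rw [ENNReal.tsum_add, lintegral_tsum fun n => (hf n).aemeasurable, ENNReal.tsum_mul_left]
  gcongr
  simp_rw [← ENNReal.tsum_mul_left]
  exact l2_tsum_le fun n => (hv.mul (hf n)).aemeasurable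

lemma seqNorm_tsum_le {ι : Type*} [Countable ι] {f : ι → ℤ → ℝ → ℝ≥0∞}
    (hv : ∀ k, Measurable (v k)) (hf : ∀ n k, Measurable (f n k)) :
    seqNorm v y (fun k σ => ∑' n, f n k σ) ≤ ∑' n, seqNorm v y (f n) := by
  simp_rw [seqNorm_eq_l2]
  refine (l2_mono fun k => modeNorm_tsum_le (hv k) fun n => hf n k).trans ?_
  exact l2_tsum_le fun n => measurable_from_top.aemeasurable

lemma seqNorm_add_le {f g : ℤ → ℝ → ℝ≥0∞} (hv : ∀ k, Measurable (v k))
    (hf : ∀ k, Measurable (f k)) (hg : ∀ k, Measurable (g k)) :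
    seqNorm v y (fun k σ => f k σ + g k σ) ≤ seqNorm v y f + seqNorm v y g := by
  simp_rw [seqNorm_eq_l2]
  refine (l2_mono fun k => modeNorm_add_le (hv k) (hf k) (hg k)).trans ?_
  exact l2_add_le measurable_from_top.aemeasurable measurable_from_top.aemeasurable

lemma seqNorm_const_mul {f : ℤ → ℝ → ℝ≥0∞} (hv : ∀ k, Measurable (v k))
    (hf : ∀ k, Measurable (f k)) (c : ℝ≥0∞) :
    seqNorm v y (fun k σ => c * f k σ) = c * seqNorm v y f := by
  simp_rw [seqNorm_eq_l2, modeNorm_const_mul (hv _) (hf _)]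
  exact l2_const_mul measurable_from_top.aemeasurable c

lemma mul_lintegral_le_seqNorm (f : ℤ → ℝ → ℝ≥0∞) (k : ℤ) :
    y k * ∫⁻ σ, f k σ ≤ seqNorm v y f :=
  (mul_lintegral_le_modeNorm _ _ _).trans (modeNorm_le_seqNorm f k)

lemma lintegral_lt_top_of_seqNorm (hvy : ∀ k, GoodWeight (v k) (y k)) {f : ℤ → ℝ → ℝ≥0∞}
    (hf : seqNorm v y f < ∞) (k : ℤ) : ∫⁻ σ, f k σ < ∞ := by
  refine lt_top_iff_ne_top.2 fun h => ?_
  have := (mul_lintegral_le_seqNorm (v := v) (y := y) f k).trans_lt hf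
  rw [h, ENNReal.mul_top (hvy k).ne_zero] at this
  exact lt_irrefl _ this

lemma integrable_of_seqNorm (hvy : ∀ k, GoodWeight (v k) (y k)) {g : ℤ → ℝ → ℂ}
    (hm : ∀ k, Measurable (g k)) (hg : seqNorm v y (fun k σ => ‖g k σ‖ₑ) < ∞) (k : ℤ) :
    Integrable (g k) :=
  ⟨(hm k).aestronglyMeasurable, lintegral_lt_top_of_seqNorm hvy hg k⟩

lemma exists_profile_lt {a : ℝ → ℤ → ℂ} {x : ℝ≥0∞} (h : profNorm v y a < x) :
    ∃ g, IsProfile a g ∧ seqNorm v y (fun k σ => ‖g k σ‖ₑ) < x := by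
  unfold profNorm at h
  simp only [iInf_lt_iff] at h
  obtain ⟨g, hg, h⟩ := h
  exact ⟨g, hg, h⟩

lemma profNorm_le {a : ℝ → ℤ → ℂ} {g : ℤ → ℝ → ℂ} (h : IsProfile a g) :
    profNorm v y a ≤ seqNorm v y (fun k σ => ‖g k σ‖ₑ) := iInf₂_le g h

lemma IsProfile.congr {a b : ℝ → ℤ → ℂ} {g : ℤ → ℝ → ℂ} (h : IsProfile a g)
    (hab : ∀ t ∈ Icc (0 : ℝ) 1, b t = a t) : IsProfile b g :=
  ⟨h.meas, h.zero, fun t ht k => by rw [hab t ht, h.eq t ht k]⟩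

lemma profNorm_congr {a b : ℝ → ℤ → ℂ} (hab : ∀ t ∈ Icc (0 : ℝ) 1, a t = b t) :
    profNorm v y a = profNorm v y b :=
  le_antisymm (le_iInf₂ fun _ hg => profNorm_le (hg.congr hab))
    (le_iInf₂ fun _ hg => profNorm_le (hg.congr fun t ht => (hab t ht).symm))

lemma enorm_osc_mul (t σ : ℝ) (z : ℂ) : ‖osc t σ * z‖ₑ = ‖z‖ₑ := by
  rw [enorm_mul, ← ofReal_norm (osc t σ), norm_osc, ENNReal.ofReal_one, one_mul]

lemma IsProfile.enorm_le {a : ℝ → ℤ → ℂ} {g : ℤ → ℝ → ℂ} (h : IsProfile a g) {t : ℝ}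
    (ht : t ∈ Icc (0 : ℝ) 1) (k : ℤ) : ‖a t k‖ₑ ≤ ∫⁻ σ, ‖g k σ‖ₑ := by
  rw [h.eq t ht k]
  refine (enorm_integral_le_lintegral_enorm _).trans_eq ?_
  simp_rw [enorm_osc_mul]

/-- The L¹ part of the norm controls every Fourier coefficient at every time. All later
identifications of functions at individual times rest on this bound. -/
lemma mul_enorm_le_profNorm (a : ℝ → ℤ → ℂ) {t : ℝ} (ht : t ∈ Icc (0 : ℝ) 1) (k : ℤ) :
    y k * ‖a t k‖ₑ ≤ profNorm v y a :=
  le_iInf₂ fun g hg => le_trans (by gcongr; exact hg.enorm_le ht k)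
    (mul_lintegral_le_seqNorm (fun k σ => ‖g k σ‖ₑ) k)

lemma eq_zero_of_profNorm (hvy : ∀ k, GoodWeight (v k) (y k)) {a : ℝ → ℤ → ℂ}
    (h : profNorm v y a = 0) {t : ℝ} (ht : t ∈ Icc (0 : ℝ) 1) : a t = 0 := by
  ext k
  have := mul_enorm_le_profNorm (v := v) (y := y) a ht k
  rw [h, nonpos_iff_eq_zero, mul_eq_zero] at this
  simpa using this.resolve_left (hvy k).ne_zero

lemma profNorm_zero : profNorm v y 0 = 0 := by
  have : IsProfile 0 0 := ⟨fun k => measurable_const, rfl, fun t _ k => by simp⟩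
  refine le_antisymm ((profNorm_le this).trans_eq ?_) bot_le
  simp [seqNorm, sqNorm, modeNorm, l2]

lemma profNorm_neg (a : ℝ → ℤ → ℂ) : profNorm v y (-a) = profNorm v y a := by
  have key : ∀ a : ℝ → ℤ → ℂ, profNorm v y (-a) ≤ profNorm v y a := fun a =>
    le_iInf₂ fun g hg => by
      have : IsProfile (-a) (-g) := ⟨fun k => (hg.meas k).neg, by
        rw [Pi.neg_apply, hg.zero, neg_zero], fun t ht k => by
          simp only [Pi.neg_apply, hg.eq t ht k, mul_neg, integral_neg]⟩
      refine (profNorm_le this).trans_eq ?_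
      simp
  exact le_antisymm (key a) (by simpa using key (-a))

lemma profNorm_add_le (hvy : ∀ k, GoodWeight (v k) (y k)) (a b : ℝ → ℤ → ℂ) :
    profNorm v y (a + b) ≤ profNorm v y a + profNorm v y b := by
  rcases eq_or_ne (profNorm v y a) ∞ with ha | ha
  · simp [ha]
  rcases eq_or_ne (profNorm v y b) ∞ with hb | hb
  · simp [hb]
  refine ENNReal.le_of_forall_pos_le_add fun ε hε _ => ?_
  have hε2 : (ε / 2 : ℝ≥0∞) ≠ 0 := by simpa using hε.ne'
  obtain ⟨g, hg, hg'⟩ := exists_profile_lt (ENNReal.lt_add_right ha hε2)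
  obtain ⟨h, hh, hh'⟩ := exists_profile_lt (ENNReal.lt_add_right hb hε2)
  have ig := integrable_of_seqNorm hvy hg.meas (hg'.trans_le le_top)
  have ih := integrable_of_seqNorm hvy hh.meas (hh'.trans_le le_top)
  have p : IsProfile (a + b) (g + h) := ⟨fun k => (hg.meas k).add (hh.meas k), by
    rw [Pi.add_apply, hg.zero, hh.zero, add_zero], fun t ht k => by
      simp only [Pi.add_apply, mul_add]
      rw [integral_add (integrable_osc_mul (ig k) t) (integrable_osc_mul (ih k) t), hg.eq t ht k,
        hh.eq t ht k]⟩
  calc _ ≤ seqNorm v y fun k σ => ‖(g + h) k σ‖ₑ := profNorm_le p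
    _ ≤ seqNorm v y fun k σ => ‖g k σ‖ₑ + ‖h k σ‖ₑ := seqNorm_mono fun k =>
        modeNorm_mono (ae_of_all _ fun σ => enorm_add_le _ _)
    _ ≤ _ := seqNorm_add_le (fun k => (hvy k).meas) (fun k => (hg.meas k).enorm)
        fun k => (hh.meas k).enorm
    _ ≤ (profNorm v y a + ε / 2) + (profNorm v y b + ε / 2) := add_le_add hg'.le hh'.le
    _ = _ := by rw [add_add_add_comm, ENNReal.add_halves]

lemma profNorm_sub_le (hvy : ∀ k, GoodWeight (v k) (y k)) (a b : ℝ → ℤ → ℂ) :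
    profNorm v y (a - b) ≤ profNorm v y a + profNorm v y b := by
  rw [sub_eq_add_neg, ← profNorm_neg b]
  exact profNorm_add_le hvy _ _

lemma summable_of_tsum_profNorm (hvy : ∀ k, GoodWeight (v k) (y k)) {a : ℕ → ℝ → ℤ → ℂ}
    (h : ∑' n, profNorm v y (a n) < ∞) {t : ℝ} (ht : t ∈ Icc (0 : ℝ) 1) (k : ℤ) :
    Summable fun n => a n t k := by
  have h1 : ∑' n, ‖a n t k‖ₑ ≠ ∞ := fun h2 => by
    have h3 : y k * ∑' n, ‖a n t k‖ₑ ≤ ∑' n, profNorm v y (a n) := by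
      rw [← ENNReal.tsum_mul_left]
      exact ENNReal.tsum_le_tsum fun n => mul_enorm_le_profNorm (a n) ht k
    rw [h2, ENNReal.mul_top (hvy k).ne_zero] at h3
    exact (h3.trans_lt h).ne rfl
  refine Summable.of_nnnorm ?_
  rwa [← ENNReal.tsum_coe_ne_top_iff_summable]

/-- Almost optimal representations, with errors that sum to ε, are added up. This countable
subadditivity is the form of completeness used in the fixed point argument. -/
lemma profNorm_tsum_le (hvy : ∀ k, GoodWeight (v k) (y k)) {a : ℕ → ℝ → ℤ → ℂ}
    (h : ∑' n, profNorm v y (a n) < ∞) :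
    profNorm v y (fun t k => ∑' n, a n t k) ≤ ∑' n, profNorm v y (a n) := by
  refine ENNReal.le_of_forall_pos_le_add fun ε hε _ => ?_
  obtain ⟨δ, hδ, hδs⟩ := ENNReal.exists_pos_sum_of_countable
    (ENNReal.coe_ne_zero.2 hε.ne') ℕ
  have hR : ∀ n, profNorm v y (a n) ≠ ∞ := fun n => ((ENNReal.le_tsum n).trans_lt h).ne
  have hex : ∀ n, ∃ g, IsProfile (a n) g ∧
      seqNorm v y (fun k σ => ‖g k σ‖ₑ) < profNorm v y (a n) + δ n := fun n =>
    exists_profile_lt (ENNReal.lt_add_right (hR n) (ENNReal.coe_ne_zero.2 (hδ n).ne'))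
  choose g hg hgn using hex
  have hsum : ∑' n, seqNorm v y (fun k σ => ‖g n k σ‖ₑ) ≤ ∑' n, profNorm v y (a n) + ε := by
    calc _ ≤ ∑' n, (profNorm v y (a n) + δ n) := ENNReal.tsum_le_tsum fun n => (hgn n).le
      _ ≤ _ := by rw [ENNReal.tsum_add]; gcongr
  have htot : seqNorm v y (fun k σ => ∑' n, ‖g n k σ‖ₑ) ≤ ∑' n, profNorm v y (a n) + ε :=
    (seqNorm_tsum_le (fun k => (hvy k).meas) fun n k => ((hg n).meas k).enorm).trans hsum
  have hfin : seqNorm v y (fun k σ => ∑' n, ‖g n k σ‖ₑ) < ∞ := htot.trans_lt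
    (ENNReal.add_lt_top.2 ⟨h, ENNReal.coe_lt_top⟩)
  have hint := lintegral_lt_top_of_seqNorm hvy hfin
  have hint' : ∀ k, ∑' n, ∫⁻ σ, ‖g n k σ‖ₑ < ∞ := fun k => by
    rw [← lintegral_tsum fun n => ((hg n).meas k).enorm.aemeasurable]
    exact hint k
  have ig : ∀ n k, Integrable (g n k) := fun n k =>
    ⟨((hg n).meas k).aestronglyMeasurable, (ENNReal.le_tsum n).trans_lt (hint' k)⟩
  have hae : ∀ k, ∀ᵐ σ, Summable fun n => g n k σ := fun k => by
    have := ae_lt_top (Measurable.tsum fun n => ((hg n).meas k).enorm) (hint k).ne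
    filter_upwards [this] with σ hσ
    refine Summable.of_nnnorm ?_
    rw [← ENNReal.tsum_coe_ne_top_iff_summable]
    exact hσ.ne
  have hGm : ∀ k, AEMeasurable fun σ => ∑' n, g n k σ := fun k => by
    refine aemeasurable_of_tendsto_metrizable_ae atTop
      (f := fun N σ => ∑ n ∈ Finset.range N, g n k σ)
      (fun N => (Finset.measurable_fun_sum _ fun n _ => (hg n).meas k).aemeasurable) ?_
    filter_upwards [hae k] with σ hσ
    exact hσ.hasSum.tendsto_sum_nat
  -- The series of modes is only a.e. measurable, so a measurable version is chosen; the mode k = 0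
  -- is set to zero by hand, since a version need not vanish everywhere.
  have p : IsProfile (fun t k => ∑' n, a n t k) fun k => if k = 0 then 0 else (hGm k).mk _ := by
    refine ⟨fun k => ?_, if_pos rfl, fun t ht k => ?_⟩
    · split_ifs
      · exact measurable_const
      · exact (hGm k).measurable_mk
    · have e : ∀ n, a n t k = ∫ σ, osc t σ * g n k σ := fun n => (hg n).eq t ht k
      simp_rw [e]
      split_ifs with hk
      · subst hk
        simp [(hg _).zero]
      · rw [← integral_tsum (fun n => (integrable_osc_mul (ig n k) t).1) (by
          simp_rw [enorm_osc_mul]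
          exact (hint' k).ne)]
        refine integral_congr_ae ?_
        filter_upwards [(hGm k).ae_eq_mk] with σ hσ
        rw [← hσ, tsum_mul_left]
  refine ((profNorm_le p).trans (seqNorm_mono fun k => modeNorm_mono ?_)).trans htot
  filter_upwards [(hGm k).ae_eq_mk, hae k] with σ hσ hs
  split_ifs with hk
  · simp
  · rw [← hσ]
    exact enorm_tsum_le_tsum_enorm

/-- The weighted norm of the initial data. -/
def dataNorm (y : ℤ → ℝ≥0∞) (a : ℤ → ℂ) : ℝ≥0∞ := (∑' k, (y k * ‖a k‖ₑ) ^ 2) ^ (1 / 2 : ℝ)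

/-- The profile of a free solution is constant in time, and on the unit interval it is represented
by the modes a k · η. -/
theorem exists_profNorm_const_le : ∃ C : ℝ≥0, ∀ v y, (∀ k, GoodWeight (v k) (y k)) →
    ∀ a : ℤ → ℂ, a 0 = 0 → profNorm v y (fun _ => a) ≤ C * dataNorm y a := by
  obtain ⟨η, hηc, hηi, C, hC, h1, -, h3⟩ := exists_cutoff
  refine ⟨(tailConst * ENNReal.ofReal C).toNNReal, fun v y hvy a ha => ?_⟩
  have hfin : tailConst * ENNReal.ofReal C ≠ ∞ := by have := tailConst_lt_top; finiteness
  rw [ENNReal.coe_toNNReal hfin]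
  have p : IsProfile (fun _ => a) fun k σ => a k * η σ := ⟨fun k => by
    have := hηc.measurable; fun_prop, by ext; simp [ha], fun t ht k => by
      simp_rw [mul_left_comm _ (a k)]
      rw [integral_const_mul, h3 t ht, mul_one]⟩
  refine (profNorm_le p).trans ?_
  rw [seqNorm_le_iff, mul_pow, dataNorm, ← ENNReal.rpow_natCast ((_ : ℝ≥0∞) ^ (1 / 2 : ℝ)),
    ← ENNReal.rpow_mul]
  norm_num
  rw [← ENNReal.tsum_mul_left]
  refine ENNReal.tsum_le_tsum fun k => ?_
  rw [← mul_pow]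
  gcongr
  calc _ ≤ modeNorm (v k) (y k) fun σ => modPow (-2) σ * (ENNReal.ofReal C * ‖a k‖ₑ) := by
        refine modeNorm_mono (ae_of_all _ fun σ => ?_)
        show ‖a k‖ₑ * ‖η σ‖ₑ ≤ _
        rw [mul_comm, ← mul_assoc]
        gcongr
        rw [← ofReal_norm, modPow, mul_comm, ← ENNReal.ofReal_mul hC]
        exact ENNReal.ofReal_le_ofReal (h1 σ)
    _ ≤ _ := modeNorm_tail_le (hvy k) _
    _ = _ := by ring

end

section

/-! ### The bilinear Duhamel operator -/

/-- The contribution of a pair of frequencies to the Duhamel integral of the profiles. -/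
def duhamelTerm (Φ : ℤ → ℤ → ℝ) (a b : ℝ → ℤ → ℂ) (t : ℝ) (k k₁ : ℤ) : ℂ :=
  ∫ t' in (0 : ℝ)..t, osc t' (-Φ k k₁) * (a t' k₁ * b t' (k - k₁))

/-- The bilinear Duhamel operator for profiles. -/
def duhamelOp (Φ : ℤ → ℤ → ℝ) (c : ℤ → ℂ) (a b : ℝ → ℤ → ℂ) (t : ℝ) (k : ℤ) : ℂ :=
  c k * ∑' k₁, duhamelTerm Φ a b t k k₁

/-- The interaction of two modes. -/
def modeConv (φ : ℝ) (g h : ℝ → ℂ) (σ : ℝ) : ℂ := ∫ s, g s * h (σ + φ - s)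

lemma measurable_modeConv {φ : ℝ} {g h : ℝ → ℂ} (hg : Measurable g) (hh : Measurable h) :
    Measurable (modeConv φ g h) := by
  have : Measurable fun z : ℝ × ℝ => g z.2 * h (z.1 + φ - z.2) := by fun_prop
  exact (this.stronglyMeasurable.integral_prod_right).measurable

lemma enorm_modeConv_le (φ : ℝ) (g h : ℝ → ℂ) (σ : ℝ) :
    ‖modeConv φ g h σ‖ₑ ≤ ∫⁻ s, ‖g s‖ₑ * ‖h (σ + φ - s)‖ₑ := by
  refine (enorm_integral_le_lintegral_enorm _).trans_eq ?_
  simp_rw [enorm_mul]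

lemma integrable_modeConv {φ : ℝ} {g h : ℝ → ℂ} (hg : Measurable g) (hh : Measurable h)
    (ig : Integrable g) (ih : Integrable h) : Integrable (modeConv φ g h) := by
  refine ⟨(measurable_modeConv hg hh).aestronglyMeasurable, ?_⟩
  refine (lintegral_mono (enorm_modeConv_le φ g h)).trans_lt ?_
  rw [lintegral_conv (fun s => ‖g s‖ₑ) (fun s => ‖h s‖ₑ) hg.enorm hh.enorm φ]
  exact ENNReal.mul_lt_top ig.2 ih.2

/-- The convolution theorem; the shift by φ in the modulation becomes the oscillation e^{-itφ}. -/
lemma integral_osc_mul_modeConv {φ : ℝ} {g h : ℝ → ℂ} (ig : Integrable g) (ih : Integrable h)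
    (t : ℝ) : ∫ σ, osc t σ * modeConv φ g h σ =
      osc t (-φ) * ((∫ σ, osc t σ * g σ) * ∫ σ, osc t σ * h σ) := by
  have e : ∀ σ, osc t σ * modeConv φ g h σ = osc t (-φ) *
      convolution (fun s => osc t s * g s) (fun s => osc t s * h s)
        (ContinuousLinearMap.mul ℝ ℂ) volume (σ + φ) := fun σ => by
    rw [modeConv, convolution, ← integral_const_mul, ← integral_const_mul]
    congr 1 with s
    rw [ContinuousLinearMap.mul_apply']
    have : osc t σ = osc t (-φ) * (osc t s * osc t (σ + φ - s)) := by
      rw [← osc_add, ← osc_add]; congr 1; ring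
    rw [this]
    ring
  simp_rw [e]
  rw [integral_const_mul, integral_add_right_eq_self (μ := volume)
    (convolution (fun s => osc t s * g s) (fun s => osc t s * h s)
        (ContinuousLinearMap.mul ℝ ℂ) volume) φ,
    integral_convolution _ (integrable_osc_mul ig t) (integrable_osc_mul ih t)]
  rfl

lemma integral_integral_osc {q : ℝ → ℂ} (hq : Integrable q) {t : ℝ} (ht : 0 ≤ t) :
    ∫ t' in (0 : ℝ)..t, ∫ σ, osc t' σ * q σ = ∫ σ, duhamelInt t σ * q σ := by
  rw [intervalIntegral.integral_of_le ht, integral_integral_swap]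
  · congr 1 with σ
    rw [integral_mul_const, duhamelInt, intervalIntegral.integral_of_le ht]
  · have := hq.comp_snd (volume.restrict (Ioc 0 t))
    refine this.bdd_mul (c := 1) continuous_osc.aestronglyMeasurable ?_
    exact ae_of_all _ fun z => (norm_osc _ _).le

lemma duhamelTerm_eq {Φ : ℤ → ℤ → ℝ} {a b : ℝ → ℤ → ℂ} {g h : ℤ → ℝ → ℂ} (hg : IsProfile a g)
    (hh : IsProfile b h) (ig : ∀ k, Integrable (g k)) (ih : ∀ k, Integrable (h k)) {t : ℝ}
    (ht : t ∈ Icc (0 : ℝ) 1) (k k₁ : ℤ) :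
    duhamelTerm Φ a b t k k₁ =
      ∫ σ, duhamelInt t σ * modeConv (Φ k k₁) (g k₁) (h (k - k₁)) σ := by
  rw [← integral_integral_osc (integrable_modeConv (hg.meas _) (hh.meas _) (ig _) (ih _)) ht.1]
  refine intervalIntegral.integral_congr fun t' ht' => ?_
  rw [uIcc_of_le ht.1] at ht'
  have ht'' : t' ∈ Icc (0 : ℝ) 1 := ⟨ht'.1, ht'.2.trans ht.2⟩
  show osc t' (-Φ k k₁) * (a t' k₁ * b t' (k - k₁)) = _
  rw [integral_osc_mul_modeConv (ig _) (ih _), hg.eq t' ht'', hh.eq t' ht'']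

/-- The sum of the interactions into a single mode. -/
theorem exists_duhamelSum : ∃ C : ℝ≥0, ∀ (Φ : ℤ → ℤ → ℝ) (a b : ℝ → ℤ → ℂ) (g h : ℤ → ℝ → ℂ),
    IsProfile a g → IsProfile b h → (∀ k, Integrable (g k)) → (∀ k, Integrable (h k)) → ∀ k,
    ∫⁻ σ, modPow (-1) σ * interact Φ (fun k σ => ‖g k σ‖ₑ) (fun k σ => ‖h k σ‖ₑ) k σ ≠ ∞ →
    (∀ t ∈ Icc (0 : ℝ) 1, Summable (duhamelTerm Φ a b t k)) ∧
    ∃ P : ℝ → ℂ, Measurable P ∧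
      (∀ t ∈ Icc (0 : ℝ) 1, ∑' k₁, duhamelTerm Φ a b t k k₁ = ∫ σ, osc t σ * P σ) ∧
      ∀ v y, GoodWeight v y → modeNorm v y (fun σ => ‖P σ‖ₑ) ≤ C * modeNorm v y
        (fun σ => modPow (-1) σ *
          interact Φ (fun k σ => ‖g k σ‖ₑ) (fun k σ => ‖h k σ‖ₑ) k σ) := by
  obtain ⟨C, hC⟩ := exists_duhamelExtension
  refine ⟨C, fun Φ a b g h hg hh ig ih k hfin => ?_⟩
  set X := interact Φ (fun k σ => ‖g k σ‖ₑ) (fun k σ => ‖h k σ‖ₑ) k with hX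
  have hXm : Measurable X :=
    measurable_interact (fun k => (hg.meas k).enorm) (fun k => (hh.meas k).enorm) k
  set q : ℤ → ℝ → ℂ := fun k₁ => modeConv (Φ k k₁) (g k₁) (h (k - k₁)) with hq
  have hqm : ∀ k₁, Measurable (q k₁) := fun k₁ => measurable_modeConv (hg.meas _) (hh.meas _)
  have hqX : ∀ σ, ∑' k₁, ‖q k₁ σ‖ₑ ≤ X σ := fun σ =>
    ENNReal.tsum_le_tsum fun k₁ => enorm_modeConv_le _ _ _ _
  have hpos : ∀ σ, modPow (-1) σ ≠ 0 := fun σ => by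
    rw [modPow, Ne, ENNReal.ofReal_eq_zero, not_le]
    exact Real.rpow_pos_of_pos (modBr_pos σ) _
  have hae : ∀ᵐ σ, Summable fun k₁ => q k₁ σ := by
    have := ae_lt_top ((measurable_modPow (-1)).mul hXm) hfin
    filter_upwards [this] with σ hσ
    refine Summable.of_nnnorm ?_
    rw [← ENNReal.tsum_coe_ne_top_iff_summable]
    refine ne_top_of_le_ne_top (fun h2 => ?_) (hqX σ)
    rw [Pi.mul_apply, h2, ENNReal.mul_top (hpos σ)] at hσ
    exact hσ.ne rfl
  have hQm : AEMeasurable fun σ => ∑' k₁, q k₁ σ := by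
    refine aemeasurable_of_tendsto_metrizable_ae (atTop : Filter (Finset ℤ))
      (f := fun S σ => ∑ k₁ ∈ S, q k₁ σ)
      (fun S => (Finset.measurable_fun_sum _ fun n _ => hqm n).aemeasurable) ?_
    filter_upwards [hae] with σ hσ
    exact hσ.hasSum
  have hQX : ∀ᵐ σ, ‖hQm.mk _ σ‖ₑ ≤ X σ := by
    filter_upwards [hQm.ae_eq_mk] with σ hσ
    rw [← hσ]
    exact enorm_tsum_le_tsum_enorm.trans (hqX σ)
  have hQX' : ∀ᵐ σ, modPow (-1) σ * ‖hQm.mk _ σ‖ₑ ≤ modPow (-1) σ * X σ := by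
    filter_upwards [hQX] with σ hσ
    gcongr
  -- The factor 3⟨σ⟩⁻¹ gained by integrating in time makes the sum over all interactions absolutely
  -- convergent, even though the products at a fixed time need not be summable.
  have hE : ∀ t ∈ Icc (0 : ℝ) 1, ∑' k₁, ∫⁻ σ, ‖duhamelInt t σ * q k₁ σ‖ₑ ≠ ∞ := by
    intro t ht
    have hm : ∀ k₁, Measurable fun σ => ‖duhamelInt t σ * q k₁ σ‖ₑ := fun k₁ =>
      ((continuous_duhamelInt t).measurable.mul (hqm k₁)).enorm
    rw [← lintegral_tsum fun k₁ => (hm k₁).aemeasurable]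
    refine ne_top_of_le_ne_top (b := 3 * ∫⁻ σ, modPow (-1) σ * X σ)
      (ENNReal.mul_ne_top (by norm_num) hfin) ?_
    rw [← lintegral_const_mul' _ _ (by norm_num)]
    refine lintegral_mono fun σ => ?_
    simp_rw [enorm_mul]
    rw [ENNReal.tsum_mul_left, ← mul_assoc]
    gcongr
    · rw [← ofReal_norm, modPow, Real.rpow_neg_one, show (3 : ℝ≥0∞) = ENNReal.ofReal 3 by norm_num,
        ← ENNReal.ofReal_mul (by norm_num)]
      exact ENNReal.ofReal_le_ofReal (norm_duhamelInt_le ht σ)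
    · exact hqX σ
  obtain ⟨P, hPm, hPe, hPn⟩ := hC (hQm.mk _) hQm.measurable_mk
    (ne_top_of_le_ne_top hfin (lintegral_mono_ae hQX'))
  refine ⟨fun t ht => ?_, P, hPm, fun t ht => ?_, fun v y hv => ?_⟩
  · refine Summable.of_nnnorm ?_
    rw [← ENNReal.tsum_coe_ne_top_iff_summable]
    refine ne_top_of_le_ne_top (hE t ht) (ENNReal.tsum_le_tsum fun k₁ => ?_)
    rw [duhamelTerm_eq hg hh ig ih ht]
    exact enorm_integral_le_lintegral_enorm _
  · rw [hPe t ht]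
    simp_rw [duhamelTerm_eq hg hh ig ih ht]
    have hmE : ∀ k₁, AEStronglyMeasurable (fun σ => duhamelInt t σ * q k₁ σ) volume := fun k₁ =>
      ((continuous_duhamelInt t).measurable.mul (hqm k₁)).aestronglyMeasurable
    refine (integral_tsum hmE (hE t ht)).symm.trans ?_
    refine integral_congr_ae ?_
    filter_upwards [hQm.ae_eq_mk] with σ hσ
    rw [← hσ, tsum_mul_left]
  · refine (hPn v y hv).trans ?_
    gcongr 1
    exact modeNorm_mono hQX'

section

variable {Φ : ℤ → ℤ → ℝ} {w : ℤ → ℝ≥0∞} {v v' : ℤ → ℝ → ℝ≥0∞} {y y' : ℤ → ℝ≥0∞} {K : ℝ≥0∞}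

lemma lintegral_interact_ne_top (hB : BilinearBound Φ w v y v' y' K) (hK : K ≠ ∞)
    (hvy' : ∀ k, GoodWeight (v' k) (y' k)) {G H : ℤ → ℝ → ℝ≥0∞} (hG : ∀ k, Measurable (G k))
    (hH : ∀ k, Measurable (H k)) (hG0 : G 0 = 0) (hH0 : H 0 = 0) (nG : seqNorm v y G < ∞)
    (nH : seqNorm v y H < ∞) {k : ℤ} (hw : w k ≠ 0) :
    ∫⁻ σ, modPow (-1) σ * interact Φ G H k σ ≠ ∞ := by
  have h1 : seqNorm v' y' (fun k σ => w k * (modPow (-1) σ * interact Φ G H k σ)) < ∞ := by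
    refine ENNReal.rpow_lt_top_of_nonneg (by norm_num) ?_
    refine ne_top_of_le_ne_top ?_ (hB G H hG hH hG0 hH0)
    rw [← seqNorm_sq, ← seqNorm_sq]
    finiteness
  have h2 := lintegral_lt_top_of_seqNorm hvy' h1 k
  have hm := measurable_interact (Φ := Φ) hG hH k
  rw [lintegral_const_mul _ (by fun_prop)] at h2
  intro h3
  rw [h3, ENNReal.mul_top hw] at h2
  exact h2.ne rfl

/-- The bound for the Duhamel operator in terms of representations. -/
theorem exists_duhamelOp_le_seqNorm : ∃ C : ℝ≥0, ∀ (Φ : ℤ → ℤ → ℝ) (w : ℤ → ℝ≥0∞)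
    (v v' : ℤ → ℝ → ℝ≥0∞) (y y' : ℤ → ℝ≥0∞) (K κ : ℝ≥0∞) (c : ℤ → ℂ),
    (∀ k, GoodWeight (v k) (y k)) → (∀ k, GoodWeight (v' k) (y' k)) →
    BilinearBound Φ w v y v' y' K → K ≠ ∞ → w 0 = 0 → (∀ k, ‖c k‖ₑ ≤ κ * w k) →
    ∀ a b g h, IsProfile a g → IsProfile b h → seqNorm v y (fun k σ => ‖g k σ‖ₑ) < ∞ →
    seqNorm v y (fun k σ => ‖h k σ‖ₑ) < ∞ →
    (∀ k, w k ≠ 0 → ∀ t ∈ Icc (0 : ℝ) 1, Summable (duhamelTerm Φ a b t k)) ∧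
    profNorm v' y' (duhamelOp Φ c a b) ≤ C * κ * K ^ (1 / 2 : ℝ) *
      (seqNorm v y (fun k σ => ‖g k σ‖ₑ) * seqNorm v y (fun k σ => ‖h k σ‖ₑ)) := by
  obtain ⟨C, hC⟩ := exists_duhamelSum
  refine ⟨C, fun Φ w v v' y y' K κ c hvy hvy' hB hK hw0 hc a b g h hg hh ng nh => ?_⟩
  have ig := integrable_of_seqNorm hvy hg.meas ng
  have ih := integrable_of_seqNorm hvy hh.meas nh
  set G : ℤ → ℝ → ℝ≥0∞ := fun k σ => ‖g k σ‖ₑ with hG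
  set H : ℤ → ℝ → ℝ≥0∞ := fun k σ => ‖h k σ‖ₑ with hH
  have hGm : ∀ k, Measurable (G k) := fun k => (hg.meas k).enorm
  have hHm : ∀ k, Measurable (H k) := fun k => (hh.meas k).enorm
  have hG0 : G 0 = 0 := by ext σ; simp [hG, hg.zero]
  have hH0 : H 0 = 0 := by ext σ; simp [hH, hh.zero]
  have main := fun k (hwk : w k ≠ 0) => hC Φ a b g h hg hh ig ih k
    (lintegral_interact_ne_top hB hK hvy' hGm hHm hG0 hH0 ng nh hwk)
  refine ⟨fun k hwk => (main k hwk).1, ?_⟩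
  have hP : ∀ k, ∃ P : ℝ → ℂ, Measurable P ∧
      (∀ t ∈ Icc (0 : ℝ) 1, duhamelOp Φ c a b t k = ∫ σ, osc t σ * P σ) ∧ (w k = 0 → P = 0) ∧
      modeNorm (v' k) (y' k) (fun σ => ‖P σ‖ₑ) ≤ modeNorm (v' k) (y' k) (fun σ =>
        (C * κ) * (w k * (modPow (-1) σ * interact Φ G H k σ))) := fun k => by
    -- Where w vanishes the coefficient c vanishes too, and zero represents the mode; elsewhere
    -- finiteness of the weighted norm gives the convergence of the sum.
    by_cases hwk : w k = 0
    · have hck : c k = 0 := by simpa [hwk] using hc k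
      refine ⟨0, measurable_const, fun t _ => by simp [duhamelOp, hck], fun _ => rfl, ?_⟩
      exact modeNorm_mono (ae_of_all _ fun σ => by simp)
    · obtain ⟨-, P, hPm, hPe, hPn⟩ := main k hwk
      have hm := measurable_interact (Φ := Φ) hGm hHm k
      refine ⟨fun σ => c k * P σ, hPm.const_mul _, fun t ht => ?_, fun h => absurd h hwk, ?_⟩
      · simp_rw [mul_left_comm _ (c k)]
        rw [integral_const_mul, duhamelOp, hPe t ht]
      · have hv := (hvy' k).meas
        have e : ∀ σ, (C * κ) * (w k * (modPow (-1) σ * interact Φ G H k σ)) =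
          (C * (κ * w k)) * (modPow (-1) σ * interact Φ G H k σ) := fun σ => by ring
        simp_rw [enorm_mul, e]
        rw [modeNorm_const_mul hv hPm.enorm, modeNorm_const_mul hv (by fun_prop), mul_comm (C : ℝ≥0∞),
          mul_assoc]
        gcongr
        · exact hc k
        · exact hPn _ _ (hvy' k)
  choose P hPm hPe hP0 hPn using hP
  have p : IsProfile (duhamelOp Φ c a b) P := ⟨hPm, hP0 0 hw0, fun t ht k => hPe k t ht⟩
  calc _ ≤ seqNorm v' y' fun k σ => ‖P k σ‖ₑ := profNorm_le p
    _ ≤ seqNorm v' y' fun k σ => (C * κ) * (w k * (modPow (-1) σ * interact Φ G H k σ)) :=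
        seqNorm_mono hPn
    _ = C * κ * seqNorm v' y' fun k σ => w k * (modPow (-1) σ * interact Φ G H k σ) :=
        seqNorm_const_mul (f := fun k σ => w k * (modPow (-1) σ * interact Φ G H k σ))
          (fun k => (hvy' k).meas) (fun k => by
            have hm := measurable_interact (Φ := Φ) hGm hHm k
            fun_prop) _
    _ ≤ C * κ * (K ^ (1 / 2 : ℝ) * (seqNorm v y G * seqNorm v y H)) := by
        gcongr
        rw [seqNorm, seqNorm, seqNorm, ← ENNReal.mul_rpow_of_nonneg _ _ (by norm_num),
          ← ENNReal.mul_rpow_of_nonneg _ _ (by norm_num)]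
        exact ENNReal.rpow_le_rpow (hB G H hGm hHm hG0 hH0) (by norm_num)
    _ = _ := by ring

/-- Passage from nearly optimal representations to the two infima, by continuity of the product at
finite values. -/
lemma ennreal_le_mul_of_forall_lt {z c x x' : ℝ≥0∞} (hc : c ≠ ∞) (hx : x ≠ ∞) (hx' : x' ≠ ∞)
    (h : ∀ u u', x < u → x' < u' → u ≠ ∞ → u' ≠ ∞ → z ≤ c * (u * u')) : z ≤ c * (x * x') := by
  have ht : Tendsto (fun ε : ℝ≥0 => c * ((x + ε) * (x' + ε))) (𝓝[>] 0) (𝓝 (c * (x * x'))) := by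
    have h0 : Tendsto (fun ε : ℝ≥0 => (ε : ℝ≥0∞)) (𝓝[>] 0) (𝓝 0) :=
      (ENNReal.tendsto_coe.2 tendsto_id).mono_left nhdsWithin_le_nhds
    have h1 := h0.const_add x
    have h2 := h0.const_add x'
    rw [add_zero] at h1 h2
    exact ENNReal.Tendsto.const_mul (ENNReal.Tendsto.mul h1 (Or.inr hx') h2 (Or.inr hx))
      (Or.inr hc)
  refine ge_of_tendsto ht ?_
  filter_upwards [self_mem_nhdsWithin] with ε hε
  have hε' : (ε : ℝ≥0∞) ≠ 0 := ENNReal.coe_ne_zero.2 (ne_of_gt hε)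
  exact h _ _ (ENNReal.lt_add_right hx hε') (ENNReal.lt_add_right hx' hε') (by finiteness)
    (by finiteness)

/-- The bound for the Duhamel operator. -/
theorem exists_duhamelOp_le : ∃ C : ℝ≥0, ∀ (Φ : ℤ → ℤ → ℝ) (w : ℤ → ℝ≥0∞)
    (v v' : ℤ → ℝ → ℝ≥0∞) (y y' : ℤ → ℝ≥0∞) (K κ : ℝ≥0∞) (c : ℤ → ℂ),
    (∀ k, GoodWeight (v k) (y k)) → (∀ k, GoodWeight (v' k) (y' k)) →
    BilinearBound Φ w v y v' y' K → K ≠ ∞ → κ ≠ ∞ → w 0 = 0 → (∀ k, ‖c k‖ₑ ≤ κ * w k) →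
    ∀ a b, profNorm v y a < ∞ → profNorm v y b < ∞ →
    (∀ k, w k ≠ 0 → ∀ t ∈ Icc (0 : ℝ) 1, Summable (duhamelTerm Φ a b t k)) ∧
    profNorm v' y' (duhamelOp Φ c a b) ≤ C * κ * K ^ (1 / 2 : ℝ) *
      (profNorm v y a * profNorm v y b) := by
  obtain ⟨C, hC⟩ := exists_duhamelOp_le_seqNorm
  refine ⟨C, fun Φ w v v' y y' K κ c hvy hvy' hB hK hκ hw0 hc a b ha hb => ⟨?_, ?_⟩⟩
  · obtain ⟨g, hg, ng⟩ := exists_profile_lt ha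
    obtain ⟨h, hh, nh⟩ := exists_profile_lt hb
    exact (hC Φ w v v' y y' K κ c hvy hvy' hB hK hw0 hc a b g h hg hh ng nh).1
  · refine ennreal_le_mul_of_forall_lt ?_ ha.ne hb.ne fun u u' hu hu' _ _ => ?_
    · have := ENNReal.rpow_lt_top_of_nonneg (show (0 : ℝ) ≤ 1 / 2 by norm_num) hK
      finiteness
    · obtain ⟨g, hg, ng⟩ := exists_profile_lt hu
      obtain ⟨h, hh, nh⟩ := exists_profile_lt hu'
      refine (hC Φ w v v' y y' K κ c hvy hvy' hB hK hw0 hc a b g h hg hh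
        (ng.trans_le le_top) (nh.trans_le le_top)).2.trans ?_
      gcongr

end

end

section

/-! ### The fixed point argument -/

/-- The Duhamel operator is well defined and bounded on the restriction space. -/
structure OpBound (Φ : ℤ → ℤ → ℝ) (c : ℤ → ℂ) (v : ℤ → ℝ → ℝ≥0∞) (y : ℤ → ℝ≥0∞) (θ : ℝ≥0∞) :
    Prop where
  good : ∀ k, GoodWeight (v k) (y k)
  coeff_zero : c 0 = 0
  ne_top : θ ≠ ∞
  summable : ∀ a b, profNorm v y a < ∞ → profNorm v y b < ∞ → ∀ k, k ≠ 0 →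
    ∀ t ∈ Icc (0 : ℝ) 1, Summable (duhamelTerm Φ a b t k)
  le : ∀ a b, profNorm v y a < ∞ → profNorm v y b < ∞ →
    profNorm v y (duhamelOp Φ c a b) ≤ θ * (profNorm v y a * profNorm v y b)

variable {Φ : ℤ → ℤ → ℝ} {c : ℤ → ℂ} {v : ℤ → ℝ → ℝ≥0∞} {y : ℤ → ℝ≥0∞} {θ : ℝ≥0∞}

lemma continuous_integral_osc {g : ℝ → ℂ} (hg : Integrable g) :
    Continuous fun t => ∫ σ, osc t σ * g σ := by
  refine continuous_of_dominated (bound := fun σ => ‖g σ‖)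
    (fun t => (integrable_osc_mul hg t).1) (fun t => ae_of_all _ fun σ => ?_) hg.norm
    (ae_of_all _ fun σ => ?_)
  · rw [norm_mul, norm_osc, one_mul]
  · unfold osc; fun_prop

/-- Continuity in time of each coefficient makes the integrands of `duhamelTerm` integrable, so that
their integrals can be added and split. -/
lemma continuousOn_of_profNorm (hvy : ∀ k, GoodWeight (v k) (y k)) {a : ℝ → ℤ → ℂ}
    (ha : profNorm v y a < ∞) (k : ℤ) : ContinuousOn (fun t => a t k) (Icc 0 1) := by
  obtain ⟨g, hg, ng⟩ := exists_profile_lt ha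
  refine (continuous_integral_osc (integrable_of_seqNorm hvy hg.meas ng k)).continuousOn.congr ?_
  intro t ht
  exact hg.eq t ht k

lemma intervalIntegrable_duhamelTerm {a b : ℝ → ℤ → ℂ}
    (ha : ∀ k, ContinuousOn (fun t => a t k) (Icc 0 1))
    (hb : ∀ k, ContinuousOn (fun t => b t k) (Icc 0 1)) {t : ℝ} (ht : t ∈ Icc (0 : ℝ) 1) (φ : ℝ)
    (k k₁ : ℤ) :
    IntervalIntegrable (fun t' => osc t' φ * (a t' k₁ * b t' (k - k₁))) volume 0 t := by
  refine ContinuousOn.intervalIntegrable ?_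
  rw [uIcc_of_le ht.1]
  have hs : Icc 0 t ⊆ Icc 0 1 := Icc_subset_Icc_right ht.2
  have h1 : Continuous fun t' => osc t' φ := by unfold osc; fun_prop
  exact h1.continuousOn.mul (((ha _).mono hs).mul ((hb _).mono hs))

namespace OpBound

variable (h : OpBound Φ c v y θ) {a a' b b' : ℝ → ℤ → ℂ}
include h

/-- Linearity of the operator needs the convergence of the integrals and of the sums over
interactions for both terms, because `tsum` and the integral have default values otherwise. -/
lemma sub_left (ha : profNorm v y a < ∞) (ha' : profNorm v y a' < ∞) (hb : profNorm v y b < ∞)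
    {t : ℝ} (ht : t ∈ Icc (0 : ℝ) 1) :
    duhamelOp Φ c (a - a') b t = duhamelOp Φ c a b t - duhamelOp Φ c a' b t := by
  ext k
  rcases eq_or_ne k 0 with rfl | hk
  · simp [duhamelOp, h.coeff_zero]
  have e : ∀ k₁, duhamelTerm Φ (a - a') b t k k₁ =
      duhamelTerm Φ a b t k k₁ - duhamelTerm Φ a' b t k k₁ := fun k₁ => by
    unfold duhamelTerm
    rw [← intervalIntegral.integral_sub
      (intervalIntegrable_duhamelTerm (continuousOn_of_profNorm h.good ha)
        (continuousOn_of_profNorm h.good hb) ht _ _ _)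
      (intervalIntegrable_duhamelTerm (continuousOn_of_profNorm h.good ha')
        (continuousOn_of_profNorm h.good hb) ht _ _ _)]
    congr 1 with t'
    simp only [Pi.sub_apply]
    ring
  simp only [duhamelOp, Pi.sub_apply]
  rw [← mul_sub, ← (h.summable a b ha hb k hk t ht).tsum_sub (h.summable a' b ha' hb k hk t ht)]
  simp_rw [e]

lemma sub_right (ha : profNorm v y a < ∞) (hb : profNorm v y b < ∞) (hb' : profNorm v y b' < ∞)
    {t : ℝ} (ht : t ∈ Icc (0 : ℝ) 1) :
    duhamelOp Φ c a (b - b') t = duhamelOp Φ c a b t - duhamelOp Φ c a b' t := by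
  ext k
  rcases eq_or_ne k 0 with rfl | hk
  · simp [duhamelOp, h.coeff_zero]
  have e : ∀ k₁, duhamelTerm Φ a (b - b') t k k₁ =
      duhamelTerm Φ a b t k k₁ - duhamelTerm Φ a b' t k k₁ := fun k₁ => by
    unfold duhamelTerm
    rw [← intervalIntegral.integral_sub
      (intervalIntegrable_duhamelTerm (continuousOn_of_profNorm h.good ha)
        (continuousOn_of_profNorm h.good hb) ht _ _ _)
      (intervalIntegrable_duhamelTerm (continuousOn_of_profNorm h.good ha)
        (continuousOn_of_profNorm h.good hb') ht _ _ _)]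
    congr 1 with t'
    simp only [Pi.sub_apply]
    ring
  simp only [duhamelOp, Pi.sub_apply]
  rw [← mul_sub, ← (h.summable a b ha hb k hk t ht).tsum_sub (h.summable a b' ha hb' k hk t ht)]
  simp_rw [e]

lemma sub_lt_top (ha : profNorm v y a < ∞) (hb : profNorm v y b < ∞) :
    profNorm v y (a - b) < ∞ :=
  (profNorm_sub_le h.good a b).trans_lt (ENNReal.add_lt_top.2 ⟨ha, hb⟩)

/-- The difference of two squares. -/
lemma profNorm_sq_sub_le (ha : profNorm v y a < ∞) (hb : profNorm v y b < ∞) :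
    profNorm v y (duhamelOp Φ c a a - duhamelOp Φ c b b) ≤
      θ * (profNorm v y a + profNorm v y b) * profNorm v y (a - b) := by
  have hab := h.sub_lt_top ha hb
  have e : profNorm v y (duhamelOp Φ c a a - duhamelOp Φ c b b) =
      profNorm v y (duhamelOp Φ c (a - b) a + duhamelOp Φ c b (a - b)) := by
    refine profNorm_congr fun t ht => ?_
    simp only [Pi.sub_apply, Pi.add_apply]
    rw [h.sub_left ha hb ha ht, h.sub_right hb ha hb ht]
    abel
  rw [e]
  calc _ ≤ _ := profNorm_add_le h.good _ _
    _ ≤ _ := add_le_add (h.le _ _ hab ha) (h.le _ _ hb hab)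
    _ = _ := by ring

end OpBound

lemma ennreal_le_two_mul_of_le {x z : ℝ≥0∞} (hx : x ≠ ∞) (h : x ≤ z + x / 2) : x ≤ 2 * z := by
  have h1 : x / 2 ≤ z := by
    refine (ENNReal.add_le_add_iff_right (a := x / 2) (ENNReal.div_ne_top hx (by norm_num))).1 ?_
    rwa [ENNReal.add_halves]
  calc x = 2 * (x / 2) := by rw [ENNReal.mul_div_cancel (by norm_num) (by norm_num)]
    _ ≤ _ := by gcongr

/-- Two solutions of the fixed point equation differ at most by twice the difference of the data. -/
theorem OpBound.profNorm_sub_le (h : OpBound Φ c v y θ) {a b a₀ b₀ : ℝ → ℤ → ℂ} {M : ℝ≥0∞}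
    (hM : 4 * (θ * M) ≤ 1) (hMt : M ≠ ∞) (ha : profNorm v y a ≤ M) (hb : profNorm v y b ≤ M)
    (ea : ∀ t ∈ Icc (0 : ℝ) 1, a t = a₀ t + duhamelOp Φ c a a t)
    (eb : ∀ t ∈ Icc (0 : ℝ) 1, b t = b₀ t + duhamelOp Φ c b b t) :
    profNorm v y (a - b) ≤ 2 * profNorm v y (a₀ - b₀) := by
  have ha' := ha.trans_lt hMt.lt_top
  have hb' := hb.trans_lt hMt.lt_top
  refine ennreal_le_two_mul_of_le (h.sub_lt_top ha' hb').ne ?_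
  have e : profNorm v y (a - b) =
      profNorm v y ((a₀ - b₀) + (duhamelOp Φ c a a - duhamelOp Φ c b b)) := by
    refine profNorm_congr fun t ht => ?_
    simp only [Pi.sub_apply, Pi.add_apply]
    rw [ea t ht, eb t ht]
    abel
  have hθ : θ * (profNorm v y a + profNorm v y b) ≤ 2⁻¹ := by
    calc _ ≤ θ * (M + M) := by gcongr
      _ = 2⁻¹ * (4 * (θ * M)) := by
          rw [show (4 : ℝ≥0∞) = 2 * 2 by norm_num, mul_assoc 2 2 _, ← mul_assoc 2⁻¹,
            ENNReal.inv_mul_cancel (by norm_num) (by norm_num)]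
          ring
      _ ≤ 2⁻¹ * 1 := by gcongr
      _ = _ := mul_one _
  calc _ = _ := e
    _ ≤ _ := profNorm_add_le h.good _ _
    _ ≤ profNorm v y (a₀ - b₀) + 2⁻¹ * profNorm v y (a - b) := by
        gcongr
        exact (h.profNorm_sq_sub_le ha' hb').trans (by gcongr)
    _ = _ := by rw [ENNReal.div_eq_inv_mul]

/-- The iterates of the fixed point map. -/
def picard (Φ : ℤ → ℤ → ℝ) (c : ℤ → ℂ) (a₀ : ℝ → ℤ → ℂ) : ℕ → ℝ → ℤ → ℂ
  | 0 => a₀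
  | n + 1 => a₀ + duhamelOp Φ c (picard Φ c a₀ n) (picard Φ c a₀ n)

/-- Existence of a solution of the fixed point equation. -/
theorem OpBound.exists_fixedPoint (h : OpBound Φ c v y θ) {a₀ : ℝ → ℤ → ℂ} {m : ℝ≥0∞}
    (hm : 8 * (θ * m) ≤ 1) (hmt : m ≠ ∞) (ha₀ : profNorm v y a₀ ≤ m) :
    ∃ a, profNorm v y a ≤ 2 * m ∧ ∀ t ∈ Icc (0 : ℝ) 1, a t = a₀ t + duhamelOp Φ c a a t := by
  set u := picard Φ c a₀ with hu
  have half : θ * (2 * m + 2 * m) ≤ 2⁻¹ := by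
    calc _ = 2⁻¹ * (8 * (θ * m)) := by
          rw [show (8 : ℝ≥0∞) = 2 * 4 by norm_num, mul_assoc 2 4 _, ← mul_assoc 2⁻¹,
            ENNReal.inv_mul_cancel (by norm_num) (by norm_num)]
          ring
      _ ≤ 2⁻¹ * 1 := by gcongr
      _ = _ := mul_one _
  have quad : θ * (2 * m * (2 * m)) ≤ m := by
    calc _ ≤ θ * ((2 * m + 2 * m) * (2 * m)) := by gcongr; exact le_self_add
      _ = θ * (2 * m + 2 * m) * (2 * m) := by ring
      _ ≤ 2⁻¹ * (2 * m) := by gcongr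
      _ = m := by rw [← mul_assoc, ENNReal.inv_mul_cancel (by norm_num) (by norm_num), one_mul]
  have h2m : 2 * m ≠ ∞ := by finiteness
  have hun : ∀ n, profNorm v y (u n) ≤ 2 * m := fun n => by
    induction n with
    | zero => exact ha₀.trans (le_mul_of_one_le_left' (by norm_num))
    | succ n ih =>
      have ih' := ih.trans_lt h2m.lt_top
      calc _ ≤ _ := profNorm_add_le h.good _ _
        _ ≤ m + θ * (2 * m * (2 * m)) := by
            refine add_le_add ha₀ ((h.le _ _ ih' ih').trans ?_)
            gcongr
        _ ≤ m + m := by gcongr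
        _ = _ := by ring
  have hunt : ∀ n, profNorm v y (u n) < ∞ := fun n => (hun n).trans_lt h2m.lt_top
  set d : ℕ → ℝ → ℤ → ℂ := fun n => u (n + 1) - u n with hd
  have hdn : ∀ n, profNorm v y (d n) ≤ 2⁻¹ ^ n * m := fun n => by
    induction n with
    | zero =>
      rw [pow_zero, one_mul]
      have e : d 0 = duhamelOp Φ c (u 0) (u 0) := by
        simp only [hd, hu, picard, add_sub_cancel_left]
      rw [e]
      refine (h.le _ _ (hunt 0) (hunt 0)).trans (le_trans ?_ quad)
      gcongr <;> exact hun 0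
    | succ n ih =>
      have e : d (n + 1) = duhamelOp Φ c (u (n + 1)) (u (n + 1)) - duhamelOp Φ c (u n) (u n) := by
        simp only [hd]
        show a₀ + duhamelOp Φ c (u (n + 1)) (u (n + 1)) - (a₀ + duhamelOp Φ c (u n) (u n)) = _
        rw [add_sub_add_left_eq_sub]
      rw [e]
      calc _ ≤ _ := h.profNorm_sq_sub_le (hunt _) (hunt _)
        _ ≤ θ * (2 * m + 2 * m) * (2⁻¹ ^ n * m) := by
            gcongr
            · exact hun _
            · exact hun _
        _ ≤ 2⁻¹ * (2⁻¹ ^ n * m) := by gcongr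
        _ = _ := by rw [pow_succ]; ring
  have tail : ∀ n, ∑' j, profNorm v y (d (j + n)) ≤ 2⁻¹ ^ n * (2 * m) := fun n => by
    calc _ ≤ ∑' j, 2⁻¹ ^ j * (2⁻¹ ^ n * m) := ENNReal.tsum_le_tsum fun j => by
          rw [← mul_assoc, ← pow_add]; exact hdn _
      _ = _ := by
          rw [ENNReal.tsum_mul_right, ENNReal.tsum_geometric, ENNReal.one_sub_inv_two, inv_inv]
          ring
  have tail_fin : ∀ n, ∑' j, profNorm v y (d (j + n)) < ∞ := fun n =>
    (tail n).trans_lt (by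
      have : (2⁻¹ : ℝ≥0∞) ^ n ≠ ∞ := ENNReal.pow_ne_top (by norm_num)
      finiteness)
  -- The limit of the iterates as a telescoping series. It converges for every k and every t in
  -- [0,1]; its values at other times play no role.
  set a : ℝ → ℤ → ℂ := fun t k => a₀ t k + ∑' j, d j t k with ha
  have hsub : ∀ n, ∀ t ∈ Icc (0 : ℝ) 1, (a - u n) t = fun k => ∑' j, d (j + n) t k := by
    intro n t ht
    ext k
    have hs := summable_of_tsum_profNorm h.good (a := d) (by simpa using tail_fin 0) ht k
    have h1 := hs.sum_add_tsum_nat_add n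
    have h2 : ∑ i ∈ Finset.range n, d i t k = u n t k - u 0 t k := by
      simp only [hd, Pi.sub_apply]
      exact Finset.sum_range_sub (fun i => u i t k) n
    simp only [ha, Pi.sub_apply]
    rw [← h1, h2]
    simp only [hu, picard]
    ring
  have herr : ∀ n, profNorm v y (a - u n) ≤ 2⁻¹ ^ n * (2 * m) := fun n => by
    rw [profNorm_congr (hsub n)]
    exact (profNorm_tsum_le h.good (a := fun j => d (j + n)) (tail_fin n)).trans (tail n)
  have hpow : Tendsto (fun n : ℕ => (2⁻¹ : ℝ≥0∞) ^ n) atTop (𝓝 0) :=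
    ENNReal.tendsto_pow_atTop_nhds_zero_of_lt_one (by norm_num)
  have hra : profNorm v y a ≤ 2 * m := by
    have hlim : Tendsto (fun n : ℕ => (2⁻¹ : ℝ≥0∞) ^ n * (2 * m) + 2 * m) atTop
        (𝓝 (0 * (2 * m) + 2 * m)) :=
      (ENNReal.Tendsto.mul_const hpow (Or.inr h2m)).add_const _
    rw [zero_mul, zero_add] at hlim
    refine ge_of_tendsto' hlim fun n => ?_
    calc profNorm v y a = profNorm v y ((a - u n) + u n) := by rw [sub_add_cancel]
      _ ≤ _ := profNorm_add_le h.good _ _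
      _ ≤ _ := add_le_add (herr n) (hun n)
  have hrat := hra.trans_lt h2m.lt_top
  refine ⟨a, hra, ?_⟩
  -- The defect of the limit is compared with that of the n-th step: both a - u_{n+1} and B(u_n,u_n)
  -- - B(a,a) are O(2⁻ⁿ).
  have hzero : profNorm v y (a - (a₀ + duhamelOp Φ c a a)) = 0 := by
    refine le_antisymm ?_ bot_le
    have hlim : Tendsto (fun n : ℕ => (2⁻¹ : ℝ≥0∞) ^ n * (2 * m) + (2⁻¹ : ℝ≥0∞) ^ n * (2 * m)) atTop
        (𝓝 (0 * (2 * m) + 0 * (2 * m))) :=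
      (ENNReal.Tendsto.mul_const hpow (Or.inr h2m)).add
        (ENNReal.Tendsto.mul_const hpow (Or.inr h2m))
    rw [zero_mul, add_zero] at hlim
    refine ge_of_tendsto' hlim fun n => ?_
    have e : a - (a₀ + duhamelOp Φ c a a) =
        (a - u (n + 1)) + (duhamelOp Φ c (u n) (u n) - duhamelOp Φ c a a) := by
      show _ = (a - (a₀ + duhamelOp Φ c (u n) (u n))) + _
      abel
    rw [e]
    refine (profNorm_add_le h.good _ _).trans (add_le_add ?_ ?_)
    · refine (herr _).trans ?_
      gcongr 1
      rw [pow_succ]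
      exact mul_le_of_le_one_right' (by norm_num)
    · rw [← profNorm_neg, neg_sub]
      calc _ ≤ _ := h.profNorm_sq_sub_le hrat (hunt n)
        _ ≤ θ * (2 * m + 2 * m) * (2⁻¹ ^ n * (2 * m)) := by
            gcongr
            · exact hun n
            · exact herr n
        _ ≤ 2⁻¹ * (2⁻¹ ^ n * (2 * m)) := by gcongr
        _ ≤ _ := mul_le_of_le_one_left' (by norm_num)
  intro t ht
  have := eq_zero_of_profNorm h.good hzero ht
  simpa [sub_eq_zero] using this

/-! ### Real-valued solutions -/

/-- The complex conjugate of a function, in terms of its Fourier coefficients. -/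
def reflect (a : ℝ → ℤ → ℂ) (t : ℝ) (k : ℤ) : ℂ := conj (a t (-k))

lemma conj_osc (t σ : ℝ) : conj (osc t σ) = osc t (-σ) := by
  rw [osc, osc, ← Complex.exp_conj]
  congr 1
  simp

lemma profNorm_reflect_le (hv : ∀ k σ, v (-k) (-σ) = v k σ) (hy : ∀ k, y (-k) = y k)
    (a : ℝ → ℤ → ℂ) : profNorm v y (reflect a) ≤ profNorm v y a := by
  refine le_iInf₂ fun g hg => ?_
  have p : IsProfile (reflect a) fun k σ => conj (g (-k) (-σ)) := by
    refine ⟨fun k => ?_, by ext; simp [hg.zero], fun t ht k => ?_⟩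
    · have := hg.meas (-k)
      exact Complex.continuous_conj.measurable.comp (this.comp measurable_neg)
    · rw [reflect, hg.eq t ht, ← integral_conj, ← integral_neg_eq_self]
      congr 1 with σ
      rw [map_mul, conj_osc, neg_neg]
  refine (profNorm_le p).trans_eq ?_
  unfold seqNorm sqNorm
  congr 1
  rw [← (Equiv.neg ℤ).tsum_eq]
  congr 1 with k
  congr 1
  simp only [Equiv.neg_apply, neg_neg, modeNorm, l2]
  congr 1
  · congr 1
    rw [← lintegral_comp_sub _ 0]
    congr 1 with σ
    rw [zero_sub, hv, neg_neg]
    congr 2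
    exact RCLike.enorm_conj _
  · rw [hy, ← lintegral_comp_sub _ 0]
    congr 2 with σ
    rw [zero_sub, neg_neg]
    exact RCLike.enorm_conj _

lemma duhamelOp_reflect (hΦ : ∀ k k₁, Φ (-k) (-k₁) = -Φ k k₁) (hc : ∀ k, c (-k) = conj (c k))
    (a b : ℝ → ℤ → ℂ) : duhamelOp Φ c (reflect a) (reflect b) = reflect (duhamelOp Φ c a b) := by
  ext t k
  rw [reflect, duhamelOp, duhamelOp, map_mul, hc, Complex.conj_conj, Complex.conj_tsum,
    ← (Equiv.neg ℤ).tsum_eq]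
  congr 2 with k₁
  rw [duhamelTerm, duhamelTerm, intervalIntegral, intervalIntegral, map_sub, ← integral_conj,
    ← integral_conj, ← intervalIntegral, ← intervalIntegral]
  congr 1 with t'
  simp only [Equiv.neg_apply, reflect, map_mul, conj_osc, neg_neg, neg_sub]
  have : Φ k (-k₁) = -Φ (-k) k₁ := by
    have := hΦ k (-k₁)
    rw [neg_neg] at this
    rw [this, neg_neg]
  rw [this, neg_neg]
  congr 4
  ring

end

/-! ### The weights on the lattice vary slowly -/

lemma modBr_le_mul (σ σ' : ℝ) : modBr σ ≤ modBr σ' * modBr (σ - σ') := by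
  unfold modBr
  have : |σ| ≤ |σ'| + |σ - σ'| := by
    have := abs_sub_abs_le_abs_sub σ σ'
    linarith
  nlinarith [abs_nonneg σ', abs_nonneg (σ - σ')]

lemma modBr_neg (σ : ℝ) : modBr (-σ) = modBr σ := by rw [modBr, modBr, abs_neg]

lemma abs_log_modBr_sub_le (σ σ' : ℝ) :
    |Real.log (modBr σ) - Real.log (modBr σ')| ≤ Real.log (modBr (σ - σ')) := by
  have h : ∀ σ σ', Real.log (modBr σ) ≤ Real.log (modBr σ') + Real.log (modBr (σ - σ')) :=
    fun σ σ' => by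
      rw [← Real.log_mul (modBr_pos _).ne' (modBr_pos _).ne']
      exact Real.log_le_log (modBr_pos _) (modBr_le_mul _ _)
  rw [abs_le]
  constructor
  · have := h σ' σ
    rw [← neg_sub σ σ', modBr_neg] at this
    linarith
  · linarith [h σ σ']

lemma modBr_rpow (r σ : ℝ) : modBr σ ^ r = Real.exp (r * Real.log (modBr σ)) := by
  rw [Real.rpow_def_of_pos (modBr_pos σ), mul_comm]

lemma zWeight_slow {s : ℝ} (hs : -(3 / 2) ≤ s) (hs' : s ≤ -1) (ξ σ σ' : ℝ) :
    zWeight s ξ σ ≤ zWeight s ξ σ' * modBr (σ - σ') ^ (3 / 4 : ℝ) := by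
  rw [zWeight, zWeight, modBr_rpow, ← Real.exp_add]
  refine Real.exp_le_exp.2 ?_
  have h1 := logWeight_lipschitz hs hs' (log_freqBr_nonneg ξ) (a := Real.log (modBr σ))
    (b := Real.log (modBr σ'))
  have h2 := abs_log_modBr_sub_le σ σ'
  linarith

lemma zWeight_zero (s ξ : ℝ) : zWeight s ξ 0 = freqBr ξ ^ s := by
  rw [zWeight, freqBr_rpow]
  congr 1
  have : modBr 0 = 1 := by simp [modBr]
  rw [this, Real.log_one, logWeight, if_pos (by linarith [log_freqBr_nonneg ξ])]
  ring

lemma goodWeight_lattice {s : ℝ} (hs : -(3 / 2) ≤ s) (hs' : s ≤ -1) (ρ lam : ℝ) (k : ℤ) :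
    GoodWeight (latticeWeight s ρ lam k) (latticeBr (s + ρ) lam k) where
  meas := by unfold latticeWeight; fun_prop
  slow σ σ' := by
    have := Real.rpow_nonneg (freqBr_pos (k / lam)).le ρ
    have hz : 0 ≤ zWeight s (k / lam) σ' := (Real.exp_pos _).le
    rw [latticeWeight, latticeWeight, modPow, ← ENNReal.ofReal_mul (by positivity)]
    refine ENNReal.ofReal_le_ofReal ?_
    rw [mul_assoc]
    gcongr
    exact zWeight_slow hs hs' _ _ _
  zero_le := by
    rw [latticeWeight, latticeBr, zWeight_zero, ← Real.rpow_add (freqBr_pos _), add_comm]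
  ne_zero := by
    rw [latticeBr, Ne, ENNReal.ofReal_eq_zero, not_le]
    exact Real.rpow_pos_of_pos (freqBr_pos _) _
  ne_top := ENNReal.ofReal_ne_top

lemma goodWeight_half (lam : ℝ) (k : ℤ) : GoodWeight (latticeHalf lam k) (latticeBr (-1) lam k) where
  meas := by unfold latticeHalf; fun_prop
  slow σ σ' := by
    rw [latticeHalf, latticeHalf, modPow,
      ← ENNReal.ofReal_mul (show 0 ≤ halfWeight (k / lam) σ' from (Real.exp_pos _).le)]
    refine ENNReal.ofReal_le_ofReal ?_
    rw [halfWeight, halfWeight, modBr_rpow, ← Real.exp_add]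
    refine Real.exp_le_exp.2 ?_
    have h1 := (le_abs_self _).trans (abs_log_modBr_sub_le σ σ')
    have h2 := log_modBr_nonneg (σ - σ')
    linarith
  zero_le := by
    rw [latticeHalf, latticeBr, halfWeight, freqBr_rpow]
    simp [modBr]
  ne_zero := by
    rw [latticeBr, Ne, ENNReal.ofReal_eq_zero, not_le]
    exact Real.rpow_pos_of_pos (freqBr_pos _) _
  ne_top := ENNReal.ofReal_ne_top

/-! ### The Duhamel operator of the equation -/

/-- The coefficient of the nonlinearity on a time interval of length `lam⁻⁵`. -/
def duhamelCoeff (γ lam : ℝ) (k : ℤ) : ℂ :=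
  -((γ : ℂ) * (Complex.I * k) * (((Real.sqrt (2 * Real.pi))⁻¹ * (lam ^ 5)⁻¹ : ℝ) : ℂ))

lemma sqrt_two_pi_inv_le_one : (Real.sqrt (2 * Real.pi))⁻¹ ≤ 1 := by
  refine inv_le_one_of_one_le₀ (Real.one_le_sqrt.2 ?_)
  linarith [Real.pi_gt_three]

lemma enorm_duhamelCoeff_le (γ : ℝ) {lam : ℝ} (hlam : 0 < lam) (k : ℤ) :
    ‖duhamelCoeff γ lam k‖ₑ ≤ ENNReal.ofReal (|γ| * (lam ^ 4)⁻¹) * latticeAbs lam k := by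
  rw [latticeAbs, ← ENNReal.ofReal_mul (by positivity), ← ofReal_norm]
  refine ENNReal.ofReal_le_ofReal ?_
  rw [duhamelCoeff, norm_neg, norm_mul, norm_mul, norm_mul, Complex.norm_I, Complex.norm_real,
    Complex.norm_intCast, Complex.norm_real, Real.norm_eq_abs, Real.norm_eq_abs, abs_div,
    abs_of_pos hlam,
    abs_of_nonneg (show 0 ≤ (Real.sqrt (2 * Real.pi))⁻¹ * (lam ^ 5)⁻¹ by positivity)]
  have h := sqrt_two_pi_inv_le_one
  calc |γ| * (1 * |(k : ℝ)|) * ((Real.sqrt (2 * Real.pi))⁻¹ * (lam ^ 5)⁻¹)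
      ≤ |γ| * (1 * |(k : ℝ)|) * (1 * (lam ^ 5)⁻¹) := by gcongr
    _ = _ := by field_simp

lemma latticeAbs_ne_zero {lam : ℝ} (hlam : 0 < lam) {k : ℤ} (hk : k ≠ 0) : latticeAbs lam k ≠ 0 := by
  rw [latticeAbs, Ne, ENNReal.ofReal_eq_zero, not_le, abs_pos]
  exact div_ne_zero (by exact_mod_cast hk) hlam.ne'

lemma latticeAbs_zero (lam : ℝ) : latticeAbs lam 0 = 0 := by simp [latticeAbs]

lemma abs_div_sq_le (β : ℝ) {lam : ℝ} (hlam : 1 ≤ lam) : |β / lam ^ 2| ≤ |β| := by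
  rw [abs_div, abs_of_pos (by positivity : 0 < lam ^ 2)]
  exact div_le_self (abs_nonneg _) (one_le_pow₀ hlam)

/-- The Duhamel operator of the equation is bounded, with a norm of order `lam^{-7/2}`. -/
theorem exists_opBound {α : ℝ} (hα : α ≠ 0) (β γ : ℝ) {s ρ : ℝ} (hs : -(3 / 2) ≤ s) (hs' : s ≤ -1)
    (hρ : 0 ≤ ρ) : ∃ C : ℝ, 0 ≤ C ∧ ∀ lam : ℝ, 1 ≤ lam →
    OpBound (latticeRes α (β / lam ^ 2) lam) (duhamelCoeff γ lam) (latticeWeight s ρ lam)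
      (latticeBr (s + ρ) lam) (ENNReal.ofReal (C * lam ^ (-(7 / 2) : ℝ))) := by
  obtain ⟨C₁, h₁⟩ := exists_duhamelOp_le
  obtain ⟨C₂, h₂⟩ := exists_bilinearBound hα β hs hs' hρ
  refine ⟨C₁ * |γ| * (C₂ : ℝ) ^ (1 / 2 : ℝ), by positivity, fun lam hlam => ?_⟩
  have hlam0 : 0 < lam := by linarith
  have hgood := goodWeight_lattice hs hs' ρ lam
  have main := h₁ _ _ _ _ _ _ _ _ (duhamelCoeff γ lam) hgood hgood
    (h₂ _ (abs_div_sq_le β hlam) lam hlam) (by finiteness) ENNReal.ofReal_ne_top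
    (latticeAbs_zero lam) (enorm_duhamelCoeff_le γ hlam0)
  refine ⟨hgood, by simp [duhamelCoeff], ENNReal.ofReal_ne_top, fun a b ha hb k hk =>
    (main a b ha hb).1 k (latticeAbs_ne_zero hlam0 hk), fun a b ha hb =>
    (main a b ha hb).2.trans_eq ?_⟩
  congr 1
  rw [← ENNReal.ofReal_coe_nnreal, ← ENNReal.ofReal_coe_nnreal, ← ENNReal.ofReal_mul (by positivity),
    ← ENNReal.ofReal_mul (by positivity), ENNReal.ofReal_rpow_of_nonneg (by positivity) (by norm_num),
    ← ENNReal.ofReal_mul (by positivity)]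
  congr 1
  rw [Real.mul_rpow (by positivity) hlam0.le]
  -- λ⁻⁴ comes from the coefficient of the nonlinearity; λ^{1/2} is the root of the factor λ in the
  -- bilinear estimate, which is one for squared norms.
  have : lam ^ (-(7 / 2) : ℝ) = (lam ^ 4)⁻¹ * lam ^ (1 / 2 : ℝ) := by
    rw [← Real.rpow_natCast, ← Real.rpow_neg hlam0.le, ← Real.rpow_add hlam0]
    norm_num
  rw [this]
  ring

/-- The Duhamel operator maps the larger space `X^{-1,1/2}` into the modified Bourgain space of
order `-3/2`. -/
theorem profNorm_duhamelOp_half_lt_top {α : ℝ} (hα : α ≠ 0) (β γ : ℝ) {lam : ℝ} (hlam : 1 ≤ lam)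
    {a : ℝ → ℤ → ℂ} (ha : profNorm (latticeHalf lam) (latticeBr (-1) lam) a < ∞) :
    profNorm (latticeWeight (-(3 / 2)) 0 lam) (latticeBr (-(3 / 2)) lam)
      (duhamelOp (latticeRes α (β / lam ^ 2) lam) (duhamelCoeff γ lam) a a) < ∞ := by
  obtain ⟨C₁, h₁⟩ := exists_duhamelOp_le
  obtain ⟨C₂, h₂⟩ := exists_bilinearBound_half hα β hlam
  have hlam0 : 0 < lam := by linarith
  have hgood : ∀ k, GoodWeight (latticeWeight (-(3 / 2)) 0 lam k) (latticeBr (-(3 / 2)) lam k) :=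
    fun k => by
      have := goodWeight_lattice (s := -(3 / 2)) le_rfl (by norm_num) 0 lam k
      rwa [add_zero] at this
  have main := h₁ _ _ _ _ _ _ _ _ (duhamelCoeff γ lam) (goodWeight_half lam) hgood
    (h₂ _ (abs_div_sq_le β hlam)) (by finiteness) ENNReal.ofReal_ne_top
    (latticeAbs_zero lam) (enorm_duhamelCoeff_le γ hlam0)
  refine (main a a ha ha).2.trans_lt ?_
  have : (C₂ : ℝ≥0∞) ^ (1 / 2 : ℝ) ≠ ∞ :=
    ENNReal.rpow_ne_top_of_nonneg (by norm_num) ENNReal.coe_ne_top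
  finiteness

/-! ### Restriction to shorter time intervals -/

lemma lintegral_comp_affine {f : ℝ → ℝ≥0∞} (hf : Measurable f) {a : ℝ} (ha : 0 < a) (b : ℝ) :
    ∫⁻ x, f (a * x + b) = ENNReal.ofReal a⁻¹ * ∫⁻ x, f x := by
  have h1 : ∫⁻ x, f (a * x + b) = ∫⁻ x, f (x + b) ∂(Measure.map (a * ·) volume) := by
    rw [lintegral_map (by fun_prop) (by fun_prop)]
  rw [h1, Real.map_volume_mul_left ha.ne', lintegral_smul_measure, lintegral_add_right_eq_self f,
    abs_of_pos (inv_pos.2 ha), smul_eq_mul]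

lemma integral_comp_affine (f : ℝ → ℂ) {a : ℝ} (ha : 0 < a) (b : ℝ) :
    ∫ x, f (a * x + b) = (a⁻¹ : ℝ) • ∫ x, f x := by
  rw [Measure.integral_comp_mul_left (fun x => f (x + b)) a, integral_add_right_eq_self f,
    abs_of_pos (inv_pos.2 ha)]

/-- The norm `ℓ²L¹` with weights. -/
def l1Norm (y : ℤ → ℝ≥0∞) (f : ℤ → ℝ → ℝ≥0∞) : ℝ≥0∞ :=
  (∑' k, (y k * ∫⁻ σ, f k σ) ^ 2) ^ (1 / 2 : ℝ)

lemma l1Norm_eq_l2 (y : ℤ → ℝ≥0∞) (f : ℤ → ℝ → ℝ≥0∞) :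
    l1Norm y f = l2 Measure.count fun k => y k * ∫⁻ σ, f k σ := by
  rw [l1Norm, l2, lintegral_count' measurable_from_top]

lemma l1Norm_le_seqNorm (v : ℤ → ℝ → ℝ≥0∞) (y : ℤ → ℝ≥0∞) (f : ℤ → ℝ → ℝ≥0∞) :
    l1Norm y f ≤ seqNorm v y f := by
  rw [l1Norm_eq_l2, seqNorm_eq_l2]
  exact l2_mono fun k => mul_lintegral_le_modeNorm _ _ _

/-- On the unit interval, modulations smaller than one only contribute to the `L¹` norm. -/
theorem exists_profNorm_le_cutoff : ∃ C : ℝ≥0, ∀ v y, (∀ k, GoodWeight (v k) (y k)) →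
    ∀ (a : ℝ → ℤ → ℂ) (g : ℤ → ℝ → ℂ), IsProfile a g → (∀ k, Integrable (g k)) →
    profNorm v y a ≤ C * l1Norm y (fun k σ => ‖g k σ‖ₑ) +
      seqNorm v y fun k => {σ : ℝ | 1 ≤ |σ|}.indicator fun σ => ‖g k σ‖ₑ := by
  obtain ⟨η, hηc, hηi, C, hC, h1, -, h3⟩ := exists_cutoff
  refine ⟨(tailConst * ENNReal.ofReal (4 * C)).toNNReal, fun v y hvy a g hg ig => ?_⟩
  have hfin : tailConst * ENNReal.ofReal (4 * C) ≠ ∞ := by have := tailConst_lt_top; finiteness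
  rw [ENNReal.coe_toNNReal hfin]
  set A : Set ℝ := {σ : ℝ | 1 ≤ |σ|} with hA
  have hAm : MeasurableSet A := measurableSet_le measurable_const (by fun_prop)
  set lo : ℤ → ℝ → ℂ := fun k => Aᶜ.indicator (g k) with hlo
  set hi : ℤ → ℝ → ℂ := fun k => A.indicator (g k) with hhi
  have lom : ∀ k, Measurable (lo k) := fun k => (hg.meas k).indicator hAm.compl
  have him : ∀ k, Measurable (hi k) := fun k => (hg.meas k).indicator hAm
  have loi : ∀ k, Integrable (lo k) := fun k => (ig k).indicator hAm.compl
  have hii : ∀ k, Integrable (hi k) := fun k => (ig k).indicator hAm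
  have hηm := hηc.measurable
  -- Convolution with η does not change the function on [0,1]. Modulations below one are spread into
  -- a tail ⟨σ⟩⁻² whose size is given by the L¹ norm of the mode.
  set P : ℤ → ℝ → ℂ := fun k => modeConv 0 (lo k) η with hP
  have hPm : ∀ k, Measurable (P k) := fun k => measurable_modeConv (lom k) hηm
  have hPb : ∀ k σ, ‖P k σ‖ₑ ≤ modPow (-2) σ * (ENNReal.ofReal (4 * C) * ∫⁻ s, ‖g k s‖ₑ) := by
    intro k σ
    refine (enorm_modeConv_le _ _ _ _).trans ?_
    rw [← mul_assoc, ← lintegral_const_mul _ (hg.meas k).enorm]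
    refine lintegral_mono fun s => ?_
    by_cases hs : s ∈ A
    · simp [hlo, hs]
    · have e : lo k s = g k s := indicator_of_mem (show s ∈ Aᶜ from hs) _
      rw [e, mul_comm]
      gcongr
      rw [add_zero, ← ofReal_norm, modPow, ← ENNReal.ofReal_mul
        (Real.rpow_nonneg (modBr_pos σ).le _)]
      refine ENNReal.ofReal_le_ofReal ((h1 _).trans ?_)
      have hs' : |s| < 1 := not_le.1 hs
      rw [modBr_rpow_neg_two, modBr_rpow_neg_two, ← div_eq_inv_mul, ← div_eq_mul_inv,
        div_le_div_iff₀ (pow_pos (modBr_pos _) 2) (pow_pos (modBr_pos _) 2)]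
      have h4 : modBr σ ≤ 2 * modBr (σ - s) := by
        have := modBr_le_mul σ s
        have h5 : modBr s ≤ 2 := by unfold modBr; linarith
        have := modBr_pos (σ - s)
        nlinarith
      have h6 : modBr σ ^ 2 ≤ 4 * modBr (σ - s) ^ 2 := by nlinarith [modBr_pos σ]
      nlinarith
  have p : IsProfile a fun k σ => P k σ + hi k σ := by
    refine ⟨fun k => (hPm k).add (him k), ?_, fun t ht k => ?_⟩
    · ext σ
      simp [hP, hhi, hlo, hg.zero, modeConv]
    · have e1 := integral_osc_mul_modeConv (φ := 0) (loi k) hηi t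
      rw [h3 t ht, mul_one, neg_zero, osc_zero, one_mul] at e1
      have ip : Integrable (P k) := integrable_modeConv (lom k) hηm (loi k) hηi
      simp_rw [mul_add]
      rw [integral_add (integrable_osc_mul ip t) (integrable_osc_mul (hii k) t), hg.eq t ht k]
      show _ = (∫ σ, osc t σ * modeConv 0 (lo k) η σ) + _
      rw [e1, ← integral_add (integrable_osc_mul (loi k) t) (integrable_osc_mul (hii k) t)]
      congr 1 with σ
      rw [← mul_add]
      congr 1
      exact (congrFun (indicator_compl_add_self A (g k)) σ).symm
  calc _ ≤ seqNorm v y fun k σ => ‖P k σ + hi k σ‖ₑ := profNorm_le p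
    _ ≤ seqNorm v y fun k σ => ‖P k σ‖ₑ + ‖hi k σ‖ₑ :=
        seqNorm_mono fun k => modeNorm_mono (ae_of_all _ fun σ => enorm_add_le _ _)
    _ ≤ seqNorm v y (fun k σ => ‖P k σ‖ₑ) + seqNorm v y fun k σ => ‖hi k σ‖ₑ :=
        seqNorm_add_le (fun k => (hvy k).meas) (fun k => (hPm k).enorm) fun k => (him k).enorm
    _ ≤ _ := by
        refine add_le_add ?_ (le_of_eq ?_)
        · rw [seqNorm_eq_l2, l1Norm_eq_l2, ← l2_const_mul measurable_from_top.aemeasurable]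
          refine l2_mono fun k => ?_
          calc _ ≤ modeNorm (v k) (y k) fun σ =>
                modPow (-2) σ * (ENNReal.ofReal (4 * C) * ∫⁻ s, ‖g k s‖ₑ) :=
                modeNorm_mono (ae_of_all _ (hPb k))
            _ ≤ _ := modeNorm_tail_le (hvy k) _
            _ = _ := by ring
        · congr 1 with k σ
          exact enorm_indicator_eq_indicator_enorm (g k) σ

lemma le_mul_profNorm {v : ℤ → ℝ → ℝ≥0∞} {y : ℤ → ℝ≥0∞} {a : ℝ → ℤ → ℂ} {x c : ℝ≥0∞}
    (hc : c ≠ 0) (hct : c ≠ ∞)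
    (h : ∀ g, IsProfile a g → x ≤ c * seqNorm v y fun k σ => ‖g k σ‖ₑ) :
    x ≤ c * profNorm v y a := by
  rw [← ENNReal.div_le_iff' hc hct]
  exact le_iInf₂ fun g hg => (ENNReal.div_le_iff' hc hct).2 (h g hg)

/-- The profile of a function on the time interval `[t₀, t₀ + δ]`. -/
def prof (p : ℤ → ℝ) (δ t₀ : ℝ) (u : ℝ → ℤ → ℂ) (t : ℝ) (k : ℤ) : ℂ :=
  osc t (-(δ * p k)) * u (t₀ + δ * t) k

/-- At s = -3/2 the shift of (j, a) by (ℓ, 5ℓ) lowers the three linear forms by (9/4)ℓ, ℓ and ℓ, so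
the weight at the finer scale is the smaller one. -/
lemma logWeight_rescale {j ℓ a : ℝ} (hj : 0 ≤ j) (hℓ : 0 ≤ ℓ) :
    logWeight (-(3 / 2)) (max (j - ℓ) 0) (a - 5 * ℓ) ≤ logWeight (-(3 / 2)) j a := by
  unfold logWeight
  rcases le_total (j - ℓ) 0 with h | h
  · rw [max_eq_right h]
    split_ifs <;> linarith
  · rw [max_eq_left h]
    split_ifs <;> linarith

lemma freqBr_div (ξ : ℝ) {μ : ℝ} (hμ : 1 ≤ μ) : freqBr (ξ / μ) = max (freqBr ξ / μ) 1 := by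
  have hμ0 : 0 < μ := by linarith
  unfold freqBr
  rw [abs_div, abs_of_pos hμ0, ← max_div_div_right hμ0.le, max_right_comm,
    max_eq_right (div_le_one_of_le₀ hμ hμ0.le), max_comm]

lemma log_freqBr_div (ξ : ℝ) {μ : ℝ} (hμ : 1 ≤ μ) :
    Real.log (freqBr (ξ / μ)) = max (Real.log (freqBr ξ) - Real.log μ) 0 := by
  have hμ0 : 0 < μ := by linarith
  rw [freqBr_div ξ hμ, ← Real.log_div (freqBr_pos ξ).ne' hμ0.ne', ← Real.log_one]
  have h0 : 0 < freqBr ξ / μ := div_pos (freqBr_pos ξ) hμ0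
  rcases le_total (freqBr ξ / μ) 1 with h | h
  · rw [max_eq_right h, max_eq_right (Real.log_le_log h0 h)]
  · rw [max_eq_left h, max_eq_left (Real.log_le_log one_pos h)]

/-- For |σ| ≥ 1 the brackets of μ⁵σ and μ⁵ times the bracket of σ agree up to a factor 2. For
smaller σ this fails, which is why small modulations are treated by the cutoff. -/
lemma zWeight_div_le (ξ : ℝ) {μ σ : ℝ} (hμ : 1 ≤ μ) (hσ : 1 ≤ |σ|) :
    zWeight (-(3 / 2)) (ξ / μ) σ ≤ Real.exp 1 * zWeight (-(3 / 2)) ξ (μ ^ 5 * σ) := by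
  have hμ0 : 0 < μ := by linarith
  have hN : 0 < μ ^ 5 := by positivity
  have hN1 : 1 ≤ μ ^ 5 := one_le_pow₀ hμ
  rw [zWeight, zWeight, ← Real.exp_add, log_freqBr_div ξ hμ]
  refine Real.exp_le_exp.2 ?_
  have e : modBr (μ ^ 5 * σ) = 1 + μ ^ 5 * |σ| := by rw [modBr, abs_mul, abs_of_pos hN]
  have hlog : Real.log (μ ^ 5) = 5 * Real.log μ := by rw [Real.log_pow]; norm_num
  have h2 : Real.log (modBr (μ ^ 5 * σ)) ≤ Real.log (modBr σ) + 5 * Real.log μ := by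
    rw [← hlog, ← Real.log_mul (modBr_pos σ).ne' hN.ne']
    refine Real.log_le_log (modBr_pos _) ?_
    rw [e, modBr]
    nlinarith
  have h3 : Real.log (modBr σ) + 5 * Real.log μ ≤ Real.log (modBr (μ ^ 5 * σ)) + 1 := by
    rw [← hlog, ← Real.log_mul (modBr_pos σ).ne' hN.ne']
    refine log_le_log_add_one (mul_pos (modBr_pos σ) hN) (modBr_pos _) ?_
    rw [e, modBr]
    nlinarith
  have h4 := logWeight_lipschitz (s := -(3 / 2)) le_rfl (by norm_num)
    (le_max_right (Real.log (freqBr ξ) - Real.log μ) 0) (a := Real.log (modBr σ))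
    (b := Real.log (modBr (μ ^ 5 * σ)) - 5 * Real.log μ)
  have h5 := logWeight_rescale (log_freqBr_nonneg ξ) (Real.log_nonneg hμ)
    (a := Real.log (modBr (μ ^ 5 * σ)))
  have h6 : |Real.log (modBr σ) - (Real.log (modBr (μ ^ 5 * σ)) - 5 * Real.log μ)| ≤ 1 := by
    rw [abs_le]; constructor <;> linarith
  linarith

lemma latticeBr_mul_le {lam μ : ℝ} (hμ : 1 ≤ μ) (k : ℤ) :
    latticeBr (-(3 / 2)) (lam * μ) k ≤
      ENNReal.ofReal (μ ^ (3 / 2 : ℝ)) * latticeBr (-(3 / 2)) lam k := by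
  have hμ0 : 0 < μ := by linarith
  rw [latticeBr, latticeBr, ← ENNReal.ofReal_mul (by positivity), ← div_div]
  refine ENNReal.ofReal_le_ofReal ?_
  have h1 : freqBr (k / lam) ≤ μ * freqBr (k / lam / μ) := by
    rw [freqBr_div _ hμ, mul_max_of_nonneg _ _ hμ0.le, mul_div_cancel₀ _ hμ0.ne']
    exact le_max_left _ _
  have hJ := freqBr_pos (k / lam)
  have hJ' := freqBr_pos (k / lam / μ)
  calc freqBr (k / lam / μ) ^ (-(3 / 2) : ℝ)
      = μ ^ (3 / 2 : ℝ) * (μ * freqBr (k / lam / μ)) ^ (-(3 / 2) : ℝ) := by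
        rw [Real.mul_rpow hμ0.le hJ'.le, ← mul_assoc, ← Real.rpow_add hμ0]
        norm_num
    _ ≤ _ := mul_le_mul_of_nonneg_left
        (Real.rpow_le_rpow_of_nonpos hJ h1 (by norm_num)) (by positivity)

/-- The norm on a shorter time interval, measured at the scale of that interval. -/
theorem exists_profNorm_prof_le : ∃ C : ℝ≥0, ∀ (p : ℤ → ℝ) (lam μ t₀ : ℝ) (u : ℝ → ℤ → ℂ),
    1 ≤ lam → 1 ≤ μ → 0 ≤ t₀ → t₀ + ((lam * μ) ^ 5)⁻¹ ≤ (lam ^ 5)⁻¹ →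
    profNorm (latticeWeight (-(3 / 2)) 0 (lam * μ)) (latticeBr (-(3 / 2)) (lam * μ))
      (prof p ((lam * μ) ^ 5)⁻¹ t₀ u) ≤ C * ENNReal.ofReal (μ ^ (5 / 2 : ℝ)) *
      profNorm (latticeWeight (-(3 / 2)) 0 lam) (latticeBr (-(3 / 2)) lam)
        (prof p (lam ^ 5)⁻¹ 0 u) := by
  obtain ⟨C, hC⟩ := exists_profNorm_le_cutoff
  refine ⟨C + (ENNReal.ofReal (Real.exp 1)).toNNReal + 1, fun p lam μ t₀ u hlam hμ ht₀ hT => ?_⟩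
  have hlam0 : 0 < lam := by linarith
  have hμ0 : 0 < μ := by linarith
  have hgood : ∀ lam, ∀ k,
      GoodWeight (latticeWeight (-(3 / 2)) 0 lam k) (latticeBr (-(3 / 2)) lam k) := fun lam k => by
    have := goodWeight_lattice (s := -(3 / 2)) le_rfl (by norm_num) 0 lam k
    rwa [add_zero] at this
  have hμr : ENNReal.ofReal (μ ^ (5 / 2 : ℝ)) ≠ 0 := by
    rw [Ne, ENNReal.ofReal_eq_zero, not_le]; positivity
  refine le_mul_profNorm (mul_ne_zero (by simp) hμr) (by finiteness) fun g hg => ?_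
  rcases eq_or_ne (seqNorm (latticeWeight (-(3 / 2)) 0 lam) (latticeBr (-(3 / 2)) lam)
    fun k σ => ‖g k σ‖ₑ) ∞ with hinf | hfin
  · rw [hinf, ENNReal.mul_top (mul_ne_zero (by simp) hμr)]
    exact le_top
  have ig := integrable_of_seqNorm (hgood lam) hg.meas (lt_top_iff_ne_top.2 hfin)
  set N := μ ^ 5 with hN
  have hN0 : 0 < N := by positivity
  -- The new profile at time t is the old one at time t₀λ⁵ + t/μ⁵, up to the phase e^{it₀p(k)}. On
  -- the Fourier side this is a dilation by μ⁵ and a modulation.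
  set g₁ : ℤ → ℝ → ℂ := fun k σ => (N : ℂ) * (osc t₀ (p k) *
    (osc (t₀ * lam ^ 5) (N * σ) * g k (N * σ))) with hg₁
  have hg₁m : ∀ k, Measurable (g₁ k) := fun k => by
    have := hg.meas k
    simp only [hg₁, osc]
    fun_prop
  have hn : ∀ k σ, ‖g₁ k σ‖ₑ = ENNReal.ofReal N * ‖g k (N * σ + 0)‖ₑ := fun k σ => by
    simp only [hg₁]
    rw [enorm_mul, enorm_osc_mul, enorm_osc_mul, add_zero, ← ofReal_norm (N : ℂ), Complex.norm_real,
      Real.norm_of_nonneg hN0.le]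
  have hmass : ∀ k, ∫⁻ σ, ‖g₁ k σ‖ₑ = ∫⁻ σ, ‖g k σ‖ₑ := fun k => by
    simp_rw [hn]
    rw [lintegral_const_mul' _ _ ENNReal.ofReal_ne_top,
      lintegral_comp_affine (hg.meas k).enorm hN0 0, ← mul_assoc, ← ENNReal.ofReal_mul hN0.le,
      mul_inv_cancel₀ hN0.ne', ENNReal.ofReal_one, one_mul]
  have ig₁ : ∀ k, Integrable (g₁ k) := fun k =>
    ⟨(hg₁m k).aestronglyMeasurable, by
      show ∫⁻ σ, ‖g₁ k σ‖ₑ < ∞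
      rw [hmass]; exact (ig k).2⟩
  have pr : IsProfile (prof p ((lam * μ) ^ 5)⁻¹ t₀ u) g₁ := by
    refine ⟨hg₁m, by ext σ; simp [hg₁, hg.zero], fun t ht k => ?_⟩
    set x := t₀ * lam ^ 5 + t / N with hx
    have hδ : ((lam * μ) ^ 5)⁻¹ = (lam ^ 5)⁻¹ / N := by rw [hN]; field_simp
    have hδx : (lam ^ 5)⁻¹ * x = t₀ + ((lam * μ) ^ 5)⁻¹ * t := by
      rw [hδ, hx]; field_simp
    have hxm : x ∈ Icc (0 : ℝ) 1 := by
      have ht0 := ht.1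
      refine ⟨by positivity, ?_⟩
      have h1 : (lam ^ 5)⁻¹ * x ≤ (lam ^ 5)⁻¹ * 1 := by
        rw [hδx, mul_one]
        refine le_trans ?_ hT
        have : ((lam * μ) ^ 5)⁻¹ * t ≤ ((lam * μ) ^ 5)⁻¹ * 1 :=
          mul_le_mul_of_nonneg_left ht.2 (by positivity)
        linarith
      exact le_of_mul_le_mul_left h1 (by positivity)
    have h1 := hg.eq x hxm k
    have h2 : ∫ σ, osc t σ * g₁ k σ = osc t₀ (p k) * ∫ σ, osc x σ * g k σ := by
      have e : ∀ σ, osc t σ * g₁ k σ = osc t₀ (p k) * ((N : ℂ) * (fun σ => osc x σ * g k σ)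
          (N * σ + 0)) := fun σ => by
        have : osc x (N * σ) = osc t σ * osc (t₀ * lam ^ 5) (N * σ) := by
          rw [osc, osc, osc, ← Complex.exp_add]
          congr 1
          have hN' : (N : ℂ) ≠ 0 := by exact_mod_cast hN0.ne'
          rw [hx]
          push_cast
          field_simp
          ring
        simp only [hg₁, add_zero]
        rw [this]
        ring
      rw [integral_congr_ae (ae_of_all _ e), integral_const_mul, integral_const_mul,
        integral_comp_affine (fun σ => osc x σ * g k σ) hN0, Complex.real_smul,
        ← mul_assoc (N : ℂ), ← Complex.ofReal_mul, mul_inv_cancel₀ hN0.ne', Complex.ofReal_one,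
        one_mul]
    rw [h2, ← h1, prof, prof, zero_add, hδx, ← mul_assoc]
    congr 1
    rw [osc, osc, osc, ← Complex.exp_add]
    congr 1
    have hx2 : (x : ℂ) * (((lam ^ 5)⁻¹ : ℝ) : ℂ) = t₀ + (((lam * μ) ^ 5)⁻¹ : ℝ) * t := by
      rw [mul_comm]; exact_mod_cast hδx
    push_cast at hx2 ⊢
    linear_combination (Complex.I * (p k : ℂ)) * hx2
  have hl1 : l1Norm (latticeBr (-(3 / 2)) (lam * μ)) (fun k σ => ‖g₁ k σ‖ₑ) ≤
      ENNReal.ofReal (μ ^ (5 / 2 : ℝ)) * l1Norm (latticeBr (-(3 / 2)) lam) fun k σ => ‖g k σ‖ₑ := by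
    rw [l1Norm_eq_l2, l1Norm_eq_l2, ← l2_const_mul measurable_from_top.aemeasurable]
    refine l2_mono fun k => ?_
    rw [hmass, ← mul_assoc]
    gcongr 1
    refine (latticeBr_mul_le hμ k).trans ?_
    gcongr
    norm_num
  have hhi : seqNorm (latticeWeight (-(3 / 2)) 0 (lam * μ)) (latticeBr (-(3 / 2)) (lam * μ))
      (fun k => {σ : ℝ | 1 ≤ |σ|}.indicator fun σ => ‖g₁ k σ‖ₑ) ≤
      (ENNReal.ofReal (Real.exp 1) + 1) * ENNReal.ofReal (μ ^ (5 / 2 : ℝ)) *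
        seqNorm (latticeWeight (-(3 / 2)) 0 lam) (latticeBr (-(3 / 2)) lam)
        fun k σ => ‖g k σ‖ₑ := by
    rw [seqNorm_eq_l2, seqNorm_eq_l2, ← l2_const_mul measurable_from_top.aemeasurable]
    refine l2_mono fun k => ?_
    have hvm := (hgood lam k).meas
    have hgk := hg.meas k
    have hL2 : l2 volume (fun σ => latticeWeight (-(3 / 2)) 0 (lam * μ) k σ *
        {σ : ℝ | 1 ≤ |σ|}.indicator (fun σ => ‖g₁ k σ‖ₑ) σ) ≤
        ENNReal.ofReal (Real.exp 1) * ENNReal.ofReal (μ ^ (5 / 2 : ℝ)) *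
          l2 volume (fun σ => latticeWeight (-(3 / 2)) 0 lam k σ * ‖g k σ‖ₑ) := by
      rw [le_l2_iff, mul_pow, l2_sq]
      calc _ ≤ ∫⁻ σ, (ENNReal.ofReal (Real.exp 1) * ENNReal.ofReal N) ^ 2 *
            (fun σ => (latticeWeight (-(3 / 2)) 0 lam k σ * ‖g k σ‖ₑ) ^ 2) (N * σ + 0) := by
            refine lintegral_mono fun σ => ?_
            rw [← mul_pow]
            refine pow_le_pow_left' ?_ 2
            by_cases hσ : 1 ≤ |σ|
            · rw [indicator_of_mem (show σ ∈ {σ : ℝ | 1 ≤ |σ|} from hσ), hn]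
              have hw : latticeWeight (-(3 / 2)) 0 (lam * μ) k σ ≤
                  ENNReal.ofReal (Real.exp 1) * latticeWeight (-(3 / 2)) 0 lam k (N * σ + 0) := by
                rw [latticeWeight, latticeWeight, ← ENNReal.ofReal_mul (Real.exp_pos _).le,
                  Real.rpow_zero, Real.rpow_zero, one_mul, one_mul, add_zero, ← div_div]
                exact ENNReal.ofReal_le_ofReal (zWeight_div_le _ hμ hσ)
              refine (mul_le_mul_left hw _).trans_eq (by ring)
            · rw [indicator_of_notMem (show σ ∉ {σ : ℝ | 1 ≤ |σ|} from hσ), mul_zero]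
              exact bot_le
        _ = _ := by
            rw [lintegral_const_mul' _ _ (by finiteness), lintegral_comp_affine (f := fun σ =>
              (latticeWeight (-(3 / 2)) 0 lam k σ * ‖g k σ‖ₑ) ^ 2) (by fun_prop) hN0 0, ← mul_assoc]
            congr 1
            -- The dilation N g(Nσ) multiplies L² norms by N^{1/2} = μ^{5/2}, the dominant loss. The
            -- L¹ part only loses μ^{3/2}, through its frequency weight.
            have hr : (μ ^ (5 / 2 : ℝ)) ^ 2 = N ^ 2 * N⁻¹ := by
              rw [← Real.rpow_natCast (μ ^ (5 / 2 : ℝ)), ← Real.rpow_mul hμ0.le,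
                show N ^ 2 * N⁻¹ = μ ^ (5 : ℕ) by rw [← hN]; field_simp, ← Real.rpow_natCast μ]
              norm_num
            rw [mul_pow, mul_pow, mul_assoc, ← ENNReal.ofReal_pow hN0.le,
              ← ENNReal.ofReal_mul (by positivity), ← ENNReal.ofReal_pow (by positivity) (n := 2)
                (p := μ ^ (5 / 2 : ℝ)), hr]
    have hL1 : latticeBr (-(3 / 2)) (lam * μ) k * ∫⁻ σ,
        {σ : ℝ | 1 ≤ |σ|}.indicator (fun σ => ‖g₁ k σ‖ₑ) σ ≤
        ENNReal.ofReal (μ ^ (5 / 2 : ℝ)) * (latticeBr (-(3 / 2)) lam k * ∫⁻ σ, ‖g k σ‖ₑ) := by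
      rw [← hmass, ← mul_assoc]
      gcongr 1
      · refine (latticeBr_mul_le hμ k).trans ?_
        gcongr
        norm_num
      · exact lintegral_mono fun σ => indicator_le_self _ _ _
    unfold modeNorm
    calc _ ≤ _ := add_le_add hL2 hL1
      _ ≤ (ENNReal.ofReal (Real.exp 1) + 1) * ENNReal.ofReal (μ ^ (5 / 2 : ℝ)) *
            l2 volume (fun σ => latticeWeight (-(3 / 2)) 0 lam k σ * ‖g k σ‖ₑ) +
          (ENNReal.ofReal (Real.exp 1) + 1) * ENNReal.ofReal (μ ^ (5 / 2 : ℝ)) *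
            (latticeBr (-(3 / 2)) lam k * ∫⁻ σ, ‖g k σ‖ₑ) := by
          gcongr
          · exact le_self_add
          · exact le_mul_of_one_le_left' le_add_self
      _ = _ := by ring
  calc _ ≤ _ := hC _ _ (hgood _) _ _ pr ig₁
    _ ≤ C * (ENNReal.ofReal (μ ^ (5 / 2 : ℝ)) *
          seqNorm (latticeWeight (-(3 / 2)) 0 lam) (latticeBr (-(3 / 2)) lam) fun k σ => ‖g k σ‖ₑ) +
        (ENNReal.ofReal (Real.exp 1) + 1) * ENNReal.ofReal (μ ^ (5 / 2 : ℝ)) *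
          seqNorm (latticeWeight (-(3 / 2)) 0 lam) (latticeBr (-(3 / 2)) lam)
          fun k σ => ‖g k σ‖ₑ := by
        gcongr
        refine hl1.trans ?_
        gcongr
        exact l1Norm_le_seqNorm _ _ _
    _ = _ := by
        push_cast
        rw [ENNReal.coe_toNNReal ENNReal.ofReal_ne_top]
        ring

section

/-! ### The integral equation for profiles -/

/-- Homogeneity: dividing the frequencies by λ and the modulations by λ⁵ preserves α and turns β
into β/λ². -/
lemma latticeRes_eq (α β : ℝ) {lam : ℝ} (hlam : lam ≠ 0) (k k₁ : ℤ) :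
    latticeRes α (β / lam ^ 2) lam k k₁ =
      (lam ^ 5)⁻¹ * (disp α β k - disp α β k₁ - disp α β (k - k₁)) := by
  simp only [latticeRes, resonance, phase, disp]
  push_cast
  field_simp

lemma osc_add_left (t t' σ : ℝ) : osc (t + t') σ = osc t σ * osc t' σ := by
  rw [osc, osc, osc, ← Complex.exp_add]; congr 1; push_cast; ring

lemma osc_mul_osc_neg (t σ : ℝ) : osc t σ * osc t (-σ) = 1 := by
  rw [← osc_add, add_neg_cancel, osc_zero]

lemma osc_mul_left (c t σ : ℝ) : osc t (c * σ) = osc (c * t) σ := by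
  rw [osc, osc]; congr 1; push_cast; ring

lemma interaction_eq (p : ℤ → ℝ) (u : ℝ → ℤ → ℂ) (t : ℝ) (k k₁ : ℤ) :
    interaction p u t k k₁ = ((Real.sqrt (2 * Real.pi))⁻¹ : ℝ) *
      (osc t (p k) * ∫ t' in (0 : ℝ)..t, osc t' (-p k) * (u t' k₁ * u t' (k - k₁))) := by
  rw [interaction]
  congr 1
  rw [← intervalIntegral.integral_const_mul]
  apply intervalIntegral.integral_congr
  intro t' _
  dsimp only
  rw [← mul_assoc (osc _ _), osc, osc, ← Complex.exp_add]
  congr 2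
  push_cast
  ring

section

variable {p : ℤ → ℝ} {δ t₀ : ℝ} {u : ℝ → ℤ → ℂ} {Φ : ℤ → ℤ → ℝ} {γ : ℝ} {u₀ : ℤ → ℂ}

/-- The phases of the kernel and of the two profiles combine to e^{-iτp(k)} at the original time τ =
t₀ + δt', up to the constant phase e^{it₀p(k)}. -/
lemma duhamelTerm_prof (hδ : 0 < δ) (hΦ : ∀ k k₁, Φ k k₁ = δ * (p k - p k₁ - p (k - k₁))) (t : ℝ)
    (k k₁ : ℤ) : δ * duhamelTerm Φ (prof p δ t₀ u) (prof p δ t₀ u) t k k₁ =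
      osc t₀ (p k) * ∫ τ in t₀..(t₀ + δ * t), osc τ (-p k) * (u τ k₁ * u τ (k - k₁)) := by
  have e : ∀ t', osc t' (-Φ k k₁) * (prof p δ t₀ u t' k₁ * prof p δ t₀ u t' (k - k₁)) =
      osc t₀ (p k) * (fun τ => osc τ (-p k) * (u τ k₁ * u τ (k - k₁))) (δ * t' + t₀) := fun t' => by
    have h1 : osc t' (-Φ k k₁) * (osc t' (-(δ * p k₁)) * osc t' (-(δ * p (k - k₁)))) =
        osc t₀ (p k) * osc (δ * t' + t₀) (-p k) := by
      rw [← osc_add, ← osc_add, osc_add_left, mul_left_comm, osc_mul_osc_neg, mul_one, hΦ,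
        ← osc_mul_left]
      congr 1
      ring
    simp only [prof]
    rw [add_comm t₀, ← mul_assoc (osc t₀ _), ← h1]
    ring
  rw [duhamelTerm, intervalIntegral.integral_congr (fun t' _ => e t'),
    intervalIntegral.integral_const_mul,
    intervalIntegral.integral_comp_mul_add
      (fun τ => osc τ (-p k) * (u τ k₁ * u τ (k - k₁))) hδ.ne',
    Complex.real_smul, mul_zero, zero_add, add_comm (δ * t)]
  have : (δ : ℂ) ≠ 0 := by exact_mod_cast hδ.ne'
  push_cast
  field_simp

/-- This allows the equation to be restarted at t₀: with the linear evolution undone, two Duhamel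
integrals differ by the integral over the time in between. -/
lemma interaction_shift (hδ : 0 < δ) (ht₀ : 0 ≤ t₀)
    (hΦ : ∀ k k₁, Φ k k₁ = δ * (p k - p k₁ - p (k - k₁)))
    (hu : ∀ k, ContinuousOn (fun t => u t k) (Icc 0 (t₀ + δ))) {t : ℝ} (ht : t ∈ Icc (0 : ℝ) 1)
    (k k₁ : ℤ) :
    osc (δ * t) (-p k) * interaction p u (t₀ + δ * t) k k₁ - interaction p u t₀ k k₁ =
      ((Real.sqrt (2 * Real.pi))⁻¹ : ℝ) *
        (δ * duhamelTerm Φ (prof p δ t₀ u) (prof p δ t₀ u) t k k₁) := by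
  have h0 : 0 ≤ δ * t := mul_nonneg hδ.le ht.1
  have h1 : δ * t ≤ δ := mul_le_of_le_one_right hδ.le ht.2
  have hc : ContinuousOn (fun τ => osc τ (-p k) * (u τ k₁ * u τ (k - k₁))) (Icc 0 (t₀ + δ)) := by
    have h1 : Continuous fun t' => osc t' (-p k) := by unfold osc; fun_prop
    exact h1.continuousOn.mul ((hu _).mul (hu _))
  have hi : ∀ x y, 0 ≤ x → x ≤ y → y ≤ t₀ + δ →
      IntervalIntegrable (fun τ => osc τ (-p k) * (u τ k₁ * u τ (k - k₁))) volume x y := by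
    intro x y hx hxy hy
    refine (hc.mono ?_).intervalIntegrable
    rw [uIcc_of_le hxy]
    exact Icc_subset_Icc hx hy
  have hadd := intervalIntegral.integral_add_adjacent_intervals
    (hi 0 t₀ le_rfl ht₀ (by linarith)) (hi t₀ (t₀ + δ * t) ht₀ (by linarith) (by linarith))
  rw [duhamelTerm_prof hδ hΦ, interaction_eq, interaction_eq, ← hadd, osc_add_left]
  have := osc_mul_osc_neg (δ * t) (p k)
  linear_combination (((Real.sqrt (2 * Real.pi))⁻¹ : ℝ) * osc t₀ (p k) *
    ((∫ τ in (0 : ℝ)..t₀, osc τ (-p k) * (u τ k₁ * u τ (k - k₁))) +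
      ∫ τ in t₀..(t₀ + δ * t), osc τ (-p k) * (u τ k₁ * u τ (k - k₁)))) * this

lemma exp_eq_osc (x t : ℝ) : Complex.exp (Complex.I * (x : ℂ) * (t : ℂ)) = osc t x := by
  rw [osc]; ring_nf

lemma duhamelCoeff_eq (γ lam : ℝ) (k : ℤ) (S : ℂ) : duhamelCoeff γ lam k * S =
    -((γ : ℂ) * (Complex.I * k)) * (((Real.sqrt (2 * Real.pi))⁻¹ : ℝ) * (((lam ^ 5)⁻¹ : ℝ) * S)) := by
  rw [duhamelCoeff]
  push_cast
  ring

end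

/-- The profile of a solution solves a fixed point equation on each subinterval. -/
theorem Duhamel.prof_eq {α β γ T lam t₀ : ℝ} {u₀ : ℤ → ℂ} {u : ℝ → ℤ → ℂ}
    (h : Duhamel (disp α β) γ T u₀ u) (hu : ∀ k, ContinuousOn (fun t => u t k) (Icc 0 T))
    (hlam : 0 < lam) (ht₀ : 0 ≤ t₀) (hT : t₀ + (lam ^ 5)⁻¹ ≤ T) {t : ℝ} (ht : t ∈ Icc (0 : ℝ) 1) :
    prof (disp α β) (lam ^ 5)⁻¹ t₀ u t = u t₀ +
      duhamelOp (latticeRes α (β / lam ^ 2) lam) (duhamelCoeff γ lam)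
        (prof (disp α β) (lam ^ 5)⁻¹ t₀ u) (prof (disp α β) (lam ^ 5)⁻¹ t₀ u) t := by
  set p := disp α β
  set δ := (lam ^ 5)⁻¹ with hδ'
  have hδ : 0 < δ := by positivity
  have h0 : 0 ≤ δ * t := mul_nonneg hδ.le ht.1
  have h1 : δ * t ≤ δ := mul_le_of_le_one_right hδ.le ht.2
  have m₀ : t₀ ∈ Icc 0 T := ⟨ht₀, by linarith⟩
  have m₁ : t₀ + δ * t ∈ Icc 0 T := ⟨by linarith, by linarith⟩
  ext k
  rw [Pi.add_apply]
  rcases eq_or_ne k 0 with rfl | hk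
  · rw [duhamelOp, prof, (h _ m₁).1, (h _ m₀).1]
    simp [duhamelCoeff]
  obtain ⟨S₀, hS₀, e₀⟩ := (h _ m₀).2 k hk
  obtain ⟨S₁, hS₁, e₁⟩ := (h _ m₁).2 k hk
  -- Convergence of the sum over interactions on the subinterval is inherited from the two sums at
  -- its ends; no estimate is needed here.
  have hsum := (hS₁.mul_left (osc (δ * t) (-p k))).sub hS₀
  have e := interaction_shift hδ ht₀ (latticeRes_eq α β hlam.ne')
    (fun k => (hu k).mono (Icc_subset_Icc_right hT)) ht k
  rw [funext e] at hsum
  have hS := hsum.tsum_eq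
  rw [tsum_mul_left, tsum_mul_left] at hS
  rw [duhamelOp, duhamelCoeff_eq, hS, prof, e₀, e₁, exp_eq_osc, exp_eq_osc, osc_add_left,
    ← mul_neg, osc_mul_left]
  have := osc_mul_osc_neg (δ * t) (p k)
  linear_combination (osc t₀ (p k) * u₀ k) * this

/-- A solution of the fixed point equation gives a solution of the integral equation. -/
theorem duhamel_of_fixedPoint {α β γ lam : ℝ} (hlam : 0 < lam) {v : ℤ → ℝ → ℝ≥0∞} {y : ℤ → ℝ≥0∞}
    {θ : ℝ≥0∞} (hop : OpBound (latticeRes α (β / lam ^ 2) lam) (duhamelCoeff γ lam) v y θ)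
    {a : ℝ → ℤ → ℂ} (ha : profNorm v y a < ∞) {u₀ : ℤ → ℂ} (hu₀ : u₀ 0 = 0)
    (hfix : ∀ t ∈ Icc (0 : ℝ) 1, a t = u₀ +
      duhamelOp (latticeRes α (β / lam ^ 2) lam) (duhamelCoeff γ lam) a a t)
    {u : ℝ → ℤ → ℂ} (hua : prof (disp α β) (lam ^ 5)⁻¹ 0 u = a) :
    Duhamel (disp α β) γ (lam ^ 5)⁻¹ u₀ u := by
  set p := disp α β
  set δ := (lam ^ 5)⁻¹ with hδ'
  have hδ : 0 < δ := by positivity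
  have hua' : ∀ t k, u t k = osc t (p k) * a (t / δ) k := fun t k => by
    rw [← hua, prof, zero_add, mul_div_cancel₀ _ hδ.ne', ← mul_neg, osc_mul_left,
      mul_div_cancel₀ _ hδ.ne', ← mul_assoc, osc_mul_osc_neg, one_mul]
  have hmem : ∀ {t}, t ∈ Icc 0 δ → t / δ ∈ Icc (0 : ℝ) 1 := fun ht =>
    ⟨div_nonneg ht.1 hδ.le, (div_le_one hδ).2 ht.2⟩
  have hcont : ∀ k, ContinuousOn (fun t => u t k) (Icc 0 (0 + δ)) := fun k => by
    simp_rw [hua', zero_add]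
    have h1 : Continuous fun t' => osc t' (p k) := by unfold osc; fun_prop
    refine h1.continuousOn.mul ((continuousOn_of_profNorm hop.good ha k).comp
      (continuous_id.div_const δ).continuousOn fun t ht => hmem ht)
  intro t ht
  have ht' := hmem ht
  refine ⟨?_, fun k hk => ?_⟩
  · rw [hua', hfix _ ht', Pi.add_apply, hu₀, duhamelOp, hop.coeff_zero, zero_mul, add_zero, mul_zero]
  have e : ∀ k₁, interaction p u t k k₁ = osc t (p k) * (((Real.sqrt (2 * Real.pi))⁻¹ : ℝ) *
      (δ * duhamelTerm (latticeRes α (β / lam ^ 2) lam) a a (t / δ) k k₁)) := fun k₁ => by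
    have h1 := interaction_shift hδ le_rfl (latticeRes_eq α β hlam.ne') hcont ht' k k₁
    have h2 : interaction p u 0 k k₁ = 0 := by rw [interaction, intervalIntegral.integral_same, mul_zero]
    rw [hua, zero_add, mul_div_cancel₀ _ hδ.ne', h2, sub_zero] at h1
    rw [← h1, ← mul_assoc, osc_mul_osc_neg, one_mul]
  have hs := (hop.summable a a ha ha k hk _ ht').hasSum
  refine ⟨_, (((hs.mul_left (δ : ℂ)).mul_left _).mul_left _).congr_fun e, ?_⟩
  rw [hua', hfix _ ht', Pi.add_apply, duhamelOp, duhamelCoeff_eq, exp_eq_osc]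
  ring

end

section

/-! ### Comparison of the weights -/

lemma one_le_bracket (x : ℝ) : 1 ≤ bracket x := Real.one_le_sqrt.2 (by nlinarith [sq_nonneg x])

lemma bracket_pos (x : ℝ) : 0 < bracket x := one_pos.trans_le (one_le_bracket x)

lemma abs_le_bracket (x : ℝ) : |x| ≤ bracket x := Real.abs_le_sqrt (by linarith)

lemma bracket_le (x : ℝ) : bracket x ≤ 1 + |x| :=
  Real.sqrt_le_iff.2 ⟨by positivity, by nlinarith [abs_nonneg x, sq_abs x]⟩

lemma log_bracket_nonneg (x : ℝ) : 0 ≤ Real.log (bracket x) := Real.log_nonneg (one_le_bracket x)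

lemma bracket_rpow (x r : ℝ) : bracket x ^ r = Real.exp (r * Real.log (bracket x)) := by
  rw [Real.rpow_def_of_pos (bracket_pos x), mul_comm]

section Logs

variable {lam : ℝ} (hlam : 1 ≤ lam)
include hlam

lemma log_freqBr_le (x : ℝ) : Real.log (freqBr (x / lam)) ≤ Real.log (bracket x) := by
  have hlam0 : 0 < lam := by linarith
  refine Real.log_le_log (freqBr_pos _) (max_le (one_le_bracket x) ?_)
  rw [abs_div, abs_of_pos hlam0]
  exact (div_le_self (abs_nonneg x) hlam).trans (abs_le_bracket x)

lemma log_bracket_le_log_freqBr (x : ℝ) :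
    Real.log (bracket x) ≤ Real.log (freqBr (x / lam)) + Real.log (2 * lam) := by
  have hlam0 : 0 < lam := by linarith
  rw [← Real.log_mul (freqBr_pos _).ne' (by positivity)]
  refine Real.log_le_log (bracket_pos x) ((bracket_le x).trans ?_)
  have h1 := one_le_freqBr (x / lam)
  have h2 := abs_le_freqBr (x / lam)
  rw [abs_div, abs_of_pos hlam0, div_le_iff₀ hlam0] at h2
  nlinarith

lemma log_modBr_le (x : ℝ) :
    Real.log (modBr (x / lam ^ 5)) ≤ Real.log (bracket x) + 5 * Real.log (2 * lam) := by
  have h5 : 1 ≤ lam ^ 5 := one_le_pow₀ hlam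
  have h1 : Real.log (modBr (x / lam ^ 5)) ≤ Real.log (2 * bracket x) := by
    refine Real.log_le_log (modBr_pos _) ?_
    have h2 : |x / lam ^ 5| ≤ |x| := by
      rw [abs_div, abs_of_pos (by linarith : 0 < lam ^ 5)]
      exact div_le_self (abs_nonneg x) h5
    rw [modBr]
    linarith [one_le_bracket x, abs_le_bracket x]
  have h3 : Real.log 2 ≤ Real.log (2 * lam) := Real.log_le_log two_pos (by linarith)
  rw [Real.log_mul two_ne_zero (bracket_pos x).ne'] at h1
  linarith [Real.log_pos one_lt_two]

lemma log_bracket_le_log_modBr (x : ℝ) :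
    Real.log (bracket x) ≤ Real.log (modBr (x / lam ^ 5)) + 5 * Real.log (2 * lam) := by
  have hlam0 : 0 < lam := by linarith
  have h : Real.log (bracket x) ≤ Real.log (modBr (x / lam ^ 5) * (2 * lam) ^ 5) := by
    refine Real.log_le_log (bracket_pos x) ((bracket_le x).trans ?_)
    have h5 : 1 ≤ lam ^ 5 := one_le_pow₀ hlam
    have h0 := abs_nonneg x
    rw [modBr, abs_div, abs_of_pos (by positivity : 0 < lam ^ 5), mul_pow, add_mul,
      show |x| / lam ^ 5 * (2 ^ 5 * lam ^ 5) = 32 * |x| by field_simp; norm_num]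
    linarith
  rwa [Real.log_mul (modBr_pos _).ne' (by positivity), Real.log_pow] at h

end Logs

section Regions

variable {s j a j' a' L K : ℝ} (hs : -(3 / 2) ≤ s) (hs' : s ≤ -1) (hj : 0 ≤ j) (hL : 0 ≤ L)
  (h1 : j ≤ j') (h2 : j' ≤ j + L) (h3 : a ≤ a' + 5 * L) (h4 : a' ≤ a + 5 * L)
include hs hs' hj hL h1 h2 h3 h4

/-- The corners of the weight in rescaled variables and the boundaries of the regions in the
original ones differ by O(L + K). As the linear forms agree at the corners, using a neighbouring
form costs no more than that. The two lemmas below treat the other regions in the same way. -/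
lemma abs_logWeight_sub_small (hK : 0 ≤ K) (h : a' ≤ 4 * j' + K) :
    |logWeight s j a - (s * j' + 3 / 4 * a')| ≤ 28 * L + 2 * K := by
  have u1 : 0 ≤ s + 3 / 2 := by linarith
  have u2 : 0 ≤ -1 - s := by linarith
  have e1 : |logWeight s j a - (s * j + 3 / 4 * a)| ≤ 20 * L + 2 * K := by
    unfold logWeight
    rw [abs_le]
    split_ifs with c1 c2
    · constructor <;> linarith
    · have := not_le.1 c1
      constructor <;> nlinarith
    · have := not_le.1 c1
      have := not_le.1 c2
      constructor <;> nlinarith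
  rw [abs_le] at e1 ⊢
  constructor <;> nlinarith

omit hj in
lemma abs_logWeight_sub_middle (hK : 0 ≤ K) (h : 4 * j' ≤ a' + K) (h' : a' ≤ 5 * j' + K) :
    |logWeight s j a - ((-3 * s - 1) * j' + (s + 1) * a')| ≤ 28 * L + 2 * K := by
  have u1 : 0 ≤ s + 3 / 2 := by linarith
  have u2 : 0 ≤ -1 - s := by linarith
  have e1 : |logWeight s j a - ((-3 * s - 1) * j + (s + 1) * a)| ≤ 20 * L + 2 * K := by
    unfold logWeight
    rw [abs_le]
    split_ifs with c1 c2
    · constructor <;> nlinarith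
    · constructor <;> linarith
    · have := not_le.1 c2
      constructor <;> nlinarith
  rw [abs_le] at e1 ⊢
  constructor <;> nlinarith

lemma abs_logWeight_sub_large (hK : 0 ≤ K) (h : 5 * j' ≤ a' + K) :
    |logWeight s j a - ((-s / 2 - 1) * j' + (s / 2 + 1) * a')| ≤ 28 * L + 2 * K := by
  have u1 : 0 ≤ s + 3 / 2 := by linarith
  have u2 : 0 ≤ -1 - s := by linarith
  have e1 : |logWeight s j a - ((-s / 2 - 1) * j + (s / 2 + 1) * a)| ≤ 20 * L + 2 * K := by
    unfold logWeight
    rw [abs_le]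
    split_ifs with c1 c2
    · constructor <;> nlinarith
    · constructor <;> nlinarith
    · constructor <;> linarith
  rw [abs_le] at e1 ⊢
  constructor <;> nlinarith

end Regions

lemma log_bracket_le_of_le {x y : ℝ} {n : ℕ} (h : |x| ≤ |y| ^ n / 10) :
    Real.log (bracket x) ≤ n * Real.log (bracket y) + Real.log 320 := by
  have hy := bracket_pos y
  rw [← Real.log_pow, ← Real.log_mul (by positivity) (by norm_num)]
  refine Real.log_le_log (bracket_pos x) ((bracket_le x).trans ?_)
  have h1 : |y| ^ n ≤ bracket y ^ n := pow_le_pow_left₀ (abs_nonneg y) (abs_le_bracket y) n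
  have h2 : 1 ≤ bracket y ^ n := one_le_pow₀ (one_le_bracket y)
  linarith

/-- For |y| ≥ 1 one has ⟨y⟩ ≤ 2|y|, and 320 = 2⁵ · 10; for |y| ≤ 1 the left side is bounded by a
constant. -/
lemma log_bracket_le_of_ge {x y : ℝ} {n : ℕ} (hn : n ≤ 5)
    (h : |y| ^ n / 10 ≤ |x| ∧ 1 ≤ |y| ∨ |y| ≤ 1) :
    n * Real.log (bracket y) ≤ Real.log (bracket x) + Real.log 320 := by
  have hy := bracket_pos y
  rw [← Real.log_pow, ← Real.log_mul (bracket_pos x).ne' (by norm_num)]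
  refine Real.log_le_log (by positivity) ?_
  have h2 : (2 : ℝ) ^ n ≤ 2 ^ 5 := pow_le_pow_right₀ one_le_two hn
  rcases h with ⟨h, h1⟩ | h
  · calc bracket y ^ n ≤ (2 * |y|) ^ n := by gcongr; linarith [bracket_le y]
      _ = 2 ^ n * |y| ^ n := mul_pow _ _ _
      _ ≤ 2 ^ 5 * |y| ^ n := by gcongr
      _ ≤ _ := by linarith [abs_le_bracket x]
  · calc bracket y ^ n ≤ 2 ^ n := by gcongr; linarith [bracket_le y]
      _ ≤ _ := by linarith [one_le_bracket x]

/-- The derivatives of the three forms in s are j, a - 3j and (a - j)/2, all nonnegative in their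
regions. Hence Z^s embeds into Z^{-3/2}. -/
lemma logWeight_mono {s j a : ℝ} (hs : -(3 / 2) ≤ s) (hj : 0 ≤ j) (ha : 0 ≤ a) :
    logWeight (-(3 / 2)) j a ≤ logWeight s j a := by
  have u : 0 ≤ s + 3 / 2 := by linarith
  unfold logWeight
  split_ifs with c1 c2
  · nlinarith
  · have := not_le.1 c1
    nlinarith
  · have := not_le.1 c2
    nlinarith

lemma le_logWeight_neg_one {j a : ℝ} (hj : 0 ≤ j) (ha : 0 ≤ a) :
    -j + a / 2 ≤ logWeight (-1) j a := by
  unfold logWeight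
  split_ifs <;> linarith

end

/-! ### Comparison of the norms -/

/-- The norm `ℓ²L²` with a weight. -/
def rawNorm (w : ℤ → ℝ → ℝ≥0∞) (f : ℤ → ℝ → ℂ) : ℝ≥0∞ :=
  (∑' k, ∫⁻ τ, (w k τ * ‖f k τ‖ₑ) ^ 2) ^ (1 / 2 : ℝ)

lemma rpow_half_sq (x : ℝ≥0∞) : (x ^ (1 / 2 : ℝ)) ^ 2 = x := by
  rw [← ENNReal.rpow_natCast, ← ENNReal.rpow_mul]; norm_num

lemma rpow_half_le_iff {x y : ℝ≥0∞} : x ^ (1 / 2 : ℝ) ≤ y ↔ x ≤ y ^ 2 := by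
  rw [one_div, ENNReal.rpow_inv_le_iff two_pos, ENNReal.rpow_two]

lemma xNorm_le_rawNorm {p : ℤ → ℝ} {σ b : ℝ} {D : Set (ℝ × ℤ)}
    (hD : ∀ k, MeasurableSet {τ | (τ, k) ∈ D}) {w : ℤ → ℝ → ℝ≥0∞} {C : ℝ≥0}
    (h : ∀ k τ, (τ, k) ∈ D → ENNReal.ofReal (bracket k ^ σ * bracket (τ - p k) ^ b) ≤ C * w k τ)
    (f : ℤ → ℝ → ℂ) : xNorm p σ b D f ≤ C * rawNorm w f := by
  rw [xNorm, rpow_half_le_iff, mul_pow, rawNorm, rpow_half_sq, ← ENNReal.tsum_mul_left]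
  refine ENNReal.tsum_le_tsum fun k => ?_
  rw [← lintegral_const_mul' _ _ (by finiteness)]
  refine (setLIntegral_mono' (hD k) fun τ hτ => ?_).trans (setLIntegral_le_lintegral _ _)
  rw [← mul_pow, ← mul_assoc]
  gcongr
  exact h k τ hτ

lemma setLIntegral_le_xNorm {p : ℤ → ℝ} {σ b : ℝ} {D : Set (ℝ × ℤ)}
    (hD : ∀ k, MeasurableSet {τ | (τ, k) ∈ D}) {w : ℤ → ℝ → ℝ≥0∞} {C : ℝ≥0}
    (h : ∀ k τ, (τ, k) ∈ D → w k τ ≤ C * ENNReal.ofReal (bracket k ^ σ * bracket (τ - p k) ^ b))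
    (f : ℤ → ℝ → ℂ) :
    ∑' k, ∫⁻ τ in {τ | (τ, k) ∈ D}, (w k τ * ‖f k τ‖ₑ) ^ 2 ≤ (C * xNorm p σ b D f) ^ 2 := by
  rw [xNorm, mul_pow, rpow_half_sq, ← ENNReal.tsum_mul_left]
  refine ENNReal.tsum_le_tsum fun k => ?_
  rw [← lintegral_const_mul' _ _ (by finiteness)]
  refine setLIntegral_mono' (hD k) fun τ hτ => ?_
  rw [← mul_pow, ← mul_assoc]
  gcongr
  exact h k τ hτ

lemma measurableSet_D₁ (p : ℤ → ℝ) (k : ℤ) : MeasurableSet {τ | (τ, k) ∈ D₁ p} := by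
  have e : {τ | (τ, k) ∈ D₁ p} =
      {τ : ℝ | |τ - p k| ≤ |(k : ℝ)| ^ 4 / 10} ∩ {_τ : ℝ | 1 ≤ |(k : ℝ)|} := Set.ext fun τ => Iff.rfl
  rw [e]
  exact (measurableSet_le (by fun_prop) measurable_const).inter (MeasurableSet.const _)

lemma measurableSet_D₂ (p : ℤ → ℝ) (k : ℤ) : MeasurableSet {τ | (τ, k) ∈ D₂ p} := by
  have e : {τ | (τ, k) ∈ D₂ p} = {τ : ℝ | |(k : ℝ)| ^ 4 / 10 ≤ |τ - p k|} ∩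
      ({τ : ℝ | |τ - p k| ≤ |(k : ℝ)| ^ 5 / 10} ∩ {_τ : ℝ | 1 ≤ |(k : ℝ)|}) :=
    Set.ext fun τ => Iff.rfl
  rw [e]
  exact (measurableSet_le measurable_const (by fun_prop)).inter
    ((measurableSet_le (by fun_prop) measurable_const).inter (MeasurableSet.const _))

lemma measurableSet_D₃ (p : ℤ → ℝ) (k : ℤ) : MeasurableSet {τ | (τ, k) ∈ D₃ p} := by
  have e : {τ | (τ, k) ∈ D₃ p} =
      {τ : ℝ | |(k : ℝ)| ^ 5 / 10 ≤ |τ - p k|} ∪ {_τ : ℝ | |(k : ℝ)| ≤ 1} := Set.ext fun τ => Iff.rfl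
  rw [e]
  exact (measurableSet_le measurable_const (by fun_prop)).union (MeasurableSet.const _)

lemma mem_D_cover (p : ℤ → ℝ) (τ : ℝ) (k : ℤ) : (τ, k) ∈ D₁ p ∨ (τ, k) ∈ D₂ p ∨ (τ, k) ∈ D₃ p := by
  simp only [D₁, D₂, D₃, mem_ofPred_eq]
  rcases le_total |(k : ℝ)| 1 with h | h
  · exact Or.inr (Or.inr (Or.inr h))
  rcases le_total |τ - p k| (|(k : ℝ)| ^ 4 / 10) with h1 | h1
  · exact Or.inl ⟨h1, h⟩
  rcases le_total |τ - p k| (|(k : ℝ)| ^ 5 / 10) with h2 | h2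
  · exact Or.inr (Or.inl ⟨h1, h2, h⟩)
  · exact Or.inr (Or.inr (Or.inl h2))

lemma rawNorm_le_xNorm {p : ℤ → ℝ} {s : ℝ} {w : ℤ → ℝ → ℝ≥0∞} {C : ℝ≥0}
    (h₁ : ∀ k τ, (τ, k) ∈ D₁ p →
      w k τ ≤ C * ENNReal.ofReal (bracket k ^ s * bracket (τ - p k) ^ (3 / 4 : ℝ)))
    (h₂ : ∀ k τ, (τ, k) ∈ D₂ p →
      w k τ ≤ C * ENNReal.ofReal (bracket k ^ (-3 * s - 1) * bracket (τ - p k) ^ (s + 1)))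
    (h₃ : ∀ k τ, (τ, k) ∈ D₃ p →
      w k τ ≤ C * ENNReal.ofReal (bracket k ^ (-s / 2 - 1) * bracket (τ - p k) ^ (s / 2 + 1)))
    (f : ℤ → ℝ → ℂ) :
    rawNorm w f ≤ C * (xNorm p s (3 / 4) (D₁ p) f + xNorm p (-3 * s - 1) (s + 1) (D₂ p) f +
      xNorm p (-s / 2 - 1) (s / 2 + 1) (D₃ p) f) := by
  have b₁ := setLIntegral_le_xNorm (measurableSet_D₁ p) h₁ f
  have b₂ := setLIntegral_le_xNorm (measurableSet_D₂ p) h₂ f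
  have b₃ := setLIntegral_le_xNorm (measurableSet_D₃ p) h₃ f
  rw [rawNorm, rpow_half_le_iff]
  set x₁ := xNorm p s (3 / 4) (D₁ p) f
  set x₂ := xNorm p (-3 * s - 1) (s + 1) (D₂ p) f
  set x₃ := xNorm p (-s / 2 - 1) (s / 2 + 1) (D₃ p) f
  calc _ ≤ ∑' k, ((∫⁻ τ in {τ | (τ, k) ∈ D₁ p}, (w k τ * ‖f k τ‖ₑ) ^ 2) +
        ((∫⁻ τ in {τ | (τ, k) ∈ D₂ p}, (w k τ * ‖f k τ‖ₑ) ^ 2) +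
          ∫⁻ τ in {τ | (τ, k) ∈ D₃ p}, (w k τ * ‖f k τ‖ₑ) ^ 2)) := by
        refine ENNReal.tsum_le_tsum fun k => ?_
        have hu : (univ : Set ℝ) = {τ | (τ, k) ∈ D₁ p} ∪ ({τ | (τ, k) ∈ D₂ p} ∪ {τ | (τ, k) ∈ D₃ p}) :=
          (eq_univ_of_forall fun τ => mem_D_cover p τ k).symm
        rw [← setLIntegral_univ, hu]
        refine (lintegral_union_le _ _ _).trans ?_
        gcongr
        exact lintegral_union_le _ _ _
    _ ≤ (C * x₁) ^ 2 + ((C * x₂) ^ 2 + (C * x₃) ^ 2) := by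
        rw [ENNReal.tsum_add, ENNReal.tsum_add]
        gcongr
    _ ≤ (C * x₁) ^ 2 + ((C * x₂) ^ 2 + (C * x₃) ^ 2) + 2 * C ^ 2 * (x₁ * x₂ + x₂ * x₃ + x₁ * x₃) :=
        le_self_add
    _ = _ := by ring

/-- The comparison of the weights on the three regions. -/
lemma exists_zWeight_compare {s : ℝ} (hs : -(3 / 2) ≤ s) (hs' : s ≤ -1) {lam : ℝ} (hlam : 1 ≤ lam) :
    ∃ C : ℝ≥0, ∀ (p : ℤ → ℝ) (k : ℤ) (τ : ℝ),
      ((τ, k) ∈ D₁ p → zWeight s (k / lam) ((τ - p k) / lam ^ 5) ≤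
          C * (bracket k ^ s * bracket (τ - p k) ^ (3 / 4 : ℝ)) ∧
        bracket k ^ s * bracket (τ - p k) ^ (3 / 4 : ℝ) ≤
          C * zWeight s (k / lam) ((τ - p k) / lam ^ 5)) ∧
      ((τ, k) ∈ D₂ p → zWeight s (k / lam) ((τ - p k) / lam ^ 5) ≤
          C * (bracket k ^ (-3 * s - 1) * bracket (τ - p k) ^ (s + 1)) ∧
        bracket k ^ (-3 * s - 1) * bracket (τ - p k) ^ (s + 1) ≤
          C * zWeight s (k / lam) ((τ - p k) / lam ^ 5)) ∧
      ((τ, k) ∈ D₃ p → zWeight s (k / lam) ((τ - p k) / lam ^ 5) ≤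
          C * (bracket k ^ (-s / 2 - 1) * bracket (τ - p k) ^ (s / 2 + 1)) ∧
        bracket k ^ (-s / 2 - 1) * bracket (τ - p k) ^ (s / 2 + 1) ≤
          C * zWeight s (k / lam) ((τ - p k) / lam ^ 5)) := by
  have hL : 0 ≤ Real.log (2 * lam) := Real.log_nonneg (by linarith)
  have hK : 0 ≤ Real.log 320 := Real.log_nonneg (by norm_num)
  set L := Real.log (2 * lam)
  set K := Real.log 320
  refine ⟨(Real.exp (28 * L + 2 * K)).toNNReal, fun p k τ => ?_⟩
  rw [Real.coe_toNNReal _ (Real.exp_pos _).le]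
  have i1 := log_freqBr_le hlam k
  have i2 := log_bracket_le_log_freqBr hlam k
  have i3 := log_modBr_le hlam (τ - p k)
  have i4 := log_bracket_le_log_modBr hlam (τ - p k)
  have i0 := log_freqBr_nonneg (k / lam)
  have conclude : ∀ σ b : ℝ, |logWeight s (Real.log (freqBr (k / lam)))
      (Real.log (modBr ((τ - p k) / lam ^ 5))) - (σ * Real.log (bracket k) +
        b * Real.log (bracket (τ - p k)))| ≤ 28 * L + 2 * K →
      zWeight s (k / lam) ((τ - p k) / lam ^ 5) ≤
        Real.exp (28 * L + 2 * K) * (bracket k ^ σ * bracket (τ - p k) ^ b) ∧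
      bracket k ^ σ * bracket (τ - p k) ^ b ≤
        Real.exp (28 * L + 2 * K) * zWeight s (k / lam) ((τ - p k) / lam ^ 5) := by
    intro σ b h
    rw [abs_le] at h
    rw [bracket_rpow, bracket_rpow, ← Real.exp_add, zWeight, ← Real.exp_add, ← Real.exp_add,
      Real.exp_le_exp, Real.exp_le_exp]
    constructor <;> linarith
  refine ⟨fun hD => conclude _ _ ?_, fun hD => conclude _ _ ?_, fun hD => conclude _ _ ?_⟩
  · exact abs_logWeight_sub_small hs hs' i0 hL i1 i2 i3 i4 hK
      (by simpa using log_bracket_le_of_le (n := 4) hD.1)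
  · exact abs_logWeight_sub_middle hs hs' hL i1 i2 i3 i4 hK
      (by simpa using log_bracket_le_of_ge (n := 4) (by norm_num) (Or.inl ⟨hD.1, hD.2.2⟩))
      (by simpa using log_bracket_le_of_le (n := 5) hD.2.1)
  · refine abs_logWeight_sub_large hs hs' i0 hL i1 i2 i3 i4 hK ?_
    have h : |(k : ℝ)| ^ 5 / 10 ≤ |τ - p k| ∧ 1 ≤ |(k : ℝ)| ∨ |(k : ℝ)| ≤ 1 := by
      rcases le_total |(k : ℝ)| 1 with h | h
      · exact Or.inr h
      · rcases hD with h1 | h1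
        · exact Or.inl ⟨h1, h⟩
        · exact Or.inr h1
    simpa using log_bracket_le_of_ge (n := 5) le_rfl h

/-- The weight of a mode at the scale `lam`, as a function of the modulation. -/
def scaledWeight (v : ℤ → ℝ → ℝ≥0∞) (p : ℤ → ℝ) (lam : ℝ) (k : ℤ) (τ : ℝ) : ℝ≥0∞ :=
  v k ((τ - p k) / lam ^ 5)

lemma coe_mul_ofReal (C : ℝ≥0) (x : ℝ) : (C : ℝ≥0∞) * ENNReal.ofReal x = ENNReal.ofReal (C * x) := by
  rw [ENNReal.ofReal_mul C.coe_nonneg, ENNReal.ofReal_coe_nnreal]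

/-- For uniqueness: every solution space with s ≤ -1 is contained in the one of order -3/2, at any
scale λ. -/
theorem exists_rawNorm_le_zNorm {s : ℝ} (hs : -(3 / 2) ≤ s) (hs' : s ≤ -1) {lam : ℝ}
    (hlam : 1 ≤ lam) : ∃ C : ℝ≥0, ∀ (p : ℤ → ℝ) (f : ℤ → ℝ → ℂ),
    rawNorm (scaledWeight (latticeWeight (-(3 / 2)) 0 lam) p lam) f ≤ C * zNorm p s f := by
  obtain ⟨C, hC⟩ := exists_zWeight_compare hs hs' hlam
  refine ⟨C, fun p f => (rawNorm_le_xNorm (p := p) (s := s) (C := C) (fun k τ h => ?_) (fun k τ h => ?_)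
    (fun k τ h => ?_) f).trans (mul_le_mul_right le_self_add _)⟩
  all_goals
    rw [coe_mul_ofReal, scaledWeight, latticeWeight, Real.rpow_zero, one_mul]
    refine ENNReal.ofReal_le_ofReal (le_trans (Real.exp_le_exp.2 (logWeight_mono hs
      (log_freqBr_nonneg _) (log_modBr_nonneg _))) ?_)
  · exact ((hC p k τ).1 h).1
  · exact ((hC p k τ).2.1 h).1
  · exact ((hC p k τ).2.2 h).1

/-- For existence: the space of the iteration is contained in Z^s, with a constant that may depend
on λ. -/
theorem exists_zNorm_le_rawNorm {s : ℝ} (hs : -(3 / 2) ≤ s) (hs' : s ≤ -1) {lam : ℝ}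
    (hlam : 1 ≤ lam) : ∃ C : ℝ≥0, ∀ (p : ℤ → ℝ) (f : ℤ → ℝ → ℂ),
    zNorm p s f ≤ C * rawNorm (scaledWeight (latticeWeight s 0 lam) p lam) f + yNorm s f := by
  obtain ⟨C, hC⟩ := exists_zWeight_compare hs hs' hlam
  refine ⟨3 * C, fun p f => ?_⟩
  have key : ∀ σ b : ℝ, ∀ D : Set (ℝ × ℤ), (∀ k, MeasurableSet {τ | (τ, k) ∈ D}) →
      (∀ k τ, (τ, k) ∈ D → bracket k ^ σ * bracket (τ - p k) ^ b ≤
        C * zWeight s (k / lam) ((τ - p k) / lam ^ 5)) →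
      xNorm p σ b D f ≤ C * rawNorm (scaledWeight (latticeWeight s 0 lam) p lam) f := by
    intro σ b D hD h
    refine xNorm_le_rawNorm hD (fun k τ hτ => ?_) f
    rw [scaledWeight, latticeWeight, Real.rpow_zero, one_mul, coe_mul_ofReal]
    exact ENNReal.ofReal_le_ofReal (h k τ hτ)
  rw [zNorm]
  gcongr
  calc _ ≤ _ := add_le_add (add_le_add
        (key _ _ _ (measurableSet_D₁ p) fun k τ h => ((hC p k τ).1 h).2)
        (key _ _ _ (measurableSet_D₂ p) fun k τ h => ((hC p k τ).2.1 h).2))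
        (key _ _ _ (measurableSet_D₃ p) fun k τ h => ((hC p k τ).2.2 h).2)
    _ = _ := by push_cast; ring

/-- The exponent 1/2 of W^s is below the 3/4 of Z^{-3/2} at small modulations, so in general only
X^{-1,1/2} is reached directly. -/
theorem exists_rawNorm_le_wNorm {s : ℝ} (hs : -1 < s) {lam : ℝ} (hlam : 1 ≤ lam) :
    ∃ C : ℝ≥0, ∀ (p : ℤ → ℝ) (f : ℤ → ℝ → ℂ),
    rawNorm (scaledWeight (latticeHalf lam) p lam) f ≤ C * wNorm p s f := by
  refine ⟨(Real.exp (4 * Real.log (2 * lam))).toNNReal, fun p f => ?_⟩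
  have h : ∀ k τ, scaledWeight (latticeHalf lam) p lam k τ ≤ (Real.exp (4 * Real.log (2 * lam))).toNNReal *
      ENNReal.ofReal (bracket k ^ s * bracket (τ - p k) ^ (1 / 2 : ℝ)) := fun k τ => by
    rw [coe_mul_ofReal, scaledWeight, latticeHalf, Real.coe_toNNReal _ (Real.exp_pos _).le,
      bracket_rpow, bracket_rpow, ← Real.exp_add, ← Real.exp_add, halfWeight]
    refine ENNReal.ofReal_le_ofReal (Real.exp_le_exp.2 ?_)
    have i2 := log_bracket_le_log_freqBr hlam k
    have i3 := log_modBr_le hlam (τ - p k)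
    have i5 := log_bracket_nonneg k
    have hL : 0 ≤ Real.log (2 * lam) := Real.log_nonneg (by linarith)
    nlinarith
  have := setLIntegral_le_xNorm (p := p) (D := univ) (fun _ => MeasurableSet.univ) (fun k τ _ => h k τ) f
  rw [wNorm, rawNorm, rpow_half_le_iff]
  simp only [mem_univ, ofPred_true, setLIntegral_univ] at this
  refine this.trans ?_
  gcongr
  exact le_self_add

/-- For s > -1 the iteration runs in Z^{-1} with the factor ⟨k⟩^{s+1}. The weight of Z^{-1}
dominates ⟨k⟩^{-1}⟨σ⟩^{1/2}, which gives the embedding into W^s. -/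
theorem exists_wNorm_le_rawNorm {s : ℝ} {lam : ℝ} (hlam : 1 ≤ lam) :
    ∃ C : ℝ≥0, ∀ (p : ℤ → ℝ) (f : ℤ → ℝ → ℂ),
    wNorm p s f ≤ C * rawNorm (scaledWeight (latticeWeight (-1) (s + 1) lam) p lam) f + yNorm s f := by
  refine ⟨(Real.exp ((|s| + 5 / 2) * Real.log (2 * lam))).toNNReal, fun p f => ?_⟩
  rw [wNorm]
  gcongr
  refine xNorm_le_rawNorm (fun k => by simp) (fun k τ _ => ?_) f
  rw [scaledWeight, latticeWeight, coe_mul_ofReal, Real.coe_toNNReal _ (Real.exp_pos _).le,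
    bracket_rpow, bracket_rpow, ← Real.exp_add, freqBr_rpow, zWeight, ← Real.exp_add, ← Real.exp_add]
  refine ENNReal.ofReal_le_ofReal (Real.exp_le_exp.2 ?_)
  have i1 := log_freqBr_le hlam k
  have i2 := log_bracket_le_log_freqBr hlam k
  have i4 := log_bracket_le_log_modBr hlam (τ - p k)
  have i6 := le_logWeight_neg_one (log_freqBr_nonneg (k / lam)) (log_modBr_nonneg ((τ - p k) / lam ^ 5))
  have hL : 0 ≤ Real.log (2 * lam) := Real.log_nonneg (by linarith)
  have h1 : s * (Real.log (bracket k) - Real.log (freqBr (k / lam))) ≤ |s| * Real.log (2 * lam) := by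
    refine (le_abs_self _).trans ?_
    rw [abs_mul]
    gcongr
    rw [abs_le]
    constructor <;> linarith
  linarith

lemma bracket_rpow_le (s : ℝ) {lam : ℝ} (hlam : 1 ≤ lam) (x : ℝ) :
    bracket x ^ s ≤ Real.exp (|s| * Real.log (2 * lam)) * freqBr (x / lam) ^ s := by
  have i1 := log_freqBr_le hlam x
  have i2 := log_bracket_le_log_freqBr hlam x
  have hL : 0 ≤ Real.log (2 * lam) := Real.log_nonneg (by linarith)
  have h1 : s * (Real.log (bracket x) - Real.log (freqBr (x / lam))) ≤ |s| * Real.log (2 * lam) := by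
    refine (le_abs_self _).trans ?_
    rw [abs_mul]
    gcongr
    rw [abs_le]
    constructor <;> linarith
  rw [bracket_rpow, freqBr_rpow, ← Real.exp_add]
  exact Real.exp_le_exp.2 (by linarith)

/-- For |k| ≤ λ the bracket of k/λ stays at 1, whereas ⟨k⟩^r may drop to λ^r up to a constant. The
resulting loss λ^{3/2} enters the lifespan together with the factor λ^{-7/2} of the Duhamel
operator. -/
lemma freqBr_rpow_le {r s : ℝ} (hr : -(3 / 2) ≤ r) (hrs : r ≤ s) {lam : ℝ} (hlam : 1 ≤ lam) (x : ℝ) :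
    freqBr (x / lam) ^ r ≤ (2 * lam) ^ (3 / 2 : ℝ) * bracket x ^ s := by
  have i1 := log_freqBr_le hlam x
  have i2 := log_bracket_le_log_freqBr hlam x
  have i5 := log_bracket_nonneg x
  have hL : 0 ≤ Real.log (2 * lam) := Real.log_nonneg (by linarith)
  rw [bracket_rpow, freqBr_rpow, Real.rpow_def_of_pos (by linarith), ← Real.exp_add]
  refine Real.exp_le_exp.2 ?_
  have h1 : r * Real.log (bracket x) ≤ s * Real.log (bracket x) := by gcongr
  have h2 : r * (Real.log (freqBr (x / lam)) - Real.log (bracket x)) ≤ 3 / 2 * Real.log (2 * lam) := by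
    nlinarith
  linarith

/-- The data norm at the scale `lam`. -/
lemma dataNorm_le {r s : ℝ} (hr : -(3 / 2) ≤ r) (hrs : r ≤ s) {lam : ℝ} (hlam : 1 ≤ lam)
    (a : ℤ → ℂ) :
    dataNorm (latticeBr r lam) a ≤ ENNReal.ofReal ((2 * lam) ^ (3 / 2 : ℝ)) * hsNorm s a := by
  rw [dataNorm, rpow_half_le_iff, mul_pow, hsNorm, rpow_half_sq, ← ENNReal.tsum_mul_left]
  refine ENNReal.tsum_le_tsum fun k => ?_
  rw [← mul_pow, ← mul_assoc, ← ENNReal.ofReal_mul (by positivity)]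
  gcongr
  exact ENNReal.ofReal_le_ofReal (freqBr_rpow_le hr hrs hlam k)

/-! ### Extensions and profiles -/

lemma rawNorm_eq_l2 (w : ℤ → ℝ → ℝ≥0∞) (f : ℤ → ℝ → ℂ) :
    rawNorm w f = l2 Measure.count fun k => l2 volume fun τ => w k τ * ‖f k τ‖ₑ := by
  rw [rawNorm, l2, lintegral_count' measurable_from_top]
  simp_rw [l2_sq]

lemma seqNorm_le_rawNorm (v : ℤ → ℝ → ℝ≥0∞) (y : ℤ → ℝ≥0∞) (g : ℤ → ℝ → ℂ) :
    seqNorm v y (fun k σ => ‖g k σ‖ₑ) ≤ rawNorm v g + l1Norm y fun k σ => ‖g k σ‖ₑ := by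
  rw [seqNorm_eq_l2, rawNorm_eq_l2, l1Norm_eq_l2]
  exact l2_add_le measurable_from_top.aemeasurable measurable_from_top.aemeasurable

lemma rawNorm_le_seqNorm (v : ℤ → ℝ → ℝ≥0∞) (y : ℤ → ℝ≥0∞) (g : ℤ → ℝ → ℂ) :
    rawNorm v g ≤ seqNorm v y (fun k σ => ‖g k σ‖ₑ) := by
  rw [seqNorm_eq_l2, rawNorm_eq_l2]
  exact l2_mono fun k => l2_le_modeNorm _ _ _

lemma rawNorm_congr {w : ℤ → ℝ → ℝ≥0∞} {f f' : ℤ → ℝ → ℂ} (h : ∀ k, f k =ᵐ[volume] f' k) :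
    rawNorm w f = rawNorm w f' := by
  unfold rawNorm
  congr 2 with k
  exact lintegral_congr_ae ((h k).mono fun τ hτ => by simp only [hτ])

/-- The norms of an affine reparametrization. -/
lemma rawNorm_affine {v : ℤ → ℝ → ℝ≥0∞} (hv : ∀ k, Measurable (v k)) {f : ℤ → ℝ → ℂ}
    (hf : ∀ k, Measurable (f k)) {c d : ℝ} (hc : 0 < c) (b : ℤ → ℝ) (hd : 0 ≤ d)
    {w : ℤ → ℝ → ℝ≥0∞} (hw : ∀ k x, w k x = v k (c * x + b k)) :
    rawNorm w (fun k x => (d : ℂ) * f k (c * x + b k)) =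
      ENNReal.ofReal (d * (c⁻¹) ^ (1 / 2 : ℝ)) * rawNorm v f := by
  have h : ∀ k, ∫⁻ x, (w k x * ‖(d : ℂ) * f k (c * x + b k)‖ₑ) ^ 2 =
      ENNReal.ofReal d ^ 2 * ENNReal.ofReal c⁻¹ * ∫⁻ x, (v k x * ‖f k x‖ₑ) ^ 2 := fun k => by
    have hfk := hf k
    have hvk := hv k
    rw [mul_assoc, ← lintegral_comp_affine (f := fun x => (v k x * ‖f k x‖ₑ) ^ 2) (by fun_prop) hc
      (b k), ← lintegral_const_mul' _ _ (by finiteness)]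
    refine lintegral_congr fun x => ?_
    rw [hw, ← mul_pow, enorm_mul, ← ofReal_norm (d : ℂ), Complex.norm_real, Real.norm_of_nonneg hd]
    ring
  simp_rw [rawNorm, h]
  rw [ENNReal.tsum_mul_left, ENNReal.mul_rpow_of_nonneg _ _ (by norm_num),
    ENNReal.mul_rpow_of_nonneg _ _ (by norm_num), ENNReal.ofReal_mul hd,
    ENNReal.ofReal_rpow_of_nonneg (inv_nonneg.2 hc.le) (by norm_num), ← ENNReal.rpow_natCast,
    ← ENNReal.rpow_mul]
  norm_num

lemma lintegral_affine {f : ℝ → ℂ} (hf : Measurable f) {c d : ℝ} (hc : 0 < c) (b : ℝ) (hd : 0 ≤ d) :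
    ∫⁻ x, ‖(d : ℂ) * f (c * x + b)‖ₑ = ENNReal.ofReal (d * c⁻¹) * ∫⁻ x, ‖f x‖ₑ := by
  simp_rw [enorm_mul]
  rw [lintegral_const_mul' _ _ (by finiteness), lintegral_comp_affine hf.enorm hc b,
    ← ofReal_norm (d : ℂ), Complex.norm_real, Real.norm_of_nonneg hd, ENNReal.ofReal_mul hd, mul_assoc]

lemma IsExtension.exists_measurable {T : ℝ} {u : ℝ → ℤ → ℂ} {f : ℤ → ℝ → ℂ}
    (hf : IsExtension T u f) :
    ∃ f', IsExtension T u f' ∧ (∀ k, Measurable (f' k)) ∧ ∀ k, f k =ᵐ[volume] f' k := by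
  classical
  obtain ⟨hm, h0, he⟩ := hf
  set f' : ℤ → ℝ → ℂ := fun k => if k = 0 then 0 else (hm k).mk (f k) with hf'
  have hae : ∀ k, f k =ᵐ[volume] f' k := fun k => by
    rcases eq_or_ne k 0 with rfl | hk
    · simp [hf', h0]
    · simp only [hf', hk, if_false]
      exact (hm k).ae_eq_mk
  have hmeas : ∀ k, Measurable (f' k) := fun k => by
    rcases eq_or_ne k 0 with rfl | hk
    · simp only [hf', if_true]
      exact measurable_const
    · simp only [hf', hk, if_false]
      exact (hm k).stronglyMeasurable_mk.measurable
  refine ⟨f', ⟨fun k => (hmeas k).aestronglyMeasurable, by simp [hf'], fun t ht k => ?_⟩, hmeas, hae⟩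
  rw [he t ht k]
  congr 1
  exact integral_congr_ae ((hae k).mono fun τ hτ => by simp only [hτ])

lemma yNorm_congr {s : ℝ} {f f' : ℤ → ℝ → ℂ} (h : ∀ k, f k =ᵐ[volume] f' k) :
    yNorm s f = yNorm s f' := by
  unfold yNorm
  congr 2 with k
  rw [lintegral_congr_ae (g := fun τ => ‖f' k τ‖ₑ) ((h k).mono fun τ hτ => by simp only [hτ])]

/-- An extension of a function on a short interval yields a profile. -/
theorem profNorm_prof_le {p : ℤ → ℝ} {s lam : ℝ} (hlam : 1 ≤ lam) {v : ℤ → ℝ → ℝ≥0∞} {y : ℤ → ℝ≥0∞}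
    (hv : ∀ k, Measurable (v k)) {C : ℝ≥0} (hy : ∀ k : ℤ, y k ≤ C * ENNReal.ofReal (bracket k ^ s))
    {u : ℝ → ℤ → ℂ} {f : ℤ → ℝ → ℂ} (hf : IsExtension (lam ^ 5)⁻¹ u f) :
    profNorm v y (prof p (lam ^ 5)⁻¹ 0 u) ≤
      ENNReal.ofReal (lam ^ 5) * rawNorm (scaledWeight v p lam) f + C * yNorm s f := by
  obtain ⟨f', hf', hm, hae⟩ := hf.exists_measurable
  rw [rawNorm_congr hae, yNorm_congr hae]
  have hlam0 : 0 < lam := by linarith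
  set κ := (Real.sqrt (2 * Real.pi))⁻¹ with hκd
  have hκ : 0 < κ := by positivity
  have hκ1 : κ ≤ 1 := sqrt_two_pi_inv_le_one
  set N := lam ^ 5 with hN
  have hN0 : 0 < N := by positivity
  have hN1 : 1 ≤ N := one_le_pow₀ hlam
  -- The shift by p(k) undoes the linear evolution, the dilation by λ⁵ stretches time, and κ is the
  -- normalizing factor of the Fourier transform.
  set g : ℤ → ℝ → ℂ := fun k σ => ((κ * N : ℝ) : ℂ) * f' k (N * σ + p k) with hg
  have hgm : ∀ k, Measurable (g k) := fun k => by
    have := hm k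
    simp only [hg]
    fun_prop
  have pr : IsProfile (prof p N⁻¹ 0 u) g := by
    refine ⟨hgm, by ext σ; simp [hg, hf'.2.1], fun t ht k => ?_⟩
    have e : ∀ σ, osc t σ * g k σ = ((κ * N : ℝ) : ℂ) * (osc t (-(N⁻¹ * p k)) *
        (fun τ => osc (N⁻¹ * t) τ * f' k τ) (N * σ + p k)) := fun σ => by
      have h1 : osc t σ = osc t (-(N⁻¹ * p k)) * osc (N⁻¹ * t) (N * σ + p k) := by
        rw [← osc_mul_left, ← osc_add]
        congr 1
        field_simp
        ring
      rw [h1, hg]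
      ring
    have hmem : 0 + N⁻¹ * t ∈ Icc 0 N⁻¹ := by
      rw [zero_add]
      exact ⟨mul_nonneg (by positivity) ht.1, mul_le_of_le_one_right (by positivity) ht.2⟩
    rw [integral_congr_ae (ae_of_all _ e), integral_const_mul, integral_const_mul,
      integral_comp_affine (fun τ => osc (N⁻¹ * t) τ * f' k τ) hN0, Complex.real_smul, prof,
      hf'.2.2 _ hmem k, zero_add, ← hκd]
    have : (N : ℂ) ≠ 0 := by exact_mod_cast hN0.ne'
    simp only [osc]
    push_cast
    field_simp
  refine ((profNorm_le pr).trans (seqNorm_le_rawNorm _ _ _)).trans (add_le_add ?_ ?_)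
  · have e : v = fun k σ => scaledWeight v p lam k (N * σ + p k) := by
      ext k σ
      rw [scaledWeight, add_sub_cancel_right, mul_div_cancel_left₀ _ hN0.ne']
    have hsm : ∀ k, Measurable (scaledWeight v p lam k) := fun k => by
      have := hv k
      unfold scaledWeight
      fun_prop
    rw [rawNorm_affine hsm hm hN0 p (by positivity) (fun k x => congrFun (congrFun e k) x)]
    gcongr
    have : (N⁻¹) ^ (1 / 2 : ℝ) ≤ 1 := Real.rpow_le_one (by positivity) (inv_le_one_of_one_le₀ hN1)
      (by norm_num)
    calc κ * N * (N⁻¹) ^ (1 / 2 : ℝ) ≤ 1 * N * 1 := by gcongr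
      _ = N := by ring
  · rw [l1Norm, rpow_half_le_iff, mul_pow, yNorm, rpow_half_sq, ← ENNReal.tsum_mul_left]
    refine ENNReal.tsum_le_tsum fun k => ?_
    rw [← mul_pow, ← mul_assoc]
    refine pow_le_pow_left' (mul_le_mul' (hy k) ?_) 2
    · rw [lintegral_affine (hm k) hN0 _ (by positivity), mul_inv_cancel_right₀ hN0.ne']
      exact mul_le_of_le_one_left' (by simpa using hκ1)

lemma sqrt_two_pi_le : Real.sqrt (2 * Real.pi) ≤ 3 :=
  Real.sqrt_le_iff.2 ⟨by norm_num, by linarith [Real.pi_lt_d2]⟩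

/-- A profile yields an extension. -/
theorem restrNorm_le_profNorm {p : ℤ → ℝ} {s lam : ℝ} (hlam : 1 ≤ lam) {v : ℤ → ℝ → ℝ≥0∞}
    {y : ℤ → ℝ≥0∞} (hv : ∀ k, Measurable (v k)) {C C' : ℝ≥0}
    (hy : ∀ k : ℤ, ENNReal.ofReal (bracket k ^ s) ≤ C * y k)
    (hsol : ∀ f, solNorm p s f ≤ C' * rawNorm (scaledWeight v p lam) f + yNorm s f)
    (u : ℝ → ℤ → ℂ) :
    restrNorm p s (lam ^ 5)⁻¹ u ≤ (3 * C' + 3 * C + 1 : ℝ≥0) *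
      profNorm v y (prof p (lam ^ 5)⁻¹ 0 u) := by
  -- The summand 1 in the constant only ensures that it is not zero, as needed to pull it out of the
  -- infimum.
  refine le_mul_profNorm (by simp) (by finiteness) fun g hg => ?_
  have hlam0 : 0 < lam := by linarith
  set κ := Real.sqrt (2 * Real.pi) with hκd
  have hκ : 0 < κ := by positivity
  have hκ3 : κ ≤ 3 := sqrt_two_pi_le
  set N := lam ^ 5 with hN
  have hN0 : 0 < N := by positivity
  have hN1 : 1 ≤ N := one_le_pow₀ hlam
  have hi0 : 0 < N⁻¹ := by positivity
  have hi1 : N⁻¹ ≤ 1 := inv_le_one_of_one_le₀ hN1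
  set f : ℤ → ℝ → ℂ := fun k τ => ((κ * N⁻¹ : ℝ) : ℂ) * g k (N⁻¹ * τ + -(N⁻¹ * p k)) with hf
  have hfm : ∀ k, Measurable (f k) := fun k => by
    have := hg.meas k
    simp only [hf]
    fun_prop
  have ext : IsExtension N⁻¹ u f := by
    refine ⟨fun k => (hfm k).aestronglyMeasurable, by ext τ; simp [hf, hg.zero], fun t ht k => ?_⟩
    have hmem : t / N⁻¹ ∈ Icc (0 : ℝ) 1 := ⟨div_nonneg ht.1 hi0.le, (div_le_one hi0).2 ht.2⟩
    have h1 := hg.eq _ hmem k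
    rw [prof, zero_add, mul_div_cancel₀ _ hi0.ne'] at h1
    have e : ∀ τ : ℝ, Complex.exp (Complex.I * (t : ℂ) * (τ : ℂ)) * f k τ =
        ((κ * N⁻¹ : ℝ) : ℂ) * (osc (t / N⁻¹) (N⁻¹ * p k) *
          (fun σ => osc (t / N⁻¹) σ * g k σ) (N⁻¹ * τ + -(N⁻¹ * p k))) := fun τ => by
      have h2 : Complex.exp (Complex.I * (t : ℂ) * (τ : ℂ)) =
          osc (t / N⁻¹) (N⁻¹ * p k) * osc (t / N⁻¹) (N⁻¹ * τ + -(N⁻¹ * p k)) := by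
        rw [← osc_add, add_comm (N⁻¹ * τ), add_neg_cancel_left, osc_mul_left,
          mul_div_cancel₀ _ hi0.ne', osc]
      rw [h2, hf]
      ring
    rw [integral_congr_ae (ae_of_all _ e), integral_const_mul, integral_const_mul,
      integral_comp_affine (fun σ => osc (t / N⁻¹) σ * g k σ) hi0, Complex.real_smul, ← h1,
      mul_left_comm (osc _ (N⁻¹ * p k)), ← mul_assoc (osc _ (N⁻¹ * p k)), osc_mul_osc_neg, one_mul,
      ← hκd]
    have h3 : (N : ℂ) ≠ 0 := by exact_mod_cast hN0.ne'
    have h4 : (κ : ℂ) ≠ 0 := by exact_mod_cast hκ.ne'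
    push_cast
    field_simp
  refine (iInf₂_le f ext).trans ((hsol f).trans ?_)
  have b1 : rawNorm (scaledWeight v p lam) f ≤ 3 * seqNorm v y fun k σ => ‖g k σ‖ₑ := by
    have e : ∀ k τ, scaledWeight v p lam k τ = v k (N⁻¹ * τ + -(N⁻¹ * p k)) := fun k τ => by
      rw [scaledWeight, ← mul_neg, ← mul_add, ← sub_eq_add_neg, div_eq_inv_mul]
    rw [hf, rawNorm_affine hv hg.meas hi0 (fun k => -(N⁻¹ * p k)) (by positivity) e]
    gcongr
    · rw [inv_inv, ← ENNReal.ofReal_ofNat 3]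
      refine ENNReal.ofReal_le_ofReal ?_
      have : N ^ (1 / 2 : ℝ) ≤ N := by
        simpa using Real.rpow_le_rpow_of_exponent_le hN1 (show (1 / 2 : ℝ) ≤ 1 by norm_num)
      calc κ * N⁻¹ * N ^ (1 / 2 : ℝ) ≤ 3 * N⁻¹ * N := by gcongr
        _ = 3 := by field_simp
    · exact rawNorm_le_seqNorm _ _ _
  have b2 : yNorm s f ≤ 3 * C * seqNorm v y fun k σ => ‖g k σ‖ₑ := by
    refine le_trans ?_ (mul_le_mul_right (l1Norm_le_seqNorm _ _ _) _)
    rw [yNorm, rpow_half_le_iff, mul_pow, l1Norm, rpow_half_sq, ← ENNReal.tsum_mul_left]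
    refine ENNReal.tsum_le_tsum fun k => ?_
    rw [← mul_pow]
    refine pow_le_pow_left' ?_ 2
    rw [hf, lintegral_affine (hg.meas k) hi0 _ (by positivity), mul_inv_cancel_right₀ hi0.ne']
    calc _ ≤ (C * y k) * (ENNReal.ofReal 3 * ∫⁻ x, ‖g k x‖ₑ) := by
          gcongr
          exact hy k
      _ = _ := by rw [ENNReal.ofReal_ofNat]; ring
  calc _ ≤ C' * (3 * seqNorm v y fun k σ => ‖g k σ‖ₑ) + 3 * C * seqNorm v y fun k σ => ‖g k σ‖ₑ := by
        gcongr
    _ ≤ C' * (3 * seqNorm v y fun k σ => ‖g k σ‖ₑ) + (3 * C * seqNorm v y fun k σ => ‖g k σ‖ₑ) +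
        seqNorm v y fun k σ => ‖g k σ‖ₑ := le_self_add
    _ = _ := by push_cast; ring

lemma yNorm_le_solNorm (p : ℤ → ℝ) (s : ℝ) (f : ℤ → ℝ → ℂ) : yNorm s f ≤ solNorm p s f := by
  unfold solNorm zNorm wNorm
  split_ifs
  · exact le_add_self
  · exact le_add_self

lemma exists_extension_lt {p : ℤ → ℝ} {s T : ℝ} {u : ℝ → ℤ → ℂ} (h : restrNorm p s T u < ∞) :
    ∃ f, IsExtension T u f ∧ solNorm p s f < ∞ := by
  unfold restrNorm at h
  simp only [iInf_lt_iff] at h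
  obtain ⟨f, hf, h⟩ := h
  exact ⟨f, hf, h⟩

lemma exists_restrNorm_le {s : ℝ} (hs : -(3 / 2) ≤ s) {lam : ℝ} (hlam : 1 ≤ lam) :
    ∃ C : ℝ≥0, ∀ (p : ℤ → ℝ) (u : ℝ → ℤ → ℂ), restrNorm p s (lam ^ 5)⁻¹ u ≤
      C * profNorm (latticeWeight (min s (-1)) (max (s + 1) 0) lam) (latticeBr s lam)
        (prof p (lam ^ 5)⁻¹ 0 u) := by
  have hsol : ∃ C' : ℝ≥0, ∀ (p : ℤ → ℝ) (f : ℤ → ℝ → ℂ), solNorm p s f ≤ C' * rawNorm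
      (scaledWeight (latticeWeight (min s (-1)) (max (s + 1) 0) lam) p lam) f + yNorm s f := by
    unfold solNorm
    split_ifs with h
    · rw [min_eq_left h, max_eq_right (by linarith)]
      exact exists_zNorm_le_rawNorm hs h hlam
    · have h' := not_le.1 h
      rw [min_eq_right h'.le, max_eq_left (by linarith)]
      exact exists_wNorm_le_rawNorm hlam
  obtain ⟨C', hC'⟩ := hsol
  refine ⟨_, fun p u => restrNorm_le_profNorm (C := (Real.exp (|s| * Real.log (2 * lam))).toNNReal) hlam
    (fun k => by unfold latticeWeight; fun_prop) (fun k => ?_) (hC' p) u⟩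
  rw [latticeBr, coe_mul_ofReal, Real.coe_toNNReal _ (Real.exp_pos _).le]
  exact ENNReal.ofReal_le_ofReal (bracket_rpow_le s hlam k)

/-- Only the Y^s norm matters: each coefficient is continuous in time and bounded, uniformly in
time, by the L¹ norm of its mode. Dominated convergence over the frequencies gives continuity in
Ḣ^s. -/
theorem IsSolution.isContinuousInHs {α β γ s T : ℝ} {u₀ : ℤ → ℂ} {u : ℝ → ℤ → ℂ}
    (h : IsSolution α β γ s T u₀ u) : IsContinuousInHs s T u := by
  obtain ⟨f₀, hf₀, hlt₀⟩ := exists_extension_lt h.1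
  obtain ⟨f, hf, hm, hae⟩ := hf₀.exists_measurable
  have hlt : yNorm s f < ∞ := by
    rw [← yNorm_congr hae]
    exact (yNorm_le_solNorm _ _ _).trans_lt hlt₀
  have hlt2 : ∑' k : ℤ, (ENNReal.ofReal (bracket k ^ s) * ∫⁻ τ : ℝ, ‖f k τ‖ₑ) ^ 2 < ∞ := by
    rw [← rpow_half_sq (∑' k : ℤ, _)]
    exact ENNReal.pow_lt_top hlt
  have hint : ∀ k, Integrable (f k) := fun k => by
    refine ⟨(hm k).aestronglyMeasurable, ?_⟩
    have h1 := (ENNReal.le_tsum k).trans_lt hlt2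
    refine lt_top_iff_ne_top.2 fun h2 => ?_
    have : ENNReal.ofReal (bracket k ^ s) ≠ 0 := by
      rw [Ne, ENNReal.ofReal_eq_zero, not_le]
      exact Real.rpow_pos_of_pos (bracket_pos _) _
    change ∫⁻ τ, ‖f k τ‖ₑ = ∞ at h2
    rw [h2, ENNReal.mul_top this] at h1
    simp at h1
  have hbd : ∀ t ∈ Icc 0 T, ∀ k, ‖u t k‖ₑ ≤ ∫⁻ τ, ‖f k τ‖ₑ := fun t ht k => by
    rw [hf.2.2 t ht k, enorm_mul]
    have h1 : ‖(((Real.sqrt (2 * Real.pi))⁻¹ : ℝ) : ℂ)‖ₑ ≤ 1 := by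
      rw [← ofReal_norm, Complex.norm_real, Real.norm_of_nonneg (by positivity)]
      exact ENNReal.ofReal_le_one.2 sqrt_two_pi_inv_le_one
    refine (mul_le_of_le_one_left' h1).trans ((enorm_integral_le_lintegral_enorm _).trans_eq ?_)
    exact lintegral_congr fun τ => enorm_osc_mul t τ _
  have hcont : ∀ k, ContinuousOn (fun t => u t k) (Icc 0 T) := fun k =>
    (continuous_const.mul (continuous_integral_osc (hint k))).continuousOn.congr
      fun t ht => hf.2.2 t ht k
  intro t ht
  refine ⟨⟨by rw [hf.2.2 t ht 0, hf.2.1]; simp, ?_⟩, ?_⟩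
  · refine lt_of_le_of_lt ?_ hlt
    unfold hsNorm yNorm
    gcongr with k
    exact hbd t ht k
  · have hB : ∫⁻ k : ℤ, (ENNReal.ofReal (bracket k ^ s) * (2 * ∫⁻ τ : ℝ, ‖f k τ‖ₑ)) ^ 2
        ∂Measure.count ≠ ∞ := by
      rw [lintegral_count' measurable_from_top]
      have e : ∀ k : ℤ, (ENNReal.ofReal (bracket k ^ s) * (2 * ∫⁻ τ : ℝ, ‖f k τ‖ₑ)) ^ 2 =
          4 * (ENNReal.ofReal (bracket k ^ s) * ∫⁻ τ : ℝ, ‖f k τ‖ₑ) ^ 2 := fun k => by ring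
      simp_rw [e]
      rw [ENNReal.tsum_mul_left]
      exact ENNReal.mul_ne_top (by norm_num) hlt2.ne
    have lim := tendsto_lintegral_filter_of_dominated_convergence (μ := Measure.count)
      (l := 𝓝[Icc 0 T] t) (F := fun t' (k : ℤ) => (ENNReal.ofReal (bracket k ^ s) *
        ‖(u t' - u t) k‖ₑ) ^ 2) (f := fun _ => 0) _
      (Eventually.of_forall fun _ => measurable_from_top)
      (eventually_mem_nhdsWithin.mono fun t' ht' => ae_of_all _ fun k => ?_) hB
      (ae_of_all _ fun k => ?_)
    · simp only [lintegral_count' measurable_from_top] at lim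
      have := lim.ennrpow_const (1 / 2)
      simpa [hsNorm] using this
    · gcongr
      rw [two_mul, Pi.sub_apply]
      exact enorm_sub_le.trans (add_le_add (hbd t' ht' k) (hbd t ht k))
    · have h1 : Tendsto (fun t' => (u t' - u t) k) (𝓝[Icc 0 T] t) (𝓝 0) := by
        have := ((hcont k) t ht).sub_const (u t k)
        simpa using this
      have h2 := ENNReal.Tendsto.const_mul (a := ENNReal.ofReal (bracket k ^ s))
        (by simpa using h1.enorm) (Or.inr ENNReal.ofReal_ne_top)
      simpa [Function.comp_def] using ((ENNReal.continuous_pow 2).tendsto _).comp h2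

/-! ### Uniqueness -/

lemma prof_eq_iff {p : ℤ → ℝ} {δ : ℝ} {t₀ : ℝ} {u w : ℝ → ℤ → ℂ} {t : ℝ} :
    prof p δ t₀ u t = prof p δ t₀ w t ↔ u (t₀ + δ * t) = w (t₀ + δ * t) := by
  have h0 : ∀ k, osc t (-(δ * p k)) ≠ 0 := fun k => by
    rw [← norm_ne_zero_iff, norm_osc]
    exact one_ne_zero
  simp only [funext_iff, prof]
  exact forall_congr' fun k => mul_right_inj' (h0 k)

lemma continuousOn_of_prof {v : ℤ → ℝ → ℝ≥0∞} {y : ℤ → ℝ≥0∞} (hvy : ∀ k, GoodWeight (v k) (y k))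
    {p : ℤ → ℝ} {δ : ℝ} (hδ : 0 < δ) {u : ℝ → ℤ → ℂ} (h : profNorm v y (prof p δ 0 u) < ∞) (k : ℤ) :
    ContinuousOn (fun t => u t k) (Icc 0 δ) := by
  have e : (fun t => u t k) = fun t => osc t (p k) * prof p δ 0 u (t / δ) k := by
    ext t
    rw [prof, zero_add, mul_div_cancel₀ _ hδ.ne', ← mul_neg, osc_mul_left, mul_div_cancel₀ _ hδ.ne',
      ← mul_assoc, osc_mul_osc_neg, one_mul]
  rw [e]
  have h1 : Continuous fun t' => osc t' (p k) := by unfold osc; fun_prop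
  exact h1.continuousOn.mul ((continuousOn_of_profNorm hvy h k).comp
    (continuous_id.div_const δ).continuousOn fun t ht =>
      ⟨div_nonneg ht.1 hδ.le, (div_le_one hδ).2 ht.2⟩)

lemma Duhamel.initial {p : ℤ → ℝ} {γ T : ℝ} {u₀ : ℤ → ℂ} {u : ℝ → ℤ → ℂ} (h : Duhamel p γ T u₀ u)
    (hT : 0 ≤ T) (hu₀ : u₀ 0 = 0) : u 0 = u₀ := by
  ext k
  obtain ⟨h1, h2⟩ := h 0 ⟨le_rfl, hT⟩
  rcases eq_or_ne k 0 with rfl | hk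
  · rw [h1, hu₀]
  obtain ⟨S, hS, e⟩ := h2 k hk
  have h0 : interaction p u 0 k = 0 := by
    ext k₁
    rw [interaction, intervalIntegral.integral_same, mul_zero, Pi.zero_apply]
  rw [h0] at hS
  rw [e, hS.unique hasSum_zero]
  simp

lemma goodWeight_lowest (lam : ℝ) (k : ℤ) :
    GoodWeight (latticeWeight (-(3 / 2)) 0 lam k) (latticeBr (-(3 / 2)) lam k) := by
  have := goodWeight_lattice (s := -(3 / 2)) le_rfl (by norm_num) 0 lam k
  rwa [add_zero] at this

lemma profNorm_const_lt_top {s : ℝ} (hs : -(3 / 2) ≤ s) {lam : ℝ} (hlam : 1 ≤ lam) {u₀ : ℤ → ℂ}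
    (h0 : u₀ 0 = 0) (hu₀ : hsNorm s u₀ < ∞) :
    profNorm (latticeWeight (-(3 / 2)) 0 lam) (latticeBr (-(3 / 2)) lam) (fun _ => u₀) < ∞ := by
  obtain ⟨C, hC⟩ := exists_profNorm_const_le
  refine (hC _ _ (goodWeight_lowest lam) u₀ h0).trans_lt (ENNReal.mul_lt_top ENNReal.coe_lt_top ?_)
  exact (dataNorm_le le_rfl hs hlam u₀).trans_lt (ENNReal.mul_lt_top ENNReal.ofReal_lt_top hu₀)

lemma latticeBr_le {r s : ℝ} (hr : -(3 / 2) ≤ r) (hrs : r ≤ s) {lam : ℝ} (hlam : 1 ≤ lam) (k : ℤ) :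
    latticeBr r lam k ≤ ((2 * lam) ^ (3 / 2 : ℝ)).toNNReal * ENNReal.ofReal (bracket k ^ s) := by
  rw [latticeBr, coe_mul_ofReal, Real.coe_toNNReal _ (by positivity)]
  exact ENNReal.ofReal_le_ofReal (freqBr_rpow_le hr hrs hlam k)

/-- The profile of a solution belongs to the largest of the modified Bourgain spaces. -/
theorem IsSolution.profNorm_lt_top {α β γ s lam : ℝ} (hα : α ≠ 0) (hs : -(3 / 2) ≤ s)
    (hlam : 1 ≤ lam) {u₀ : ℤ → ℂ} (h0 : u₀ 0 = 0) (hu₀ : hsNorm s u₀ < ∞) {u : ℝ → ℤ → ℂ}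
    (h : IsSolution α β γ s (lam ^ 5)⁻¹ u₀ u) :
    profNorm (latticeWeight (-(3 / 2)) 0 lam) (latticeBr (-(3 / 2)) lam)
      (prof (disp α β) (lam ^ 5)⁻¹ 0 u) < ∞ := by
  have hlam0 : 0 < lam := by linarith
  obtain ⟨f, hf, hlt⟩ := exists_extension_lt h.1
  have hy := (yNorm_le_solNorm _ _ _).trans_lt hlt
  rcases le_or_gt s (-1) with hs' | hs'
  · obtain ⟨C, hC⟩ := exists_rawNorm_le_zNorm hs hs' hlam
    rw [solNorm, if_pos hs'] at hlt
    have h1 := (hC (disp α β) f).trans_lt (ENNReal.mul_lt_top ENNReal.coe_lt_top hlt)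
    refine (profNorm_prof_le hlam (fun k => by unfold latticeWeight; fun_prop)
      (latticeBr_le le_rfl hs hlam) hf).trans_lt ?_
    finiteness
  · obtain ⟨C, hC⟩ := exists_rawNorm_le_wNorm hs' hlam
    rw [solNorm, if_neg (not_le.2 hs')] at hlt
    have h1 := (hC (disp α β) f).trans_lt (ENNReal.mul_lt_top ENNReal.coe_lt_top hlt)
    have h2 : profNorm (latticeHalf lam) (latticeBr (-1) lam) (prof (disp α β) (lam ^ 5)⁻¹ 0 u) < ∞ := by
      refine (profNorm_prof_le hlam (fun k => by unfold latticeHalf; fun_prop)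
        (latticeBr_le (by norm_num) hs'.le hlam) hf).trans_lt ?_
      finiteness
    -- The modulation weight which W^s does not provide is regained from the equation: u is the free
    -- solution plus a Duhamel term, and both lie in the space of order -3/2.
    have h3 := profNorm_duhamelOp_half_lt_top hα β γ hlam h2
    have hc := continuousOn_of_prof (goodWeight_half lam) (by positivity) h2
    have e : ∀ t ∈ Icc (0 : ℝ) 1, prof (disp α β) (lam ^ 5)⁻¹ 0 u t = ((fun _ => u₀ : ℝ → ℤ → ℂ) +
        duhamelOp (latticeRes α (β / lam ^ 2) lam) (duhamelCoeff γ lam)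
          (prof (disp α β) (lam ^ 5)⁻¹ 0 u) (prof (disp α β) (lam ^ 5)⁻¹ 0 u)) t := fun t ht => by
      have := h.2.prof_eq hc hlam0 le_rfl (zero_add _).le ht
      rwa [h.2.initial (by positivity) h0] at this
    rw [profNorm_congr e]
    exact (profNorm_add_le (goodWeight_lowest lam) _ _).trans_lt
      (ENNReal.add_lt_top.2 ⟨profNorm_const_lt_top hs hlam h0 hu₀, h3⟩)

lemma exists_large (K : ℝ) : ∃ n : ℕ, 1 ≤ (n : ℝ) ∧ K ≤ n := by
  obtain ⟨n, hn⟩ := exists_nat_ge (max K 1)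
  exact ⟨n, (le_max_right _ _).trans hn, (le_max_left _ _).trans hn⟩

/-- Two solutions of the integral equation with the same data agree. -/
theorem Duhamel.unique {α β γ lam : ℝ} (hα : α ≠ 0) (hlam : 1 ≤ lam) {u₀ : ℤ → ℂ} (h0 : u₀ 0 = 0)
    {u w : ℝ → ℤ → ℂ}
    (hu : Duhamel (disp α β) γ (lam ^ 5)⁻¹ u₀ u) (hw : Duhamel (disp α β) γ (lam ^ 5)⁻¹ u₀ w)
    (nu : profNorm (latticeWeight (-(3 / 2)) 0 lam) (latticeBr (-(3 / 2)) lam)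
      (prof (disp α β) (lam ^ 5)⁻¹ 0 u) < ∞)
    (nw : profNorm (latticeWeight (-(3 / 2)) 0 lam) (latticeBr (-(3 / 2)) lam)
      (prof (disp α β) (lam ^ 5)⁻¹ 0 w) < ∞) :
    ∀ t ∈ Icc 0 (lam ^ 5)⁻¹, u t = w t := by
  have hlam0 : 0 < lam := by linarith
  obtain ⟨C₁, h₁⟩ := exists_profNorm_prof_le
  obtain ⟨C₂, hC₂, h₂⟩ := exists_opBound hα β γ (s := -(3 / 2)) (ρ := 0) le_rfl (by norm_num) le_rfl
  rw [add_zero] at h₂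
  have cu := continuousOn_of_prof (goodWeight_lowest lam) (by positivity) nu
  have cw := continuousOn_of_prof (goodWeight_lowest lam) (by positivity) nw
  set M := max (profNorm (latticeWeight (-(3 / 2)) 0 lam) (latticeBr (-(3 / 2)) lam)
      (prof (disp α β) (lam ^ 5)⁻¹ 0 u)) (profNorm (latticeWeight (-(3 / 2)) 0 lam)
      (latticeBr (-(3 / 2)) lam) (prof (disp α β) (lam ^ 5)⁻¹ 0 w)) with hM
  have hMu := le_max_left (profNorm (latticeWeight (-(3 / 2)) 0 lam) (latticeBr (-(3 / 2)) lam)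
      (prof (disp α β) (lam ^ 5)⁻¹ 0 u)) (profNorm (latticeWeight (-(3 / 2)) 0 lam)
      (latticeBr (-(3 / 2)) lam) (prof (disp α β) (lam ^ 5)⁻¹ 0 w))
  have hMw := le_max_right (profNorm (latticeWeight (-(3 / 2)) 0 lam) (latticeBr (-(3 / 2)) lam)
      (prof (disp α β) (lam ^ 5)⁻¹ 0 u)) (profNorm (latticeWeight (-(3 / 2)) 0 lam)
      (latticeBr (-(3 / 2)) lam) (prof (disp α β) (lam ^ 5)⁻¹ 0 w))
  rw [← hM] at hMu hMw
  have hMt : M ≠ ∞ := (max_lt nu nw).ne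
  -- The factor μ is an integer n, so that n⁵ intervals of length δ fill [0, λ⁻⁵] exactly.
  obtain ⟨n, hn1, hn⟩ := exists_large (4 * (C₂ * (C₁ * M.toReal)))
  have hn0 : 0 < (n : ℝ) := by linarith
  set μ : ℝ := (n : ℝ) with hμ
  have hlm : 1 ≤ lam * μ := one_le_mul_of_one_le_of_one_le hlam hn1
  set R : ℝ≥0∞ := C₁ * ENNReal.ofReal (μ ^ (5 / 2 : ℝ)) * M with hR
  have hRt : R ≠ ∞ := by finiteness
  -- The growth μ^{5/2} of the norms meets the decay μ^{-7/2} of the operator; what is left is 1/μ,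
  -- small against the fixed size of the two solutions.
  have small : 4 * (ENNReal.ofReal (C₂ * (lam * μ) ^ (-(7 / 2) : ℝ)) * R) ≤ 1 := by
    rw [hR, ← ENNReal.ofReal_toReal hMt, ← ENNReal.ofReal_coe_nnreal (p := C₁),
      ← ENNReal.ofReal_mul (by positivity), ← ENNReal.ofReal_mul (by positivity),
      ← ENNReal.ofReal_mul (by positivity), ← ENNReal.ofReal_ofNat 4,
      ← ENNReal.ofReal_mul (by norm_num), ENNReal.ofReal_le_one]
    have e1 : (lam * μ) ^ (-(7 / 2) : ℝ) ≤ μ ^ (-(7 / 2) : ℝ) :=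
      Real.rpow_le_rpow_of_nonpos hn0 (by nlinarith) (by norm_num)
    have e2 : μ ^ (-(7 / 2) : ℝ) * μ ^ (5 / 2 : ℝ) = μ⁻¹ := by
      rw [← Real.rpow_add hn0, ← Real.rpow_neg_one]
      norm_num
    have e3 := @ENNReal.toReal_nonneg M
    calc 4 * (C₂ * (lam * μ) ^ (-(7 / 2) : ℝ) * (C₁ * μ ^ (5 / 2 : ℝ) * M.toReal))
        ≤ 4 * (C₂ * μ ^ (-(7 / 2) : ℝ) * (C₁ * μ ^ (5 / 2 : ℝ) * M.toReal)) := by gcongr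
      _ = 4 * (C₂ * (C₁ * M.toReal)) * (μ ^ (-(7 / 2) : ℝ) * μ ^ (5 / 2 : ℝ)) := by ring
      _ ≤ μ * μ⁻¹ := by rw [e2]; gcongr
      _ = 1 := mul_inv_cancel₀ hn0.ne'
  set δ := ((lam * μ) ^ 5)⁻¹ with hδ'
  have hδ : 0 < δ := by positivity
  have hδN : (lam ^ 5)⁻¹ = (n ^ 5 : ℕ) * δ := by
    rw [hδ']
    push_cast
    field_simp
    ring
  -- The bound for the norms on the subintervals does not depend on their position, so the same μ
  -- serves in every step.
  have step : ∀ j : ℕ, j ≤ n ^ 5 → ∀ t ∈ Icc 0 (j * δ), u t = w t := by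
    intro j
    induction j with
    | zero =>
      intro _ t ht
      have : t = 0 := le_antisymm (by simpa using ht.2) ht.1
      rw [this, hu.initial (by positivity) h0, hw.initial (by positivity) h0]
    | succ j ih =>
      intro hj t ht
      have ih := ih (by omega)
      rcases le_total t (j * δ) with hle | hle
      · exact ih t ⟨ht.1, hle⟩
      have ht₀ : 0 ≤ j * δ := by positivity
      have hT : j * δ + δ ≤ (lam ^ 5)⁻¹ := by
        have : ((j + 1 : ℕ) : ℝ) ≤ (n ^ 5 : ℕ) := by exact_mod_cast hj
        rw [hδN]
        push_cast at this ⊢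
        nlinarith
      have eu := fun t ht => hu.prof_eq cu (hlam0.trans_le (by nlinarith)) ht₀ hT (t := t) ht
      have ew := fun t ht => hw.prof_eq cw (hlam0.trans_le (by nlinarith)) ht₀ hT (t := t) ht
      have bu := (h₁ (disp α β) lam μ _ u hlam hn1 ht₀ hT).trans
        (mul_le_mul_right hMu _)
      have bw := (h₁ (disp α β) lam μ _ w hlam hn1 ht₀ hT).trans
        (mul_le_mul_right hMw _)
      have key := (h₂ (lam * μ) hlm).profNorm_sub_le (a₀ := fun _ => u (j * δ))
        (b₀ := fun _ => w (j * δ)) small hRt bu bw eu ew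
      rw [ih (j * δ) ⟨ht₀, le_rfl⟩, sub_self, profNorm_zero, mul_zero, nonpos_iff_eq_zero] at key
      have hm : (t - j * δ) / δ ∈ Icc (0 : ℝ) 1 := by
        refine ⟨div_nonneg (by linarith) hδ.le, (div_le_one hδ).2 ?_⟩
        have := ht.2
        push_cast at this
        linarith
      have h4 := eq_zero_of_profNorm (goodWeight_lowest (lam * μ)) key hm
      rw [Pi.sub_apply, sub_eq_zero, prof_eq_iff, mul_div_cancel₀ _ hδ.ne', add_sub_cancel] at h4
      exact h4
  intro t ht
  exact step (n ^ 5) le_rfl t (by rwa [← hδN])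

section

/-! ### Local theory at a fixed scale -/

/-- The weight of the solution space at the scale `lam`. -/
def solWeight (s lam : ℝ) : ℤ → ℝ → ℝ≥0∞ := latticeWeight (min s (-1)) (max (s + 1) 0) lam

lemma min_add_max_eq (s : ℝ) : min s (-1) + max (s + 1) 0 = s := by
  rcases le_total s (-1) with h | h
  · rw [min_eq_left h, max_eq_right (by linarith), add_zero]
  · rw [min_eq_right h, max_eq_left (by linarith)]
    ring

lemma goodWeight_solWeight {s : ℝ} (hs : -(3 / 2) ≤ s) (lam : ℝ) (k : ℤ) :
    GoodWeight (solWeight s lam k) (latticeBr s lam k) := by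
  have := goodWeight_lattice (le_min hs (by norm_num)) (min_le_right s (-1)) (max (s + 1) 0) lam k
  rwa [min_add_max_eq] at this

lemma exists_profNorm_const_le_hsNorm {s : ℝ} (hs : -(3 / 2) ≤ s) : ∃ C : ℝ≥0, ∀ lam : ℝ, 1 ≤ lam →
    ∀ a : ℤ → ℂ, a 0 = 0 → profNorm (solWeight s lam) (latticeBr s lam) (fun _ => a) ≤
      ENNReal.ofReal (C * lam ^ (3 / 2 : ℝ)) * hsNorm s a := by
  obtain ⟨C, hC⟩ := exists_profNorm_const_le
  refine ⟨C * (2 ^ (3 / 2 : ℝ)), fun lam hlam a ha => ?_⟩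
  have hlam0 : 0 < lam := by linarith
  refine ((hC _ _ (goodWeight_solWeight hs lam) a ha).trans
    (mul_le_mul_right (dataNorm_le hs le_rfl hlam a) _)).trans_eq ?_
  rw [← mul_assoc, coe_mul_ofReal, Real.mul_rpow (by norm_num) hlam0.le]
  congr 2
  push_cast
  ring

/-- Existence of solutions with a bound by the data, together with the smallness of the Duhamel
operator on solutions. -/
theorem exists_solution {α : ℝ} (hα : α ≠ 0) (β γ : ℝ) {s : ℝ} (hs : -(3 / 2) ≤ s) :
    ∃ K : ℝ, 0 ≤ K ∧ ∀ lam r : ℝ, 1 ≤ lam → 0 ≤ r → K * r ≤ lam ^ 2 → ∃ θ M : ℝ≥0∞,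
      OpBound (latticeRes α (β / lam ^ 2) lam) (duhamelCoeff γ lam) (solWeight s lam)
        (latticeBr s lam) θ ∧ 4 * (θ * M) ≤ 1 ∧ M ≠ ∞ ∧
      ∀ u₀ ∈ hsBall s r, ∃ u, Duhamel (disp α β) γ (lam ^ 5)⁻¹ u₀ u ∧
        profNorm (solWeight s lam) (latticeBr s lam) (prof (disp α β) (lam ^ 5)⁻¹ 0 u) ≤ M := by
  obtain ⟨C₂, hC₂, h₂⟩ := exists_opBound hα β γ (le_min hs (by norm_num)) (min_le_right s (-1))
    (le_max_right (s + 1) 0)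
  obtain ⟨C₃, h₃⟩ := exists_profNorm_const_le_hsNorm hs
  rw [min_add_max_eq] at h₂
  refine ⟨8 * (C₂ * C₃), by positivity, fun lam r hlam hr hK => ?_⟩
  have hlam0 : 0 < lam := by linarith
  -- The size of the data at scale λ. Multiplied by the operator norm λ^{-7/2} it gives r/λ², so the
  -- smallness condition reads K r ≤ λ².
  set m : ℝ := C₃ * lam ^ (3 / 2 : ℝ) * r with hm
  have hm0 : 0 ≤ m := by positivity
  have small : 8 * (ENNReal.ofReal (C₂ * lam ^ (-(7 / 2) : ℝ)) * ENNReal.ofReal m) ≤ 1 := by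
    rw [← ENNReal.ofReal_mul (by positivity), ← ENNReal.ofReal_ofNat 8,
      ← ENNReal.ofReal_mul (by norm_num), ENNReal.ofReal_le_one]
    have e : lam ^ (-(7 / 2) : ℝ) * lam ^ (3 / 2 : ℝ) = (lam ^ 2)⁻¹ := by
      rw [← Real.rpow_add hlam0, ← Real.rpow_two, ← Real.rpow_neg hlam0.le]
      norm_num
    calc 8 * (C₂ * lam ^ (-(7 / 2) : ℝ) * m)
        = 8 * (C₂ * C₃) * r * (lam ^ (-(7 / 2) : ℝ) * lam ^ (3 / 2 : ℝ)) := by rw [hm]; ring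
      _ ≤ lam ^ 2 * (lam ^ 2)⁻¹ := by rw [e]; gcongr
      _ = 1 := mul_inv_cancel₀ (by positivity)
  refine ⟨_, 2 * ENNReal.ofReal m, h₂ lam hlam, ?_, by finiteness, fun u₀ hu₀ => ?_⟩
  · refine le_trans (le_of_eq ?_) small
    ring
  have hc : profNorm (solWeight s lam) (latticeBr s lam) (fun _ => u₀) ≤ ENNReal.ofReal m := by
    refine (h₃ lam hlam u₀ hu₀.1).trans ?_
    rw [hm, ENNReal.ofReal_mul (q := r) (by positivity)]
    gcongr
    exact hu₀.2
  obtain ⟨a, ha, hfix⟩ := (h₂ lam hlam).exists_fixedPoint small ENNReal.ofReal_ne_top hc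
  set δ := (lam ^ 5)⁻¹ with hδ'
  have hδ : 0 < δ := by positivity
  have e : prof (disp α β) δ 0 (fun t k => osc t (disp α β k) * a (t / δ) k) = a := by
    ext t k
    rw [prof, zero_add, mul_div_cancel_left₀ _ hδ.ne', ← mul_neg, osc_mul_left, mul_comm, mul_right_comm,
      osc_mul_osc_neg, one_mul]
  exact ⟨_, duhamel_of_fixedPoint hlam0 (h₂ lam hlam) (ha.trans_lt (by finiteness)) hu₀.1 hfix e,
    e.symm ▸ ha⟩

lemma solWeight_neg (s lam : ℝ) (k : ℤ) (σ : ℝ) : solWeight s lam (-k) (-σ) = solWeight s lam k σ := by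
  simp only [solWeight, latticeWeight, zWeight, freqBr, modBr]
  push_cast
  rw [neg_div, abs_neg, abs_neg]

lemma latticeBr_neg (s lam : ℝ) (k : ℤ) : latticeBr s lam (-k) = latticeBr s lam k := by
  simp only [latticeBr, freqBr]
  push_cast
  rw [neg_div, abs_neg]

lemma latticeRes_neg (A B lam : ℝ) (k k₁ : ℤ) :
    latticeRes A B lam (-k) (-k₁) = -latticeRes A B lam k k₁ := by
  simp only [latticeRes, resonance, phase]
  push_cast
  ring

lemma duhamelCoeff_neg (γ lam : ℝ) (k : ℤ) : duhamelCoeff γ lam (-k) = conj (duhamelCoeff γ lam k) := by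
  simp only [duhamelCoeff, map_neg, map_mul, Complex.conj_ofReal, Complex.conj_I, map_intCast]
  push_cast
  ring

lemma disp_neg (α β : ℝ) (k : ℤ) : disp α β (-k) = -disp α β k := by
  simp only [disp]
  push_cast
  ring

section

variable {α β γ s lam : ℝ} {θ M : ℝ≥0∞}
  (hop : OpBound (latticeRes α (β / lam ^ 2) lam) (duhamelCoeff γ lam) (solWeight s lam)
    (latticeBr s lam) θ) (hlam : 1 ≤ lam) (hM : 4 * (θ * M) ≤ 1) (hMt : M ≠ ∞)
include hop hlam hM hMt

/-- Two small solutions differ at most by a multiple of the difference of the data. -/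
lemma profNorm_sub_le_of_duhamel {u₀ w₀ : ℤ → ℂ} {u w : ℝ → ℤ → ℂ}
    (hu : Duhamel (disp α β) γ (lam ^ 5)⁻¹ u₀ u) (hw : Duhamel (disp α β) γ (lam ^ 5)⁻¹ w₀ w)
    (hu₀ : u₀ 0 = 0) (hw₀ : w₀ 0 = 0)
    (nu : profNorm (solWeight s lam) (latticeBr s lam) (prof (disp α β) (lam ^ 5)⁻¹ 0 u) ≤ M)
    (nw : profNorm (solWeight s lam) (latticeBr s lam) (prof (disp α β) (lam ^ 5)⁻¹ 0 w) ≤ M) :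
    profNorm (solWeight s lam) (latticeBr s lam) (prof (disp α β) (lam ^ 5)⁻¹ 0 u -
      prof (disp α β) (lam ^ 5)⁻¹ 0 w) ≤
      2 * profNorm (solWeight s lam) (latticeBr s lam) (fun _ => u₀ - w₀) := by
  have hlam0 : 0 < lam := by linarith
  have cu := continuousOn_of_prof hop.good (by positivity) (nu.trans_lt hMt.lt_top)
  have cw := continuousOn_of_prof hop.good (by positivity) (nw.trans_lt hMt.lt_top)
  have eu := fun t ht => hu.prof_eq cu hlam0 le_rfl (zero_add _).le (t := t) ht
  have ew := fun t ht => hw.prof_eq cw hlam0 le_rfl (zero_add _).le (t := t) ht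
  rw [hu.initial (by positivity) hu₀] at eu
  rw [hw.initial (by positivity) hw₀] at ew
  exact hop.profNorm_sub_le (a₀ := fun _ => u₀) (b₀ := fun _ => w₀) hM hMt nu nw eu ew

/-- Small solutions with real-valued data are real-valued. -/
lemma isRealValued_of_duhamel {u₀ : ℤ → ℂ} {u : ℝ → ℤ → ℂ}
    (hu : Duhamel (disp α β) γ (lam ^ 5)⁻¹ u₀ u) (hu₀ : u₀ 0 = 0) (hreal : IsRealValued u₀)
    (nu : profNorm (solWeight s lam) (latticeBr s lam) (prof (disp α β) (lam ^ 5)⁻¹ 0 u) ≤ M) :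
    ∀ t ∈ Icc 0 (lam ^ 5)⁻¹, IsRealValued (u t) := by
  have hlam0 : 0 < lam := by linarith
  set δ := (lam ^ 5)⁻¹ with hδ'
  have hδ : 0 < δ := by positivity
  set a := prof (disp α β) δ 0 u with ha
  have cu := continuousOn_of_prof hop.good hδ (nu.trans_lt hMt.lt_top)
  have eu : ∀ t ∈ Icc (0 : ℝ) 1, a t = u₀ + duhamelOp (latticeRes α (β / lam ^ 2) lam)
      (duhamelCoeff γ lam) a a t := fun t ht => by
    have := hu.prof_eq cu hlam0 le_rfl (zero_add _).le ht
    rwa [hu.initial hδ.le hu₀] at this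
  -- The reflected profile solves the same fixed point equation with the same data, and its norm is
  -- no larger, so the contraction estimate identifies the two.
  have er : ∀ t ∈ Icc (0 : ℝ) 1, reflect a t = u₀ + duhamelOp (latticeRes α (β / lam ^ 2) lam)
      (duhamelCoeff γ lam) (reflect a) (reflect a) t := fun t ht => by
    rw [duhamelOp_reflect (latticeRes_neg _ _ _) (duhamelCoeff_neg _ _)]
    ext k
    have h1 := congrFun (eu t ht) (-k)
    rw [reflect, Pi.add_apply, reflect, h1, Pi.add_apply, map_add, hreal k, Complex.conj_conj]
  have key := hop.profNorm_sub_le (a₀ := fun _ => u₀) (b₀ := fun _ => u₀) hM hMt nu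
    ((profNorm_reflect_le (solWeight_neg s lam) (latticeBr_neg s lam) a).trans nu) eu er
  rw [sub_self, profNorm_zero, mul_zero, nonpos_iff_eq_zero] at key
  intro t ht k
  have h1 := congrFun (eq_zero_of_profNorm hop.good key
    (t := t / δ) ⟨div_nonneg ht.1 hδ.le, (div_le_one hδ).2 ht.2⟩) k
  rw [Pi.sub_apply, Pi.sub_apply, Pi.zero_apply, sub_eq_zero, reflect, ha, prof, prof, zero_add,
    mul_div_cancel₀ _ hδ.ne', map_mul, conj_osc, disp_neg, mul_neg, neg_neg] at h1
  have h0 : osc (t / δ) (-(δ * disp α β k)) ≠ 0 := by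
    rw [← norm_ne_zero_iff, norm_osc]
    exact one_ne_zero
  rw [mul_right_inj' h0] at h1
  rw [h1, Complex.conj_conj]

end

end

end Kawahara

end

/-! ### The main theorem -/

theorem theorem1 (α β γ : ℝ) (hα : α ≠ 0) (hγ : γ ≠ 0) (s : ℝ) (hs : -(3 / 2) ≤ s) :
    ∃ c : ℝ, 0 < c ∧ ∀ r : ℝ, 1 < r → ∃ T : ℝ, T = c * r ^ (-(5 / 2) : ℝ) ∧
      -- existence and uniqueness in the solution space on `[0,T]`
      (∀ u₀ ∈ Kawahara.hsBall s r,
        ∃ u : ℝ → ℤ → ℂ, Kawahara.IsSolution α β γ s T u₀ u ∧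
          Kawahara.IsContinuousInHs s T u ∧
          (Kawahara.IsRealValued u₀ → ∀ t ∈ Set.Icc 0 T, Kawahara.IsRealValued (u t)) ∧
          ∀ v : ℝ → ℤ → ℂ, Kawahara.IsSolution α β γ s T u₀ v →
            ∀ t ∈ Set.Icc 0 T, v t = u t) ∧
      -- the data-to-solution map is locally Lipschitz
      (∀ u₀ ∈ Kawahara.hsBall s r, ∃ ε : ℝ≥0∞, 0 < ε ∧ ∃ L : ℝ≥0,
        ∀ v₀ ∈ Kawahara.hsBall s r, ∀ w₀ ∈ Kawahara.hsBall s r,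
          Kawahara.hsNorm s (v₀ - u₀) < ε → Kawahara.hsNorm s (w₀ - u₀) < ε →
          ∀ v w : ℝ → ℤ → ℂ, Kawahara.IsSolution α β γ s T v₀ v →
            Kawahara.IsSolution α β γ s T w₀ w →
            Kawahara.restrNorm (Kawahara.disp α β) s T (v - w)
              ≤ L * Kawahara.hsNorm s (v₀ - w₀)) := by
  obtain ⟨K, hK, hex⟩ := Kawahara.exists_solution hα β γ hs
  obtain ⟨C, hC⟩ := Kawahara.exists_profNorm_const_le_hsNorm hs
  have hK1 : 0 < K + 1 := by linarith
  refine ⟨((K + 1) ^ 5)⁻¹, by positivity, fun r hr => ?_⟩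
  have hr0 : 0 < r := by linarith
  -- This choice gives λ ≥ 1 and λ² ≥ K r, while λ⁻⁵ = (K + 1)⁻⁵ r^{-5/2} is T. K + 1 replaces K
  -- because K may vanish.
  set lam : ℝ := (K + 1) * r ^ (1 / 2 : ℝ) with hlam_def
  have hlam : 1 ≤ lam :=
    one_le_mul_of_one_le_of_one_le (by linarith) (Real.one_le_rpow hr.le (by norm_num))
  have hlam0 : 0 < lam := by linarith
  have hT : (lam ^ 5)⁻¹ = ((K + 1) ^ 5)⁻¹ * r ^ (-(5 / 2) : ℝ) := by
    rw [hlam_def, mul_pow, mul_inv, ← Real.rpow_natCast (r ^ (1 / 2 : ℝ)), ← Real.rpow_mul hr0.le,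
      ← Real.rpow_neg hr0.le]
    norm_num
  have hKr : K * r ≤ lam ^ 2 := by
    have h1 : (r ^ (1 / 2 : ℝ)) ^ 2 = r := by
      rw [← Real.rpow_natCast, ← Real.rpow_mul hr0.le]
      norm_num
    rw [hlam_def, mul_pow, h1]
    gcongr
    nlinarith
  obtain ⟨θ, M, hop, hM, hMt, hsol⟩ := hex lam r hlam hr0.le hKr
  obtain ⟨C', hC'⟩ := Kawahara.exists_restrNorm_le hs hlam
  have hball : ∀ u₀ ∈ Kawahara.hsBall s r, Kawahara.hsNorm s u₀ < ∞ := fun u₀ hu₀ =>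
    hu₀.2.trans_lt ENNReal.ofReal_lt_top
  have hunique : ∀ u₀ ∈ Kawahara.hsBall s r, ∀ u w,
      Kawahara.IsSolution α β γ s (lam ^ 5)⁻¹ u₀ u → Kawahara.IsSolution α β γ s (lam ^ 5)⁻¹ u₀ w →
      ∀ t ∈ Set.Icc 0 (lam ^ 5)⁻¹, u t = w t := fun u₀ hu₀ u w hu hw =>
    hu.2.unique hα hlam hu₀.1 hw.2 (hu.profNorm_lt_top hα hs hlam hu₀.1 (hball u₀ hu₀))
      (hw.profNorm_lt_top hα hs hlam hu₀.1 (hball u₀ hu₀))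
  have hconstruct : ∀ u₀ ∈ Kawahara.hsBall s r, ∃ u,
      Kawahara.IsSolution α β γ s (lam ^ 5)⁻¹ u₀ u ∧
      Kawahara.profNorm (Kawahara.solWeight s lam) (Kawahara.latticeBr s lam)
        (Kawahara.prof (Kawahara.disp α β) (lam ^ 5)⁻¹ 0 u) ≤ M := fun u₀ hu₀ => by
    obtain ⟨u, hu, nu⟩ := hsol u₀ hu₀
    exact ⟨u, ⟨(hC' _ u).trans_lt (ENNReal.mul_lt_top ENNReal.coe_lt_top (nu.trans_lt hMt.lt_top)), hu⟩, nu⟩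
  -- The Lipschitz bound holds on the whole ball with a single constant, so the radius 1 of the
  -- neighbourhood is arbitrary.
  refine ⟨(lam ^ 5)⁻¹, hT, fun u₀ hu₀ => ?_, fun u₀ hu₀ => ⟨1, one_pos,
    C' * (2 * (C * lam ^ (3 / 2 : ℝ)).toNNReal), fun v₀ hv₀ w₀ hw₀ _ _ v w hv hw => ?_⟩⟩
  · obtain ⟨u, hu, nu⟩ := hconstruct u₀ hu₀
    exact ⟨u, hu, hu.isContinuousInHs,
      fun hreal => Kawahara.isRealValued_of_duhamel hop hlam hM hMt hu.2 hu₀.1 hreal nu,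
      fun v hv => hunique u₀ hu₀ v u hv hu⟩
  -- No smallness is known for the given solutions. By uniqueness they agree on [0,T] with the
  -- constructed ones, to which the contraction estimate applies.
  · obtain ⟨v', hv', nv⟩ := hconstruct v₀ hv₀
    obtain ⟨w', hw', nw⟩ := hconstruct w₀ hw₀
    have hδ : 0 < (lam ^ 5)⁻¹ := by positivity
    have e : ∀ t ∈ Set.Icc (0 : ℝ) 1,
        Kawahara.prof (Kawahara.disp α β) (lam ^ 5)⁻¹ 0 (v - w) t =
          (Kawahara.prof (Kawahara.disp α β) (lam ^ 5)⁻¹ 0 v' -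
            Kawahara.prof (Kawahara.disp α β) (lam ^ 5)⁻¹ 0 w') t := fun t ht => by
      have hm : 0 + (lam ^ 5)⁻¹ * t ∈ Set.Icc 0 (lam ^ 5)⁻¹ := by
        rw [zero_add]
        exact ⟨mul_nonneg hδ.le ht.1, mul_le_of_le_one_right hδ.le ht.2⟩
      ext k
      simp only [Kawahara.prof, Pi.sub_apply]
      rw [hunique v₀ hv₀ v v' hv hv' _ hm, hunique w₀ hw₀ w w' hw hw' _ hm, mul_sub]
    have hsub : (v₀ - w₀) 0 = 0 := by rw [Pi.sub_apply, hv₀.1, hw₀.1, sub_zero]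
    calc _ ≤ _ := hC' _ (v - w)
      _ ≤ C' * (2 * (ENNReal.ofReal (C * lam ^ (3 / 2 : ℝ)) * Kawahara.hsNorm s (v₀ - w₀))) := by
        gcongr
        rw [Kawahara.profNorm_congr e]
        refine (Kawahara.profNorm_sub_le_of_duhamel hop hlam hM hMt hv'.2 hw'.2 hv₀.1 hw₀.1 nv nw).trans ?_
        gcongr
        exact hC lam hlam _ hsub
      _ = _ := by
        push_cast
        rw [ENNReal.ofReal]
        ring
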